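/- Let $k$ be a field and let $X$, $Y$ be varieties over $k$, i.e. separated schemes of finite type over $k$. Let $\alpha=\{\alpha_{ijk}\}$ (resp. $\beta$) be a Čech 2-cocycle with values in $\mathcal O^*$ for an étale covering $\{U_i\to X\}$ (resp. for an étale covering of $Y$) whose class lies in the Brauer group $\mathrm{Br}\,X$ (resp. $\mathrm{Br}\,Y$), i.e. is the class of an Azumaya algebra. An $\alpha$-twisted sheaf is a family of $\mathcal O_{U_i}$-modules $\mathcal F_i$ with isomorphisms $\varphi_{ij}:\mathcal F_j|_{U_{ij}}\to\mathcal F_i|_{U_{ij}}$ such that $\varphi_{ij}\circ\varphi_{jk}=\alpha_{ijk}\,\varphi_{ik}$ on $U_{ijk}$, where $U_{ij}=U_i\times_XU_j$ and $U_{ijk}=U_i\times_XU_j\times_XU_k$; it is coherent if all $\mathcal F_i$ are. Let $\mathrm{Coh}(X,\alpha)$ be the category of coherent $\alpha$-twisted sheaves and, for $Z\subseteq X$ closed, $\mathrm{Coh}_Z(X,\alpha)$ the Serre subcategory of those with support contained in $Z$. Suppose that $(X,\alpha)$ and $(Y,\beta)$ satisfy the restriction condition: for every open $U\subseteq X$,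 the functor $$j_U^*:\mathrm{Coh}(X,\alpha)/\mathrm{Coh}_{X\setminus U}(X,\alpha)\longrightarrow\mathrm{Coh}(U,\alpha|_U)$$ induced by restriction to $U$ is an equivalence, and likewise for $(Y,\beta)$. Then any equivalence of categories $F:\mathrm{Coh}(X,\alpha)\to\mathrm{Coh}(Y,\beta)$ induces an isomorphism of schemes $f:X\to Y$. That is, there is a unique isomorphism of schemes $f$ such that 1. for every closed $Z\subseteq X$ and every $M$ in $\mathrm{Coh}(X,\alpha)$, $M$ belongs to $\mathrm{Coh}_Z(X,\alpha)$ if and only if $F(M)$ belongs to $\mathrm{Coh}_{f(Z)}(Y,\beta)$; 2. for every open $W\subseteq Y$ with preimage $U=f^{-1}(W)$, there is an equivalence $F_W:\mathrm{Coh}(U,\alpha|_U)\to\mathrm{Coh}(W,\beta|_W)$ with $F_W\circ j_U^*\cong j_W^*\circ F$ which carries multiplication by $f^\sharp(s)$ to multiplication by $s$, for every $s\in\Gamma(W,\mathcal O_Y)$. If moreover $F$ is $k$-linear, then $f$ is an isomorphism of varieties over $k$. -/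

import Mathlib

open CategoryTheory Limits AlgebraicGeometry

universe t t' u

noncomputable section

namespace TwistedSheaf

/-! ### Auxiliary facts on `𝒪`-modules -/

/-- Multiplication by a global section `r` of the structure sheaf, as an endomorphism of an
`𝒪_X`-module `M`. -/
def smulEnd {X : Scheme.{u}} (M : X.Modules) (r : Γ(X, ⊤)) : M ⟶ M :=
  SheafOfModules.Hom.mk (PresheafOfModules.homMk
    { app := fun V => M.smul (X.presheaf.map (homOfLE (le_top : V.unop ≤ ⊤)).op r)
      naturality := fun V W i => by
        have := Scheme.Modules.map_comp_smul (M := M) i.unop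
          (X.presheaf.map (homOfLE (le_top : V.unop ≤ ⊤)).op r)
        rw [← ConcreteCategory.comp_apply, ← Functor.map_comp] at this
        exact this.symm }
    (fun V s m => by
      let V' := V.unop
      have (a b : Γ(X, V')) (m : Γ(M, V')) : a • (b • m) = b • (a • m) := smul_comm a b m
      exact this _ _ _))

lemma smulEnd_app_apply {X : Scheme.{u}} (M : X.Modules) (r : Γ(X, ⊤)) (V : X.Opens)
    (m : Γ(M, V)) :
    (smulEnd M r).app V m = X.presheaf.map (homOfLE (le_top : V ≤ ⊤)).op r • m := rfl

lemma smulEnd_comp {X : Scheme.{u}} {M N : X.Modules} (φ : M ⟶ N) (r : Γ(X, ⊤)) :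
    smulEnd M r ≫ φ = φ ≫ smulEnd N r := by
  ext V m
  simp [smulEnd_app_apply]

lemma smulEnd_pushforward {X Y : Scheme.{u}} (g : X ⟶ Y) (M : X.Modules) (r : Γ(Y, ⊤)) :
    (Scheme.Modules.pushforward g).map (smulEnd M (g.appTop r)) =
      smulEnd ((Scheme.Modules.pushforward g).obj M) r := by
  ext V m
  have h : X.presheaf.map (homOfLE (le_top : g ⁻¹ᵁ V ≤ ⊤)).op (g.appTop r) =
      g.app V (Y.presheaf.map (homOfLE (le_top : V ≤ ⊤)).op r) := by
    have := g.naturality (homOfLE (le_top : V ≤ ⊤)).op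
    rw [← ConcreteCategory.comp_apply, ← ConcreteCategory.comp_apply, this]
    rfl
  let m' : Γ(M, g ⁻¹ᵁ V) := m
  change X.presheaf.map (homOfLE (le_top : g ⁻¹ᵁ V ≤ ⊤)).op (g.appTop r) • m' = _
  rw [h]
  rfl

lemma pullback_map_smulEnd {X Y : Scheme.{u}} (g : X ⟶ Y) (M : Y.Modules) (r : Γ(Y, ⊤)) :
    (Scheme.Modules.pullback g).map (smulEnd M r) =
      smulEnd ((Scheme.Modules.pullback g).obj M) (g.appTop r) := by
  let adj := Scheme.Modules.pullbackPushforwardAdjunction g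
  apply (adj.homEquiv _ _).injective
  rw [Adjunction.homEquiv_unit, Adjunction.homEquiv_unit, smulEnd_pushforward]
  exact (adj.unit_naturality (smulEnd M r)).trans (smulEnd_comp _ _)

lemma pullbackComp_assoc {X Y Z W : Scheme.{u}} (g : X ⟶ Y) (b : Y ⟶ Z) (q : Z ⟶ W)
    (N : W.Modules) :
    (Scheme.Modules.pullbackComp g b).inv.app ((Scheme.Modules.pullback q).obj N) ≫
      (Scheme.Modules.pullback g).map ((Scheme.Modules.pullbackComp b q).hom.app N) =
    (Scheme.Modules.pullbackComp (g ≫ b) q).hom.app N ≫ eqToHom (by rw [Category.assoc]) ≫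
      (Scheme.Modules.pullbackComp g (b ≫ q)).inv.app N := by
  have h := congr_app (Scheme.Modules.pseudofunctor_associativity g b q) N
  simp only [NatTrans.comp_app, Functor.whiskerRight_app, Functor.associator_hom_app,
    Functor.whiskerLeft_app, Category.id_comp, eqToHom_app] at h
  have h₁ : eqToHom (by rw [Category.assoc]) =
      inv ((Scheme.Modules.pullbackComp g (b ≫ q)).inv.app N ≫
      (Scheme.Modules.pullback g).map ((Scheme.Modules.pullbackComp b q).inv.app N) ≫
        (Scheme.Modules.pullbackComp g b).hom.app ((Scheme.Modules.pullback q).obj N) ≫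
          (Scheme.Modules.pullbackComp (g ≫ b) q).hom.app N) := by
    simp only [h, inv_eqToHom]
  rw [h₁]
  simp [← Functor.map_inv]

lemma pullbackComp_assoc' {X Y Z W : Scheme.{u}} (g : X ⟶ Y) (b : Y ⟶ Z) (q : Z ⟶ W)
    (N : W.Modules) :
    (Scheme.Modules.pullback g).map ((Scheme.Modules.pullbackComp b q).inv.app N) ≫
      (Scheme.Modules.pullbackComp g b).hom.app ((Scheme.Modules.pullback q).obj N) =
    (Scheme.Modules.pullbackComp g (b ≫ q)).hom.app N ≫ eqToHom (by rw [Category.assoc]) ≫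
      (Scheme.Modules.pullbackComp (g ≫ b) q).inv.app N := by
  have h := congr_app (Scheme.Modules.pseudofunctor_associativity g b q) N
  simp only [NatTrans.comp_app, Functor.whiskerRight_app, Functor.associator_hom_app,
    Functor.whiskerLeft_app, Category.id_comp, eqToHom_app] at h
  rw [← h]
  simp

/-- The pullback along `g : T' ⟶ T` of a morphism `b^* N ⟶ a^* M` of `𝒪_T`-modules, read as a
morphism `(b g)^* N ⟶ (a g)^* M` through the canonical isomorphisms `g^* b^* ≅ (b g)^*`. -/
def pullHom {T T' V W : Scheme.{u}} (g : T' ⟶ T) {a : T ⟶ V} {b : T ⟶ W} {M : V.Modules}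
    {N : W.Modules}
    (φ : (Scheme.Modules.pullback b).obj N ⟶ (Scheme.Modules.pullback a).obj M) :
    (Scheme.Modules.pullback (g ≫ b)).obj N ⟶ (Scheme.Modules.pullback (g ≫ a)).obj M :=
  (Scheme.Modules.pullbackComp g b).inv.app N ≫ (Scheme.Modules.pullback g).map φ ≫
    (Scheme.Modules.pullbackComp g a).hom.app M

/-- Coherent modules, on a locally Noetherian scheme: quasi-coherent modules whose sections over
every affine open subset form a finitely generated module. -/
def IsCoherent {X : Scheme.{u}} (M : X.Modules) : Prop :=
  SheafOfModules.IsQuasicoherent M ∧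
    ∀ V : X.Opens, IsAffineOpen V → Module.Finite Γ(X, V) Γ(M, V)

lemma IsCoherent.of_iso {X : Scheme.{u}} {M N : X.Modules} (e : M ≅ N) (h : IsCoherent M) :
    IsCoherent N := by
  refine ⟨?_, fun V hV => ?_⟩
  · obtain ⟨⟨d⟩⟩ := h.1
    have : @IsIso (SheafOfModules X.ringCatSheaf) _ M N e.hom :=
      ⟨e.inv, e.hom_inv_id, e.inv_hom_id⟩
    exact (SheafOfModules.QuasicoherentData.ofIsIso.{u, u, u, u} e.hom d).isQuasicoherent
  have := h.2 V hV
  let l : Γ(M, V) →ₗ[Γ(X, V)] Γ(N, V) :=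
    { toFun := e.hom.app V
      map_add' := map_add _
      map_smul' := fun r x => Scheme.Modules.Hom.app_smul _ r x }
  refine Module.Finite.of_surjective l fun y => ⟨e.inv.app V y, ?_⟩
  change e.hom.app V (e.inv.app V y) = y
  rw [← ConcreteCategory.comp_apply, ← Scheme.Modules.Hom.comp_app, e.inv_hom_id]
  rfl

lemma IsCoherent.pullback {X Y : Scheme.{u}} (g : X ⟶ Y) [IsOpenImmersion g] {M : Y.Modules}
    (h : IsCoherent M) : IsCoherent ((Scheme.Modules.pullback g).obj M) := by
  refine IsCoherent.of_iso ((Scheme.Modules.restrictFunctorIsoPullback g).app M) ⟨?_, fun V hV => ?_⟩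
  · have := h.1
    exact Scheme.Modules.isQuasicoherent_restrictFunctor g M
  · have := h.2 (g ''ᵁ V) (hV.image_of_isOpenImmersion g)
    let σ : Γ(Y, g ''ᵁ V) →+* Γ(X, V) := (g.appIso V).hom.hom
    have : RingHomSurjective σ := ⟨fun x => ⟨(g.appIso V).inv x, by
      change (g.appIso V).hom ((g.appIso V).inv x) = x
      rw [← ConcreteCategory.comp_apply, Iso.inv_hom_id]
      rfl⟩⟩
    let l : Γ(M, g ''ᵁ V) →ₛₗ[σ] Γ(M.restrict g, V) :=
      { toFun := (M.restrictAppIso g V).inv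
        map_add' := map_add _
        map_smul' := fun r x => congr($(M.smul_restrictAppIso_inv g V r) x) }
    exact Module.Finite.of_surjective l fun y => ⟨y, rfl⟩

/-! ### Čech cocycles and twisted sheaves -/

/-- A Čech 2-cocycle with values in `𝒪^*` for a family of morphisms `f i : U i ⟶ S`.

Its component `α_{ijk}` is a unit on `U_{ijk} = U i ×_S U j ×_S U k`. It is recorded through all its
pullbacks: `val a b c` is the pullback of `α_{ijk}` along the morphism `T ⟶ U_{ijk}` with
components `a`, `b`, `c`. By `map_val` these units are determined by the one with `T = U_{ijk}`,
which can be any unit on `U_{ijk}`. The last field says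
`α_{jkl} α_{ijl} = α_{ikl} α_{ijk}` on `U_{ijkl}`. -/
structure Cocycle {S : Scheme.{u}} {ι : Type t} {U : ι → Scheme.{u}} (f : ∀ i, U i ⟶ S) where
  val {T : Scheme.{u}} {i j k : ι} (a : T ⟶ U i) (b : T ⟶ U j) (c : T ⟶ U k)
    (hab : a ≫ f i = b ≫ f j) (hbc : b ≫ f j = c ≫ f k) : Γ(T, ⊤)ˣ
  map_val {T T' : Scheme.{u}} (g : T' ⟶ T) {i j k : ι} (a : T ⟶ U i) (b : T ⟶ U j) (c : T ⟶ U k)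
    (hab : a ≫ f i = b ≫ f j) (hbc : b ≫ f j = c ≫ f k) :
    g.appTop (val a b c hab hbc : Γ(T, ⊤)) =
      val (g ≫ a) (g ≫ b) (g ≫ c) (by simp [hab]) (by simp [hbc])
  cocycle {T : Scheme.{u}} {i j k l : ι} (a : T ⟶ U i) (b : T ⟶ U j) (c : T ⟶ U k) (d : T ⟶ U l)
    (hab : a ≫ f i = b ≫ f j) (hbc : b ≫ f j = c ≫ f k) (hcd : c ≫ f k = d ≫ f l) :
    val b c d hbc hcd * val a b d hab (hbc.trans hcd) =
      val a c d (hab.trans hbc) hcd * val a b c hab hbc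

/-- An `α`-twisted sheaf: `𝒪_{U i}`-modules `M_i` with isomorphisms
`φ_{ij} : M_j|_{U_{ij}} ≅ M_i|_{U_{ij}}` on `U_{ij} = U i ×_S U j` such that
`φ_{ij} ∘ φ_{jk} = α_{ijk} • φ_{ik}` on `U_{ijk}`.

As for cocycles, `φ a b` is the pullback of `φ_{ij}` along the morphism `T ⟶ U_{ij}` with
components `a` and `b`, and by `pullHom_φ` the case `T = U_{ij}` determines all the others. -/
structure Sheaf {S : Scheme.{u}} {ι : Type t} {U : ι → Scheme.{u}} (f : ∀ i, U i ⟶ S)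
    (α : Cocycle f) where
  obj (i : ι) : (U i).Modules
  φ {T : Scheme.{u}} {i j : ι} (a : T ⟶ U i) (b : T ⟶ U j) (h : a ≫ f i = b ≫ f j) :
    (Scheme.Modules.pullback b).obj (obj j) ≅ (Scheme.Modules.pullback a).obj (obj i)
  pullHom_φ {T T' : Scheme.{u}} (g : T' ⟶ T) {i j : ι} (a : T ⟶ U i) (b : T ⟶ U j)
    (h : a ≫ f i = b ≫ f j) :
    pullHom g (φ a b h).hom = (φ (g ≫ a) (g ≫ b) (by simp [h])).hom
  φ_comp {T : Scheme.{u}} {i j k : ι} (a : T ⟶ U i) (b : T ⟶ U j) (c : T ⟶ U k)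
    (hab : a ≫ f i = b ≫ f j) (hbc : b ≫ f j = c ≫ f k) :
    (φ b c hbc).hom ≫ (φ a b hab).hom =
      (φ a c (hab.trans hbc)).hom ≫ smulEnd _ (α.val a b c hab hbc)

namespace Sheaf

section

variable {S : Scheme.{u}} {ι : Type t} {U : ι → Scheme.{u}} {f : ∀ i, U i ⟶ S} {α : Cocycle f}

/-- Morphisms of `α`-twisted sheaves: families of morphisms `M_i ⟶ N_i` that commute with the
gluing isomorphisms. -/
@[ext]
structure Hom (M N : Sheaf f α) where
  hom (i : ι) : M.obj i ⟶ N.obj i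
  comm {T : Scheme.{u}} {i j : ι} (a : T ⟶ U i) (b : T ⟶ U j) (h : a ≫ f i = b ≫ f j) :
    (Scheme.Modules.pullback b).map (hom j) ≫ (N.φ a b h).hom =
      (M.φ a b h).hom ≫ (Scheme.Modules.pullback a).map (hom i)

instance : Category (Sheaf f α) where
  Hom M N := Hom M N
  id M :=
    { hom i := 𝟙 _
      comm a b h := by simp }
  comp p q :=
    { hom i := p.hom i ≫ q.hom i
      comm a b h := by
        rw [Functor.map_comp, Functor.map_comp, Category.assoc, q.comm, ← Category.assoc, p.comm,
          Category.assoc] }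

@[ext]
lemma hom_ext {M N : Sheaf f α} {p q : M ⟶ N} (h : ∀ i, p.hom i = q.hom i) : p = q :=
  Hom.ext (funext h)

@[simp] lemma id_hom (M : Sheaf f α) (i : ι) : Hom.hom (𝟙 M) i = 𝟙 (M.obj i) := rfl

@[simp] lemma comp_hom {M N K : Sheaf f α} (p : M ⟶ N) (q : N ⟶ K) (i : ι) :
    (p ≫ q).hom i = p.hom i ≫ q.hom i := rfl

section Preadditive

variable {M N : Sheaf f α}

instance : Zero (M ⟶ N) := ⟨{ hom _ := 0, comm a b h := by simp }⟩

instance : Add (M ⟶ N) :=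
  ⟨fun p q =>
    { hom i := p.hom i + q.hom i
      comm a b h := by simp [Functor.map_add, p.comm, q.comm] }⟩

instance : Neg (M ⟶ N) :=
  ⟨fun p => { hom i := - p.hom i, comm a b h := by simp [Functor.map_neg, p.comm] }⟩

instance : Sub (M ⟶ N) :=
  ⟨fun p q =>
    { hom i := p.hom i - q.hom i
      comm a b h := by simp [Functor.map_sub, p.comm, q.comm] }⟩

instance : SMul ℕ (M ⟶ N) :=
  ⟨fun n p => { hom i := n • p.hom i, comm a b h := by simp [p.comm] }⟩

instance : SMul ℤ (M ⟶ N) :=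
  ⟨fun n p => { hom i := n • p.hom i, comm a b h := by simp [p.comm] }⟩

instance : AddCommGroup (M ⟶ N) :=
  Function.Injective.addCommGroup (fun (p : M ⟶ N) => p.hom) (fun _ _ h => Hom.ext h)
    rfl (fun _ _ => rfl) (fun _ => rfl) (fun _ _ => rfl) (fun _ _ => rfl) (fun _ _ => rfl)

@[simp] lemma add_hom (p q : M ⟶ N) (i : ι) : (p + q).hom i = p.hom i + q.hom i := rfl

instance : Preadditive (Sheaf f α) where
  add_comp _ _ _ _ _ _ := by ext i : 1; simp
  comp_add _ _ _ _ _ _ := by ext i : 1; simp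

end Preadditive

/-- Multiplication by `s ∈ Γ(S, 𝒪_S)` on a twisted sheaf: on `M_i` it is multiplication by the
image of `s` in `Γ(U i, 𝒪)`. -/
def scalar (M : Sheaf f α) (s : Γ(S, ⊤)) : M ⟶ M where
  hom i := smulEnd (M.obj i) ((f i).appTop s)
  comm a b h := by
    have e : a.appTop ((f _).appTop s) = b.appTop ((f _).appTop s) := by
      rw [← ConcreteCategory.comp_apply, ← ConcreteCategory.comp_apply,
        ← Scheme.Hom.comp_appTop, ← Scheme.Hom.comp_appTop, h]
    rw [pullback_map_smulEnd, pullback_map_smulEnd, smulEnd_comp, e]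

/-- The support of a twisted sheaf: the points `x` of `S` such that the stalk of `M_i` at a point
of `U i` over `x` is not zero. -/
def support (M : Sheaf f α) : Set S :=
  {x | ∃ (i : ι) (y : U i), f i y = x ∧ Nontrivial ((M.obj i).presheaf.stalk y)}

lemma φ_congr (M : Sheaf f α) {T : Scheme.{u}} {i j : ι} {a a' : T ⟶ U i}
    {b b' : T ⟶ U j} (ha : a = a') (hb : b = b') (h : a ≫ f i = b ≫ f j) :
    (M.φ a b h).hom = eqToHom (by rw [hb]) ≫ (M.φ a' b' (by rw [← ha, ← hb, h])).hom ≫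
      eqToHom (by rw [ha]) := by
  subst ha hb
  simp

end

end Sheaf

/-! ### Pullback of cocycles and of twisted sheaves -/

section Pull

variable {S S' : Scheme.{u}} {ι : Type t} {ι' : Type t'} {U : ι → Scheme.{u}}
  {U' : ι' → Scheme.{u}} {f : ∀ i, U i ⟶ S} {f' : ∀ j, U' j ⟶ S'} {p : S' ⟶ S} {r : ι' → ι}

lemma pull_aux (q : ∀ j, U' j ⟶ U (r j)) (w : ∀ j, q j ≫ f (r j) = f' j ≫ p)
    {T : Scheme.{u}} {i j : ι'} {a : T ⟶ U' i} {b : T ⟶ U' j}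
    (h : a ≫ f' i = b ≫ f' j) : (a ≫ q i) ≫ f (r i) = (b ≫ q j) ≫ f (r j) := by
  rw [Category.assoc, Category.assoc, w, w, ← Category.assoc, h, Category.assoc]

/-- The pullback of a cocycle for `U i ⟶ S` to a cocycle for a family `U' j ⟶ S'` that maps to it
over a morphism `S' ⟶ S`. -/
def Cocycle.pull (α : Cocycle f) (q : ∀ j, U' j ⟶ U (r j))
    (w : ∀ j, q j ≫ f (r j) = f' j ≫ p) : Cocycle f' where
  val a b c hab hbc := α.val (a ≫ q _) (b ≫ q _) (c ≫ q _) (pull_aux q w hab) (pull_aux q w hbc)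
  map_val g i j k a b c hab hbc := by
    rw [α.map_val]
    simp only [Category.assoc]
  cocycle a b c d hab hbc hcd := α.cocycle _ _ _ _ _ _ _

/-- The pullback of an `α`-twisted sheaf, with components `q_j^* M_{r j}`. -/
def Sheaf.pull {α : Cocycle f} (M : Sheaf f α) (q : ∀ j, U' j ⟶ U (r j))
    (w : ∀ j, q j ≫ f (r j) = f' j ≫ p) : Sheaf f' (α.pull q w) where
  obj j := (Scheme.Modules.pullback (q j)).obj (M.obj (r j))
  φ {T i j} a b h := (Scheme.Modules.pullbackComp b (q j)).app _ ≪≫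
    M.φ (a ≫ q i) (b ≫ q j) (pull_aux q w h) ≪≫ (Scheme.Modules.pullbackComp a (q i)).symm.app _
  pullHom_φ {T T'} g {i j} a b h := by
    have h₁ := M.φ_congr (Category.assoc g a (q i)) (Category.assoc g b (q j))
      (pull_aux q w (a := g ≫ a) (b := g ≫ b) (by simp [h]))
    have h₂ := M.pullHom_φ g (a ≫ q i) (b ≫ q j) (pull_aux q w h)
    rw [← h₂] at h₁
    simp only [Iso.trans_hom, Iso.symm_hom, Iso.app_hom]
    rw [h₁]
    simp only [pullHom, Functor.map_comp, Category.assoc]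
    rw [pullbackComp_assoc', reassoc_of% pullbackComp_assoc g b (q j)]
  φ_comp a b c hab hbc := by
    have := M.φ_comp (a ≫ q _) (b ≫ q _) (c ≫ q _) (pull_aux q w hab) (pull_aux q w hbc)
    simp
    rw [reassoc_of% this, smulEnd_comp]
    rfl

/-- The pullback of twisted sheaves, as a functor. -/
def Sheaf.pullFunctor (α : Cocycle f) (q : ∀ j, U' j ⟶ U (r j))
    (w : ∀ j, q j ≫ f (r j) = f' j ≫ p) : Sheaf f α ⥤ Sheaf f' (α.pull q w) where
  obj M := M.pull q w
  map {M N} u :=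
    { hom j := (Scheme.Modules.pullback (q j)).map (u.hom (r j))
      comm {T i j} a b h := by
        have := u.comm (a ≫ q i) (b ≫ q j) (pull_aux q w h)
        have h₁ := (Scheme.Modules.pullbackComp b (q j)).hom.naturality (u.hom (r j))
        have h₂ := (Scheme.Modules.pullbackComp a (q i)).inv.naturality (u.hom (r i))
        simp only [Functor.comp_map] at h₁ h₂
        simp only [Sheaf.pull, Iso.trans_hom, Iso.symm_hom, Iso.app_hom, Category.assoc]
        rw [reassoc_of% h₁, reassoc_of% this, h₂] }

end Pull

/-! ### The Brauer group -/

section Brauer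

variable {S : Scheme.{u}} {ι : Type t} {U : ι → Scheme.{u}}

/-- An Azumaya algebra of degree `n` over `S` that is split by the covering `f i : U i ⟶ S`, given
by its descent datum: isomorphisms `θ_{ij}` of the algebra of `n × n` matrices over `U_{ij}`
(recorded through all their pullbacks, as for cocycles) with `θ_{ij} ∘ θ_{jk} = θ_{ik}`. -/
structure AzumayaDatum (f : ∀ i, U i ⟶ S) (n : ℕ) where
  θ {T : Scheme.{u}} {i j : ι} (a : T ⟶ U i) (b : T ⟶ U j) (h : a ≫ f i = b ≫ f j) :
    Matrix (Fin n) (Fin n) Γ(T, ⊤) ≃ₐ[Γ(T, ⊤)] Matrix (Fin n) (Fin n) Γ(T, ⊤)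
  map_θ {T T' : Scheme.{u}} (g : T' ⟶ T) {i j : ι} (a : T ⟶ U i) (b : T ⟶ U j)
    (h : a ≫ f i = b ≫ f j) (x : Matrix (Fin n) (Fin n) Γ(T, ⊤)) :
    (θ a b h x).map g.appTop.hom = θ (g ≫ a) (g ≫ b) (by simp [h]) (x.map g.appTop.hom)
  θ_comp {T : Scheme.{u}} {i j k : ι} (a : T ⟶ U i) (b : T ⟶ U j) (c : T ⟶ U k)
    (hab : a ≫ f i = b ≫ f j) (hbc : b ≫ f j = c ≫ f k) (x : Matrix (Fin n) (Fin n) Γ(T, ⊤)) :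
    θ a b hab (θ b c hbc x) = θ a c (hab.trans hbc) x

/-- `α` is the coboundary of a lift to `GL_n` of the `PGL_n`-cocycle `θ` of the Azumaya algebra:
there are `g_{ij} ∈ GL_n(U_{ij})` such that `θ_{ij}` is conjugation by `g_{ij}` and
`g_{ij} g_{jk} = α_{ijk} g_{ik}`. -/
def AzumayaDatum.HasClass {f : ∀ i, U i ⟶ S} {n : ℕ} (A : AzumayaDatum f n) (α : Cocycle f) :
    Prop :=
  ∃ g : ∀ {T : Scheme.{u}} {i j : ι} (a : T ⟶ U i) (b : T ⟶ U j), a ≫ f i = b ≫ f j →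
      (Matrix (Fin n) (Fin n) Γ(T, ⊤))ˣ,
    (∀ {T T' : Scheme.{u}} (s : T' ⟶ T) {i j : ι} (a : T ⟶ U i) (b : T ⟶ U j)
      (h : a ≫ f i = b ≫ f j),
      (g a b h).val.map s.appTop.hom = (g (s ≫ a) (s ≫ b) (by simp [h])).val) ∧
    (∀ {T : Scheme.{u}} {i j : ι} (a : T ⟶ U i) (b : T ⟶ U j) (h : a ≫ f i = b ≫ f j)
      (x : Matrix (Fin n) (Fin n) Γ(T, ⊤)),
      A.θ a b h x = (g a b h).val * x * (g a b h)⁻¹.val) ∧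
    (∀ {T : Scheme.{u}} {i j k : ι} (a : T ⟶ U i) (b : T ⟶ U j) (c : T ⟶ U k)
      (hab : a ≫ f i = b ≫ f j) (hbc : b ≫ f j = c ≫ f k),
      (g a b hab).val * (g b c hbc).val =
        (α.val a b c hab hbc : Γ(T, ⊤)) • (g a c (hab.trans hbc)).val)

/-- The class of `α` belongs to the Brauer group of `S`: after passing to a refinement of the
covering, `α` represents the class of an Azumaya algebra (of positive degree). -/
def Cocycle.IsBrauer {f : ∀ i, U i ⟶ S} (α : Cocycle f) : Prop :=
  ∃ (𝒱 : Scheme.Cover.{u} (Scheme.precoverage @Etale) S) (r : 𝒱.I₀ → ι)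
    (q : ∀ j, 𝒱.X j ⟶ U (r j)) (w : ∀ j, q j ≫ f (r j) = 𝒱.f j ≫ 𝟙 S)
    (n : ℕ) (A : AzumayaDatum 𝒱.f n), 0 < n ∧ A.HasClass (α.pull q w)

end Brauer

/-! ### Coherent twisted sheaves and the restriction condition -/

section Coh

variable {S : Scheme.{u}} {ι : Type t} {U : ι → Scheme.{u}}

/-- The category `Coh(S, α)` of coherent `α`-twisted sheaves. -/
abbrev Coh (f : ∀ i, U i ⟶ S) (α : Cocycle f) :=
  ObjectProperty.FullSubcategory (fun M : Sheaf f α => ∀ i, IsCoherent (M.obj i))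

variable {f : ∀ i, U i ⟶ S}

/-- Multiplication by `s ∈ Γ(S, 𝒪_S)` on a coherent twisted sheaf. -/
def Coh.scalar {α : Cocycle f} (M : Coh f α) (s : Γ(S, ⊤)) : M ⟶ M :=
  ObjectProperty.homMk (M.obj.scalar s)

/-- `Coh_Z(S, α)`: the coherent twisted sheaves with support contained in `Z`. -/
def Coh.supportedOn (α : Cocycle f) (Z : Set S) : ObjectProperty (Coh f α) :=
  fun M => M.obj.support ⊆ Z

/-- The restriction `α|_W` of a cocycle to an open subscheme `W` of `S`, for the family of the
`f i ⁻¹(W) ⟶ W`. -/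
def Cocycle.restrict (α : Cocycle f) (W : S.Opens) : Cocycle (fun i => f i ∣_ W) :=
  α.pull (p := W.ι) (r := id) (fun i => (f i ⁻¹ᵁ W).ι) (fun i => (morphismRestrict_ι (f i) W).symm)

/-- The restriction functor `j_W^* : Coh(S, α) ⥤ Coh(W, α|_W)`. -/
def Coh.restrict (α : Cocycle f) (W : S.Opens) :
    Coh f α ⥤ Coh (fun i => f i ∣_ W) (α.restrict W) :=
  ObjectProperty.lift _
    (ObjectProperty.ι _ ⋙ Sheaf.pullFunctor (p := W.ι) (r := id) α (fun i => (f i ⁻¹ᵁ W).ι)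
      (fun i => (morphismRestrict_ι (f i) W).symm))
    (fun M i => (M.property i).pullback (f i ⁻¹ᵁ W).ι)

end Coh

/-- The morphisms which become invertible in the quotient by a Serre subcategory `P`: those with
a kernel and a cokernel in `P`. -/
def isoModulo {C : Type t} [Category.{t'} C] [Preadditive C] (P : ObjectProperty C) :
    MorphismProperty C := fun _ _ u =>
  (∃ c : KernelFork u, Nonempty (IsLimit c) ∧ P c.pt) ∧
    (∃ c : CokernelCofork u, Nonempty (IsColimit c) ∧ P c.pt)

section

variable {S : Scheme.{u}} {ι : Type t} {U : ι → Scheme.{u}} {f : ∀ i, U i ⟶ S}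

/-- `(S, α)` satisfies the restriction condition: for every open `W ⊆ S` the functor
`Coh(S, α) / Coh_{S ∖ W}(S, α) ⥤ Coh(W, α|_W)` induced by `j_W^*` is an equivalence. The quotient
by a Serre subcategory is the localization at the morphisms with kernel and cokernel in it, and
`Functor.IsLocalization` says that `j_W^*` inverts them and that the induced functor is an
equivalence. -/
def RestrictionCondition (α : Cocycle f) : Prop :=
  ∀ W : S.Opens, (Coh.restrict α W).IsLocalization
    (isoModulo (Coh.supportedOn α (W : Set S)ᶜ))

end

/-! ### The isomorphism induced by an equivalence -/

section

variable {X Y : Scheme.{u}} {ι : Type t} {U : ι → Scheme.{u}} {f : ∀ i, U i ⟶ X}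
  {κ : Type t'} {V : κ → Scheme.{u}} {g : ∀ i, V i ⟶ Y} {α : Cocycle f} {β : Cocycle g}

/-- The isomorphism of schemes `e : X ≅ Y` is induced by the equivalence
`F : Coh(X, α) ≌ Coh(Y, β)`. On points: `F` carries `Coh_Z(X, α)` to `Coh_{e(Z)}(Y, β)` for every
closed `Z ⊆ X`. On functions: for every open `W ⊆ Y`, the equivalence
`Coh(e⁻¹ W, α|) ≌ Coh(W, β|)` which `F` induces carries multiplication by `e^♯ s` to
multiplication by `s`, for every section `s` of `𝒪_Y` over `W`. -/
structure IsInducedBy (F : Coh f α ≌ Coh g β) (e : X ≅ Y) : Prop where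
  supportedOn_iff (Z : Set X) (hZ : IsClosed Z) (M : Coh f α) :
    Coh.supportedOn α Z M ↔ Coh.supportedOn β (e.hom '' Z) (F.functor.obj M)
  exists_equivalence (W : Y.Opens) :
    ∃ G : Coh (fun i => f i ∣_ (e.hom ⁻¹ᵁ W)) (α.restrict (e.hom ⁻¹ᵁ W)) ≌
        Coh (fun i => g i ∣_ W) (β.restrict W),
      Nonempty (Coh.restrict α (e.hom ⁻¹ᵁ W) ⋙ G.functor ≅ F.functor ⋙ Coh.restrict β W) ∧
      ∀ (s : Γ(W, ⊤)) (M : Coh (fun i => f i ∣_ (e.hom ⁻¹ᵁ W)) (α.restrict (e.hom ⁻¹ᵁ W))),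
        G.functor.map (M.scalar ((e.hom ∣_ W).appTop s)) = (G.functor.obj M).scalar s

end

/-- The image in `Γ(X, 𝒪_X)` of an element of the base field. -/
def constant (k : Type u) [Field k] (X : Scheme.{u}) [X.Over (Spec (.of k))] (c : k) : Γ(X, ⊤) :=
  (X ↘ Spec (.of k)).appTop ((Scheme.ΓSpecIso (.of k)).inv c)

/-- A variety over a field `k`: a separated scheme of finite type over `k`. -/
class IsVariety (k : Type u) [Field k] (X : Scheme.{u}) [X.Over (Spec (.of k))] : Prop where
  isSeparated : IsSeparated (X ↘ Spec (.of k))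
  locallyOfFiniteType : LocallyOfFiniteType (X ↘ Spec (.of k))
  quasiCompact : QuasiCompact (X ↘ Spec (.of k))

end TwistedSheaf

end

open scoped TensorProduct

noncomputable section

namespace TwistedSheaf

/-! This is Gabriel's reconstruction with a twist: the category remembers the points of the scheme
through supports of objects, and the functions through its centre.

Points. Supports of coherent twisted sheaves are closed, and two of them intersect exactly when some
quotient of the first sheaf has a nonzero morphism to some quotient of the second
(`Nice.meets_iff`). Indeed both sheaves can be cut down to a common closed point `x`, and two
sheaves with support `{x}` always have a nonzero morphism between them (`Nice.exists_hom_ne_zero`).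
So intersection of supports is a categorical notion, `Meets`, and is preserved by `F`. Since closed
points are dense in closed sets, it decides when a support lies in a finite union of supports
(`Nice.support_subset_iff`). Hence irreducibility of a support is preserved, and passing to generic
points yields a homeomorphism compatible with supports (`exists_homeomorph`).

Functions. If `O` is the preimage of an open `W`, then `F` matches the sheaves supported off `O`
with those supported off `W`, so by the restriction condition it induces an equivalence `G` between
the categories over `O` and `W`. Functions act by natural endomorphisms of the identity functor, and
over a small affine open every such endomorphism is multiplication by a unique function
(`Chart.exists_eq_scalar`, `Chart.eq_of_scalar_eq`). Thus `G` matches functions over charts. The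
relation `Corresponds` is local and one-to-one, so the sheaf property extends the matching to all
opens, and the result is an isomorphism of structure sheaves over the homeomorphism. An isomorphism
induced by `F` has prescribed effect on supports and on functions, which gives uniqueness; the
effect on constants gives the statement over `k`.

The centre. Here the Brauer condition enters. Near each point it provides a flat cover `Spec B ⟶ W`
and invertible matrices on its self-products whose multiplication law is twisted by `α`. Flat
descent turns them into a twisted sheaf `E` whose pullback to `Spec B` is free of positive rank
(`MatrixCocycle.coh`, `MatrixCocycle.nonempty_equiv`). For any two coherent twisted sheaves the
scalars `α` cancel in the module of homomorphisms, so this module carries an ordinary descent datum,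
and the homomorphisms that descend span it over `B` (`Sheaf.span_compat`). A natural endomorphism of
the identity therefore commutes with all `B`-linear maps between the pullbacks. On the free module
it must be a scalar `b`, hence it is `b` on every sheaf, and `b` descends to a function on `W`.

The technical base is flat descent in terms of sections. `IsBC` says that a semilinear map is a base
change, `isBC_sec` that the pullback of a quasi-coherent module is a base change over affine opens,
and `isBC_descent` is the effectivity of descent for modules. -/

/-- A copy of `a` which does not unfold. -/
def sealed {A : Sort*} (a : A) : A := Classical.choose (⟨a, rfl⟩ : ∃ b, b = a)

lemma sealed_eq {A : Sort*} (a : A) : sealed a = a :=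
  Classical.choose_spec (⟨a, rfl⟩ : ∃ b, b = a)

/-! ### Coherence of pullbacks of modules and of their morphisms. -/

section Pullback

variable {T T' T'' V W Z : Scheme.{u}}

/-- The canonical isomorphism `g^* b^* ≅ b'^*` for `b' = b ∘ g`. -/
def pbIso (g : T' ⟶ T) {b : T ⟶ W} {b' : T' ⟶ W} (h : g ≫ b = b') :
    Scheme.Modules.pullback b ⋙ Scheme.Modules.pullback g ≅ Scheme.Modules.pullback b' :=
  Scheme.Modules.pullbackComp g b ≪≫ eqToIso (by rw [h])

lemma pbIso_rfl (g : T' ⟶ T) (b : T ⟶ W) :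
    pbIso g (rfl : g ≫ b = g ≫ b) = Scheme.Modules.pullbackComp g b := by
  ext; simp [pbIso]

/-- The canonical isomorphism `g^* b^* N ≅ b'^* N` for `b' = b ∘ g`. -/
def pbC (g : T' ⟶ T) {b : T ⟶ W} {b' : T' ⟶ W} (h : g ≫ b = b') (N : W.Modules) :
    (Scheme.Modules.pullback g).obj ((Scheme.Modules.pullback b).obj N) ≅
      (Scheme.Modules.pullback b').obj N :=
  sealed ((pbIso g h).app N)

lemma pbC_eq (g : T' ⟶ T) {b : T ⟶ W} {b' : T' ⟶ W} (h : g ≫ b = b') (N : W.Modules) :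
    pbC g h N = (pbIso g h).app N := sealed_eq _

lemma pbC_naturality (g : T' ⟶ T) {b : T ⟶ W} {b' : T' ⟶ W} (h : g ≫ b = b') {N N' : W.Modules}
    (u : N ⟶ N') :
    (Scheme.Modules.pullback g).map ((Scheme.Modules.pullback b).map u) ≫ (pbC g h N').hom =
      (pbC g h N).hom ≫ (Scheme.Modules.pullback b').map u := by
  rw [pbC_eq, pbC_eq]
  exact (pbIso g h).hom.naturality u

/-- The pullback along `g` of a morphism `b^* N ⟶ a^* M`, as a morphism `b'^* N ⟶ a'^* M` for
`a' = a ∘ g` and `b' = b ∘ g`. -/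
def ph (g : T' ⟶ T) {a : T ⟶ V} {b : T ⟶ W} {a' : T' ⟶ V} {b' : T' ⟶ W} (hb : g ≫ b = b')
    (ha : g ≫ a = a') {M : V.Modules} {N : W.Modules}
    (φ : (Scheme.Modules.pullback b).obj N ⟶ (Scheme.Modules.pullback a).obj M) :
    (Scheme.Modules.pullback b').obj N ⟶ (Scheme.Modules.pullback a').obj M :=
  sealed ((pbC g hb N).inv ≫ (Scheme.Modules.pullback g).map φ ≫ (pbC g ha M).hom)

lemma ph_eq (g : T' ⟶ T) {a : T ⟶ V} {b : T ⟶ W} {a' : T' ⟶ V} {b' : T' ⟶ W} (hb : g ≫ b = b')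
    (ha : g ≫ a = a') {M : V.Modules} {N : W.Modules}
    (φ : (Scheme.Modules.pullback b).obj N ⟶ (Scheme.Modules.pullback a).obj M) :
    ph g hb ha φ = (pbC g hb N).inv ≫ (Scheme.Modules.pullback g).map φ ≫ (pbC g ha M).hom :=
  sealed_eq _

lemma ph_rfl (g : T' ⟶ T) {a : T ⟶ V} {b : T ⟶ W} {M : V.Modules} {N : W.Modules}
    (φ : (Scheme.Modules.pullback b).obj N ⟶ (Scheme.Modules.pullback a).obj M) :
    ph g rfl rfl φ = pullHom g φ := by
  simp [ph_eq, pbC_eq, pullHom, pbIso_rfl]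

section

variable (g : T' ⟶ T) {a : T ⟶ V} {b : T ⟶ W} {c : T ⟶ Z} {a' : T' ⟶ V} {b' : T' ⟶ W}
  {c' : T' ⟶ Z} {M : V.Modules} {N : W.Modules} {K : Z.Modules}

lemma ph_comp (hc : g ≫ c = c') (hb : g ≫ b = b') (ha : g ≫ a = a')
    (φ : (Scheme.Modules.pullback c).obj K ⟶ (Scheme.Modules.pullback b).obj N)
    (ψ : (Scheme.Modules.pullback b).obj N ⟶ (Scheme.Modules.pullback a).obj M) :
    ph g hc ha (φ ≫ ψ) = ph g hc hb φ ≫ ph g hb ha ψ := by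
  simp [ph_eq]

lemma ph_id (ha : g ≫ a = a') : ph g ha ha (𝟙 ((Scheme.Modules.pullback a).obj M)) = 𝟙 _ := by
  simp [ph_eq]

lemma ph_add (hb : g ≫ b = b') (ha : g ≫ a = a')
    (φ ψ : (Scheme.Modules.pullback b).obj N ⟶ (Scheme.Modules.pullback a).obj M) :
    ph g hb ha (φ + ψ) = ph g hb ha φ + ph g hb ha ψ := by
  simp [ph_eq, Functor.map_add]

lemma ph_zero (hb : g ≫ b = b') (ha : g ≫ a = a') :
    ph g hb ha (0 : (Scheme.Modules.pullback b).obj N ⟶ (Scheme.Modules.pullback a).obj M) = 0 := by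
  simp [ph_eq]

/-- `ph` of an isomorphism. -/
def phIso (hb : g ≫ b = b') (ha : g ≫ a = a')
    (φ : (Scheme.Modules.pullback b).obj N ≅ (Scheme.Modules.pullback a).obj M) :
    (Scheme.Modules.pullback b').obj N ≅ (Scheme.Modules.pullback a').obj M where
  hom := ph g hb ha φ.hom
  inv := ph g ha hb φ.inv
  hom_inv_id := by rw [← ph_comp, φ.hom_inv_id, ph_id]
  inv_hom_id := by rw [← ph_comp, φ.inv_hom_id, ph_id]

lemma ph_map (ha : g ≫ a = a') {M' : V.Modules} (u : M ⟶ M') :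
    ph g ha ha ((Scheme.Modules.pullback a).map u) = (Scheme.Modules.pullback a').map u := by
  rw [ph_eq, pbC_naturality, Iso.inv_hom_id_assoc]

lemma ph_smulEnd (ha : g ≫ a = a') (r : Γ(T, ⊤)) :
    ph g ha ha (smulEnd ((Scheme.Modules.pullback a).obj M) r) = smulEnd _ (g.appTop r) := by
  simp [ph_eq, pullback_map_smulEnd, smulEnd_comp]

/-- Associativity of the canonical isomorphisms of composite pullbacks. All composites are free
variables with equations, so that later uses never transport along an equality of morphisms. -/
lemma ph_ph (g' : T'' ⟶ T') (hb : g ≫ b = b') (ha : g ≫ a = a') {a'' : T'' ⟶ V} {b'' : T'' ⟶ W}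
    (hb' : g' ≫ b' = b'') (ha' : g' ≫ a' = a'') {g'' : T'' ⟶ T} (hg : g' ≫ g = g'')
    (φ : (Scheme.Modules.pullback b).obj N ⟶ (Scheme.Modules.pullback a).obj M) :
    ph g' hb' ha' (ph g hb ha φ) =
      ph g'' (by rw [← hg, Category.assoc, hb, hb']) (by rw [← hg, Category.assoc, ha, ha']) φ := by
  subst hb ha hb' ha' hg
  rw [ph_rfl, ph_rfl]
  have h1 := pullbackComp_assoc g' g b N
  have h2 := pullbackComp_assoc' g' g a M
  have h3 := (Scheme.Modules.pullbackComp g' g).hom.naturality φ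
  have h4 : (Scheme.Modules.pullbackComp g' (g ≫ b)).inv.app N ≫
      (Scheme.Modules.pullback g').map ((Scheme.Modules.pullbackComp g b).inv.app N) =
      eqToHom (by rw [Category.assoc]) ≫ (Scheme.Modules.pullbackComp (g' ≫ g) b).inv.app N ≫
      (Scheme.Modules.pullbackComp g' g).inv.app _ := by
    rw [← cancel_mono
      ((Scheme.Modules.pullback g').map ((Scheme.Modules.pullbackComp g b).hom.app N))]
    simp only [Category.assoc]
    rw [h1, ← Functor.map_comp]
    simp
  have h5 : (Scheme.Modules.pullback g').map ((Scheme.Modules.pullbackComp g a).hom.app M) ≫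
      (Scheme.Modules.pullbackComp g' (g ≫ a)).hom.app M =
      (Scheme.Modules.pullbackComp g' g).hom.app _ ≫
      (Scheme.Modules.pullbackComp (g' ≫ g) a).hom.app M ≫ eqToHom (by rw [Category.assoc]) := by
    rw [← cancel_epi ((Scheme.Modules.pullback g').map ((Scheme.Modules.pullbackComp g a).inv.app M))]
    rw [reassoc_of% h2, ← reassoc_of% Functor.map_comp]
    simp
  simp only [ph_eq, pbC_eq]
  dsimp [pullHom, pbIso] at h3 ⊢
  simp only [Functor.map_comp, Category.assoc]
  rw [reassoc_of% h4, h5]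
  rw [reassoc_of% h3]
  simp

end

lemma ph_id_left {a a' : T ⟶ V} {b b' : T ⟶ W} {M : V.Modules} {N : W.Modules}
    (hb : 𝟙 T ≫ b = b') (ha : 𝟙 T ≫ a = a')
    (φ : (Scheme.Modules.pullback b).obj N ⟶ (Scheme.Modules.pullback a).obj M) :
    ph (𝟙 T) hb ha φ = eqToHom (by rw [← hb, Category.id_comp]) ≫ φ ≫
      eqToHom (by rw [← ha, Category.id_comp]) := by
  obtain rfl : b = b' := by simpa using hb
  obtain rfl : a = a' := by simpa using ha
  have h (g : T ⟶ W) (hb : 𝟙 T ≫ g = g) (N : W.Modules): (pbIso (𝟙 T) hb).hom.app N =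
      (Scheme.Modules.pullbackId T).hom.app _ := by
    have := congr_app (Scheme.Modules.pseudofunctor_right_unitality g) N
    simp only [NatTrans.comp_app, Functor.whiskerLeft_app, Functor.rightUnitor_hom_app,
      eqToHom_app] at this
    simp only [pbIso, Iso.trans_hom, NatTrans.comp_app, eqToIso.hom, eqToHom_app]
    rw [← this]
    simp
  have h' : (pbIso (𝟙 T) hb).inv.app N = (Scheme.Modules.pullbackId T).inv.app _ := by
    rw [← cancel_mono ((pbIso (𝟙 T) hb).hom.app N), h]
    simp [← NatTrans.comp_app, - Scheme.Modules.toPresheaf_map]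
    rw [← h b hb, ← NatTrans.comp_app, Iso.inv_hom_id]; rfl
  have h2 (g : T ⟶ V) (hb : 𝟙 T ≫ g = g) (N : V.Modules): (pbIso (𝟙 T) hb).hom.app N =
      (Scheme.Modules.pullbackId T).hom.app _ := by
    have := congr_app (Scheme.Modules.pseudofunctor_right_unitality g) N
    simp only [NatTrans.comp_app, Functor.whiskerLeft_app, Functor.rightUnitor_hom_app,
      eqToHom_app] at this
    simp only [pbIso, Iso.trans_hom, NatTrans.comp_app, eqToIso.hom, eqToHom_app]
    rw [← this]
    simp
  have h3 := (Scheme.Modules.pullbackId T).hom.naturality φ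
  simp only [ph_eq, pbC_eq, Iso.app_hom, Iso.app_inv, h2, h', eqToHom_refl, Category.id_comp,
    Category.comp_id]
  rw [h3, ← Category.assoc, Iso.inv_hom_id_app]
  simp

/-! ### Sections of pullbacks -/

/-- The unit of the adjunction between pullback and pushforward, on sections. -/
def eta (g : T' ⟶ T) (M : T.Modules) (O : T.Opens) :
    Γ(M, O) →+ Γ((Scheme.Modules.pullback g).obj M, g ⁻¹ᵁ O) :=
  (((Scheme.Modules.pullbackPushforwardAdjunction g).unit.app M).app O).hom

lemma eta_map (g : T' ⟶ T) {M N : T.Modules} (u : M ⟶ N) {O : T.Opens} (x : Γ(M, O)) :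
    ((Scheme.Modules.pullback g).map u).app (g ⁻¹ᵁ O) (eta g M O x) = eta g N O (u.app O x) :=
  congr(($((Scheme.Modules.pullbackPushforwardAdjunction g).unit.naturality u)).app O x).symm

lemma app_map {M N : T.Modules} (u : M ⟶ N) {O O' : T.Opens} (i : O' ≤ O) (x : Γ(M, O)) :
    u.app O' (M.presheaf.map (homOfLE i).op x) = N.presheaf.map (homOfLE i).op (u.app O x) :=
  congr($(u.mapPresheaf.naturality (homOfLE i).op) x)

lemma map_map (M : T.Modules) {O O' O'' : T.Opens} (i : O' ≤ O) (i' : O'' ≤ O') (x : Γ(M, O)) :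
    M.presheaf.map (homOfLE i').op (M.presheaf.map (homOfLE i).op x) =
      M.presheaf.map (homOfLE (i'.trans i)).op x := by
  rw [← ConcreteCategory.comp_apply, ← Functor.map_comp]
  rfl

lemma map_self (M : T.Modules) {O : T.Opens} (i : O ≤ O) (x : Γ(M, O)) :
    M.presheaf.map (homOfLE i).op x = x := by
  have : (homOfLE i).op = 𝟙 _ := rfl
  rw [this, CategoryTheory.Functor.map_id]
  rfl

lemma preimage_mono (g : T' ⟶ T) {O O' : T.Opens} (i : O' ≤ O) :
    (g ⁻¹ᵁ O' : T'.Opens) ≤ (g ⁻¹ᵁ O : T'.Opens) := fun _ h => i h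

lemma preimage_le_self (g : T' ⟶ T) (O : T.Opens) :
    (g ⁻¹ᵁ O : T'.Opens) ≤ (g ⁻¹ᵁ O : T'.Opens) := le_rfl

lemma eta_restrict (g : T' ⟶ T) (M : T.Modules) {O O' : T.Opens} (i : O' ≤ O) (x : Γ(M, O)) :
    eta g M O' (M.presheaf.map (homOfLE i).op x) =
      ((Scheme.Modules.pullback g).obj M).presheaf.map
        (homOfLE (preimage_mono g i)).op (eta g M O x) :=
  app_map ((Scheme.Modules.pullbackPushforwardAdjunction g).unit.app M) i x

lemma eta_smul (g : T' ⟶ T) (M : T.Modules) {O : T.Opens} (r : Γ(T, O)) (x : Γ(M, O)) :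
    eta g M O (r • x) = g.app O r • eta g M O x :=
  Scheme.Modules.Hom.app_smul ((Scheme.Modules.pullbackPushforwardAdjunction g).unit.app M) r x

/-- `pullbackComp` is conjugate, under the adjunctions, to the composition of pushforwards, which
does nothing to sections; so units compose to units. -/
lemma eta_comp (g : T' ⟶ T) (b : T ⟶ W) (N : W.Modules) {O : W.Opens} (x : Γ(N, O)) :
    ((Scheme.Modules.pullbackComp g b).hom.app N).app (g ⁻¹ᵁ b ⁻¹ᵁ O)
      (eta g _ (b ⁻¹ᵁ O) (eta b N O x)) = eta (g ≫ b) N O x := by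
  have h1 := unit_conjugateEquiv ((Scheme.Modules.pullbackPushforwardAdjunction b).comp
    (Scheme.Modules.pullbackPushforwardAdjunction g))
    (Scheme.Modules.pullbackPushforwardAdjunction (g ≫ b)) (Scheme.Modules.pullbackComp g b).inv N
  rw [Scheme.Modules.conjugateEquiv_pullbackComp_inv] at h1
  have h2 : eta g _ (b ⁻¹ᵁ O) (eta b N O x) =
    ((Scheme.Modules.pullbackComp g b).inv.app N).app (g ⁻¹ᵁ b ⁻¹ᵁ O) (eta (g ≫ b) N O x) :=
      congr(($h1).app O x)
  rw [h2]
  exact congr(($((Scheme.Modules.pullbackComp g b).inv_hom_id_app N)).app (g ⁻¹ᵁ b ⁻¹ᵁ O)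
    (eta (g ≫ b) N O x))

/-- The pullback of sections, from an open subset `O` to an open subset `O'` of its preimage. -/
def sec (g : T' ⟶ T) (M : T.Modules) {O : T.Opens} {O' : T'.Opens} (e : O' ≤ g ⁻¹ᵁ O) :
    Γ(M, O) →+ Γ((Scheme.Modules.pullback g).obj M, O') :=
  sealed ((((Scheme.Modules.pullback g).obj M).presheaf.map (homOfLE e).op).hom.comp (eta g M O))

lemma sec_apply (g : T' ⟶ T) (M : T.Modules) {O : T.Opens} {O' : T'.Opens} (e : O' ≤ g ⁻¹ᵁ O)
    (x : Γ(M, O)) : sec g M e x =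
      ((Scheme.Modules.pullback g).obj M).presheaf.map (homOfLE e).op (eta g M O x) := by
  rw [sec, sealed_eq]
  rfl

lemma sec_map (g : T' ⟶ T) {M N : T.Modules} (u : M ⟶ N) {O : T.Opens} {O' : T'.Opens}
    (e : O' ≤ g ⁻¹ᵁ O) (x : Γ(M, O)) :
    ((Scheme.Modules.pullback g).map u).app O' (sec g M e x) = sec g N e (u.app O x) := by
  rw [sec_apply, app_map, eta_map, sec_apply]

lemma sec_restrict (g : T' ⟶ T) (M : T.Modules) {O O₁ : T.Opens} {O' O₁' : T'.Opens}
    (e : O' ≤ g ⁻¹ᵁ O) (e₁ : O₁' ≤ g ⁻¹ᵁ O₁) (i : O₁ ≤ O) (i' : O₁' ≤ O') (x : Γ(M, O)) :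
    sec g M e₁ (M.presheaf.map (homOfLE i).op x) =
      ((Scheme.Modules.pullback g).obj M).presheaf.map (homOfLE i').op (sec g M e x) := by
  rw [sec_apply, eta_restrict, map_map, sec_apply, map_map]

lemma sec_smul (g : T' ⟶ T) (M : T.Modules) {O : T.Opens} {O' : T'.Opens}
    (e : O' ≤ g ⁻¹ᵁ O) (r : Γ(T, O)) (x : Γ(M, O)) :
    sec g M e (r • x) = g.appLE O O' e r • sec g M e x := by
  rw [sec_apply, sec_apply, eta_smul, Scheme.Modules.map_smul]
  rfl

lemma sec_comp (g : T' ⟶ T) (b : T ⟶ W) {b' : T' ⟶ W} (hb : g ≫ b = b') (N : W.Modules)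
    {O : W.Opens} {O' : T.Opens} {O'' : T'.Opens} (e : O' ≤ b ⁻¹ᵁ O) (e' : O'' ≤ g ⁻¹ᵁ O')
    (e'' : O'' ≤ b' ⁻¹ᵁ O) (x : Γ(N, O)) :
    (pbC g hb N).hom.app O'' (sec g _ e' (sec b N e x)) = sec b' N e'' x := by
  subst hb
  have h : O'' ≤ g ⁻¹ᵁ b ⁻¹ᵁ O := e''
  have h1 : sec g _ e' (sec b N e x) = sec g _ h (eta b N O x) := by
    rw [sec_apply b, sec_restrict g _ h e' e le_rfl, map_self]
  rw [h1, sec_apply g, app_map, sec_apply, ← eta_comp, pbC_eq, pbIso_rfl]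
  rfl

/-- The pullback of sections of `b^* N` to sections of `b'^* N`, for `b' = b ∘ g`. -/
def res (g : T' ⟶ T) {b : T ⟶ W} {b' : T' ⟶ W} (hb : g ≫ b = b') (N : W.Modules)
    {O : T.Opens} {O' : T'.Opens} (e : O' ≤ g ⁻¹ᵁ O) :
    Γ((Scheme.Modules.pullback b).obj N, O) →+ Γ((Scheme.Modules.pullback b').obj N, O') :=
  sealed (((pbC g hb N).hom.app O').hom.comp (sec g _ e))

lemma comp_app_apply {A : Type u} [AddCommGroup A] {M N : T.Modules} (u : M ⟶ N) (O : T.Opens)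
    (f : A →+ Γ(M, O)) (x : A) : ((u.app O).hom.comp f) x = u.app O (f x) := rfl

lemma app_comp {M N K : T.Modules} (u : M ⟶ N) (v : N ⟶ K) (O : T.Opens) (x : Γ(M, O)) :
    (u ≫ v).app O x = v.app O (u.app O x) := rfl

lemma res_apply (g : T' ⟶ T) {b : T ⟶ W} {b' : T' ⟶ W} (hb : g ≫ b = b') (N : W.Modules)
    {O : T.Opens} {O' : T'.Opens} (e : O' ≤ g ⁻¹ᵁ O) (x) :
    res g hb N e x = (pbC g hb N).hom.app O' (sec g _ e x) := by
  rw [res, sealed_eq]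
  exact comp_app_apply _ _ _ _

lemma res_smul (g : T' ⟶ T) {b : T ⟶ W} {b' : T' ⟶ W} (hb : g ≫ b = b') (N : W.Modules)
    {O : T.Opens} {O' : T'.Opens} (e : O' ≤ g ⁻¹ᵁ O) (r : Γ(T, O)) (x) :
    res g hb N e (r • x) = g.appLE O O' e r • res g hb N e x := by
  rw [res_apply, res_apply, sec_smul]
  exact Scheme.Modules.Hom.app_smul _ _ _

lemma res_sec (g : T' ⟶ T) {b : T ⟶ W} {b' : T' ⟶ W} (hb : g ≫ b = b') (N : W.Modules)
    {O : W.Opens} {O' : T.Opens} {O'' : T'.Opens} (e : O' ≤ b ⁻¹ᵁ O) (e' : O'' ≤ g ⁻¹ᵁ O')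
    (e'' : O'' ≤ b' ⁻¹ᵁ O) (x : Γ(N, O)) :
    res g hb N e' (sec b N e x) = sec b' N e'' x := by
  rw [res_apply]
  exact sec_comp g b hb N e e' e'' x

/-- The bridge between the language of morphisms and that of sections, on which the descent
arguments rely. -/
lemma ph_res (g : T' ⟶ T) {a : T ⟶ V} {b : T ⟶ W} {a' : T' ⟶ V} {b' : T' ⟶ W} (hb : g ≫ b = b')
    (ha : g ≫ a = a') {M : V.Modules} {N : W.Modules}
    (φ : (Scheme.Modules.pullback b).obj N ⟶ (Scheme.Modules.pullback a).obj M)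
    {O : T.Opens} {O' : T'.Opens} (e : O' ≤ g ⁻¹ᵁ O) (x) :
    (ph g hb ha φ).app O' (res g hb N e x) = res g ha M e (φ.app O x) := by
  rw [res_apply, res_apply, ← sec_map, ← app_comp, ← app_comp, ph_eq, Iso.hom_inv_id_assoc]

lemma res_restrict (g : T' ⟶ T) {b : T ⟶ W} {b' : T' ⟶ W} (hb : g ≫ b = b') (N : W.Modules)
    {O O₁ : T.Opens} {O' O₁' : T'.Opens}
    (e : O' ≤ g ⁻¹ᵁ O) (e₁ : O₁' ≤ g ⁻¹ᵁ O₁) (i : O₁ ≤ O) (i' : O₁' ≤ O') (x) :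
    res g hb N e₁ (((Scheme.Modules.pullback b).obj N).presheaf.map (homOfLE i).op x) =
      ((Scheme.Modules.pullback b').obj N).presheaf.map (homOfLE i').op (res g hb N e x) := by
  rw [res_apply, sec_restrict g _ e e₁ i i', app_map, res_apply]

lemma pbC_comp (g : T' ⟶ T) (g' : T'' ⟶ T') {g'' : T'' ⟶ T} (hg : g' ≫ g = g'')
    {b : T ⟶ W} {b' : T' ⟶ W} {b'' : T'' ⟶ W} (hb : g ≫ b = b') (hb' : g' ≫ b' = b'')
    (N : W.Modules) :
    (Scheme.Modules.pullback g').map (pbC g hb N).hom ≫ (pbC g' hb' N).hom =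
    (pbC g' hg _).hom ≫ (pbC g'' (by rw [← hg, Category.assoc, hb, hb']) N).hom := by
  subst hb hb' hg
  have h2 := pullbackComp_assoc' g' g b N
  rw [← cancel_epi ((Scheme.Modules.pullback g').map ((Scheme.Modules.pullbackComp g b).inv.app N)),
    pbC_eq, pbC_eq, pbC_eq, pbC_eq, pbIso_rfl, pbIso_rfl, pbIso_rfl, pbIso]
  dsimp
  rw [reassoc_of% h2, ← reassoc_of% Functor.map_comp]
  simp

lemma res_res (g : T' ⟶ T) (g' : T'' ⟶ T') {g'' : T'' ⟶ T} (hg : g' ≫ g = g'')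
    {b : T ⟶ W} {b' : T' ⟶ W} {b'' : T'' ⟶ W} (hb : g ≫ b = b') (hb' : g' ≫ b' = b'')
    (N : W.Modules) {O : T.Opens} {O' : T'.Opens} {O'' : T''.Opens} (e : O' ≤ g ⁻¹ᵁ O)
    (e' : O'' ≤ g' ⁻¹ᵁ O') (e'' : O'' ≤ g'' ⁻¹ᵁ O) (x) :
    res g' hb' N e' (res g hb N e x) =
      res g'' (by rw [← hg, Category.assoc, hb, hb']) N e'' x := by
  rw [res_apply, res_apply, res_apply, ← sec_map, ← app_comp, pbC_comp g g' hg hb hb' N,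
    app_comp, sec_comp g' g hg _ e e' e'']

end Pullback

end TwistedSheaf

namespace TwistedSheaf

/-! ### Base change of modules -/

section IsBC

variable {R S P M N K : Type u} [CommRing R] [CommRing S] [CommRing P] [AddCommGroup M]
  [AddCommGroup N] [AddCommGroup K] [Module R M] [Module S N] [Module P K]

/-- The semilinear map `ψ : M →+ N` over `σ : R →+* S` exhibits `N` as the base change of `M`. -/
structure IsBC (σ : R →+* S) (ψ : M →+ N) : Prop where
  smul (r : R) (x : M) : ψ (r • x) = σ r • ψ x
  exists_lift (Q : Type u) [AddCommGroup Q] [Module S Q] (χ : M →+ Q)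
    (_ : ∀ r x, χ (r • x) = σ r • χ x) : ∃ f : N →ₗ[S] Q, ∀ x, f (ψ x) = χ x
  hom_ext (Q : Type u) [AddCommGroup Q] [Module S Q] (f g : N →ₗ[S] Q)
    (_ : ∀ x, f (ψ x) = g (ψ x)) : f = g

namespace IsBC

variable {σ : R →+* S} {τ : S →+* P} {ψ : M →+ N} {ψ' : N →+ K}

/-- With a universal property as definition, composition is formal: a `P`-module is viewed over `S`
by restriction of scalars, and no algebra structures have to be fixed on rings of sections. -/
lemma comp (h : IsBC σ ψ) (h' : IsBC τ ψ') : IsBC (τ.comp σ) (ψ'.comp ψ) where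
  smul r x := by simp [h.smul, h'.smul]
  exists_lift Q _ _ χ hχ := by
    let : Module S Q := Module.compHom Q τ
    obtain ⟨f, hf⟩ := h.exists_lift Q χ hχ
    obtain ⟨f', hf'⟩ := h'.exists_lift Q f.toAddMonoidHom (fun r x => f.map_smul r x)
    exact ⟨f', fun x => (hf' _).trans (hf x)⟩
  hom_ext Q _ _ f g hfg := by
    let : Module S Q := Module.compHom Q τ
    refine h'.hom_ext Q f g fun x => ?_
    let f₁ : N →ₗ[S] Q := ⟨⟨fun x => f (ψ' x), by simp⟩, fun r x => by
      change f (ψ' (r • x)) = τ r • f (ψ' x); rw [h'.smul, map_smul]⟩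
    let g₁ : N →ₗ[S] Q := ⟨⟨fun x => g (ψ' x), by simp⟩, fun r x => by
      change g (ψ' (r • x)) = τ r • g (ψ' x); rw [h'.smul, map_smul]⟩
    exact congr($(h.hom_ext Q f₁ g₁ hfg) x)

/-- Semilinear maps out of `N` are determined by their composites with `ψ`, so the universal
property of the composite passes to the second factor. -/
lemma of_comp (h : IsBC σ ψ) (h' : IsBC (τ.comp σ) (ψ'.comp ψ))
    (hs : ∀ r x, ψ' (r • x) = τ r • ψ' x) : IsBC τ ψ' where
  smul := hs
  exists_lift Q _ _ χ hχ := by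
    let : Module S Q := Module.compHom Q τ
    obtain ⟨f, hf⟩ := h'.exists_lift Q (χ.comp ψ) (fun r x => by
      simp [h.smul, hχ])
    refine ⟨f, fun x => ?_⟩
    let f₁ : N →ₗ[S] Q := ⟨⟨fun x => f (ψ' x), by simp⟩, fun r x => by
      change f (ψ' (r • x)) = τ r • f (ψ' x); rw [hs, map_smul]⟩
    let g₁ : N →ₗ[S] Q := ⟨⟨χ, by simp⟩, fun r x => hχ r x⟩
    exact congr($(h.hom_ext Q f₁ g₁ hf) x)
  hom_ext Q _ _ f g hfg := h'.hom_ext Q f g fun x => hfg _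

lemma of_bijective (hσ : Function.Bijective σ) (hψ : Function.Bijective ψ)
    (hs : ∀ r x, ψ (r • x) = σ r • ψ x) : IsBC σ ψ where
  smul := hs
  exists_lift Q _ _ χ hχ := by
    let e := AddEquiv.ofBijective ψ hψ
    refine ⟨⟨⟨fun x => χ (e.symm x), by simp⟩, fun r x => ?_⟩,
      fun x => congrArg χ (e.symm_apply_apply x)⟩
    obtain ⟨x, rfl⟩ := e.surjective x
    obtain ⟨r, rfl⟩ := hσ.2 r
    have : σ r • e x = e (r • x) := (hs r x).symm
    change χ (e.symm (σ r • e x)) = σ r • χ (e.symm (e x))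
    rw [this, AddEquiv.symm_apply_apply, AddEquiv.symm_apply_apply, hχ]
  hom_ext Q _ _ f g hfg := by
    ext x
    obtain ⟨x, rfl⟩ := hψ.2 x
    exact hfg x

lemma of_comp_bijective (h : IsBC (τ.comp σ) (ψ'.comp ψ)) (hτ : Function.Bijective τ)
    (hψ : Function.Bijective ψ') (hs : ∀ r x, ψ' (r • x) = τ r • ψ' x) : IsBC σ ψ := by
  let eτ := RingEquiv.ofBijective τ hτ
  let eψ := AddEquiv.ofBijective ψ' hψ
  have h2 : IsBC (eτ.symm : P →+* S) (eψ.symm : K →+ N) :=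
    .of_bijective eτ.symm.bijective eψ.symm.bijective fun r x => by
      obtain ⟨r, rfl⟩ := eτ.surjective r
      obtain ⟨x, rfl⟩ := eψ.surjective x
      have h3 : eτ r • eψ x = eψ (r • x) := (hs r x).symm
      rw [h3]
      simp
  have h4 := h.comp h2
  have h5 : ((eτ.symm : P →+* S).comp (τ.comp σ)) = σ := by
    ext r
    exact eτ.symm_apply_apply _
  have h6 : ((eψ.symm : K →+ N).comp (ψ'.comp ψ)) = ψ := by
    ext r
    exact eψ.symm_apply_apply _
  rwa [h5, h6] at h4

lemma of_equiv_right (h : IsBC σ ψ) {N' : Type u} [AddCommGroup N'] [Module S N'] {ψ₁ : M →+ N'}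
    (e : N ≃ₗ[S] N') (he : ∀ x, ψ₁ x = e (ψ x)) : IsBC σ ψ₁ := by
  have := h.comp (of_bijective (σ := RingHom.id S) (ψ := e.toAddEquiv.toAddMonoidHom)
    Function.bijective_id e.bijective (fun r x => e.map_smul r x))
  have h₁ : ψ₁ = e.toAddEquiv.toAddMonoidHom.comp ψ := AddMonoidHom.ext he
  rw [h₁]
  exact this

lemma of_equiv_left {M' : Type u} [AddCommGroup M'] [Module R M'] {ψ₁ : M' →+ N}
    (h : IsBC σ ψ) (e : M' ≃ₗ[R] M) (he : ∀ x, ψ₁ x = ψ (e x)) : IsBC σ ψ₁ := by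
  have := (of_bijective (σ := RingHom.id R) (ψ := e.toAddEquiv.toAddMonoidHom)
    Function.bijective_id e.bijective (fun r x => e.map_smul r x)).comp h
  have h₁ : ψ₁ = ψ.comp e.toAddEquiv.toAddMonoidHom := AddMonoidHom.ext he
  rw [h₁]
  exact this

/-- The projection modulo the span and the zero map agree on the image of `ψ`, hence are equal. -/
lemma span (h : IsBC σ ψ) : Submodule.span S (Set.range ψ) = ⊤ := by
  rw [← Submodule.ker_mkQ (Submodule.span S (Set.range ψ)), LinearMap.ker_eq_top]
  refine h.hom_ext _ _ _ fun x => ?_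
  exact (Submodule.Quotient.mk_eq_zero _).2 (Submodule.subset_span ⟨x, rfl⟩)

lemma subsingleton (h : IsBC σ ψ) [Subsingleton M] : Subsingleton N := by
  have h1 : LinearMap.id = (0 : N →ₗ[S] N) := h.hom_ext _ _ _ fun x => by
    rw [Subsingleton.elim x 0]; simp
  exact ⟨fun x y => congr($h1 x).trans (congr($h1 y)).symm⟩

lemma finite (h : IsBC σ ψ) [Module.Finite R M] : Module.Finite S N := by
  classical
  have hfg : (⊤ : Submodule R M).FG := Module.Finite.fg_top
  obtain ⟨s, hs⟩ := hfg
  refine ⟨⟨s.image ψ, ?_⟩⟩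
  rw [eq_top_iff, ← h.span, Submodule.span_le]
  rintro _ ⟨x, rfl⟩
  have hx : x ∈ Submodule.span R (s : Set M) := hs ▸ Submodule.mem_top
  induction hx using Submodule.span_induction with
  | mem x hx => exact Submodule.subset_span (by rw [Finset.coe_image]; exact ⟨x, hx, rfl⟩)
  | zero => simp
  | add x y _ _ hx hy => rw [map_add]; exact Submodule.add_mem _ hx hy
  | smul r x _ hx => rw [h.smul]; exact Submodule.smul_mem _ _ hx

lemma isBaseChange [Algebra R S] [Module R N] [IsScalarTower R S N] (h : IsBC σ ψ)
    (hσ : algebraMap R S = σ) (f : M →ₗ[R] N) (hf : ∀ x, f x = ψ x) : IsBaseChange S f := by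
  refine IsBaseChange.of_lift_unique _ fun Q _ _ _ _ g => ?_
  let : AddCommGroup Q := Module.addCommMonoidToAddCommGroup S (M := Q)
  obtain ⟨g', hg'⟩ := h.exists_lift Q g.toAddMonoidHom (fun r x => by
    rw [← hσ, algebraMap_smul]; exact g.map_smul r x)
  refine ⟨g', ?_, fun y hy => h.hom_ext Q _ _ fun x => ?_⟩
  · ext x
    exact (congrArg g' (hf x)).trans (hg' x)
  · rw [← hf]
    exact congr($hy x).trans (((congrArg g' (hf x)).trans (hg' x))).symm

lemma injective [Algebra R S] [Module.FaithfullyFlat R S] (h : IsBC (algebraMap R S) ψ) :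
    Function.Injective ψ := by
  let : Module R N := Module.compHom N (algebraMap R S)
  have : IsScalarTower R S N := IsScalarTower.of_compHom R S N
  let f : M →ₗ[R] N := { toFun := ψ, map_add' := map_add ψ, map_smul' := fun r x => h.smul r x }
  have hf := h.isBaseChange rfl f (fun _ => rfl)
  intro x y hxy
  apply Module.FaithfullyFlat.tensorProduct_mk_injective (A := R) (B := S) M
  apply hf.equiv.injective
  simp only [TensorProduct.mk_apply, hf.equiv_tmul, one_smul]
  exact hxy

lemma of_isBaseChange [Algebra R S] [Module R N] [IsScalarTower R S N]
    (hσ : algebraMap R S = σ) {f : M →ₗ[R] N} (h : IsBaseChange S f) (hf : ∀ x, f x = ψ x) :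
    IsBC σ ψ where
  smul r x := by rw [← hf, ← hf, ← hσ, algebraMap_smul, map_smul]
  exists_lift Q _ _ χ hχ := by
    let : Module R Q := Module.compHom Q (algebraMap R S)
    have : IsScalarTower R S Q := IsScalarTower.of_compHom R S Q
    let g : M →ₗ[R] Q := ⟨⟨χ, by simp⟩, fun r x => by
      change χ (r • x) = _ • χ x; rw [hχ, ← hσ]; rfl⟩
    exact ⟨h.lift g, fun x => by rw [← hf, h.lift_eq]; rfl⟩
  hom_ext Q _ _ f g hfg := by
    exact h.algHom_ext _ _ fun x => by rw [hf, hfg]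

lemma tensor [Algebra R S] : IsBC (algebraMap R S)
    (TensorProduct.mk R S M 1).toAddMonoidHom :=
  of_isBaseChange rfl (TensorProduct.isBaseChange R M S) (fun _ => rfl)

end IsBC

end IsBC

/-! ### Sections of the pullback of a quasi-coherent module -/

section Affine

variable {R R' : CommRingCat.{u}} (φ : R ⟶ R')

/-- Global sections of a pushforward along `Spec R' ⟶ Spec R`. -/
def pushforwardΓIso : Scheme.Modules.pushforward (Spec.map φ) ⋙ moduleSpecΓFunctor (R := R) ≅
    moduleSpecΓFunctor (R := R') ⋙ ModuleCat.restrictScalars φ.hom :=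
  Functor.isoWhiskerRight (pushforwardCompModulesSpecToSheafIso φ)
    (TopCat.Sheaf.forget _ _ ⋙ (evaluation _ _).obj (.op ⊤))

/-- The pullback of `tilde N` is `tilde` of the base change. -/
def pullbackTildeIso : tilde.functor R ⋙ Scheme.Modules.pullback (Spec.map φ) ≅
    ModuleCat.extendScalars φ.hom ⋙ tilde.functor R' :=
  -- Both functors are left adjoint to global sections followed by restriction of scalars.
  ((tilde.adjunction.comp (Scheme.Modules.pullbackPushforwardAdjunction (Spec.map φ))).ofNatIsoRight
    (pushforwardΓIso φ)).leftAdjointUniq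
    ((ModuleCat.extendRestrictScalarsAdj φ.hom).comp tilde.adjunction)

lemma qcoh_of_iso {X : Scheme.{u}} {M N : X.Modules} (e : M ≅ N) (h : M.IsQuasicoherent) :
    N.IsQuasicoherent :=
  (SheafOfModules.isQuasicoherent X.ringCatSheaf).prop_of_iso e h

lemma qcoh_pullback_SpecMap (M : (Spec R).Modules) (h : M.IsQuasicoherent) :
    ((Scheme.Modules.pullback (Spec.map φ)).obj M).IsQuasicoherent := by
  have e : M ≅ tilde ((modulesSpecToSheaf.obj M).presheaf.obj (.op ⊤)) :=
    (asIso M.fromTildeΓ).symm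
  refine qcoh_of_iso ((Scheme.Modules.pullback (Spec.map φ)).mapIso e ≪≫
    (pullbackTildeIso φ).app _).symm ?_
  have (A : ModuleCat.{u} R') : (tilde (R := R') A).IsQuasicoherent := inferInstance
  exact this _

lemma top_le_preimage_top {X Y : Scheme.{u}} (g : X ⟶ Y) : (⊤ : X.Opens) ≤ g ⁻¹ᵁ ⊤ :=
  le_rfl

lemma sec_top {X Y : Scheme.{u}} (g : X ⟶ Y) (M : Y.Modules) (x : Γ(M, ⊤)) :
    sec g M (top_le_preimage_top g) x = eta g M ⊤ x := by
  rw [sec_apply]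
  exact map_self _ _ _

/-- An isomorphism of left adjoints carries unit to unit. After identifying global sections of
`tilde N` with `N`, the pullback of sections becomes `n ↦ 1 ⊗ n`. -/
lemma isBC_sec_tilde (N : ModuleCat.{u} R) :
    IsBC φ.hom (sec (Spec.map φ) (tilde N) (O := ⊤) (O' := ⊤) (top_le_preimage_top _)) := by
  have h1 := Adjunction.unit_leftAdjointUniq_hom_app
    ((tilde.adjunction.comp (Scheme.Modules.pullbackPushforwardAdjunction (Spec.map φ))).ofNatIsoRight
    (pushforwardΓIso φ))
    ((ModuleCat.extendRestrictScalarsAdj φ.hom).comp tilde.adjunction) N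
  let e : (Scheme.Modules.pullback (Spec.map φ)).obj (tilde N) ≅
    tilde ((ModuleCat.extendScalars φ.hom).obj N) := (pullbackTildeIso φ).app N
  let et : Γ((Scheme.Modules.pullback (Spec.map φ)).obj (tilde N), ⊤) ≃ₗ[R']
      (ModuleCat.extendScalars φ.hom).obj N :=
    (moduleSpecΓFunctor.mapIso e ≪≫ (tilde.isoTop _).symm).toLinearEquiv
  let e0 : N ≃ₗ[R] Γ(tilde N, ⊤) := (tilde.isoTop N).toLinearEquiv
  let : Algebra R R' := φ.hom.toAlgebra
  have h2 (x : Γ(tilde N, ⊤)) :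
      et (sec (Spec.map φ) (tilde N) (O := ⊤) (O' := ⊤) (top_le_preimage_top _) x) =
      (TensorProduct.mk R R' N 1) (e0.symm x) := by
    obtain ⟨n, rfl⟩ := e0.surjective x
    rw [LinearEquiv.symm_apply_apply, sec_top]
    have h2 := congr($h1 n)
    have h3 : e.hom.app ⊤ (eta (Spec.map φ) (tilde N) ⊤ (e0 n)) =
      (tilde.isoTop ((ModuleCat.extendScalars φ.hom).obj N)).hom
        ((1 : R') ⊗ₜ[R] n : TensorProduct R R' N) := h2
    change (tilde.isoTop ((ModuleCat.extendScalars φ.hom).obj N)).inv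
      (e.hom.app ⊤ (eta (Spec.map φ) (tilde N) ⊤ (e0 n))) = _
    rw [h3]
    exact congr($((tilde.isoTop ((ModuleCat.extendScalars φ.hom).obj N)).hom_inv_id)
      ((1 : R') ⊗ₜ[R] n : TensorProduct R R' N))
  exact IsBC.of_equiv_right (ψ := (TensorProduct.mk R R' N 1).toAddMonoidHom.comp
    e0.symm.toAddEquiv.toAddMonoidHom) ((IsBC.tensor (R := R) (S := R') (M := N)).of_equiv_left
      e0.symm (fun _ => rfl)) et.symm fun x => ((LinearEquiv.symm_apply_eq et).2 (h2 x).symm).symm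

end Affine

end TwistedSheaf

namespace TwistedSheaf

section

variable {X Y : Scheme.{u}}

lemma image_le_of_le_preimage (j : X ⟶ Y) [IsOpenImmersion j] {O : Y.Opens}
    {O' : X.Opens} (e : O' ≤ j ⁻¹ᵁ O) : j ''ᵁ O' ≤ O := by
  rintro _ ⟨y, hy, rfl⟩
  exact e hy

/-- Restriction to an open subscheme and pullback are both left adjoint to pushforward, so their
units correspond. -/
lemma sec_eq_of_isOpenImmersion (j : X ⟶ Y) [IsOpenImmersion j] (M : Y.Modules) {O : Y.Opens}
    {O' : X.Opens} (e : O' ≤ j ⁻¹ᵁ O) (x : Γ(M, O)) :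
    sec j M e x = ((Scheme.Modules.restrictFunctorIsoPullback j).hom.app M).app O'
      ((M.restrictAppIso j O').inv
        (M.presheaf.map (homOfLE (image_le_of_le_preimage j e)).op x)) := by
  have h1 := Adjunction.unit_leftAdjointUniq_hom_app (Scheme.Modules.restrictAdjunction j)
    (Scheme.Modules.pullbackPushforwardAdjunction j) M
  have h2 : eta j M O x = ((Scheme.Modules.restrictFunctorIsoPullback j).hom.app M).app (j ⁻¹ᵁ O)
      (((Scheme.Modules.restrictAdjunction j).unit.app M).app O x) := congr(($h1).app O x).symm
  rw [sec_apply, h2]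
  refine (app_map ((Scheme.Modules.restrictFunctorIsoPullback j).hom.app M) e
    (((Scheme.Modules.restrictAdjunction j).unit.app M).app O x)).symm.trans ?_
  refine congrArg _ ?_
  exact map_map M (j.image_preimage_le O) (j.image_mono e) x

lemma bijective_sec_of_isOpenImmersion (j : X ⟶ Y) [IsOpenImmersion j] (M : Y.Modules)
    {O : Y.Opens} {O' : X.Opens} (e : O' ≤ j ⁻¹ᵁ O) (h : O ≤ j ''ᵁ O') :
    Function.Bijective (sec j M e) := by
  have h' : j ''ᵁ O' ≤ O := image_le_of_le_preimage j e
  obtain rfl : O = j ''ᵁ O' := le_antisymm h h'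
  have h1 : (sec j M e : _ → _) = (((M.restrictAppIso j O').symm ≪≫
    asIso (((Scheme.Modules.restrictFunctorIsoPullback j).hom.app M).app O')).hom) := by
    ext x
    rw [sec_eq_of_isOpenImmersion, map_self]
    rfl
  rw [h1]
  exact ConcreteCategory.bijective_of_isIso _

lemma bijective_appLE_of_isOpenImmersion (j : X ⟶ Y) [IsOpenImmersion j]
    {O : Y.Opens} {O' : X.Opens} (e : O' ≤ j ⁻¹ᵁ O) (h : O ≤ j ''ᵁ O') :
    Function.Bijective (j.appLE O O' e) := by
  have h' : j ''ᵁ O' ≤ O := image_le_of_le_preimage j e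
  obtain rfl : O = j ''ᵁ O' := le_antisymm h h'
  rw [← Scheme.Hom.appIso_hom']
  exact ConcreteCategory.bijective_of_isIso _

lemma isBC_sec_of_isOpenImmersion (j : X ⟶ Y) [IsOpenImmersion j] (M : Y.Modules)
    {O : Y.Opens} {O' : X.Opens} (e : O' ≤ j ⁻¹ᵁ O) (h : O ≤ j ''ᵁ O') :
    IsBC (j.appLE O O' e).hom (sec j M e) :=
  .of_bijective (bijective_appLE_of_isOpenImmersion j e h) (bijective_sec_of_isOpenImmersion j M e h)
    (sec_smul j M e)

/-- An isomorphism of modules on sections, as a linear equivalence. -/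
def appEquiv {M N : X.Modules} (i : M ≅ N) (O : X.Opens) : Γ(M, O) ≃ₗ[Γ(X, O)] Γ(N, O) where
  toFun := i.hom.app O
  map_add' := map_add _
  map_smul' r x := Scheme.Modules.Hom.app_smul _ r x
  invFun := i.inv.app O
  left_inv x := congr(($i.hom_inv_id).app O x)
  right_inv x := congr(($i.inv_hom_id).app O x)

lemma appEquiv_apply {M N : X.Modules} (i : M ≅ N) (O : X.Opens) (x : Γ(M, O)) :
    appEquiv i O x = i.hom.app O x := rfl

lemma isBC_sec_of_iso {g : X ⟶ Y} {M N : Y.Modules} (i : M ≅ N) {V : Y.Opens} {U : X.Opens}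
    {e : U ≤ g ⁻¹ᵁ V} (h : IsBC (g.appLE V U e).hom (sec g M e)) :
    IsBC (g.appLE V U e).hom (sec g N e) := by
  refine (h.of_equiv_left (ψ₁ := (sec g M e).comp (appEquiv i.symm V).toAddEquiv.toAddMonoidHom)
    (appEquiv i.symm V) (fun _ => rfl)).of_equiv_right
    (appEquiv ((Scheme.Modules.pullback g).mapIso i) U) fun x => ?_
  have := sec_map g i.hom e (i.inv.app V x)
  rw [appEquiv_apply]
  refine Eq.trans ?_ this.symm
  rw [← ConcreteCategory.comp_apply, ← Scheme.Modules.Hom.comp_app, i.inv_hom_id]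
  rfl

/-- A quasi-coherent module on `Spec R` is `tilde` of its global sections. What remains is to
replace `R` by the ring of global functions of `Spec R`. -/
lemma isBC_sec_SpecMap {R R' : CommRingCat.{u}} (φ : R ⟶ R') (M : (Spec R).Modules)
    (hM : M.IsQuasicoherent) :
    IsBC ((Spec.map φ).appLE ⊤ ⊤ (top_le_preimage_top _)).hom
      (sec (Spec.map φ) M (top_le_preimage_top (Spec.map φ))) := by
  refine isBC_sec_of_iso (asIso M.fromTildeΓ) ?_
  let K := tilde ((modulesSpecToSheaf.obj M).presheaf.obj (.op ⊤))
  have h1 (A : CommRingCat.{u}) (L : (Spec A).Modules) :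
      IsBC (Scheme.ΓSpecIso A).inv.hom (AddMonoidHom.id Γ(L, ⊤)) :=
    .of_bijective (ConcreteCategory.bijective_of_isIso _) Function.bijective_id (fun r x => by
      change r • x = _
      rw [Scheme.Modules.smul_Spec_def]
      exact congr($((Spec A).presheaf.map_id (Opposite.op ⊤)) ((Scheme.ΓSpecIso A).inv r) • x))
  refine (h1 R K).of_comp ?_ (sec_smul _ _ _)
  have h2 := (isBC_sec_tilde φ ((modulesSpecToSheaf.obj M).presheaf.obj (.op ⊤))).comp (h1 R' _)
  convert h2 using 1
  swap
  · rfl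
  rw [← CommRingCat.hom_comp, ← CommRingCat.hom_comp, Scheme.ΓSpecIso_inv_naturality]
  simp [Scheme.Hom.appTop, Scheme.Hom.app_eq_appLE]

lemma res_eq_appEquiv {Z : Scheme.{u}} (g : X ⟶ Y) {b : Y ⟶ Z} {b' : X ⟶ Z} (hb : g ≫ b = b')
    (M : Z.Modules) {O : Y.Opens} {O' : X.Opens} (e : O' ≤ g ⁻¹ᵁ O) (x) :
    res g hb M e x = appEquiv (pbC g hb M) O' (sec g _ e x) := by
  rw [res_apply, appEquiv_apply]

lemma bijective_of_eq_comp {A B C : Type u} {f : A → C} {g : B → C} {h : A → B}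
    (e : ∀ x, f x = g (h x)) (hg : Function.Bijective g) (hh : Function.Bijective h) :
    Function.Bijective f := by
  rw [funext e]
  exact hg.comp hh

lemma bijective_res_of_isOpenImmersion {Z : Scheme.{u}} (j : X ⟶ Y) [IsOpenImmersion j] {b : Y ⟶ Z}
    {b' : X ⟶ Z} (hb : j ≫ b = b') (M : Z.Modules) {O : Y.Opens} {O' : X.Opens} (e : O' ≤ j ⁻¹ᵁ O)
    (h : O ≤ j ''ᵁ O') : Function.Bijective (res j hb M e) := by
  exact bijective_of_eq_comp (res_eq_appEquiv j hb M e) (appEquiv (pbC j hb M) O').bijective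
    (bijective_sec_of_isOpenImmersion _ _ _ h)

/-- The base change property of the pullback of sections is local. -/
lemma isBC_sec_of_comm {P Q : Scheme.{u}} (g : X ⟶ Y) (M : Y.Modules) {V : Y.Opens} {U : X.Opens}
    (e : U ≤ g ⁻¹ᵁ V) (jU : Q ⟶ X) (jV : P ⟶ Y) [IsOpenImmersion jU] [IsOpenImmersion jV]
    (ψ : Q ⟶ P) (hc : ψ ≫ jV = jU ≫ g) (hjV : (⊤ : P.Opens) ≤ jV ⁻¹ᵁ V)
    (hjU : (⊤ : Q.Opens) ≤ jU ⁻¹ᵁ U)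
    (hjVT : V ≤ jV ''ᵁ ⊤) (hjUT : U ≤ jU ''ᵁ ⊤)
    (h : IsBC (ψ.appLE ⊤ ⊤ (top_le_preimage_top _)).hom
      (sec ψ ((Scheme.Modules.pullback jV).obj M) (top_le_preimage_top _))) :
    IsBC (g.appLE V U e).hom (sec g M e) := by
  have hb : (⊤ : Q.Opens) ≤ (jU ≫ g) ⁻¹ᵁ V := fun x hx => e (hjU hx)
  have h1 := (isBC_sec_of_isOpenImmersion jV M hjV hjVT).comp h
  have h2 := isBC_sec_of_isOpenImmersion jU ((Scheme.Modules.pullback g).obj M) hjU hjUT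
  have h0 : (ψ.appLE ⊤ ⊤ (top_le_preimage_top _)).hom.comp
      (jV.appLE V ⊤ hjV).hom = ((jU ≫ g).appLE V ⊤ hb).hom := by
    rw [← CommRingCat.hom_comp, Scheme.Hom.appLE_comp_appLE]
    simp_rw [hc]
  rw [h0] at h1
  have h3 : IsBC ((jU ≫ g).appLE V ⊤ hb).hom (sec (jU ≫ g) M hb) :=
    h1.of_equiv_right (ψ₁ := sec (jU ≫ g) M hb) (appEquiv (pbC _ hc M) ⊤)
      fun x => by
        rw [AddMonoidHom.comp_apply, appEquiv_apply,
          sec_comp _ _ hc M hjV (top_le_preimage_top _) hb x]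
  have h4 : IsBC (jU.appLE U ⊤ hjU).hom (res jU rfl M hjU) :=
    h2.of_equiv_right (appEquiv (pbC jU rfl M) ⊤) (res_eq_appEquiv jU rfl M hjU)
  have h5 : (jU.appLE U ⊤ hjU).hom.comp (g.appLE V U e).hom = ((jU ≫ g).appLE V ⊤ hb).hom := by
    rw [← CommRingCat.hom_comp, Scheme.Hom.appLE_comp_appLE]
  have h6 : (res jU rfl M hjU).comp (sec g M e) = sec (jU ≫ g) M hb := by
    ext x
    rw [AddMonoidHom.comp_apply, res_sec _ _ M e hjU hb x]
  rw [← h5, ← h6] at h3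
  -- Going through `P` or through `X` gives the same map to sections on `Q`; the last leg from `X`
  -- is a bijection and can be cancelled.
  exact h3.of_comp_bijective (bijective_appLE_of_isOpenImmersion _ _ hjUT)
    (bijective_res_of_isOpenImmersion jU rfl M hjU hjUT) h4.smul

lemma qcoh_pullback_of_isOpenImmersion (j : X ⟶ Y) [IsOpenImmersion j] {M : Y.Modules}
    (h : M.IsQuasicoherent) : ((Scheme.Modules.pullback j).obj M).IsQuasicoherent :=
  qcoh_of_iso ((Scheme.Modules.restrictFunctorIsoPullback j).app M)
    (Scheme.Modules.isQuasicoherent_restrictFunctor _ M)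

lemma top_le_fromSpec_preimage {V : Y.Opens} (hV : IsAffineOpen V) :
    (⊤ : (Spec Γ(Y, V)).Opens) ≤ hV.fromSpec ⁻¹ᵁ V := by
  rw [hV.fromSpec_preimage_self]

lemma le_fromSpec_image_top {V : Y.Opens} (hV : IsAffineOpen V) : V ≤ hV.fromSpec ''ᵁ ⊤ := by
  simp

/-- Sections of the pullback of a quasi-coherent module over affine open subsets. -/
lemma isBC_sec (g : X ⟶ Y) {M : Y.Modules} (hM : M.IsQuasicoherent) {V : Y.Opens} {U : X.Opens}
    (hV : IsAffineOpen V) (hU : IsAffineOpen U) (e : U ≤ g ⁻¹ᵁ V) :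
    IsBC (g.appLE V U e).hom (sec g M e) :=
  isBC_sec_of_comm g M e hU.fromSpec hV.fromSpec (Spec.map (g.appLE V U e))
    (hV.SpecMap_appLE_fromSpec g hU e) (top_le_fromSpec_preimage hV) (top_le_fromSpec_preimage hU)
    (le_fromSpec_image_top hV) (le_fromSpec_image_top hU)
    (isBC_sec_SpecMap _ _ (qcoh_pullback_of_isOpenImmersion _ hM))

/-- Quasi-coherence asks for presentations over slice sites. They are obtained from presentations on
open subschemes through the equivalence of the two module categories, which preserves colimits and
the structure sheaf. -/
lemma isQuasicoherent_of_presentation_restrict {X : Scheme.{u}} (K : X.Modules) {ι : Type u}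
    (U : ι → X.Opens) (hU : TopologicalSpace.IsOpenCover U)
    (h : ∀ i, Nonempty ((K.restrict (U i).ι).Presentation)) : K.IsQuasicoherent := by
  refine (SheafOfModules.QuasicoherentData.mk (I := ι) U ?_ fun i => ?_).isQuasicoherent
  · rw [Opens.coversTop_iff]
    exact hU
  · have P := (h i).some
    let E := Scheme.Modules.overEquiv (U i)
    have hE : PreservesColimitsOfSize.{u, u, u, u, u + 1, u + 1} E.inverse := inferInstance
    let e0 : E.functor.obj (SheafOfModules.unit (X.ringCatSheaf.over (U i))) ≅
        (Scheme.Modules.restrictFunctor (U i).ι).obj (SheafOfModules.unit X.ringCatSheaf) :=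
      (Scheme.Modules.overFunctorEquiv (U i)).app (SheafOfModules.unit X.ringCatSheaf)
    let e1 : SheafOfModules.unit (X.ringCatSheaf.over (U i)) ≅
        E.inverse.obj (SheafOfModules.unit _) :=
      E.unitIso.app _ ≪≫ E.inverse.mapIso (e0 ≪≫ Scheme.Modules.restrictUnitIso (U i).ι)
    let e2 : E.inverse.obj (K.restrict (U i).ι) ≅ SheafOfModules.over K (U i) :=
      E.inverse.mapIso ((Scheme.Modules.overFunctorEquiv (U i)).app K).symm ≪≫
        (E.unitIso.app _).symm
    exact SheafOfModules.Presentation.ofIsIso.{u, u, u} e2.hom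
      (@SheafOfModules.Presentation.map _ _ _ _ _ _ _ _ _ _ _ _ _ P E.inverse hE e1)

/-- Quasi-coherence can be checked on an affine open covering. -/
lemma isQuasicoherent_of_isAffineOpen {X : Scheme.{u}} (K : X.Modules)
    (h : ∀ x : X, ∃ (U : X.Opens) (hU : IsAffineOpen U), x ∈ U ∧
      ((Scheme.Modules.pullback hU.fromSpec).obj K).IsQuasicoherent) : K.IsQuasicoherent := by
  choose U hU hxU hq using h
  refine isQuasicoherent_of_presentation_restrict K U ?_ fun x => ?_
  · rw [TopologicalSpace.IsOpenCover, eq_top_iff]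
    exact fun x _ => TopologicalSpace.Opens.mem_iSup.2 ⟨x, hxU x⟩
  · have h1 : (K.restrict (hU x).fromSpec).IsQuasicoherent :=
      qcoh_of_iso ((Scheme.Modules.restrictFunctorIsoPullback _).app K).symm (hq x)
    let L := K.restrict (hU x).fromSpec
    have : IsIso L.fromTildeΓ := Scheme.Modules.isIso_fromTildeΓ_of_isQuasicoherent L
    let N := (modulesSpecToSheaf.obj L).presheaf.obj (.op ⊤)
    have P := Scheme.Modules.presentationRestrict (hU x).isoSpec.hom
      (presentationTilde.{u} N .univ (by simp) _ (Submodule.span_eq _))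
    let e : (tilde N).restrict (hU x).isoSpec.hom ≅ K.restrict (U x).ι :=
      (Scheme.Modules.restrictFunctor _).mapIso (asIso L.fromTildeΓ) ≪≫
        (Scheme.Modules.restrictFunctorComp _ _).symm.app K ≪≫
        (Scheme.Modules.restrictFunctorCongr (by simp)).app K
    have : @IsIso (SheafOfModules _) _ _ _ e.hom := ⟨e.inv, e.hom_inv_id, e.inv_hom_id⟩
    exact ⟨SheafOfModules.Presentation.ofIsIso.{u, u, u} e.hom P⟩

/-- Locally `g` is `Spec` of a ring map, and there the pullback of `tilde` is `tilde` of the base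
change. -/
lemma qcoh_pullback (g : X ⟶ Y) {M : Y.Modules} (hM : M.IsQuasicoherent) :
    ((Scheme.Modules.pullback g).obj M).IsQuasicoherent := by
  refine isQuasicoherent_of_isAffineOpen _ fun x => ?_
  obtain ⟨V, hV, hxV, -⟩ := exists_isAffineOpen_mem_and_subset (U := (⊤ : Y.Opens)) (x := g x) trivial
  obtain ⟨U, hU, hxU, hUV⟩ := exists_isAffineOpen_mem_and_subset (U := g ⁻¹ᵁ V) hxV
  refine ⟨U, hU, hxU, ?_⟩
  refine qcoh_of_iso (pbC (Spec.map (g.appLE V U hUV)) (hV.SpecMap_appLE_fromSpec g hU hUV) M ≪≫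
    (pbC hU.fromSpec rfl M).symm) ?_
  exact qcoh_pullback_SpecMap _ _ (qcoh_pullback_of_isOpenImmersion _ hM)

end

end TwistedSheaf

/-! ### Criteria on affine opens: quasi-coherence, equality and invertibility of morphisms. -/

namespace TwistedSheaf

section

variable {X Y : Scheme.{u}}

lemma sec_restrict_left (g : X ⟶ Y) (M : Y.Modules) {O O₁ : Y.Opens} {O' : X.Opens}
    (e : O' ≤ g ⁻¹ᵁ O) (e₁ : O' ≤ g ⁻¹ᵁ O₁) (i : O₁ ≤ O) (x : Γ(M, O)) :
    sec g M e₁ (M.presheaf.map (homOfLE i).op x) = sec g M e x := by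
  rw [sec_restrict g M e e₁ i le_rfl, map_self]

lemma map_smul_opens (M : X.Modules) {V U : X.Opens} (i : U ≤ V) (r : Γ(X, V)) (x : Γ(M, V)) :
    M.presheaf.map (homOfLE i).op (r • x) =
      X.presheaf.map (homOfLE i).op r • M.presheaf.map (homOfLE i).op x :=
  Scheme.Modules.map_smul (M := M) (homOfLE i) r x

/-- Restriction of sections of a quasi-coherent module between affine open subsets. -/
lemma isBC_restrict {M : X.Modules} (hM : M.IsQuasicoherent) {V U : X.Opens}
    (hV : IsAffineOpen V) (hU : IsAffineOpen U) (i : U ≤ V) :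
    IsBC (X.presheaf.map (homOfLE i).op).hom (M.presheaf.map (homOfLE i).op).hom := by
  -- Restriction is read as pullback of sections along the identity, which brings it under
  -- `isBC_sec`.
  have e : U ≤ 𝟙 X ⁻¹ᵁ V := i
  have e₁ : U ≤ 𝟙 X ⁻¹ᵁ U := le_rfl
  have e₂ : U ≤ 𝟙 X ''ᵁ U := fun x hx => ⟨x, hx, rfl⟩
  have h := isBC_sec (𝟙 X) hM hV hU e
  refine IsBC.of_comp_bijective (τ := ((𝟙 X : X ⟶ X).appLE U U e₁).hom) (ψ' := sec (𝟙 X) M e₁) ?_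
    (bijective_appLE_of_isOpenImmersion _ _ e₂) (bijective_sec_of_isOpenImmersion _ _ _ e₂)
    (sec_smul _ _ _)
  have h1 : ((𝟙 X : X ⟶ X).appLE U U e₁).hom.comp (X.presheaf.map (homOfLE i).op).hom =
      ((𝟙 X : X ⟶ X).appLE V U e).hom := by
    rw [← CommRingCat.hom_comp, Scheme.Hom.map_appLE]
  have h2 : (sec (𝟙 X) M e₁).comp (M.presheaf.map (homOfLE i).op).hom = sec (𝟙 X) M e := by
    ext x
    exact sec_restrict_left _ _ _ _ _ _
  rw [h1, h2]
  exact h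

/-- On an affine open, a module is `tilde` of its sections once restriction to each `D(f)` is
localization at `f`; and this localization is base change to the functions on `D(f)`. -/
lemma isQuasicoherent_of_isBC_basicOpen (K : X.Modules)
    (h : ∀ (V : X.Opens) (_ : IsAffineOpen V) (f : Γ(X, V)),
      IsBC (X.presheaf.map (homOfLE (X.basicOpen_le f)).op).hom
        (K.presheaf.map (homOfLE (X.basicOpen_le f)).op).hom) : K.IsQuasicoherent := by
  refine isQuasicoherent_of_isAffineOpen _ fun x => ?_
  obtain ⟨V, hV, hxV, -⟩ := exists_isAffineOpen_mem_and_subset (U := (⊤ : X.Opens)) (x := x) trivial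
  refine ⟨V, hV, hxV, ?_⟩
  rw [isQuasicoherent_iff_isIso_fromTildeΓ, isIso_fromTildeΓ_iff_isLocalizing]
  intro f
  let R := Γ(X, V)
  let j := hV.fromSpec
  let L := (Scheme.Modules.pullback j).obj K
  let D : (Spec R).Opens := PrimeSpectrum.basicOpen f
  have hD : X.basicOpen f ≤ j ''ᵁ D := by rw [hV.fromSpec_image_basicOpen]
  have hD' : D ≤ j ⁻¹ᵁ X.basicOpen f := by rw [hV.fromSpec_preimage_basicOpen]
  have h1 := h V hV f
  have hT := isBC_sec_of_isOpenImmersion j K (top_le_fromSpec_preimage hV) (le_fromSpec_image_top hV)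
  have h2 := h1.comp (isBC_sec_of_isOpenImmersion j K hD' hD)
  have h3 : IsBC ((Spec R).presheaf.map (homOfLE (le_top : D ≤ ⊤)).op).hom
      (L.presheaf.map (homOfLE (le_top : D ≤ ⊤)).op).hom := by
    refine hT.of_comp ?_ (map_smul_opens _ _)
    have h4 : ((Spec R).presheaf.map (homOfLE (le_top : D ≤ ⊤)).op).hom.comp
        (j.appLE V ⊤ (top_le_fromSpec_preimage hV)).hom =
        (j.appLE _ _ hD').hom.comp (X.presheaf.map (homOfLE (X.basicOpen_le f)).op).hom := by
      rw [← CommRingCat.hom_comp, ← CommRingCat.hom_comp, Scheme.Hom.map_appLE,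
        Scheme.Hom.appLE_map]
    have h5 : (L.presheaf.map (homOfLE (le_top : D ≤ ⊤)).op).hom.comp
        (sec j K (top_le_fromSpec_preimage hV)) =
        (sec j K hD').comp (K.presheaf.map (homOfLE (X.basicOpen_le f)).op).hom := by
      ext x
      refine Eq.trans ?_ (sec_restrict j K (top_le_fromSpec_preimage hV) hD' (X.basicOpen_le f)
        le_top x).symm
      rfl
    rw [h4, h5]
    exact h2
  have h6 : IsBC (Scheme.ΓSpecIso R).inv.hom (AddMonoidHom.id Γ(L, ⊤)) :=
    .of_bijective (ConcreteCategory.bijective_of_isIso _) Function.bijective_id (fun r x => by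
      change r • x = _
      rw [Scheme.Modules.smul_Spec_def]
      exact congr($((Spec R).presheaf.map_id (Opposite.op ⊤)) ((Scheme.ΓSpecIso R).inv r) • x))
  have h7 := h6.comp h3
  let l : Γ(L, ⊤) →ₗ[R] Γ(L, D) := ((modulesSpecToSheaf.obj L).obj.map D.leTop.op).hom
  have h8 : IsLocalizedModule (.powers f) l := by
    rw [isLocalizedModule_iff_isBaseChange (S := .powers f) (A := Γ(Spec R, D))]
    exact h7.isBaseChange rfl l (fun _ => rfl)
  exact h8

/-- A morphism of `𝒪_X`-modules from its effect on sections. -/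
def modHomMk {M N : X.Modules} (f : ∀ V : X.Opens, Γ(M, V) →+ Γ(N, V))
    (hf : ∀ (V U : X.Opens) (i : U ≤ V) (x : Γ(M, V)), f U (M.presheaf.map (homOfLE i).op x) =
      N.presheaf.map (homOfLE i).op (f V x))
    (hs : ∀ (V : X.Opens) (r : Γ(X, V)) (x : Γ(M, V)), f V (r • x) = r • f V x) : M ⟶ N :=
  SheafOfModules.Hom.mk (PresheafOfModules.homMk
    { app := fun V => AddCommGrpCat.ofHom (f V.unop)
      naturality := fun V W i => by
        ext x
        exact hf V.unop W.unop (leOfHom i.unop) x }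
    (fun V s m => hs V.unop s m))

lemma section_ext (M : X.Modules) {V : X.Opens} (x y : Γ(M, V))
    (h : ∀ p ∈ V, ∃ (U : X.Opens) (i : U ≤ V), p ∈ U ∧
      M.presheaf.map (homOfLE i).op x = M.presheaf.map (homOfLE i).op y) : x = y := by
  refine TopCat.Presheaf.IsSheaf.section_ext M.isSheaf fun p hp => ?_
  obtain ⟨U, i, hU, e⟩ := h p hp
  exact ⟨U, i, hU, e⟩

lemma hom_ext_of_isBasis {B : Set X.Opens} (hB : TopologicalSpace.Opens.IsBasis B) {M N : X.Modules}
    {u v : M ⟶ N} (h : ∀ V ∈ B, ∀ x, u.app V x = v.app V x) : u = v := by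
  ext O x
  refine section_ext N _ _ fun p hp => ?_
  obtain ⟨_, ⟨U, hU, rfl⟩, hpU, hUO⟩ := hB.exists_subset_of_mem_open hp O.2
  have hUO : U ≤ O := hUO
  refine ⟨U, hUO, hpU, ?_⟩
  exact (app_map u hUO x).symm.trans ((h U hU _).trans (app_map v hUO x))

lemma isIso_of_isBasis {B : Set X.Opens} (hB : TopologicalSpace.Opens.IsBasis B) {M N : X.Modules}
    (u : M ⟶ N) (h : ∀ V ∈ B, Function.Bijective (u.app V)) : IsIso u := by
  rw [Scheme.Modules.Hom.isIso_iff_isIso_app]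
  have hB' : TopologicalSpace.Opens.IsBasis (Set.range (fun V : B => V.1)) := by
    rwa [Subtype.range_coe]
  let F : TopCat.Sheaf Ab X := ⟨M.presheaf, M.isSheaf⟩
  let G : TopCat.Sheaf Ab X := ⟨N.presheaf, N.isSheaf⟩
  let φ : F ⟶ G := ⟨u.mapPresheaf⟩
  have h1 : IsIso φ := TopCat.Sheaf.isIso_iff_isIso_basis hB' (fun V => by
      rw [ConcreteCategory.isIso_iff_bijective]
      exact h V.1 V.2)
  have h2 := Functor.map_isIso (TopCat.Sheaf.forget Ab X) φ
  have h3 : IsIso u.mapPresheaf := h2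
  exact fun V => inferInstanceAs (IsIso (u.mapPresheaf.app (.op V)))

lemma mono_app_injective {M N : X.Modules} (u : M ⟶ N) [Mono u] (V : X.Opens) :
    Function.Injective (u.app V) := by
  have : Mono ((Scheme.Modules.toPresheaf X).map u) := inferInstance
  have := (NatTrans.mono_iff_mono_app _).1 this (.op V)
  exact (AddCommGrpCat.mono_iff_injective _).1 this

/-- Taking sections over `V` commutes with kernels, so the kernel fork of abelian groups lifts. -/
lemma exists_kernel_app_eq {M N : X.Modules} (u : M ⟶ N) (V : X.Opens) (x : Γ(M, V))
    (hx : u.app V x = 0) : ∃ y, (kernel.ι u).app V y = x := by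
  let F := Scheme.Modules.toPresheaf X ⋙ (evaluation _ Ab).obj (.op V)
  have : PreservesLimitsOfSize.{0, 0} (Scheme.Modules.toPresheaf X) :=
    preservesLimitsOfSize_shrink _
  have : PreservesLimitsOfShape WalkingParallelPair
    ((evaluation (TopologicalSpace.Opens X)ᵒᵖ Ab.{u}).obj (.op V)) := inferInstance
  have : PreservesLimitsOfShape WalkingParallelPair F := comp_preservesLimitsOfShape _ _
  have : F.PreservesZeroMorphisms := ⟨fun _ _ => rfl⟩
  have h := KernelFork.mapIsLimit _ (kernelIsKernel u) F
  let A : Ab.{u} := AddCommGrpCat.of (u.app V).hom.ker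
  let i : A ⟶ F.obj M := AddCommGrpCat.ofHom (u.app V).hom.ker.subtype
  let c : KernelFork (F.map u) := KernelFork.ofι i (by ext y; exact y.2)
  exact ⟨h.lift c (⟨x, hx⟩ : (u.app V).hom.ker),
    congr($(h.fac c WalkingParallelPair.zero) (⟨x, hx⟩ : (u.app V).hom.ker))⟩

lemma kernel_ι_app_apply {M N : X.Modules} (u : M ⟶ N) (V : X.Opens) (y) :
    u.app V ((kernel.ι u).app V y) = 0 :=
  congr(($(kernel.condition u)).app V y)

end

end TwistedSheaf

namespace TwistedSheaf

/-! ### Descent of modules along flat ring maps -/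

section Descent

variable {R S : Type u} [CommRing R] [CommRing S] [Algebra R S]

/-- Exactness of the Amitsur complex with coefficients in a module. -/
lemma exists_tmul_of_faithfullyFlat [Module.FaithfullyFlat R S] {N : Type u} [AddCommGroup N]
    [Module R N] (y : S ⊗[R] N)
    (hy : LinearMap.rTensor N (Algebra.TensorProduct.includeLeft : S →ₐ[R] S ⊗[R] S).toLinearMap y =
      LinearMap.rTensor N (Algebra.TensorProduct.includeRight : S →ₐ[R] S ⊗[R] S).toLinearMap y) :
    ∃ n : N, y = 1 ⊗ₜ n := by
  let f : N →ₗ[R] S ⊗[R] N := TensorProduct.mk R S N 1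
  let d : S ⊗[R] N →ₗ[R] (S ⊗[R] S) ⊗[R] N :=
    LinearMap.rTensor N (Algebra.TensorProduct.includeLeft : S →ₐ[R] S ⊗[R] S).toLinearMap -
    LinearMap.rTensor N (Algebra.TensorProduct.includeRight : S →ₐ[R] S ⊗[R] S).toLinearMap
  have hex : Function.Exact f d := by
    -- Exactness may be tested after a further `S ⊗ -`, where the multiplication of `S` gives a
    -- contracting homotopy.
    apply Module.FaithfullyFlat.lTensor_reflects_exact R S
    -- contraction of the first two factors
    let c : S ⊗[R] ((S ⊗[R] S) ⊗[R] N) →ₗ[R] S ⊗[R] (S ⊗[R] N) :=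
      (LinearMap.rTensor _ (LinearMap.mul' R S)) ∘ₗ
        (TensorProduct.assoc R S S (S ⊗[R] N)).symm.toLinearMap ∘ₗ
        (LinearMap.lTensor S (TensorProduct.assoc R S S N).toLinearMap)
    let c' : S ⊗[R] (S ⊗[R] N) →ₗ[R] S ⊗[R] N :=
      (LinearMap.rTensor _ (LinearMap.mul' R S)) ∘ₗ (TensorProduct.assoc R S S N).symm.toLinearMap
    have h1 : c ∘ₗ LinearMap.lTensor S d = LinearMap.lTensor S f ∘ₗ c' - LinearMap.id := by
      ext a s n
      simp [c, c', f, d]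
    intro z
    constructor
    · intro hz
      have h2 := congr($h1 z)
      simp only [LinearMap.comp_apply, hz, map_zero, LinearMap.sub_apply, LinearMap.id_apply] at h2
      exact ⟨c' z, sub_eq_zero.1 h2.symm⟩
    · rintro ⟨z, rfl⟩
      rw [← LinearMap.comp_apply, ← LinearMap.lTensor_comp]
      have : d ∘ₗ f = 0 := by
        ext n
        simp [d, f]
      rw [this]
      simp
  obtain ⟨n, hn⟩ := (hex y).1 (sub_eq_zero.2 hy : d y = 0)
  exact ⟨n, hn.symm⟩

variable {H₀ H H₂ H₃ : Type u} [AddCommGroup H] [AddCommGroup H₂] [AddCommGroup H₃]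
  [AddCommGroup H₀] [Module R H₀] [Module S H] [Module (S ⊗[R] S) H₂]
  [Module ((S ⊗[R] S) ⊗[R] S) H₃]

/-- The universal property of `H₂` yields a map `Θ` to `(S ⊗ S) ⊗ H₀` that turns `ρ₁` and `ρ₂` into
the two maps of the Amitsur complex. For `ρ₂`, semilinearity along the right factor is enough. -/
lemma exists_of_faithfullyFlat [Module.FaithfullyFlat R S] {ψ : H₀ →+ H} {ρ₁ ρ₂ : H →+ H₂}
    (hψ : IsBC (algebraMap R S) ψ)
    (h₁ : IsBC (Algebra.TensorProduct.includeLeft : S →ₐ[R] S ⊗[R] S).toRingHom ρ₁)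
    (h₂ : ∀ (s : S) x, ρ₂ (s • x) = (1 ⊗ₜ[R] s : S ⊗[R] S) • ρ₂ x)
    (h₁₂ : ∀ x, ρ₁ (ψ x) = ρ₂ (ψ x)) (y : H) (hy : ρ₁ y = ρ₂ y) : ∃ x, ψ x = y := by
  let : Module R H := Module.compHom H (algebraMap R S)
  have : IsScalarTower R S H := IsScalarTower.of_compHom R S H
  have hbc : IsBC (algebraMap R (S ⊗[R] S)) (ρ₁.comp ψ) := hψ.comp h₁
  obtain ⟨Θ, hΘ⟩ := hbc.exists_lift ((S ⊗[R] S) ⊗[R] H₀)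
    (TensorProduct.mk R (S ⊗[R] S) H₀ 1).toAddMonoidHom (fun r x => by
      change (1 : S ⊗[R] S) ⊗ₜ[R] (r • x) = algebraMap R (S ⊗[R] S) r • (1 : S ⊗[R] S) ⊗ₜ[R] x
      rw [algebraMap_smul, TensorProduct.tmul_smul])
  obtain ⟨e, he⟩ : ∃ e : S ⊗[R] H₀ →ₗ[S] H, Function.Surjective e ∧ ∀ s x, e (s ⊗ₜ x) = s • ψ x := by
    let ψ' : H₀ →ₗ[R] H := { toFun := ψ, map_add' := map_add ψ, map_smul' := fun r x => hψ.smul r x }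
    have h := hψ.isBaseChange rfl ψ' (fun _ => rfl)
    exact ⟨h.equiv, h.equiv.surjective, fun s x => h.equiv_tmul s x⟩
  obtain ⟨z, rfl⟩ := he.1 y
  have e1 (z : S ⊗[R] H₀) : Θ (ρ₁ (e z)) = LinearMap.rTensor H₀
      (Algebra.TensorProduct.includeLeft : S →ₐ[R] S ⊗[R] S).toLinearMap z := by
    induction z with
    | zero => simp
    | add x y hx hy => simp only [map_add, hx, hy]
    | tmul s x =>
      rw [he.2, h₁.smul, map_smul]
      have := hΘ x
      simp only [AddMonoidHom.comp_apply] at this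
      rw [this]
      simp [TensorProduct.smul_tmul']
  have e2 (z : S ⊗[R] H₀) : Θ (ρ₂ (e z)) = LinearMap.rTensor H₀
      (Algebra.TensorProduct.includeRight : S →ₐ[R] S ⊗[R] S).toLinearMap z := by
    induction z with
    | zero => simp
    | add x y hx hy => simp only [map_add, hx, hy]
    | tmul s x =>
      rw [he.2, h₂, map_smul]
      have := hΘ x
      simp only [AddMonoidHom.comp_apply, h₁₂] at this
      rw [this]
      simp [TensorProduct.smul_tmul']
  obtain ⟨n, rfl⟩ := exists_tmul_of_faithfullyFlat z (by rw [← e1, ← e2, hy])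
  exact ⟨n, by rw [he.2, one_smul]⟩

/-- Base change along `S' ⟶ S' ⊗ S` is the tensor product with `S`. -/
lemma IsBC.bijective_lift {S' K L : Type u} [CommRing S'] [Algebra R S'] [AddCommGroup K]
    [AddCommGroup L] [Module S' K] [Module R K] [IsScalarTower R S' K] [Module (S' ⊗[R] S) L]
    {j : K →+ L}
    (hj : IsBC (Algebra.TensorProduct.includeLeft : S' →ₐ[R] S' ⊗[R] S).toRingHom j) :
    ∃ E : K ⊗[R] S ≃+ L, ∀ x s, E (x ⊗ₜ s) = (1 ⊗ₜ[R] s : S' ⊗[R] S) • j x := by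
  let : Module S' L := Module.compHom L
    (Algebra.TensorProduct.includeLeft : S' →ₐ[R] S' ⊗[R] S).toRingHom
  have : IsScalarTower S' (S' ⊗[R] S) L := IsScalarTower.of_algebraMap_smul fun _ _ => rfl
  let j' : K →ₗ[S'] L := { toFun := j, map_add' := map_add j, map_smul' := fun r x => hj.smul r x }
  have h := hj.isBaseChange rfl j' (fun _ => rfl)
  refine ⟨((TensorProduct.AlgebraTensorModule.cancelBaseChange R S' S' K S).symm.toAddEquiv.trans
    (TensorProduct.comm S' K (S' ⊗[R] S)).toAddEquiv).trans h.equiv.toAddEquiv, fun x s => ?_⟩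
  exact h.equiv_tmul _ _

/-- Effectivity of flat descent. `H`, `H₂`, `H₃` are the sections on the cover and on its double and
triple products, the maps are the pullbacks corrected by the gluing, and `μ` is restriction to the
diagonal. Tensoring the equalizer `H₀` of `i₁`, `i₂` with the flat algebra `S` gives, inside `H ⊗ S
≃ H₂`, the equalizer of `j₁₃` and `j₂₃`. The map `i₂` embeds `H` into that equalizer, and `μ`
inverts it. Faithfulness plays no role. -/
lemma isBC_descent [Module.Flat R S] {i₁ i₂ : H →+ H₂} {j₁₂ j₁₃ j₂₃ : H₂ →+ H₃} {μ : H₂ →+ H}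
    (hi₁ : IsBC (Algebra.TensorProduct.includeLeft : S →ₐ[R] S ⊗[R] S).toRingHom i₁)
    (hi₂ : ∀ (s : S) x, i₂ (s • x) = (1 ⊗ₜ[R] s : S ⊗[R] S) • i₂ x)
    (hj₁₂ : IsBC (Algebra.TensorProduct.includeLeft : S ⊗[R] S →ₐ[R] (S ⊗[R] S) ⊗[R] S).toRingHom
      j₁₂)
    (hj₁₃ : ∀ (s : S) x, j₁₃ ((1 ⊗ₜ[R] s : S ⊗[R] S) • x) =
      (1 ⊗ₜ[R] s : (S ⊗[R] S) ⊗[R] S) • j₁₃ x)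
    (hj₂₃ : ∀ (s : S) x, j₂₃ ((1 ⊗ₜ[R] s : S ⊗[R] S) • x) =
      (1 ⊗ₜ[R] s : (S ⊗[R] S) ⊗[R] S) • j₂₃ x)
    (hμ : ∀ (s : S) x, μ ((1 ⊗ₜ[R] s : S ⊗[R] S) • x) = s • μ x)
    (h₁ : ∀ x, j₁₂ (i₁ x) = j₁₃ (i₁ x)) (h₂ : ∀ x, j₁₂ (i₂ x) = j₂₃ (i₁ x))
    (h₃ : ∀ x, j₁₃ (i₂ x) = j₂₃ (i₂ x)) (hμ₁ : ∀ x, μ (i₁ x) = x) (hμ₂ : ∀ x, μ (i₂ x) = x)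
    {ι : H₀ →+ H} (hι : Function.Injective ι) (hιs : ∀ (r : R) x, ι (r • x) = algebraMap R S r • ι x)
    (hιr : ∀ x, (∃ y, ι y = x) ↔ i₁ x = i₂ x) :
    IsBC (algebraMap R S) ι := by
  let : Module R H := Module.compHom H (algebraMap R S)
  have : IsScalarTower R S H := IsScalarTower.of_compHom R S H
  let : Module R H₂ := Module.compHom H₂ (algebraMap R (S ⊗[R] S))
  have : IsScalarTower R (S ⊗[R] S) H₂ := IsScalarTower.of_compHom R (S ⊗[R] S) H₂
  obtain ⟨E₂, hE₂⟩ := hi₁.bijective_lift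
  obtain ⟨E₃, hE₃⟩ := hj₁₂.bijective_lift
  let ι' : H₀ →ₗ[R] H := { toFun := ι, map_add' := map_add ι, map_smul' := hιs }
  have hi₁R (r : R) (x : H) : i₁ (r • x) = r • i₁ x := by
    change i₁ (algebraMap R S r • x) = algebraMap R (S ⊗[R] S) r • i₁ x
    rw [hi₁.smul]; rfl
  have hi₂R (r : R) (x : H) : i₂ (r • x) = r • i₂ x := by
    change i₂ (algebraMap R S r • x) = algebraMap R (S ⊗[R] S) r • i₂ x
    rw [hi₂, Algebra.TensorProduct.algebraMap_apply, Algebra.algebraMap_eq_smul_one,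
      TensorProduct.tmul_smul, TensorProduct.smul_tmul']
  let d : H →ₗ[R] H₂ := { toFun x := i₂ x - i₁ x
                          map_add' := fun x y => by simp only [map_add]; abel
                          map_smul' := fun r x => by simp [hi₁R, hi₂R, smul_sub] }
  have hex : Function.Exact ι' d := fun x => by
    rw [LinearMap.coe_mk, AddHom.coe_mk, sub_eq_zero, eq_comm]
    exact (hιr x).symm
  have hex' := Module.Flat.rTensor_exact S hex
  have hinj := Module.Flat.rTensor_preserves_injective_linearMap (M := S) ι' hι
  have key (z : H ⊗[R] S) : E₃ (LinearMap.rTensor S d z) = j₂₃ (E₂ z) - j₁₃ (E₂ z) := by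
    induction z with
    | zero => simp
    | add x y hx hy => simp only [map_add, hx, hy]; abel
    | tmul x s =>
      rw [LinearMap.rTensor_tmul, hE₃, hE₂, hj₂₃, hj₁₃, ← h₁, ← h₂, ← smul_sub, ← map_sub]
      rfl
  let m : H₀ ⊗[R] S →ₗ[R] H := TensorProduct.lift
    { toFun x := { toFun s := s • ι x
                   map_add' := fun a b => add_smul _ _ _
                   map_smul' := fun r s => by simp }
      map_add' := fun x y => by ext s; simp
      map_smul' := fun r x => by
        ext s
        change s • ι (r • x) = r • s • ι x
        rw [hιs, algebraMap_smul, smul_comm] }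
  have hm (x s) : m (x ⊗ₜ s) = s • ι x := rfl
  have key₂ (w : H₀ ⊗[R] S) : μ (E₂ (LinearMap.rTensor S ι' w)) = m w := by
    induction w with
    | zero => simp
    | add x y hx hy => simp only [map_add, hx, hy]
    | tmul x s => rw [LinearMap.rTensor_tmul, hE₂, hμ, hμ₁, hm]; rfl
  have key₃ (w : H₀ ⊗[R] S) : i₂ (m w) = E₂ (LinearMap.rTensor S ι' w) := by
    induction w with
    | zero => simp
    | add x y hx hy => simp only [map_add, hx, hy]
    | tmul x s =>
      rw [LinearMap.rTensor_tmul, hE₂, hm, hi₂]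
      congr 1
      exact ((hιr _).1 ⟨x, rfl⟩).symm
  have hbij : Function.Bijective m := by
    constructor
    · rw [injective_iff_map_eq_zero]
      intro w hw
      have h4 := key₃ w
      rw [hw, map_zero] at h4
      have h5 := E₂.map_eq_zero_iff.1 h4.symm
      exact hinj (by rw [h5, map_zero])
    · intro x
      -- `i₂ x` lies in the equalizer of `j₁₃` and `j₂₃`, so it comes from `H₀ ⊗ S`, and `μ`
      -- recovers `x` from it.
      have h4 : LinearMap.rTensor S d (E₂.symm (i₂ x)) = 0 := by
        apply E₃.injective
        rw [key, AddEquiv.apply_symm_apply, h₃, sub_self, map_zero]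
      obtain ⟨w, hw⟩ := (hex' _).1 h4
      exact ⟨w, by rw [← key₂, hw, AddEquiv.apply_symm_apply, hμ₂]⟩
  let M : S ⊗[R] H₀ ≃ₗ[S] H := LinearEquiv.ofBijective
    (TensorProduct.AlgebraTensorModule.lift
      { toFun s := s • ι'
        map_add' := fun a b => by ext; simp [add_smul]
        map_smul' := fun a b => by ext; simp [mul_smul] }) (by
      have : Function.Bijective (m ∘ TensorProduct.comm R S H₀) :=
        hbij.comp (TensorProduct.comm R S H₀).bijective
      convert this using 1
      ext z
      induction z with
      | zero => simp
      | add x y hx hy => simp only [map_add, hx, hy, Function.comp_apply] at *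
      | tmul s x => rfl)
  have hM : IsBaseChange S ι' := IsBaseChange.of_equiv M (fun x => by
    change (1 : S) • ι x = ι x
    rw [one_smul])
  exact IsBC.of_isBaseChange rfl hM (fun _ => rfl)

end Descent

end TwistedSheaf

/-! ### Descent of sections along flat affine morphisms. -/

namespace TwistedSheaf

section

variable {P Q Z : Scheme.{u}}

instance moduleSpecOf (A : Type u) [CommRing A] (M : (Spec (.of A)).Modules)
    (U : (Spec (.of A)).Opens) : Module A Γ(M, U) :=
  @Scheme.Modules.instModuleCarrierCarrierObjOppositeOpensCarrierCarrierCommRingCatSpecAbPresheafOp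
    (CommRingCat.of A) M U

lemma isBC_ΓSpecIso (A : CommRingCat.{u}) (L : (Spec A).Modules) :
    IsBC (Scheme.ΓSpecIso A).inv.hom (AddMonoidHom.id Γ(L, ⊤)) :=
  .of_bijective (ConcreteCategory.bijective_of_isIso _) Function.bijective_id (fun r x => by
    change r • x = _
    rw [Scheme.Modules.smul_Spec_def]
    exact congr($((Spec A).presheaf.map_id (Opposite.op ⊤)) ((Scheme.ΓSpecIso A).inv r) • x))

lemma smul_Spec_top (A : CommRingCat.{u}) (L : (Spec A).Modules) (r : A) (x : Γ(L, ⊤)) :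
    r • x = (Scheme.ΓSpecIso A).inv r • x :=
  (isBC_ΓSpecIso A L).smul r x

/-- An isomorphism of modules on `Spec A` on global sections, as a linear equivalence. -/
def appEquivSpec {A : CommRingCat.{u}} {M N : (Spec A).Modules} (i : M ≅ N) :
    Γ(M, ⊤) ≃ₗ[A] Γ(N, ⊤) :=
  { (appEquiv i ⊤).toAddEquiv with
    map_smul' := fun r x => by
      rw [smul_Spec_top, RingHom.id_apply, smul_Spec_top]
      exact (appEquiv i ⊤).map_smul _ x }

lemma appEquivSpec_apply {A : CommRingCat.{u}} {M N : (Spec A).Modules} (i : M ≅ N) (x : Γ(M, ⊤)) :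
    appEquivSpec i x = i.hom.app ⊤ x := rfl

lemma isBC_res_SpecMap {R R' : CommRingCat.{u}} (φ : R ⟶ R') {b : Spec R ⟶ Z} {b' : Spec R' ⟶ Z}
    (hb : Spec.map φ ≫ b = b') {N : Z.Modules} (hN : N.IsQuasicoherent) :
    IsBC φ.hom (res (Spec.map φ) hb N (top_le_preimage_top (Spec.map φ))) := by
  have h1 := (isBC_ΓSpecIso R _).comp (isBC_sec_SpecMap φ _ (qcoh_pullback b hN))
  have h2 : IsBC φ.hom
      (sec (Spec.map φ) ((Scheme.Modules.pullback b).obj N) (top_le_preimage_top _)) := by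
    refine IsBC.of_comp_bijective (τ := (Scheme.ΓSpecIso R').inv.hom) (ψ' := AddMonoidHom.id _) ?_
      (ConcreteCategory.bijective_of_isIso _) Function.bijective_id (smul_Spec_top _ _)
    have h3 : (Scheme.ΓSpecIso R').inv.hom.comp φ.hom =
        ((Spec.map φ).appLE ⊤ ⊤ (top_le_preimage_top _)).hom.comp (Scheme.ΓSpecIso R).inv.hom := by
      rw [← CommRingCat.hom_comp, ← CommRingCat.hom_comp, Scheme.ΓSpecIso_inv_naturality]
      simp [Scheme.Hom.appTop, Scheme.Hom.app_eq_appLE]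
    rw [h3]
    exact h1
  refine h2.of_equiv_right (appEquivSpec (pbC _ hb N)) fun x => ?_
  rw [appEquivSpec_apply, res_apply]

lemma fromSpec_appLE_top {U : P.Opens} (hU : IsAffineOpen U) :
    hU.fromSpec.appLE U ⊤ (top_le_fromSpec_preimage hU) = (Scheme.ΓSpecIso Γ(P, U)).inv := by
  rw [Scheme.Hom.appLE, hU.fromSpec_app_self, Category.assoc, ← Functor.map_comp]
  exact (congrArg _ ((Spec _).presheaf.map_id _)).trans (Category.comp_id _)

lemma isBC_res_fromSpec {U : P.Opens} (hU : IsAffineOpen U) {b : P ⟶ Z} {b' : Spec Γ(P, U) ⟶ Z}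
    (hb : hU.fromSpec ≫ b = b') (N : Z.Modules) :
    IsBC (RingHom.id Γ(P, U)) (res hU.fromSpec hb N (top_le_fromSpec_preimage hU)) := by
  refine .of_bijective Function.bijective_id
    (bijective_res_of_isOpenImmersion _ hb N _ (le_fromSpec_image_top hU)) fun r x => ?_
  rw [res_smul, fromSpec_appLE_top, RingHom.id_apply, smul_Spec_top]

/-- Sections of pullbacks along morphisms from affine schemes to an affine open subset. -/
lemma isBC_res_spec {U : P.Opens} (hU : IsAffineOpen U) {A : CommRingCat.{u}} (φ : Γ(P, U) ⟶ A)
    {g : Spec A ⟶ P} (hg : Spec.map φ ≫ hU.fromSpec = g) {b : P ⟶ Z} {b' : Spec A ⟶ Z}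
    (hb : g ≫ b = b') {N : Z.Modules} (hN : N.IsQuasicoherent) (e : (⊤ : (Spec A).Opens) ≤ g ⁻¹ᵁ U) :
    IsBC φ.hom (res g hb N e) := by
  have hb' : Spec.map φ ≫ hU.fromSpec ≫ b = b' := by rw [← hb, ← hg, Category.assoc]
  have h := (isBC_res_fromSpec hU (rfl : hU.fromSpec ≫ b = _) N).comp (isBC_res_SpecMap φ hb' hN)
  have h2 : (res (Spec.map φ) hb' N (top_le_preimage_top (Spec.map φ))).comp
      (res hU.fromSpec rfl N (top_le_fromSpec_preimage hU)) = res g hb N e := by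
    ext x
    rw [AddMonoidHom.comp_apply, res_res hU.fromSpec (Spec.map φ) hg rfl hb' N _ _ e x]
  rwa [h2, RingHom.comp_id] at h

lemma top_le_preimage_of_SpecMap_fromSpec {U : P.Opens} (hU : IsAffineOpen U) {A : CommRingCat.{u}}
    (φ : Γ(P, U) ⟶ A) {g : Spec A ⟶ P} (hg : Spec.map φ ≫ hU.fromSpec = g) :
    (⊤ : (Spec A).Opens) ≤ g ⁻¹ᵁ U := by
  subst hg
  exact fun x _ => top_le_fromSpec_preimage hU trivial

lemma appLE_self_eq (p : P ⟶ Q) (V : Q.Opens) : p.appLE V (p ⁻¹ᵁ V) le_rfl = p.app V := by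
  rw [← Scheme.Hom.app_eq_appLE]

/-- Surjectivity on spectra is only known through the points of `P` over `V`; they lie in `p ⁻¹ᵁ V`,
hence come from the spectrum of its functions. -/
lemma faithfullyFlat_app (p : P ⟶ Q) [Flat p] {V : Q.Opens} (hV : IsAffineOpen V)
    (hpV : IsAffineOpen (p ⁻¹ᵁ V)) (h : (V : Set Q) ⊆ Set.range p) :
    (p.app V).hom.FaithfullyFlat := by
  rw [RingHom.FaithfullyFlat.iff_flat_and_comap_surjective]
  refine ⟨?_, fun x => ?_⟩
  · rw [← appLE_self_eq]
    exact p.flat_appLE hV hpV le_rfl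
  · obtain ⟨y, hy⟩ := h (show hV.fromSpec x ∈ V from by
      have := top_le_fromSpec_preimage hV (x := x) trivial
      exact this)
    have hyV : y ∈ p ⁻¹ᵁ V := by
      change p y ∈ V
      rw [hy]
      exact top_le_fromSpec_preimage hV (x := x) trivial
    obtain ⟨z, rfl⟩ : y ∈ Set.range hpV.fromSpec := by
      rw [hpV.range_fromSpec]
      exact hyV
    refine ⟨z, hV.fromSpec.isOpenEmbedding.injective ?_⟩
    rw [← hy, ← Scheme.Hom.comp_apply, ← hV.SpecMap_appLE_fromSpec p hpV le_rfl, appLE_self_eq]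
    rfl

section DescentOfMorphisms

lemma preimage_le_of_comp_eq {p : P ⟶ Q} {T : Scheme.{u}} {g : T ⟶ P} {r : T ⟶ Q} (h : g ≫ p = r)
    (V : Q.Opens) : (r ⁻¹ᵁ V : T.Opens) ≤ (g ⁻¹ᵁ (p ⁻¹ᵁ V : P.Opens) : T.Opens) := by
  subst h
  exact le_rfl

lemma appLE_app {p : P ⟶ Q} {T : Scheme.{u}} {g : T ⟶ P} {r : T ⟶ Q} (h : g ≫ p = r)
    (V : Q.Opens) (s : Γ(Q, V)) :
    g.appLE _ _ (preimage_le_of_comp_eq h V) (p.app V s) = r.app V s := by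
  subst h
  rw [← ConcreteCategory.comp_apply, ← appLE_self_eq, Scheme.Hom.appLE_comp_appLE, ← appLE_self_eq]

/-- The ring map `S ⟶ S ⊗ S` to the left factor. -/
def inclL (R S : Type u) [CommRing R] [CommRing S] [Algebra R S] :
    CommRingCat.of S ⟶ CommRingCat.of (S ⊗[R] S) :=
  CommRingCat.ofHom (Algebra.TensorProduct.includeLeft : S →ₐ[R] S ⊗[R] S).toRingHom

/-- The ring map `S ⟶ S ⊗ S` to the right factor. -/
def inclR (R S : Type u) [CommRing R] [CommRing S] [Algebra R S] :
    CommRingCat.of S ⟶ CommRingCat.of (S ⊗[R] S) :=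
  CommRingCat.ofHom (Algebra.TensorProduct.includeRight : S →ₐ[R] S ⊗[R] S).toRingHom

variable (p : P ⟶ Q) {N : Q.Modules} [IsAffineHom p]

/-- Tested on `Spec (S ⊗[R] S)`, the hypothesis `hy` says that `y` is equalized by the two
pullbacks, and exactness of the Amitsur complex provides `x`. -/
lemma exists_sec_eq [Flat p] (hN : N.IsQuasicoherent) {V : Q.Opens} (hV : IsAffineOpen V)
    (h : (V : Set Q) ⊆ Set.range p) (y : Γ((Scheme.Modules.pullback p).obj N, p ⁻¹ᵁ V))
    (hy : ∀ {T : Scheme.{u}} (g₁ g₂ : T ⟶ P) (r : T ⟶ Q) (h₁ : g₁ ≫ p = r) (h₂ : g₂ ≫ p = r)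
      (O : T.Opens) (e₁ : O ≤ g₁ ⁻¹ᵁ p ⁻¹ᵁ V) (e₂ : O ≤ g₂ ⁻¹ᵁ p ⁻¹ᵁ V),
        res g₁ h₁ N e₁ y = res g₂ h₂ N e₂ y) :
    ∃ x, sec p N le_rfl x = y := by
  have hpV : IsAffineOpen (p ⁻¹ᵁ V) := hV.preimage p
  let R : Type u := Γ(Q, V)
  let S : Type u := Γ(P, p ⁻¹ᵁ V)
  let : Algebra R S := (p.app V).hom.toAlgebra
  have : Module.FaithfullyFlat R S := faithfullyFlat_app p hV hpV h
  let g₁ : Spec (.of (S ⊗[R] S)) ⟶ P := Spec.map (inclL R S) ≫ hpV.fromSpec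
  let g₂ : Spec (.of (S ⊗[R] S)) ⟶ P := Spec.map (inclR R S) ≫ hpV.fromSpec
  have h12 : g₁ ≫ p = g₂ ≫ p := by
    have h3 : hpV.fromSpec ≫ p = Spec.map (p.app V) ≫ hV.fromSpec := by
      rw [← appLE_self_eq, hV.SpecMap_appLE_fromSpec p hpV]
    simp only [g₁, g₂, Category.assoc]
    rw [h3, ← Spec.map_comp_assoc, ← Spec.map_comp_assoc]
    congr 2
    ext r
    exact (Algebra.TensorProduct.includeLeft : S →ₐ[R] S ⊗[R] S).commutes r |>.trans
      ((Algebra.TensorProduct.includeRight : S →ₐ[R] S ⊗[R] S).commutes r).symm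
  have e₁ := top_le_preimage_of_SpecMap_fromSpec hpV (inclL R S) (g := g₁) rfl
  have e₂ := top_le_preimage_of_SpecMap_fromSpec hpV (inclR R S) (g := g₂) rfl
  have hψ : IsBC (algebraMap R S) (sec p N (preimage_le_self p V)) := by
    have := isBC_sec p hN hV hpV le_rfl
    rw [appLE_self_eq] at this
    exact this
  have hρ₁ := isBC_res_spec hpV (inclL R S) (g := g₁) rfl (rfl : g₁ ≫ p = g₁ ≫ p) hN e₁
  have hρ₂ := isBC_res_spec hpV (inclR R S) (g := g₂) rfl (h12.symm : g₂ ≫ p = g₁ ≫ p) hN e₂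
  refine exists_of_faithfullyFlat (R := R) (S := S) hψ hρ₁ hρ₂.smul (fun x => ?_) y
    (hy _ _ _ _ _ _ _ _)
  have e : (⊤ : (Spec (.of (S ⊗[R] S))).Opens) ≤ (g₁ ≫ p) ⁻¹ᵁ V := e₁
  rw [res_sec _ _ _ _ _ e, res_sec _ _ _ _ _ e]

end DescentOfMorphisms

end

end TwistedSheaf

/-! ### Descent of morphisms of modules. -/

namespace TwistedSheaf

section

variable {P Q : Scheme.{u}}

section

variable {T : Scheme.{u}} {A : P.Modules} {B : T.Modules}

/-- A morphism between pushforwards from its effect on sections. -/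
def pushHomMk (p : P ⟶ Q) (r : T ⟶ Q) (f : ∀ V : Q.Opens, Γ(A, p ⁻¹ᵁ V) →+ Γ(B, r ⁻¹ᵁ V))
    (hf : ∀ (V U : Q.Opens) (i : U ≤ V) (x : Γ(A, p ⁻¹ᵁ V)),
      f U (A.presheaf.map (homOfLE (preimage_mono p i)).op x) =
        B.presheaf.map (homOfLE (preimage_mono r i)).op (f V x))
    (hs : ∀ (V : Q.Opens) (s : Γ(Q, V)) (x : Γ(A, p ⁻¹ᵁ V)),
      f V (p.app V s • x) = r.app V s • f V x) :
    (Scheme.Modules.pushforward p).obj A ⟶ (Scheme.Modules.pushforward r).obj B :=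
  modHomMk f hf hs

/-- The effect on sections of a morphism to a pushforward. -/
def pushApp {M : Q.Modules} {p : P ⟶ Q} (u : M ⟶ (Scheme.Modules.pushforward p).obj A)
    (V : Q.Opens) : Γ(M, V) →+ Γ(A, p ⁻¹ᵁ V) := (u.app V).hom

section

variable {M N : Q.Modules} {p : P ⟶ Q} {r : T ⟶ Q} (u u' : M ⟶ (Scheme.Modules.pushforward p).obj A)
  (V : Q.Opens)

lemma pushApp_sub (x) : pushApp (u - u') V x = pushApp u V x - pushApp u' V x := rfl

lemma pushApp_zero (x) :
    pushApp (0 : M ⟶ (Scheme.Modules.pushforward p).obj A) V x = 0 := rfl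

lemma pushApp_comp (v : N ⟶ M) (x) : pushApp (v ≫ u) V x = pushApp u V (v.app V x) := rfl

lemma pushApp_comp_map {A' : P.Modules} (v : A ⟶ A') (x) :
    pushApp (u ≫ (Scheme.Modules.pushforward p).map v) V x = v.app _ (pushApp u V x) := rfl

lemma pushApp_comp_mk (f : ∀ V : Q.Opens, Γ(A, p ⁻¹ᵁ V) →+ Γ(B, r ⁻¹ᵁ V)) (hf hs) (x) :
    pushApp (u ≫ pushHomMk p r f hf hs) V x = f V (pushApp u V x) := rfl

lemma pushApp_restrict {V' : Q.Opens} (i : V' ≤ V) (x : Γ(M, V)) :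
    pushApp u V' (M.presheaf.map (homOfLE i).op x) =
      A.presheaf.map (homOfLE (preimage_mono p i)).op (pushApp u V x) :=
  app_map u i x

lemma pushApp_smul (s : Γ(Q, V)) (x : Γ(M, V)) :
    pushApp u V (s • x) = p.app V s • pushApp u V x :=
  Scheme.Modules.Hom.app_smul u s x

lemma pushApp_injective [Mono u] : Function.Injective (pushApp u V) :=
  mono_app_injective u V

variable {u u'} in
lemma pushApp_ext (h : ∀ V x, pushApp u V x = pushApp u' V x) : u = u' := by
  ext V x
  exact h V x

end

/-- The unit of the adjunction between pullback and pushforward. -/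
def unit (p : P ⟶ Q) (M : Q.Modules) :
    M ⟶ (Scheme.Modules.pushforward p).obj ((Scheme.Modules.pullback p).obj M) :=
  (Scheme.Modules.pullbackPushforwardAdjunction p).unit.app M

lemma pushApp_unit (p : P ⟶ Q) (M : Q.Modules) (V : Q.Opens) (x) :
    pushApp (unit p M) V x = eta p M V x := rfl

lemma pullback_hom_ext {p : P ⟶ Q} {M : Q.Modules} {v v' : (Scheme.Modules.pullback p).obj M ⟶ A}
    (h : unit p M ≫ (Scheme.Modules.pushforward p).map v =
      unit p M ≫ (Scheme.Modules.pushforward p).map v') : v = v' :=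
  ((Scheme.Modules.pullbackPushforwardAdjunction p).homEquiv _ _).injective h

lemma unit_comp_map_pullback_map (p : P ⟶ Q) {M N : Q.Modules} (u : M ⟶ N) :
    unit p M ≫ (Scheme.Modules.pushforward p).map ((Scheme.Modules.pullback p).map u) =
      u ≫ unit p N :=
  ((Scheme.Modules.pullbackPushforwardAdjunction p).unit.naturality u).symm

lemma res_restrict_preimage {Z : Scheme.{u}} (p : P ⟶ Q) (g : T ⟶ P) {r : T ⟶ Q} (h : g ≫ p = r)
    {b : P ⟶ Z} {b' : T ⟶ Z} (hb : g ≫ b = b') (N : Z.Modules) (V U : Q.Opens) (i : U ≤ V) (x) :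
    res g hb N (preimage_le_of_comp_eq h U)
      (((Scheme.Modules.pullback b).obj N).presheaf.map (homOfLE (preimage_mono p i)).op x) =
     ((Scheme.Modules.pullback b').obj N).presheaf.map (homOfLE (preimage_mono r i)).op
        (res g hb N (preimage_le_of_comp_eq h V) x) :=
  res_restrict g hb N (preimage_le_of_comp_eq h V) (preimage_le_of_comp_eq h U)
    (preimage_mono p i) (preimage_mono r i) x

lemma res_app_smul {Z : Scheme.{u}} (p : P ⟶ Q) (g : T ⟶ P) {r : T ⟶ Q} (h : g ≫ p = r)
    {b : P ⟶ Z} {b' : T ⟶ Z} (hb : g ≫ b = b') (N : Z.Modules) (V : Q.Opens) (s : Γ(Q, V))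
    (x : Γ((Scheme.Modules.pullback b).obj N, p ⁻¹ᵁ V)) :
    res g hb N (preimage_le_of_comp_eq h V) (p.app V s • x) =
      r.app V s • res g hb N (preimage_le_of_comp_eq h V) x := by
  rw [res_smul g hb N (preimage_le_of_comp_eq h V) (p.app V s) x, appLE_app h V s]

/-- The family of the pullbacks of sections `res`. -/
def resFamily {Z : Scheme.{u}} (p : P ⟶ Q) (g : T ⟶ P) {r : T ⟶ Q} (h : g ≫ p = r)
    {b : P ⟶ Z} {b' : T ⟶ Z} (hb : g ≫ b = b') (N : Z.Modules) (V : Q.Opens) :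
    Γ((Scheme.Modules.pullback b).obj N, p ⁻¹ᵁ V) →+
      Γ((Scheme.Modules.pullback b').obj N, r ⁻¹ᵁ V) :=
  res g hb N (preimage_le_of_comp_eq h V)

/-- The pullback of sections `res`, as a morphism of modules on a scheme `Q` under which both
schemes lie. -/
def pushRes {Z : Scheme.{u}} (p : P ⟶ Q) (g : T ⟶ P) {r : T ⟶ Q} (h : g ≫ p = r)
    {b : P ⟶ Z} {b' : T ⟶ Z} (hb : g ≫ b = b') (N : Z.Modules) :
    (Scheme.Modules.pushforward p).obj ((Scheme.Modules.pullback b).obj N) ⟶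
      (Scheme.Modules.pushforward r).obj ((Scheme.Modules.pullback b').obj N) :=
  pushHomMk p r (resFamily p g h hb N) (res_restrict_preimage p g h hb N) (res_app_smul p g h hb N)

lemma pushApp_comp_pushRes {Z : Scheme.{u}} {p : P ⟶ Q} (g : T ⟶ P) {r : T ⟶ Q}
    (h : g ≫ p = r) {b : P ⟶ Z} {b' : T ⟶ Z} (hb : g ≫ b = b') (N : Z.Modules) {M : Q.Modules}
    (u : M ⟶ (Scheme.Modules.pushforward p).obj ((Scheme.Modules.pullback b).obj N)) (V : Q.Opens)
    (x : Γ(M, V)) : pushApp (u ≫ pushRes p g h hb N) V x =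
      res g hb N (preimage_le_of_comp_eq h V) (pushApp u V x) :=
  pushApp_comp_mk u V _ _ _ x

lemma pushApp_comp_pushRes_sub {Z : Scheme.{u}} {p : P ⟶ Q} (g₁ g₂ : T ⟶ P) {r : T ⟶ Q}
    (h₁ : g₁ ≫ p = r) (h₂ : g₂ ≫ p = r) {b : P ⟶ Z} {b' : T ⟶ Z} (hb₁ : g₁ ≫ b = b')
    (hb₂ : g₂ ≫ b = b') (N : Z.Modules) {M : Q.Modules}
    (u : M ⟶ (Scheme.Modules.pushforward p).obj ((Scheme.Modules.pullback b).obj N)) (V : Q.Opens)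
    (x : Γ(M, V)) : pushApp (u ≫ (pushRes p g₁ h₁ hb₁ N - pushRes p g₂ h₂ hb₂ N)) V x =
      res g₁ hb₁ N (preimage_le_of_comp_eq h₁ V) (pushApp u V x) -
        res g₂ hb₂ N (preimage_le_of_comp_eq h₂ V) (pushApp u V x) := by
  rw [Preadditive.comp_sub, pushApp_sub, pushApp_comp_pushRes, pushApp_comp_pushRes]

variable (p : P ⟶ Q) (N : Q.Modules)

/-- The difference of the two pullbacks of sections of `p^* N` to `P ×_Q P`. -/
def descentDiff : (Scheme.Modules.pushforward p).obj ((Scheme.Modules.pullback p).obj N) ⟶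
    (Scheme.Modules.pushforward (pullback.fst p p ≫ p)).obj
      ((Scheme.Modules.pullback (pullback.fst p p ≫ p)).obj N) :=
  pushRes p (pullback.fst p p) rfl rfl N -
    pushRes p (pullback.snd p p) pullback.condition.symm pullback.condition.symm N

variable {p N}

lemma pushApp_comp_descentDiff {M : Q.Modules}
    (u : M ⟶ (Scheme.Modules.pushforward p).obj ((Scheme.Modules.pullback p).obj N)) (V : Q.Opens)
    (x : Γ(M, V)) : pushApp (u ≫ descentDiff p N) V x =
      res (pullback.fst p p) rfl N (preimage_le_of_comp_eq rfl V) (pushApp u V x) -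
      res (pullback.snd p p) pullback.condition.symm N
        (preimage_le_of_comp_eq pullback.condition.symm V) (pushApp u V x) :=
  pushApp_comp_pushRes_sub _ _ _ _ _ _ N u V x

/-- Two morphisms to `P` with the same composite to `Q` factor through `P ×_Q P`, so the universal
case implies every other. -/
lemma res_eq_res_of_descentDiff {M : Q.Modules}
    {u : M ⟶ (Scheme.Modules.pushforward p).obj ((Scheme.Modules.pullback p).obj N)}
    (hu : u ≫ descentDiff p N = 0) {V : Q.Opens} (y : Γ(M, V))
    {T : Scheme.{u}} (g₁ g₂ : T ⟶ P) (r : T ⟶ Q) (h₁ : g₁ ≫ p = r) (h₂ : g₂ ≫ p = r)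
    (O : T.Opens) (e₁ : O ≤ g₁ ⁻¹ᵁ (p ⁻¹ᵁ V : P.Opens))
    (e₂ : O ≤ g₂ ⁻¹ᵁ (p ⁻¹ᵁ V : P.Opens)) :
    res g₁ h₁ N e₁ (pushApp u V y) = res g₂ h₂ N e₂ (pushApp u V y) := by
  have hx := pushApp_comp_descentDiff u V y
  rw [hu, pushApp_zero, eq_comm, sub_eq_zero] at hx
  let l : T ⟶ pullback p p := pullback.lift g₁ g₂ (h₁.trans h₂.symm)
  have hl : l ≫ pullback.fst p p ≫ p = r := by
    rw [pullback.lift_fst_assoc, h₁]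
  have e : O ≤ l ⁻¹ᵁ ((pullback.fst p p ≫ p) ⁻¹ᵁ V : (pullback p p).Opens) := by
    subst h₁
    rw [← Scheme.Hom.comp_preimage, hl]
    exact e₁
  have h3 := congrArg (res l hl N e) hx
  rw [res_res (pullback.fst p p) l (pullback.lift_fst _ _ _) rfl hl N _ e e₁,
    res_res (pullback.snd p p) l (pullback.lift_snd _ _ _) _ hl N _ e e₂] at h3
  exact h3

lemma sec_self (V : Q.Opens) (x : Γ(N, V)) : sec p N (preimage_le_self p V) x = eta p N V x := by
  rw [sec_apply, map_self]

lemma unit_descentDiff : unit p N ≫ descentDiff p N = 0 := by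
  refine pushApp_ext fun V x => ?_
  have h1 := res_sec (pullback.fst p p) (rfl : _ ≫ p = _) N (preimage_le_self p V)
    (preimage_le_of_comp_eq rfl V) le_rfl x
  have h2 := res_sec (pullback.snd p p) pullback.condition.symm N (preimage_le_self p V)
    (preimage_le_of_comp_eq pullback.condition.symm V) le_rfl x
  rw [sec_self] at h1 h2
  rw [pushApp_comp_descentDiff, pushApp_zero, pushApp_unit, h1, h2, sub_self]

lemma unit_comp_pushforward_descentDiff {M : Q.Modules}
    (v : (Scheme.Modules.pullback p).obj M ⟶ (Scheme.Modules.pullback p).obj N)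
    (hv : ∀ {T : Scheme.{u}} (g₁ g₂ : T ⟶ P) (r : T ⟶ Q) (h₁ : g₁ ≫ p = r) (h₂ : g₂ ≫ p = r),
      ph g₁ h₁ h₁ v = ph g₂ h₂ h₂ v) :
    (unit p M ≫ (Scheme.Modules.pushforward p).map v) ≫ descentDiff p N = 0 := by
  refine pushApp_ext fun V x => ?_
  have h1 := ph_res (pullback.fst p p) rfl rfl v (preimage_le_of_comp_eq rfl V) (eta p M V x)
  have h2 := ph_res (pullback.snd p p) pullback.condition.symm pullback.condition.symm v
    (preimage_le_of_comp_eq pullback.condition.symm V) (eta p M V x)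
  have h3 := res_sec (pullback.fst p p) (rfl : _ ≫ p = _) M (preimage_le_self p V)
    (preimage_le_of_comp_eq rfl V) le_rfl x
  have h4 := res_sec (pullback.snd p p) pullback.condition.symm M (preimage_le_self p V)
    (preimage_le_of_comp_eq pullback.condition.symm V) le_rfl x
  rw [sec_self] at h3 h4
  rw [h3] at h1
  rw [h4, ← hv _ _ _ rfl pullback.condition.symm] at h2
  rw [pushApp_comp_descentDiff, pushApp_zero, pushApp_comp_map, pushApp_unit, ← h1, ← h2, sub_self]

end

section

variable {p : P ⟶ Q} [IsAffineHom p] [Flat p] {M N : Q.Modules}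

lemma sec_injective (hN : N.IsQuasicoherent) {V : Q.Opens} (hV : IsAffineOpen V)
    (h : (V : Set Q) ⊆ Set.range p) :
    Function.Injective (sec p N (preimage_le_self p V)) := by
  have hpV : IsAffineOpen (p ⁻¹ᵁ V) := hV.preimage p
  let R : Type u := Γ(Q, V)
  let S : Type u := Γ(P, p ⁻¹ᵁ V)
  let : Algebra R S := (p.app V).hom.toAlgebra
  have : Module.FaithfullyFlat R S := faithfullyFlat_app p hV hpV h
  have hψ : IsBC (algebraMap R S) (sec p N (preimage_le_self p V)) := by
    have := isBC_sec p hN hV hpV le_rfl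
    rw [appLE_self_eq] at this
    exact this
  exact hψ.injective

/-- An affine basis of `Q` over which either `p` is surjective or `N` is zero. -/
def DescentBasis (p : P ⟶ Q) (N : Q.Modules) : Prop :=
  TopologicalSpace.Opens.IsBasis {V : Q.Opens | IsAffineOpen V ∧
    ((V : Set Q) ⊆ Set.range p ∨ Subsingleton Γ(N, V))}

/-- Where the target vanishes nothing is required of `p`. This allows `p` to cover only a
neighbourhood of the support of `N`, which is how morphisms between sheaves supported at one point
are later produced from a single chart. -/
lemma pullback_map_injective (hN : N.IsQuasicoherent) (hB : DescentBasis p N) {u u' : M ⟶ N}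
    (h : (Scheme.Modules.pullback p).map u = (Scheme.Modules.pullback p).map u') : u = u' := by
  refine hom_ext_of_isBasis hB fun V hV x => ?_
  obtain ⟨hV, h1 | h1⟩ := hV
  · apply sec_injective hN hV h1
    rw [← sec_map, ← sec_map, h]
  · exact Subsingleton.elim _ _

/-- Descent of morphisms along a flat affine morphism. -/
lemma exists_pullback_map_eq (hN : N.IsQuasicoherent) (hB : DescentBasis p N)
    (v : (Scheme.Modules.pullback p).obj M ⟶ (Scheme.Modules.pullback p).obj N)
    (hv : ∀ {T : Scheme.{u}} (g₁ g₂ : T ⟶ P) (r : T ⟶ Q) (h₁ : g₁ ≫ p = r) (h₂ : g₂ ≫ p = r),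
      ph g₁ h₁ h₁ v = ph g₂ h₂ h₂ v) :
    ∃ u : M ⟶ N, (Scheme.Modules.pullback p).map u = v := by
  let K := kernel (descentDiff p N)
  let k : K ⟶ (Scheme.Modules.pushforward p).obj ((Scheme.Modules.pullback p).obj N) :=
    kernel.ι (descentDiff p N)
  have hk : k ≫ descentDiff p N = 0 := kernel.condition _
  let i : N ⟶ K := kernel.lift _ (unit p N) unit_descentDiff
  have hi : i ≫ k = unit p N := kernel.lift_ι _ _ _
  have hi' (V : Q.Opens) (x) : pushApp k V (i.app V x) = eta p N V x := by
    rw [← pushApp_comp, hi, pushApp_unit]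
  -- `N` is the equalizer of its two pullbacks: by `exists_sec_eq` over the basis members covered by
  -- `p`, and because both sides vanish over the others. A compatible `v` sends the sections of `M`
  -- into this equalizer.
  have : IsIso i := by
    refine isIso_of_isBasis hB i fun V ⟨hV, h1⟩ => ?_
    have hιV : Function.Injective (pushApp k V) := pushApp_injective k V
    constructor
    · intro x y hxy
      rcases h1 with h1 | h1
      · apply sec_injective hN hV h1
        rw [sec_self, sec_self, ← hi', hxy, hi']
      · exact Subsingleton.elim _ _
    · intro y
      rcases h1 with h1 | h1
      · obtain ⟨x, hx⟩ := exists_sec_eq p hN hV h1 (pushApp k V y)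
          (res_eq_res_of_descentDiff hk y)
        refine ⟨x, hιV ?_⟩
        rw [hi', ← sec_self]
        exact hx
      · have h2 : Subsingleton Γ((Scheme.Modules.pullback p).obj N, p ⁻¹ᵁ V) :=
          (isBC_sec p hN hV (hV.preimage p) le_rfl).subsingleton
        exact ⟨0, hιV (h2.elim _ _)⟩
  let w : M ⟶ K := kernel.lift _ _ (unit_comp_pushforward_descentDiff v hv)
  have hw : w ≫ k = unit p M ≫ (Scheme.Modules.pushforward p).map v := kernel.lift_ι _ _ _
  refine ⟨w ≫ inv i, pullback_hom_ext ?_⟩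
  rw [unit_comp_map_pullback_map, ← hw, Category.assoc, ← hi, IsIso.inv_hom_id_assoc]

end

end

end TwistedSheaf

/-! ### Descent of morphisms of twisted sheaves. -/

namespace TwistedSheaf

section

variable {T T' T'' : Scheme.{u}} {S : Scheme.{u}} {ι : Type t} {U : ι → Scheme.{u}}
  {f : ∀ i, U i ⟶ S} {α : Cocycle f}

instance isAffineHom_pullback_fst {X Y Z : Scheme.{u}} (f : X ⟶ Z) (g : Y ⟶ Z) [IsAffineHom g] :
    IsAffineHom (pullback.fst f g) :=
  MorphismProperty.IsStableUnderBaseChange.of_isPullback (P := @IsAffineHom)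
    (IsPullback.of_hasPullback f g).flip ‹_›

namespace Sheaf

lemma ph_φ (M : Sheaf f α) (g : T' ⟶ T) {i j : ι} {a : T ⟶ U i} {b : T ⟶ U j} {a' : T' ⟶ U i}
    {b' : T' ⟶ U j} (hb : g ≫ b = b') (ha : g ≫ a = a') (h : a ≫ f i = b ≫ f j)
    (h' : a' ≫ f i = b' ≫ f j) : ph g hb ha (M.φ a b h).hom = (M.φ a' b' h').hom := by
  subst ha hb
  rw [ph_rfl, M.pullHom_φ]

lemma ph_φ_inv (M : Sheaf f α) (g : T' ⟶ T) {i j : ι} {a : T ⟶ U i} {b : T ⟶ U j} {a' : T' ⟶ U i}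
    {b' : T' ⟶ U j} (hb : g ≫ b = b') (ha : g ≫ a = a') (h : a ≫ f i = b ≫ f j)
    (h' : a' ≫ f i = b' ≫ f j) : ph g ha hb (M.φ a b h).inv = (M.φ a' b' h').inv := by
  rw [← cancel_mono (M.φ a' b' h').hom, Iso.inv_hom_id, ← M.ph_φ g hb ha h h', ← ph_comp,
    Iso.inv_hom_id, ph_id]

/-- Compatibility of a morphism `t^* M_i ⟶ t^* N_i` with the gluing isomorphisms, for a morphism
`t : T ⟶ U i`. -/
def Compat (M N : Sheaf f α) {i : ι} (t : T ⟶ U i) (v : (Scheme.Modules.pullback t).obj (M.obj i) ⟶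
    (Scheme.Modules.pullback t).obj (N.obj i)) : Prop :=
  ∀ {T' : Scheme.{u}} (a b : T' ⟶ T) (a' b' : T' ⟶ U i) (ha : a ≫ t = a') (hb : b ≫ t = b')
    (h : a' ≫ f i = b' ≫ f i),
    (M.φ a' b' h).hom ≫ ph a ha ha v = ph b hb hb v ≫ (N.φ a' b' h).hom

section

variable {M N : Sheaf f α} {i₀ : ι} {t : T ⟶ U i₀}
  (v : (Scheme.Modules.pullback t).obj (M.obj i₀) ⟶ (Scheme.Modules.pullback t).obj (N.obj i₀))

/-- The transport of a morphism `t^* M_i ⟶ t^* N_i` along the gluing isomorphisms. -/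
def tr {j : ι} (q : T' ⟶ T) {a : T' ⟶ U i₀} (ha : q ≫ t = a) (c : T' ⟶ U j)
    (h : a ≫ f i₀ = c ≫ f j) :
    (Scheme.Modules.pullback c).obj (M.obj j) ⟶ (Scheme.Modules.pullback c).obj (N.obj j) :=
  (M.φ a c h).hom ≫ ph q ha ha v ≫ (N.φ a c h).inv

lemma ph_tr {j : ι} (q : T' ⟶ T) {a : T' ⟶ U i₀} (ha : q ≫ t = a) (c : T' ⟶ U j)
    (h : a ≫ f i₀ = c ≫ f j) (g : T'' ⟶ T') {c' : T'' ⟶ U j} (hc : g ≫ c = c') {q' : T'' ⟶ T}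
    (hq : g ≫ q = q') {a' : T'' ⟶ U i₀} (ha' : q' ≫ t = a') (h' : a' ≫ f i₀ = c' ≫ f j) :
    ph g hc hc (tr v q ha c h) = tr v q' ha' c' h' := by
  have hg : g ≫ a = a' := by rw [← ha, ← ha', ← hq, Category.assoc]
  rw [tr, ph_comp g hc hg hc, ph_comp g hg hg hc, M.ph_φ g hc hg h h', N.ph_φ_inv g hc hg h h',
    ph_ph q g ha ha hg hg hq, tr]

/-- The gluing isomorphisms compose only up to `α`, but the same unit occurs for `M` and for `N`,
and scalars commute with every morphism. So transport behaves as in the untwisted case. -/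
lemma tr_comp_φ {j k : ι} (q : T' ⟶ T) {a : T' ⟶ U i₀} (ha : q ≫ t = a) (c : T' ⟶ U j)
    (h : a ≫ f i₀ = c ≫ f j) (d : T' ⟶ U k) (h' : c ≫ f j = d ≫ f k) :
    tr v q ha d (h.trans h') ≫ (N.φ c d h').hom = (M.φ c d h').hom ≫ tr v q ha c h := by
  rw [← cancel_mono (N.φ a c h).hom]
  simp only [tr, Category.assoc, Iso.inv_hom_id, Category.comp_id]
  rw [N.φ_comp, Iso.inv_hom_id_assoc, reassoc_of% M.φ_comp a c d h h', smulEnd_comp]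

variable {v}

/-- Compatibility makes the transport independent of the lift to `T`; again the two units coming
from `M` and `N` cancel. -/
lemma tr_eq_tr (hv : Compat M N t v) {j : ι} (q q' : T' ⟶ T) {a a' : T' ⟶ U i₀} (ha : q ≫ t = a)
    (ha' : q' ≫ t = a') (c : T' ⟶ U j) (h : a ≫ f i₀ = c ≫ f j) (h' : a' ≫ f i₀ = c ≫ f j) :
    tr v q ha c h = tr v q' ha' c h' := by
  have h0 : a' ≫ f i₀ = a ≫ f i₀ := h'.trans h.symm
  rw [← cancel_mono (N.φ a c h).hom, ← cancel_mono (N.φ a' a h0).hom]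
  simp only [tr, Category.assoc, Iso.inv_hom_id, Category.comp_id]
  rw [N.φ_comp, ← hv q' q a' a ha' ha h0, reassoc_of% M.φ_comp a' a c h0 h,
    Iso.inv_hom_id_assoc, smulEnd_comp]

lemma tr_self (hv : Compat M N t v) (ha : 𝟙 T ≫ t = t) : tr v (𝟙 T) ha t rfl = v := by
  have h1 := hv (𝟙 T) (𝟙 T) t t ha ha rfl
  rw [tr, reassoc_of% h1, Iso.hom_inv_id, Category.comp_id, ph_id_left]
  simp

end

/-- `N` vanishes over the open subset `W` of `S`. -/
def IsZeroOver (N : Sheaf f α) (W : S.Opens) : Prop :=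
  ∀ (i : ι) (V : (U i).Opens), IsAffineOpen V → (V : Set (U i)) ⊆ f i ⁻¹' W →
    Subsingleton Γ(N.obj i, V)

lemma isZeroOver_bot (N : Sheaf f α) : N.IsZeroOver ⊥ := by
  intro i V _ h
  obtain rfl : V = ⊥ := by
    ext x
    exact ⟨fun hx => h hx, fun hx => hx.elim⟩
  exact ⟨fun x y => section_ext _ x y fun p hp => hp.elim⟩

/-- Small affine neighbourhoods of a point over `W₁` are covered by the base change of `h`; over
`W₀` the sheaf vanishes. -/
lemma descentBasis {N : Sheaf f α} (hN : ∀ i, (N.obj i).IsQuasicoherent) {W₀ W₁ : S.Opens}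
    (hW : W₁ ⊔ W₀ = ⊤) (h₀ : N.IsZeroOver W₀) {h : T ⟶ S} (h₁ : (W₁ : Set S) ⊆ Set.range h)
    {i : ι} (a : T' ⟶ U i) : DescentBasis (pullback.fst (a ≫ f i) h)
      ((Scheme.Modules.pullback a).obj (N.obj i)) := by
  rw [DescentBasis, TopologicalSpace.Opens.isBasis_iff_nbhd]
  intro O x hx
  rcases (show f i (a x) ∈ W₁ ⊔ W₀ from hW ▸ trivial) with hx1 | hx0
  · obtain ⟨V, hV, hxV, hVO⟩ := exists_isAffineOpen_mem_and_subset
      (U := O ⊓ (a ≫ f i) ⁻¹ᵁ W₁) (x := x) ⟨hx, by simpa using hx1⟩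
    refine ⟨V, ⟨hV, .inl fun y hy => ?_⟩, hxV, hVO.trans inf_le_left⟩
    rw [Scheme.Pullback.range_fst]
    exact h₁ (hVO hy).2
  · obtain ⟨V₀, hV₀, hxV₀, hV₀O⟩ := exists_isAffineOpen_mem_and_subset
      (U := f i ⁻¹ᵁ W₀) (x := a x) hx0
    obtain ⟨V, hV, hxV, hVO⟩ := exists_isAffineOpen_mem_and_subset
      (U := O ⊓ a ⁻¹ᵁ V₀) (x := x) ⟨hx, hxV₀⟩
    refine ⟨V, ⟨hV, .inr ?_⟩, hxV, hVO.trans inf_le_left⟩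
    have := h₀ i V₀ hV₀ hV₀O
    exact (isBC_sec a (hN i) hV₀ hV (hVO.trans inf_le_right)).subsingleton

lemma descentBasis' {N : Sheaf f α} {W₀ W₁ : S.Opens}
    (hW : W₁ ⊔ W₀ = ⊤) (h₀ : N.IsZeroOver W₀) {h : T ⟶ S} (h₁ : (W₁ : Set S) ⊆ Set.range h)
    (i : ι) : DescentBasis (pullback.fst (f i) h) (N.obj i) := by
  rw [DescentBasis, TopologicalSpace.Opens.isBasis_iff_nbhd]
  intro O x hx
  rcases (show f i x ∈ W₁ ⊔ W₀ from hW ▸ trivial) with hx1 | hx0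
  · obtain ⟨V, hV, hxV, hVO⟩ := exists_isAffineOpen_mem_and_subset
      (U := O ⊓ f i ⁻¹ᵁ W₁) (x := x) ⟨hx, hx1⟩
    refine ⟨V, ⟨hV, .inl fun y hy => ?_⟩, hxV, hVO.trans inf_le_left⟩
    rw [Scheme.Pullback.range_fst]
    exact h₁ (hVO hy).2
  · obtain ⟨V, hV, hxV, hVO⟩ := exists_isAffineOpen_mem_and_subset
      (U := O ⊓ f i ⁻¹ᵁ W₀) (x := x) ⟨hx, hx0⟩
    exact ⟨V, ⟨hV, .inr (h₀ i V hV fun y hy => (hVO hy).2)⟩, hxV, hVO.trans inf_le_left⟩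

lemma ph_injective {P Q V W : Scheme.{u}} {p : P ⟶ Q} [IsAffineHom p] [Flat p] {a : Q ⟶ V}
    {b : Q ⟶ W} {M : V.Modules} {N : W.Modules} (hN : N.IsQuasicoherent)
    (hB : DescentBasis p ((Scheme.Modules.pullback b).obj N)) {a' : P ⟶ V} {b' : P ⟶ W}
    (ha : p ≫ a = a') (hb : p ≫ b = b')
    {φ ψ : (Scheme.Modules.pullback a).obj M ⟶ (Scheme.Modules.pullback b).obj N}
    (h : ph p ha hb φ = ph p ha hb ψ) : φ = ψ := by
  refine pullback_map_injective (qcoh_pullback b hN) hB ?_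
  simpa [ph_eq] using h

variable {M N : Sheaf f α} {i₀ : ι} {t : T ⟶ U i₀} [IsAffineHom (t ≫ f i₀)] [Flat (t ≫ f i₀)]

/-- On `U j ×_S T` the gluing isomorphisms conjugate the component at `j` into the one at `i₀`, so
the latter determines all others. -/
lemma hom_ext_of_pullback (hN : ∀ i, (N.obj i).IsQuasicoherent) {W₀ W₁ : S.Opens}
    (hW : W₁ ⊔ W₀ = ⊤) (h₀ : N.IsZeroOver W₀) (h₁ : (W₁ : Set S) ⊆ Set.range (t ≫ f i₀))
    {u u' : M ⟶ N} (h : (Scheme.Modules.pullback t).map (u.hom i₀) =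
      (Scheme.Modules.pullback t).map (u'.hom i₀)) : u = u' := by
  ext j : 1
  refine pullback_map_injective (p := pullback.fst (f j) (t ≫ f i₀)) (hN j)
    (descentBasis' hW h₀ h₁ j) ?_
  have hc : (pullback.snd (f j) (t ≫ f i₀) ≫ t) ≫ f i₀ = pullback.fst (f j) (t ≫ f i₀) ≫ f j := by
    rw [Category.assoc, pullback.condition]
  rw [← cancel_mono (N.φ _ _ hc).hom, u.comm, u'.comm]
  have h2 := congrArg (ph (pullback.snd (f j) (t ≫ f i₀)) rfl rfl) h
  rw [ph_map, ph_map] at h2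
  rw [h2]

/-- Descent of morphisms of twisted sheaves. -/
lemma exists_hom_of_compat (hN : ∀ i, (N.obj i).IsQuasicoherent) {W₀ W₁ : S.Opens}
    (hW : W₁ ⊔ W₀ = ⊤) (h₀ : N.IsZeroOver W₀) (h₁ : (W₁ : Set S) ⊆ Set.range (t ≫ f i₀))
    {v : (Scheme.Modules.pullback t).obj (M.obj i₀) ⟶ (Scheme.Modules.pullback t).obj (N.obj i₀)}
    (hv : Compat M N t v) :
    ∃ u : M ⟶ N, (Scheme.Modules.pullback t).map (u.hom i₀) = v := by
  have hc (j : ι) :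
      (pullback.snd (f j) (t ≫ f i₀) ≫ t) ≫ f i₀ = pullback.fst (f j) (t ≫ f i₀) ≫ f j := by
    rw [Category.assoc, pullback.condition]
  -- The component at `j` is the descent to `U j` of the transport of `v` to `U j ×_S T`.
  have hex (j : ι) : ∃ u : M.obj j ⟶ N.obj j,
      (Scheme.Modules.pullback (pullback.fst (f j) (t ≫ f i₀))).map u =
        tr v (pullback.snd (f j) (t ≫ f i₀)) rfl (pullback.fst (f j) (t ≫ f i₀)) (hc j) := by
    refine exists_pullback_map_eq (hN j) (descentBasis' hW h₀ h₁ j) _ fun g₁ g₂ r e₁ e₂ => ?_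
    have c₁ : ((g₁ ≫ pullback.snd (f j) (t ≫ f i₀)) ≫ t) ≫ f i₀ = r ≫ f j := by
      rw [← e₁, Category.assoc, Category.assoc, Category.assoc, pullback.condition]
    have c₂ : ((g₂ ≫ pullback.snd (f j) (t ≫ f i₀)) ≫ t) ≫ f i₀ = r ≫ f j := by
      rw [← e₂, Category.assoc, Category.assoc, Category.assoc, pullback.condition]
    rw [ph_tr v _ _ _ _ g₁ e₁ rfl rfl c₁, ph_tr v _ _ _ _ g₂ e₂ rfl rfl c₂]
    exact tr_eq_tr hv _ _ _ _ _ _ _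
  choose u hu using hex
  -- Every transport is a pullback of the universal one on `U j ×_S T`, so compatibility with the
  -- gluing reduces to `tr_comp_φ`.
  have key {T' : Scheme.{u}} {j : ι} (c : T' ⟶ U j) (q : T' ⟶ T) {a : T' ⟶ U i₀} (ha : q ≫ t = a)
      (h : a ≫ f i₀ = c ≫ f j) : (Scheme.Modules.pullback c).map (u j) = tr v q ha c h := by
    let l : T' ⟶ pullback (f j) (t ≫ f i₀) := pullback.lift c q (by rw [← h, ← ha, Category.assoc])
    have hl : l ≫ pullback.fst (f j) (t ≫ f i₀) = c := pullback.lift_fst _ _ _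
    rw [← ph_map l hl (u j), hu, ph_tr v _ _ _ _ l hl (pullback.lift_snd _ _ _) ha h]
  refine ⟨⟨u, fun {T'} i j a b h => ?_⟩, ?_⟩
  · refine ph_injective (p := pullback.fst (a ≫ f i) (t ≫ f i₀)) (hN i)
      (descentBasis hN hW h₀ h₁ a) rfl rfl ?_
    have h1 : (pullback.snd (a ≫ f i) (t ≫ f i₀) ≫ t) ≫ f i₀ =
        (pullback.fst (a ≫ f i) (t ≫ f i₀) ≫ a) ≫ f i := by
      rw [Category.assoc, ← pullback.condition, Category.assoc]
    have h2 : (pullback.fst (a ≫ f i) (t ≫ f i₀) ≫ a) ≫ f i =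
        (pullback.fst (a ≫ f i) (t ≫ f i₀) ≫ b) ≫ f j := by
      rw [Category.assoc, h, Category.assoc]
    rw [ph_comp _ rfl rfl rfl, ph_comp _ rfl rfl rfl, ph_map, ph_map, N.ph_φ _ rfl rfl h h2,
      M.ph_φ _ rfl rfl h h2, key _ (pullback.snd _ _) rfl h1,
      key _ (pullback.snd _ _) rfl (h1.trans h2)]
    exact tr_comp_φ v _ _ _ _ _ _
  · exact (key t (𝟙 T) (Category.id_comp t) rfl).trans (tr_self hv _)

end Sheaf

end

end TwistedSheaf

/-! ### Homomorphism modules and flat base change. -/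

namespace TwistedSheaf

section

variable {R S : Type u} [CommRing R] [CommRing S] [Algebra R S] {P Q P' Q' : Type u}
  [AddCommGroup P] [Module R P] [AddCommGroup Q] [Module R Q] [AddCommGroup P'] [Module S P']
  [AddCommGroup Q'] [Module S Q']

lemma IsBC.hom_aux [Module R P'] [IsScalarTower R S P'] [Module R Q'] [IsScalarTower R S Q']
    [Module.Flat R S] [Module.FinitePresentation R P] {p : P →ₗ[R] P'} {q : Q →ₗ[R] Q'}
    (hp : IsBaseChange S p) (hq : IsBaseChange S q)
    (Φ : (P →ₗ[R] Q) →+ (P' →ₗ[S] Q')) (hΦ : ∀ w x, Φ w (p x) = q (w x)) :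
    IsBC (algebraMap R S) Φ := by
  let ψ : (P →ₗ[R] Q) →+ (S ⊗[R] P →ₗ[S] S ⊗[R] Q) :=
    { toFun w := w.baseChange S
      map_zero' := LinearMap.baseChange_zero
      map_add' := LinearMap.baseChange_add }
  have h : IsBC (M := P →ₗ[R] Q) (N := S ⊗[R] P →ₗ[S] S ⊗[R] Q) (algebraMap R S) ψ :=
    IsBC.of_isBaseChange (M := P →ₗ[R] Q) (N := S ⊗[R] P →ₗ[S] S ⊗[R] Q) rfl
      (Module.FinitePresentation.isBaseChange_map R P Q S) fun _ => rfl
  refine h.of_equiv_right (hp.equiv.arrowCongr hq.equiv) fun w => ?_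
  refine hp.algHom_ext _ _ fun x => ?_
  rw [hΦ]
  have h1 : hp.equiv.symm (p x) = 1 ⊗ₜ x := hp.equiv_symm_apply x
  change _ = hq.equiv (w.baseChange S (hp.equiv.symm (p x)))
  rw [h1, LinearMap.baseChange_tmul, hq.equiv_tmul, one_smul]

/-- The additive map underlying a base change, as a linear map. -/
def semilinearMk [Module R P'] [IsScalarTower R S P'] {ψ : P →+ P'}
    (hψ : ∀ (r : R) x, ψ (r • x) = algebraMap R S r • ψ x) : P →ₗ[R] P' :=
  { toFun := ψ
    map_add' := map_add ψ
    map_smul' r x := by rw [RingHom.id_apply, ← algebraMap_smul S r (ψ x), hψ] }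

lemma semilinearMk_apply [Module R P'] [IsScalarTower R S P'] {ψ : P →+ P'}
    (hψ : ∀ (r : R) x, ψ (r • x) = algebraMap R S r • ψ x) (x : P) : semilinearMk hψ x = ψ x := rfl

/-- Homomorphisms from a finitely presented module are compatible with flat base change. -/
lemma IsBC.hom [Module.Flat R S] [Module.FinitePresentation R P] {ψ : P →+ P'} {χ : Q →+ Q'}
    (hψ : IsBC (algebraMap R S) ψ) (hχ : IsBC (algebraMap R S) χ)
    (Φ : (P →ₗ[R] Q) →+ (P' →ₗ[S] Q')) (hΦ : ∀ w x, Φ w (ψ x) = χ (w x)) :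
    IsBC (algebraMap R S) Φ := by
  let : Module R P' := Module.compHom P' (algebraMap R S)
  have : IsScalarTower R S P' := IsScalarTower.of_compHom R S P'
  let : Module R Q' := Module.compHom Q' (algebraMap R S)
  have : IsScalarTower R S Q' := IsScalarTower.of_compHom R S Q'
  exact IsBC.hom_aux (hψ.isBaseChange rfl (semilinearMk hψ.smul) (semilinearMk_apply _))
    (hχ.isBaseChange rfl (semilinearMk hχ.smul) (semilinearMk_apply _)) Φ hΦ

end

section

variable {R R' : CommRingCat.{u}} (L L' : (Spec R).Modules)

/-- The effect of morphisms of modules on `Spec R` on global sections. -/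
def homΓ : (L ⟶ L') →+ (Γ(L, ⊤) →ₗ[R] Γ(L', ⊤)) where
  toFun v :=
    { toFun := v.app ⊤
      map_add' := map_add _
      map_smul' r x := by
        rw [smul_Spec_top, RingHom.id_apply, smul_Spec_top]
        exact Scheme.Modules.Hom.app_smul v _ x }
  map_zero' := rfl
  map_add' _ _ := rfl

variable {L L'}

lemma homΓ_apply (v : L ⟶ L') (x : Γ(L, ⊤)) : homΓ L L' v x = v.app ⊤ x := rfl

lemma homΓ_comp_smulEnd (v : L ⟶ L') (r : R) :
    homΓ L L' (v ≫ smulEnd L' ((Scheme.ΓSpecIso R).inv r)) = r • homΓ L L' v := by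
  ext x
  rw [homΓ_apply, LinearMap.smul_apply, homΓ_apply, app_comp, smulEnd_app_apply, smul_Spec_top]
  exact congr($((Spec R).presheaf.map_id (Opposite.op ⊤)) ((Scheme.ΓSpecIso R).inv r) • _)

/-- The source is `tilde` of its global sections, so this is the adjunction between `tilde` and
global sections; the target may be arbitrary. -/
lemma homΓ_bijective (hL : L.IsQuasicoherent) : Function.Bijective (homΓ L L') := by
  have : IsIso L.fromTildeΓ := inferInstance
  have : IsIso ((tilde.adjunction (R := R)).counit.app L) := this
  have h1 : Function.Bijective (fun v : L ⟶ L' => (moduleSpecΓFunctor (R := R)).map v) := by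
    have h2 : (fun v : L ⟶ L' => (moduleSpecΓFunctor (R := R)).map v) =
        ((tilde.adjunction (R := R)).homEquiv _ _) ∘
          (fun v => (tilde.adjunction (R := R)).counit.app L ≫ v) := by
      funext v
      simp [Adjunction.homEquiv_unit]
    rw [h2]
    refine (Equiv.bijective _).comp ⟨fun v w h => (cancel_epi _).1 h, fun w =>
      ⟨inv ((tilde.adjunction (R := R)).counit.app L) ≫ w, by simp⟩⟩
  have h2 : Function.Bijective (fun v : (moduleSpecΓFunctor (R := R)).obj L ⟶
    (moduleSpecΓFunctor (R := R)).obj L' => v.hom) := ConcreteCategory.hom_bijective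
  exact h2.comp h1

/-- Morphisms between quasi-coherent modules on `Spec R` are determined by global sections. -/
def homΓEquiv (hL : L.IsQuasicoherent) : (L ⟶ L') ≃+ (Γ(L, ⊤) →ₗ[R] Γ(L', ⊤)) :=
  AddEquiv.ofBijective (homΓ L L') (homΓ_bijective hL)

lemma homΓEquiv_apply (hL : L.IsQuasicoherent) (v : L ⟶ L') (x : Γ(L, ⊤)) :
    homΓEquiv hL v x = v.app ⊤ x := rfl

lemma homΓEquiv_symm_app (hL : L.IsQuasicoherent) (w : Γ(L, ⊤) →ₗ[R] Γ(L', ⊤)) (x : Γ(L, ⊤)) :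
    ((homΓEquiv hL).symm w).app ⊤ x = w x := by
  rw [← homΓEquiv_apply hL, AddEquiv.apply_symm_apply]

end

lemma smulEnd_one {X : Scheme.{u}} (M : X.Modules) : smulEnd M 1 = 𝟙 M := by
  ext V m
  rw [smulEnd_app_apply, map_one, one_smul]
  rfl

lemma smulEnd_mul {X : Scheme.{u}} (M : X.Modules) (r s : Γ(X, ⊤)) :
    smulEnd M (r * s) = smulEnd M r ≫ smulEnd M s := by
  ext V m
  rw [app_comp, smulEnd_app_apply, smulEnd_app_apply, smulEnd_app_apply, map_mul, mul_comm,
    mul_smul]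

lemma smulEnd_add {X : Scheme.{u}} (M : X.Modules) (r s : Γ(X, ⊤)) :
    smulEnd M (r + s) = smulEnd M r + smulEnd M s := by
  ext V m
  rw [smulEnd_app_apply, map_add, add_smul]
  rfl

lemma appTop_ΓSpecIso_inv {R R' : CommRingCat.{u}} (φ : R ⟶ R') (r : R) :
    (Spec.map φ).appTop ((Scheme.ΓSpecIso R).inv r) = (Scheme.ΓSpecIso R').inv (φ r) :=
  congr($(Scheme.ΓSpecIso_inv_naturality φ) r).symm

namespace Sheaf

section

variable {T T' T'' : Scheme.{u}} {S : Scheme.{u}} {ι : Type t} {U : ι → Scheme.{u}}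
  {f : ∀ i, U i ⟶ S} {α : Cocycle f} {M N : Sheaf f α}

/-- The relation for three equal indices, with one isomorphism cancelled. The cocycle is not
normalized, so the self-gluing is a scalar and not the identity. -/
lemma φ_self (M : Sheaf f α) {i : ι} (a : T ⟶ U i) (h : a ≫ f i = a ≫ f i) :
    (M.φ a a h).hom = smulEnd _ (α.val a a a h h) := by
  rw [← cancel_epi (M.φ a a h).hom, M.φ_comp]

variable {i₀ : ι} {t : T ⟶ U i₀}
  (v : (Scheme.Modules.pullback t).obj (M.obj i₀) ⟶ (Scheme.Modules.pullback t).obj (N.obj i₀))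

lemma tr_eq_ph (q : T' ⟶ T) {a : T' ⟶ U i₀} (ha : q ≫ t = a) (h : a ≫ f i₀ = a ≫ f i₀) :
    tr v q ha a h = ph q ha ha v := by
  rw [← cancel_mono (N.φ a a h).hom, tr]
  simp only [Category.assoc, Iso.inv_hom_id, Category.comp_id]
  rw [φ_self, φ_self, smulEnd_comp]

lemma tr_add (v w : (Scheme.Modules.pullback t).obj (M.obj i₀) ⟶
    (Scheme.Modules.pullback t).obj (N.obj i₀)) {j : ι} (q : T' ⟶ T) {a : T' ⟶ U i₀}
    (ha : q ≫ t = a) (c : T' ⟶ U j) (h : a ≫ f i₀ = c ≫ f j) :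
    tr (v + w) q ha c h = tr v q ha c h + tr w q ha c h := by
  simp [tr, ph_add]

lemma tr_comp_smulEnd {j : ι} (q : T' ⟶ T) {a : T' ⟶ U i₀}
    (ha : q ≫ t = a) (c : T' ⟶ U j) (h : a ≫ f i₀ = c ≫ f j) (r : Γ(T, ⊤)) :
    tr (v ≫ smulEnd _ r) q ha c h = tr v q ha c h ≫ smulEnd _ (q.appTop r) := by
  simp [tr, ph_comp q ha ha ha, ph_smulEnd, smulEnd_comp]

lemma tr_tr {j k : ι} {s : T' ⟶ U j} (q : T' ⟶ T) {a : T' ⟶ U i₀} (ha : q ≫ t = a)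
    (h : a ≫ f i₀ = s ≫ f j) (q' : T'' ⟶ T') {a' : T'' ⟶ U j} (ha' : q' ≫ s = a') (c : T'' ⟶ U k)
    (h' : a' ≫ f j = c ≫ f k) {q'' : T'' ⟶ T} (hq : q' ≫ q = q'') {a'' : T'' ⟶ U i₀}
    (ha'' : q'' ≫ t = a'') (h'' : a'' ≫ f i₀ = c ≫ f k) :
    (M.φ a' c h').hom ≫ ph q' ha' ha' (tr v q ha s h) ≫ (N.φ a' c h').inv =
      tr v q'' ha'' c h'' := by
  rw [ph_tr v q ha s h q' ha' hq ha'' (h''.trans h'.symm), ← cancel_mono (N.φ a' c h').hom]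
  simp only [Category.assoc, Iso.inv_hom_id, Category.comp_id]
  exact (tr_comp_φ v _ _ _ _ _ _).symm

end

end Sheaf

end TwistedSheaf

/-! ### The morphisms that descend span all morphisms over the cover. -/

namespace TwistedSheaf

section

variable {R S : Type u} [CommRing R] [CommRing S] [Algebra R S] {H H₂ H₃ : Type u}
  [AddCommGroup H] [Module S H] [AddCommGroup H₂] [Module (S ⊗[R] S) H₂] [AddCommGroup H₃]
  [Module ((S ⊗[R] S) ⊗[R] S) H₃]

lemma IsBC.finitePresentation {A B : Type u} [CommRing A] [CommRing B] {P Q : Type u}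
    [AddCommGroup P] [AddCommGroup Q] [Module A P] [Module B Q] {σ : A →+* B} {ψ : P →+ Q}
    (h : IsBC σ ψ) [Module.FinitePresentation A P] : Module.FinitePresentation B Q := by
  let : Algebra A B := σ.toAlgebra
  let : Module A Q := Module.compHom Q σ
  have : IsScalarTower A B Q := IsScalarTower.of_compHom A B Q
  have h' := h.isBaseChange (R := A) (S := B) rfl (semilinearMk h.smul) (semilinearMk_apply _)
  exact Module.FinitePresentation.of_equiv h'.equiv

lemma smulEnd_zero {X : Scheme.{u}} (M : X.Modules) : smulEnd M 0 = 0 := by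
  ext V m
  rw [smulEnd_app_apply, map_zero, zero_smul]
  rfl

/-- A module with a descent datum for a flat ring homomorphism is spanned by the elements that are
fixed by the datum. -/
lemma span_of_descent [Module.Flat R S] {i₁ i₂ : H →+ H₂} {j₁₂ j₁₃ j₂₃ : H₂ →+ H₃} {μ : H₂ →+ H}
    (hi₁ : IsBC (Algebra.TensorProduct.includeLeft : S →ₐ[R] S ⊗[R] S).toRingHom i₁)
    (hi₂ : ∀ (s : S) x, i₂ (s • x) = (1 ⊗ₜ[R] s : S ⊗[R] S) • i₂ x)
    (hj₁₂ : IsBC (Algebra.TensorProduct.includeLeft : S ⊗[R] S →ₐ[R] (S ⊗[R] S) ⊗[R] S).toRingHom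
      j₁₂)
    (hj₁₃ : ∀ (s : S) x, j₁₃ ((1 ⊗ₜ[R] s : S ⊗[R] S) • x) =
      (1 ⊗ₜ[R] s : (S ⊗[R] S) ⊗[R] S) • j₁₃ x)
    (hj₂₃ : ∀ (s : S) x, j₂₃ ((1 ⊗ₜ[R] s : S ⊗[R] S) • x) =
      (1 ⊗ₜ[R] s : (S ⊗[R] S) ⊗[R] S) • j₂₃ x)
    (hμ : ∀ (s : S) x, μ ((1 ⊗ₜ[R] s : S ⊗[R] S) • x) = s • μ x)
    (h₁ : ∀ x, j₁₂ (i₁ x) = j₁₃ (i₁ x)) (h₂ : ∀ x, j₁₂ (i₂ x) = j₂₃ (i₁ x))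
    (h₃ : ∀ x, j₁₃ (i₂ x) = j₂₃ (i₂ x)) (hμ₁ : ∀ x, μ (i₁ x) = x) (hμ₂ : ∀ x, μ (i₂ x) = x) :
    Submodule.span S {x | i₁ x = i₂ x} = ⊤ := by
  let : Module R H := Module.compHom H (algebraMap R S)
  let H₀ : Submodule R H :=
    { carrier := {x | i₁ x = i₂ x}
      add_mem' := fun {x y} hx hy => by
        rw [Set.mem_ofPred_eq] at *; rw [map_add, map_add, hx, hy]
      zero_mem' := by rw [Set.mem_ofPred_eq, map_zero, map_zero]
      smul_mem' := fun r x hx => by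
        rw [Set.mem_ofPred_eq] at *
        change i₁ (algebraMap R S r • x) = i₂ (algebraMap R S r • x)
        rw [hi₁.smul, hi₂, hx, Algebra.algebraMap_eq_smul_one, TensorProduct.tmul_smul]
        rfl }
  have h := (isBC_descent hi₁ hi₂ hj₁₂ hj₁₃ hj₂₃ hμ h₁ h₂ h₃ hμ₁ hμ₂
    (ι := H₀.subtype.toAddMonoidHom) Subtype.val_injective (fun _ _ => rfl)
    (fun x => ⟨fun ⟨y, hy⟩ => hy ▸ y.2, fun hx => ⟨⟨x, hx⟩, rfl⟩⟩)).span
  convert h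
  ext x
  exact ⟨fun hx => ⟨⟨x, hx⟩, rfl⟩, fun ⟨y, hy⟩ => hy ▸ y.2⟩

variable (R S)

/-- The ring map `b ⊗ b' ↦ b ⊗ 1 ⊗ b'`. -/
def incl13 : CommRingCat.of (S ⊗[R] S) ⟶ CommRingCat.of ((S ⊗[R] S) ⊗[R] S) :=
  CommRingCat.ofHom (Algebra.TensorProduct.map
    (Algebra.TensorProduct.includeLeft : S →ₐ[R] S ⊗[R] S) (AlgHom.id R S)).toRingHom

/-- The ring map `b ⊗ b' ↦ 1 ⊗ b ⊗ b'`. -/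
def incl23 : CommRingCat.of (S ⊗[R] S) ⟶ CommRingCat.of ((S ⊗[R] S) ⊗[R] S) :=
  CommRingCat.ofHom (Algebra.TensorProduct.map
    (Algebra.TensorProduct.includeRight : S →ₐ[R] S ⊗[R] S) (AlgHom.id R S)).toRingHom

/-- The ring map `b ⊗ b' ↦ b ⊗ b' ⊗ 1`. -/
def incl12 : CommRingCat.of (S ⊗[R] S) ⟶ CommRingCat.of ((S ⊗[R] S) ⊗[R] S) :=
  CommRingCat.ofHom (Algebra.TensorProduct.includeLeft : S ⊗[R] S →ₐ[R] _).toRingHom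

/-- The multiplication of an algebra. -/
def mulHom : CommRingCat.of (S ⊗[R] S) ⟶ CommRingCat.of S :=
  CommRingCat.ofHom (Algebra.TensorProduct.lmul' R : S ⊗[R] S →ₐ[R] S).toRingHom

lemma incl_tmul (b b' : S) : (inclL R S b = b ⊗ₜ 1) ∧ (inclR R S b = 1 ⊗ₜ b) ∧
    (incl12 R S (b ⊗ₜ b') = (b ⊗ₜ b') ⊗ₜ 1) ∧ (incl13 R S (b ⊗ₜ b') = (b ⊗ₜ 1) ⊗ₜ b') ∧
    (incl23 R S (b ⊗ₜ b') = (1 ⊗ₜ b) ⊗ₜ b') ∧ (mulHom R S (b ⊗ₜ b') = b * b') :=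
  ⟨rfl, rfl, rfl, rfl, rfl, rfl⟩

/-- The simplicial identities among the cover and its double and triple products, including the
diagonal. -/
lemma incl_comp :
    (inclL R S ≫ incl12 R S = inclL R S ≫ incl13 R S) ∧
    (inclR R S ≫ incl12 R S = inclL R S ≫ incl23 R S) ∧
    (inclR R S ≫ incl13 R S = inclR R S ≫ incl23 R S) ∧
    (inclL R S ≫ mulHom R S = 𝟙 _) ∧ (inclR R S ≫ mulHom R S = 𝟙 _) ∧
    (CommRingCat.ofHom (algebraMap R S) ≫ inclL R S =
      CommRingCat.ofHom (algebraMap R S) ≫ inclR R S) := by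
  refine ⟨?_, ?_, ?_, ?_, ?_, ?_⟩ <;> ext b
  · exact rfl
  · exact rfl
  · exact rfl
  · exact mul_one b
  · exact one_mul b
  · exact ((Algebra.TensorProduct.includeLeft : S →ₐ[R] S ⊗[R] S).commutes b).trans
      ((Algebra.TensorProduct.includeRight : S →ₐ[R] S ⊗[R] S).commutes b).symm

end

section

variable {R R' : CommRingCat.{u}}

/-- The module structure on morphisms between modules over `Spec R`. -/
instance homSpecModule (L L' : (Spec R).Modules) : Module R (L ⟶ L') where
  smul r v := v ≫ smulEnd L' ((Scheme.ΓSpecIso R).inv r)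
  one_smul v := by
    change v ≫ smulEnd L' ((Scheme.ΓSpecIso R).inv 1) = v
    rw [map_one, smulEnd_one, Category.comp_id]
  mul_smul r s v := by
    change v ≫ smulEnd L' ((Scheme.ΓSpecIso R).inv (r * s)) =
      (v ≫ smulEnd L' ((Scheme.ΓSpecIso R).inv s)) ≫ smulEnd L' ((Scheme.ΓSpecIso R).inv r)
    rw [mul_comm, map_mul, smulEnd_mul, Category.assoc]
  smul_zero r := zero_comp
  smul_add r v w := Preadditive.add_comp _ _ _ _ _ _
  add_smul r s v := by
    change v ≫ smulEnd L' ((Scheme.ΓSpecIso R).inv (r + s)) =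
      v ≫ smulEnd L' ((Scheme.ΓSpecIso R).inv r) + v ≫ smulEnd L' ((Scheme.ΓSpecIso R).inv s)
    rw [map_add, smulEnd_add, Preadditive.comp_add]
  zero_smul v := by
    change v ≫ smulEnd L' ((Scheme.ΓSpecIso R).inv 0) = 0
    rw [map_zero, smulEnd_zero, comp_zero]

instance homSpecModuleOf (A : Type u) [CommRing A] (L L' : (Spec (.of A)).Modules) :
    Module A (L ⟶ L') :=
  homSpecModule (R := .of A) L L'

lemma homSpec_smul {L L' : (Spec R).Modules} (r : R) (v : L ⟶ L') :
    r • v = v ≫ smulEnd L' ((Scheme.ΓSpecIso R).inv r) := rfl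

/-- `homΓEquiv` as a linear equivalence. -/
def homΓLinearEquiv {L : (Spec R).Modules} (hL : L.IsQuasicoherent) (L' : (Spec R).Modules) :
    (L ⟶ L') ≃ₗ[R] (Γ(L, ⊤) →ₗ[R] Γ(L', ⊤)) :=
  { homΓEquiv hL with map_smul' := fun r v => homΓ_comp_smulEnd v r }

lemma homΓLinearEquiv_symm_app {L : (Spec R).Modules} (hL : L.IsQuasicoherent)
    (L' : (Spec R).Modules) (w : Γ(L, ⊤) →ₗ[R] Γ(L', ⊤)) (x : Γ(L, ⊤)) :
    ((homΓLinearEquiv hL L').symm w).app ⊤ x = w x := homΓEquiv_symm_app hL w x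

lemma IsBC.homSpec (q : R ⟶ R') (hq : q.hom.Flat) {L L₁ : (Spec R).Modules}
    {L' L₁' : (Spec R').Modules} [Module.FinitePresentation R Γ(L, ⊤)] {ψ : Γ(L, ⊤) →+ Γ(L', ⊤)}
    {χ : Γ(L₁, ⊤) →+ Γ(L₁', ⊤)} (hψ : IsBC q.hom ψ) (hχ : IsBC q.hom χ) (hL : L.IsQuasicoherent)
    (hL' : L'.IsQuasicoherent) (Φ : (L ⟶ L₁) →+ (L' ⟶ L₁'))
    (hΦ : ∀ v x, (Φ v).app ⊤ (ψ x) = χ (v.app ⊤ x)) : IsBC q.hom Φ := by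
  let : Algebra R R' := q.hom.toAlgebra
  have : Module.Flat R R' := hq
  let e := homΓLinearEquiv hL L₁
  let e' := homΓLinearEquiv hL' L₁'
  let Ψ : (Γ(L, ⊤) →ₗ[R] Γ(L₁, ⊤)) →+ (Γ(L', ⊤) →ₗ[R'] Γ(L₁', ⊤)) :=
    e'.toAddMonoidHom.comp (Φ.comp e.symm.toAddMonoidHom)
  have hΨ : IsBC q.hom Ψ := IsBC.hom hψ hχ Ψ fun w x => by
    change (Φ (e.symm w)).app ⊤ (ψ x) = _
    rw [hΦ]
    exact congrArg χ (homΓLinearEquiv_symm_app hL L₁ w x)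
  have h₂ : IsBC q.hom (Ψ.comp e.toAddMonoidHom) := IsBC.of_equiv_left hΨ e fun _ => rfl
  refine IsBC.of_equiv_right h₂ e'.symm fun v => ?_
  rw [LinearEquiv.eq_symm_apply]
  change _ = e' (Φ (e.symm (e v)))
  rw [e.symm_apply_apply]

end

namespace Sheaf

section

variable {S : Scheme.{u}} {ι : Type t} {U : ι → Scheme.{u}}
  {f : ∀ i, U i ⟶ S} {α : Cocycle f} {M N : Sheaf f α}

/-- The transport `tr` for a ring homomorphism. -/
def trSpec (M N : Sheaf f α) {R R' : CommRingCat.{u}} {i j : ι}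
    {t : Spec R ⟶ U i} {s : Spec R' ⟶ U j} (q : R ⟶ R')
    (h : (Spec.map q ≫ t) ≫ f i = s ≫ f j) :
    ((Scheme.Modules.pullback t).obj (M.obj i) ⟶ (Scheme.Modules.pullback t).obj (N.obj i)) →+
    ((Scheme.Modules.pullback s).obj (M.obj j) ⟶ (Scheme.Modules.pullback s).obj (N.obj j)) :=
  AddMonoidHom.mk' (fun v => tr v (Spec.map q) rfl s h) fun v w => tr_add v w _ _ _ _

variable {R R' R'' : CommRingCat.{u}} {i j k : ι}
    {t : Spec R ⟶ U i} {s : Spec R' ⟶ U j} {s' : Spec R'' ⟶ U k}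

lemma trSpec_apply (q : R ⟶ R') (h : (Spec.map q ≫ t) ≫ f i = s ≫ f j)
    (v : (Scheme.Modules.pullback t).obj (M.obj i) ⟶ (Scheme.Modules.pullback t).obj (N.obj i)) :
    trSpec M N q h v = tr v (Spec.map q) rfl s h := rfl

lemma trSpec_smul (q : R ⟶ R') (h : (Spec.map q ≫ t) ≫ f i = s ≫ f j) (r : R)
    (v : (Scheme.Modules.pullback t).obj (M.obj i) ⟶ (Scheme.Modules.pullback t).obj (N.obj i)) :
    trSpec M N q h (r • v) = q r • trSpec M N q h v := by
  rw [trSpec_apply, trSpec_apply, homSpec_smul, tr_comp_smulEnd, appTop_ΓSpecIso_inv, homSpec_smul]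

lemma trSpec_trSpec (q : R ⟶ R') (h : (Spec.map q ≫ t) ≫ f i = s ≫ f j) (q' : R' ⟶ R'')
    (h' : (Spec.map q' ≫ s) ≫ f j = s' ≫ f k) {q'' : R ⟶ R''} (hq : q ≫ q' = q'')
    (h'' : (Spec.map q'' ≫ t) ≫ f i = s' ≫ f k)
    (v : (Scheme.Modules.pullback t).obj (M.obj i) ⟶ (Scheme.Modules.pullback t).obj (N.obj i)) :
    trSpec M N q' h' (trSpec M N q h v) = trSpec M N q'' h'' v :=
  tr_tr _ (Spec.map q) rfl h (Spec.map q') rfl s' h' (by rw [← hq, Spec.map_comp]) rfl h''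

lemma trSpec_self (q : R ⟶ R) (hq : q = 𝟙 R) (h : (Spec.map q ≫ t) ≫ f i = t ≫ f i)
    (v : (Scheme.Modules.pullback t).obj (M.obj i) ⟶ (Scheme.Modules.pullback t).obj (N.obj i)) :
    trSpec M N q h v = v := by
  have e : Spec.map q = 𝟙 _ := by rw [hq, Spec.map_id]
  have e' : Spec.map q ≫ t = t := by rw [e, Category.id_comp]
  have h2 : tr v (Spec.map q) rfl t h = tr v (Spec.map q) e' t rfl := by
    simp only [e']
  rw [trSpec_apply, h2, tr_eq_ph]
  generalize Spec.map q = r at *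
  subst e
  rw [ph_id_left]
  simp

lemma isBC_trSpec (q : R ⟶ R') (hq : q.hom.Flat) (hM : (M.obj i).IsQuasicoherent)
    (hN : (N.obj i).IsQuasicoherent)
    [Module.FinitePresentation R Γ((Scheme.Modules.pullback t).obj (M.obj i), ⊤)]
    (h : (Spec.map q ≫ t) ≫ f i = (Spec.map q ≫ t) ≫ f i) :
    IsBC q.hom (trSpec M N q h) :=
  IsBC.homSpec q hq (isBC_res_SpecMap q rfl hM) (isBC_res_SpecMap q rfl hN) (qcoh_pullback _ hM)
    (qcoh_pullback _ hM) _ fun v x => by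
      rw [trSpec_apply, tr_eq_ph, ph_res]

end

section

variable {S : Scheme.{u}} {ι : Type t} {U : ι → Scheme.{u}}
  {f : ∀ i, U i ⟶ S} {α : Cocycle f} {M N : Sheaf f α} {A B : Type u} [CommRing A] [CommRing B]
  [Algebra A B] {i₀ : ι} {t : Spec (.of B) ⟶ U i₀} {j : Spec (.of A) ⟶ S}

lemma SpecMap_comp_eq (ht : t ≫ f i₀ = Spec.map (CommRingCat.ofHom (algebraMap A B)) ≫ j)
    {R : CommRingCat.{u}} {q q' : CommRingCat.of B ⟶ R}
    (h : CommRingCat.ofHom (algebraMap A B) ≫ q = CommRingCat.ofHom (algebraMap A B) ≫ q') :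
    (Spec.map q ≫ t) ≫ f i₀ = (Spec.map q' ≫ t) ≫ f i₀ := by
  rw [Category.assoc, Category.assoc, ht, ← Spec.map_comp_assoc, ← Spec.map_comp_assoc, h]

/-- Since `j` is a monomorphism, a pair of points of `Spec B` with the same image in `S` factors
through `Spec (B ⊗[A] B)`. One equality there implies compatibility on all test schemes. -/
lemma compat_of_tr_eq [Mono j]
    (ht : t ≫ f i₀ = Spec.map (CommRingCat.ofHom (algebraMap A B)) ≫ j)
    {v : (Scheme.Modules.pullback t).obj (M.obj i₀) ⟶ (Scheme.Modules.pullback t).obj (N.obj i₀)}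
    (hv : tr v (Spec.map (inclL A B)) rfl (Spec.map (inclL A B) ≫ t) rfl =
      tr v (Spec.map (inclR A B)) rfl (Spec.map (inclL A B) ≫ t)
        (SpecMap_comp_eq ht (incl_comp A B).2.2.2.2.2.symm)) : Compat M N t v := by
  intro T' a b a' b' ha hb h
  have h0 : a ≫ Spec.map (CommRingCat.ofHom (algebraMap A B)) =
      b ≫ Spec.map (CommRingCat.ofHom (algebraMap A B)) := by
    rw [← cancel_mono j, Category.assoc, Category.assoc, ← ht, ← Category.assoc, ← Category.assoc,
      ha, hb, h]
  have hP := isPullback_SpecMap_of_isPushout _ _ (inclL A B) (inclR A B)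
    (CommRingCat.isPushout_tensorProduct A B B)
  -- The two sides of `hv` live over the left factor, so this factor has to be matched with `b`.
  let l := hP.lift b a h0.symm
  have hl₁ : l ≫ Spec.map (inclL A B) = b := hP.lift_fst _ _ _
  have hl₂ : l ≫ Spec.map (inclR A B) = a := hP.lift_snd _ _ _
  have e : l ≫ Spec.map (inclL A B) ≫ t = b' := by rw [← hb, ← hl₁, Category.assoc]
  have h1 := congrArg (ph l e e) hv
  rw [ph_tr v _ _ _ _ l e hl₁ hb rfl, ph_tr v _ _ _ _ l e hl₂ ha h, tr_eq_ph, tr] at h1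
  rw [h1]
  simp

/-- Homomorphisms between coherent twisted sheaves over a flat covering are generated by those that
descend. -/
theorem span_compat [Mono j] [Module.Flat A B] (hM : (M.obj i₀).IsQuasicoherent)
    (hN : (N.obj i₀).IsQuasicoherent)
    (ht : t ≫ f i₀ = Spec.map (CommRingCat.ofHom (algebraMap A B)) ≫ j)
    [Module.FinitePresentation B Γ((Scheme.Modules.pullback t).obj (M.obj i₀), ⊤)] :
    Submodule.span B {v : (Scheme.Modules.pullback t).obj (M.obj i₀) ⟶
      (Scheme.Modules.pullback t).obj (N.obj i₀) | Compat M N t v} = ⊤ := by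
  obtain ⟨c₁, c₂, c₃, c₄, c₅, c₆⟩ := incl_comp A B
  let s : Spec (.of (B ⊗[A] B)) ⟶ U i₀ := Spec.map (inclL A B) ≫ t
  have hs (q : CommRingCat.of (B ⊗[A] B) ⟶ CommRingCat.of ((B ⊗[A] B) ⊗[A] B))
      (hq : CommRingCat.ofHom (algebraMap A B) ≫ inclL A B ≫ q =
        CommRingCat.ofHom (algebraMap A B) ≫ inclL A B ≫ incl12 A B) :
      (Spec.map q ≫ s) ≫ f i₀ = (Spec.map (incl12 A B) ≫ s) ≫ f i₀ := by
    have := SpecMap_comp_eq ht hq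
    simpa [s] using this
  have hq' (q : CommRingCat.of B ⟶ CommRingCat.of ((B ⊗[A] B) ⊗[A] B))
      (hq : CommRingCat.ofHom (algebraMap A B) ≫ q =
        CommRingCat.ofHom (algebraMap A B) ≫ inclL A B ≫ incl12 A B) :
      (Spec.map q ≫ t) ≫ f i₀ = (Spec.map (incl12 A B) ≫ s) ≫ f i₀ := by
    have := SpecMap_comp_eq ht hq
    simpa [s] using this
  have h3 : CommRingCat.ofHom (algebraMap A B) ≫ inclR A B ≫ incl13 A B =
      CommRingCat.ofHom (algebraMap A B) ≫ inclL A B ≫ incl12 A B := by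
    rw [c₁, ← reassoc_of% c₆]
  have h13 := hs (incl13 A B) (by rw [c₁])
  have h23 := hs (incl23 A B) (by rw [← c₂, reassoc_of% c₆])
  have hμ : (Spec.map (mulHom A B) ≫ s) ≫ f i₀ = t ≫ f i₀ := by
    simp only [s]
    rw [← Spec.map_comp_assoc, c₄, Spec.map_id, Category.id_comp]
  have hB : (inclL A B).hom.Flat := by
    change (algebraMap B (B ⊗[A] B)).Flat
    rw [RingHom.flat_algebraMap_iff]
    infer_instance
  have hB' : (incl12 A B).hom.Flat := by
    change (algebraMap (B ⊗[A] B) ((B ⊗[A] B) ⊗[A] B)).Flat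
    rw [RingHom.flat_algebraMap_iff]
    infer_instance
  have : Module.FinitePresentation (B ⊗[A] B) Γ((Scheme.Modules.pullback s).obj (M.obj i₀), ⊤) :=
    (isBC_res_SpecMap (inclL A B) (rfl : _ = s) hM).finitePresentation
  have hE₁ := isBC_trSpec (t := t) (inclL A B) hB hM hN rfl
  have hE₂ := isBC_trSpec (t := s) (incl12 A B) hB' hM hN rfl
  let H := (Scheme.Modules.pullback t).obj (M.obj i₀) ⟶ (Scheme.Modules.pullback t).obj (N.obj i₀)
  let H₂ := (Scheme.Modules.pullback s).obj (M.obj i₀) ⟶ (Scheme.Modules.pullback s).obj (N.obj i₀)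
  let H₃ := (Scheme.Modules.pullback (Spec.map (incl12 A B) ≫ s)).obj (M.obj i₀) ⟶
      (Scheme.Modules.pullback (Spec.map (incl12 A B) ≫ s)).obj (N.obj i₀)
  -- Conjugation by the gluing isomorphisms gives an untwisted descent datum on homomorphisms,
  -- because the unit `α` cancels between source and target.
  let i₁ : H →+ H₂ := trSpec M N (inclL A B) rfl
  let i₂ : H →+ H₂ := trSpec M N (inclR A B) (SpecMap_comp_eq ht c₆.symm)
  let j₁₂ : H₂ →+ H₃ := trSpec M N (incl12 A B) rfl
  let j₁₃ : H₂ →+ H₃ := trSpec M N (incl13 A B) h13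
  let j₂₃ : H₂ →+ H₃ := trSpec M N (incl23 A B) h23
  let μ : H₂ →+ H := trSpec M N (mulHom A B) hμ
  have e₁ : IsBC (Algebra.TensorProduct.includeLeft : B →ₐ[A] B ⊗[A] B).toRingHom i₁ := hE₁
  have e₂ (b : B) (x : H) : i₂ (b • x) = (1 ⊗ₜ[A] b : B ⊗[A] B) • i₂ x := by
    have := trSpec_smul (inclR A B) (SpecMap_comp_eq ht c₆.symm) b x
    exact this
  have e₁₂ : IsBC
      (Algebra.TensorProduct.includeLeft : B ⊗[A] B →ₐ[A] (B ⊗[A] B) ⊗[A] B).toRingHom j₁₂ := hE₂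
  have e₁₃ (b : B) (x : H₂) : j₁₃ ((1 ⊗ₜ[A] b : B ⊗[A] B) • x) =
      (1 ⊗ₜ[A] b : (B ⊗[A] B) ⊗[A] B) • j₁₃ x := by
    have := trSpec_smul (incl13 A B) h13 (1 ⊗ₜ b) x
    exact this
  have e₂₃ (b : B) (x : H₂) : j₂₃ ((1 ⊗ₜ[A] b : B ⊗[A] B) • x) =
      (1 ⊗ₜ[A] b : (B ⊗[A] B) ⊗[A] B) • j₂₃ x := by
    have := trSpec_smul (incl23 A B) h23 (1 ⊗ₜ b) x
    exact this
  have eμ (b : B) (x : H₂) : μ ((1 ⊗ₜ[A] b : B ⊗[A] B) • x) = b • μ x := by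
    have := trSpec_smul (mulHom A B) hμ (1 ⊗ₜ b) x
    rw [(incl_tmul A B 1 b).2.2.2.2.2, one_mul] at this
    exact this
  have key := span_of_descent e₁ e₂ e₁₂ e₁₃ e₂₃ eμ ?_ ?_ ?_ ?_ ?_
  · rw [eq_top_iff, ← key, Submodule.span_le]
    exact fun v hv => Submodule.subset_span (compat_of_tr_eq ht hv)
  · intro w
    exact (trSpec_trSpec _ _ _ _ rfl (hq' _ rfl) w).trans
      (trSpec_trSpec _ _ _ _ c₁.symm (hq' _ rfl) w).symm
  · intro w
    exact (trSpec_trSpec _ _ _ _ rfl (hq' _ (by rw [reassoc_of% c₆])) w).trans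
      (trSpec_trSpec _ _ _ _ c₂.symm (hq' _ (by rw [reassoc_of% c₆])) w).symm
  · intro w
    exact (trSpec_trSpec _ _ _ _ rfl (hq' _ h3) w).trans
      (trSpec_trSpec _ _ _ _ c₃.symm (hq' _ h3) w).symm
  · intro w
    exact (trSpec_trSpec _ _ _ _ c₄ (by simp) w).trans (trSpec_self _ rfl _ w)
  · intro w
    exact (trSpec_trSpec _ _ _ _ c₅ (by simp) w).trans (trSpec_self _ rfl _ w)

end

end Sheaf

end TwistedSheaf

/-! ### Effective descent of modules along flat affine covers. -/

namespace TwistedSheaf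

namespace IsBC

section

variable {R S : Type u} [CommRing R] [CommRing S] {σ : R →+* S} {M N N' : Type u} [AddCommGroup M]
  [AddCommGroup N] [AddCommGroup N'] [Module R M] [Module S N] [Module S N'] {ψ : M →+ N}
  {ψ' : M →+ N'}

/-- Two objects with the same universal property. -/
lemma bijective_of_comp (h : IsBC σ ψ) (h' : IsBC σ ψ') (g : N →ₗ[S] N')
    (hg : ∀ x, g (ψ x) = ψ' x) : Function.Bijective g := by
  obtain ⟨k, hk⟩ := h'.exists_lift N ψ h.smul
  have e₁ : k ∘ₗ g = LinearMap.id := h.hom_ext _ _ _ fun x => by simp [hg, hk]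
  have e₂ : g ∘ₗ k = LinearMap.id := h'.hom_ext _ _ _ fun x => by simp [hg, hk]
  exact ⟨Function.LeftInverse.injective fun x => congr($e₁ x),
    Function.RightInverse.surjective fun x => congr($e₂ x)⟩

/-- Finiteness descends along faithfully flat ring homomorphisms. -/
lemma finite_of_faithfullyFlat [Algebra R S] [Module.FaithfullyFlat R S]
    (h : IsBC (algebraMap R S) ψ) [Module.Finite S N] : Module.Finite R M := by
  classical
  have h1 : (Submodule.span S (Set.range ψ)).FG := by
    rw [h.span]; exact Module.Finite.fg_top
  obtain ⟨s, hs, hs'⟩ := (Submodule.fg_span_iff_fg_span_finset_subset _).1 h1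
  rw [h.span] at hs'
  obtain ⟨s', -, rfl⟩ := Finset.subset_set_image_iff.1 (by simpa using hs : (s : Set N) ⊆ ψ '' Set.univ)
  refine ⟨⟨s', ?_⟩⟩
  rw [← Submodule.ker_mkQ (Submodule.span R (s' : Set M)), LinearMap.ker_eq_top]
  -- The map `M → S ⊗ Q` extends over `N` and kills a generating set of `N`, so it is zero; faithful
  -- flatness then gives `Q = 0`.
  let Q := M ⧸ Submodule.span R (s' : Set M)
  let χ : M →+ S ⊗[R] Q :=
    ((TensorProduct.mk R S Q 1).comp (Submodule.mkQ _)).toAddMonoidHom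
  obtain ⟨g, hg⟩ := h.exists_lift (S ⊗[R] Q) χ fun r x => by
    change (1 : S) ⊗ₜ[R] (Submodule.mkQ _ (r • x)) = algebraMap R S r • ((1 : S) ⊗ₜ[R] _)
    rw [map_smul, algebraMap_smul, TensorProduct.tmul_smul]
  have hg0 : g = 0 := by
    refine LinearMap.ext_on hs'.symm fun y hy => ?_
    obtain ⟨x, hx, rfl⟩ := Finset.mem_image.1 hy
    rw [hg]
    change (1 : S) ⊗ₜ[R] (Submodule.mkQ _ x) = 0
    rw [Submodule.mkQ_apply, (Submodule.Quotient.mk_eq_zero _).2 (Submodule.subset_span hx),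
      TensorProduct.tmul_zero]
  ext x
  apply (IsBC.tensor (R := R) (S := S) (M := Q)).injective
  have := hg x
  rw [hg0] at this
  rw [LinearMap.zero_apply, map_zero]
  exact this.symm

end

/-- Being a base change may be checked after a faithfully flat extension. -/
lemma of_comp_faithfullyFlat {R R' R'' : Type u} [CommRing R] [CommRing R'] [CommRing R'']
    [Algebra R R'] [Algebra R' R''] [Module.FaithfullyFlat R' R''] {M M' M'' : Type u}
    [AddCommGroup M] [AddCommGroup M'] [AddCommGroup M''] [Module R M] [Module R' M']
    [Module R'' M''] {ψ : M →+ M'} {χ : M' →+ M''} (hχ : IsBC (algebraMap R' R'') χ)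
    (h : IsBC ((algebraMap R' R'').comp (algebraMap R R')) (χ.comp ψ))
    (hs : ∀ (r : R) x, ψ (r • x) = algebraMap R R' r • ψ x) : IsBC (algebraMap R R') ψ := by
  have hκ := IsBC.tensor (R := R) (S := R') (M := M)
  obtain ⟨f, hf⟩ := hκ.exists_lift M' ψ hs
  have h1 := hκ.comp (IsBC.tensor (R := R') (S := R'') (M := R' ⊗[R] M))
  have hχ' := IsBC.tensor (R := R') (S := R'') (M := M')
  obtain ⟨e, he⟩ := hχ.exists_lift _ _ hχ'.smul
  have he' := hχ.bijective_of_comp hχ' e he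
  have h2 := h.of_equiv_right (LinearEquiv.ofBijective e he')
    (ψ₁ := ((TensorProduct.mk R' R'' M' 1).toAddMonoidHom).comp ψ) fun x => (he (ψ x)).symm
  have h3 := h1.bijective_of_comp h2 (f.baseChange R'') fun x => by
    exact congrArg (fun y => (1 : R'') ⊗ₜ[R'] y) (hf x)
  have h4 : Function.Bijective f := by
    rw [← Module.FaithfullyFlat.lTensor_bijective_iff_bijective R' R'']
    exact h3
  exact hκ.of_equiv_right (LinearEquiv.ofBijective f h4) fun x => (hf x).symm

end IsBC

/-- An injective idempotent map is the identity. -/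
lemma res_self {T W : Scheme.{u}} (g : T ⟶ T) (hg : g = 𝟙 T) {b : T ⟶ W} (hb : g ≫ b = b)
    (N : W.Modules) {O : T.Opens} (e : O ≤ g ⁻¹ᵁ O) (x) : res g hb N e x = x := by
  have : IsOpenImmersion g := hg ▸ inferInstance
  have h : O ≤ g ''ᵁ O := fun x hx => ⟨x, hx, by rw [hg]; rfl⟩
  exact (bijective_res_of_isOpenImmersion g hb N e h).injective
    (res_res g g (by rw [hg, Category.comp_id]) hb hb N e e e x)

/-- A descent datum along `p : P ⟶ Q` on the pullback to `P` of a module `N` on a terminal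
scheme `Z`. -/
structure Gluing {P Q Z : Scheme.{u}} (p : P ⟶ Q) (z : ∀ X : Scheme.{u}, X ⟶ Z) (N : Z.Modules) where
  Ψ {X : Scheme.{u}} (x y : X ⟶ P) (h : x ≫ p = y ≫ p) :
    (Scheme.Modules.pullback (z X)).obj N ⟶ (Scheme.Modules.pullback (z X)).obj N
  ph_Ψ {X X' : Scheme.{u}} (g : X' ⟶ X) (hz : g ≫ z X = z X') (x y : X ⟶ P) (h : x ≫ p = y ≫ p)
    {x' y' : X' ⟶ P} (hx : g ≫ x = x') (hy : g ≫ y = y') (h' : x' ≫ p = y' ≫ p) :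
    ph g hz hz (Ψ x y h) = Ψ x' y' h'
  comp {X : Scheme.{u}} (x y w : X ⟶ P) (h : x ≫ p = y ≫ p) (h' : y ≫ p = w ≫ p) :
    Ψ y w h' ≫ Ψ x y h = Ψ x w (h.trans h')
  self {X : Scheme.{u}} (x : X ⟶ P) : Ψ x x rfl = 𝟙 _

namespace Gluing

variable {P Q Z : Scheme.{u}} {p : P ⟶ Q} {z : ∀ X : Scheme.{u}, X ⟶ Z} {N : Z.Modules}
  (G : Gluing p z N) (hz : ∀ {X Y : Scheme.{u}} (g : X ⟶ Y), g ≫ z Y = z X)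

section

variable {R R' R'' : CommRingCat.{u}}

/-- The pullback of sections, corrected by the descent datum. -/
def tw (u : Spec R ⟶ P) (u' : Spec R' ⟶ P) (q : R ⟶ R') (h : u' ≫ p = (Spec.map q ≫ u) ≫ p) :
    Γ((Scheme.Modules.pullback (z (Spec R))).obj N, ⊤) →+
      Γ((Scheme.Modules.pullback (z (Spec R'))).obj N, ⊤) :=
  ((G.Ψ u' (Spec.map q ≫ u) h).app ⊤).hom.comp
    (res (Spec.map q) (hz _) N (top_le_preimage_top (Spec.map q)))

lemma tw_apply (u : Spec R ⟶ P) (u' : Spec R' ⟶ P) (q : R ⟶ R')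
    (h : u' ≫ p = (Spec.map q ≫ u) ≫ p) (x) : G.tw hz u u' q h x =
      (G.Ψ u' (Spec.map q ≫ u) h).app ⊤
        (res (Spec.map q) (hz _) N (top_le_preimage_top (Spec.map q)) x) :=
  comp_app_apply _ _ _ _

lemma tw_smul (hN : N.IsQuasicoherent) (u : Spec R ⟶ P) (u' : Spec R' ⟶ P) (q : R ⟶ R')
    (h : u' ≫ p = (Spec.map q ≫ u) ≫ p) (r : R) (x) :
    G.tw hz u u' q h (r • x) = q r • G.tw hz u u' q h x := by
  rw [tw_apply, tw_apply, (isBC_res_SpecMap q _ hN).smul, smul_Spec_top, smul_Spec_top]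
  exact Scheme.Modules.Hom.app_smul _ _ _

/-- The cocycle condition on sections. As all modules are pulled back from the terminal scheme, the
type of `Ψ x y` does not mention `x` and `y`, and the twisted restrictions compose without
transport. -/
lemma tw_tw (u : Spec R ⟶ P) (u' : Spec R' ⟶ P) (u'' : Spec R'' ⟶ P) (q : R ⟶ R') (q' : R' ⟶ R'')
    {q'' : R ⟶ R''} (hq : q ≫ q' = q'') (h : u' ≫ p = (Spec.map q ≫ u) ≫ p)
    (h' : u'' ≫ p = (Spec.map q' ≫ u') ≫ p) (h'' : u'' ≫ p = (Spec.map q'' ≫ u) ≫ p) (x) :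
    G.tw hz u' u'' q' h' (G.tw hz u u' q h x) = G.tw hz u u'' q'' h'' x := by
  subst hq
  rw [tw_apply, tw_apply, tw_apply, ← ph_res (Spec.map q') (hz _) (hz _),
    G.ph_Ψ _ _ _ _ _ rfl (by rw [← Spec.map_comp_assoc]) (h'.symm.trans h''), ← app_comp,
    G.comp, res_res (Spec.map q) (Spec.map q') (Spec.map_comp _ _).symm]

lemma tw_self (u : Spec R ⟶ P) (q : R ⟶ R) (hq : q = 𝟙 R) (h : u ≫ p = (Spec.map q ≫ u) ≫ p) (x) :
    G.tw hz u u q h x = x := by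
  rw [tw_apply]
  have e : Spec.map q = 𝟙 _ := by rw [hq, Spec.map_id]
  have h1 : (G.Ψ u (Spec.map q ≫ u) h) = 𝟙 _ := by
    rw [← G.self u]
    congr 1
    rw [e, Category.id_comp]
  rw [h1]
  exact res_self _ e _ N _ x

lemma isBC_tw (hN : N.IsQuasicoherent) (u : Spec R ⟶ P) (q : R ⟶ R')
    (h : (Spec.map q ≫ u) ≫ p = (Spec.map q ≫ u) ≫ p) :
    IsBC q.hom (G.tw hz u (Spec.map q ≫ u) q h) := by
  have h1 : G.tw hz u (Spec.map q ≫ u) q h =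
      res (Spec.map q) (hz _) N (top_le_preimage_top (Spec.map q)) := by
    ext x
    rw [tw_apply, G.self]
    rfl
  rw [h1]
  exact isBC_res_SpecMap q _ hN

end

section

variable {R S : Type u} [CommRing R] [CommRing S] [Algebra R S] {u : Spec (.of S) ⟶ P}
  {j : Spec (.of R) ⟶ Q}

lemma SpecMap_comp_comp_eq (hu : u ≫ p = Spec.map (CommRingCat.ofHom (algebraMap R S)) ≫ j)
    {A : CommRingCat.{u}} {q q' : CommRingCat.of S ⟶ A}
    (h : CommRingCat.ofHom (algebraMap R S) ≫ q = CommRingCat.ofHom (algebraMap R S) ≫ q') :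
    (Spec.map q ≫ u) ≫ p = (Spec.map q' ≫ u) ≫ p := by
  rw [Category.assoc, Category.assoc, hu, ← Spec.map_comp_assoc, ← Spec.map_comp_assoc, h]

/-- This is `isBC_descent` with every map a twisted restriction. The point `s` of the double product
is taken over the left factor, so that `i₁` is the plain pullback and only `i₂` contains the gluing.
-/
lemma isBC_of_tw_eq [Module.Flat R S] (hN : N.IsQuasicoherent)
    (hu : u ≫ p = Spec.map (CommRingCat.ofHom (algebraMap R S)) ≫ j) {H₀ : Type u}
    [AddCommGroup H₀] [Module R H₀]
    {κ : H₀ →+ Γ((Scheme.Modules.pullback (z (Spec (.of S)))).obj N, ⊤)}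
    (hκ : Function.Injective κ) (hκs : ∀ (r : R) x, κ (r • x) = algebraMap R S r • κ x)
    (hκr : ∀ x, (∃ y, κ y = x) ↔
      res (Spec.map (inclL R S)) (hz _) N (top_le_preimage_top (Spec.map (inclL R S))) x =
      (G.Ψ (Spec.map (inclL R S) ≫ u) (Spec.map (inclR R S) ≫ u)
        (SpecMap_comp_comp_eq hu (incl_comp R S).2.2.2.2.2)).app ⊤
      (res (Spec.map (inclR R S)) (hz _) N (top_le_preimage_top (Spec.map (inclR R S))) x)) :
    IsBC (algebraMap R S) κ := by
  obtain ⟨c₁, c₂, c₃, c₄, c₅, c₆⟩ := incl_comp R S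
  let s : Spec (.of (S ⊗[R] S)) ⟶ P := Spec.map (inclL R S) ≫ u
  have hs (q : CommRingCat.of (S ⊗[R] S) ⟶ CommRingCat.of ((S ⊗[R] S) ⊗[R] S))
      (hq : CommRingCat.ofHom (algebraMap R S) ≫ inclL R S ≫ q =
        CommRingCat.ofHom (algebraMap R S) ≫ inclL R S ≫ incl12 R S) :
      (Spec.map (incl12 R S) ≫ s) ≫ p = (Spec.map q ≫ s) ≫ p := by
    have := SpecMap_comp_comp_eq hu hq.symm
    simpa [s] using this
  have hq' (q : CommRingCat.of S ⟶ CommRingCat.of ((S ⊗[R] S) ⊗[R] S))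
      (hq : CommRingCat.ofHom (algebraMap R S) ≫ q =
        CommRingCat.ofHom (algebraMap R S) ≫ inclL R S ≫ incl12 R S) :
      (Spec.map (incl12 R S) ≫ s) ≫ p = (Spec.map q ≫ u) ≫ p := by
    have := SpecMap_comp_comp_eq hu hq.symm
    simpa [s] using this
  have h3 : CommRingCat.ofHom (algebraMap R S) ≫ inclR R S ≫ incl13 R S =
      CommRingCat.ofHom (algebraMap R S) ≫ inclL R S ≫ incl12 R S := by
    rw [c₁, ← reassoc_of% c₆]
  have h13 := hs (incl13 R S) (by rw [c₁])
  have h23 := hs (incl23 R S) (by rw [← c₂, reassoc_of% c₆])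
  have hμ : u ≫ p = (Spec.map (mulHom R S) ≫ s) ≫ p := by
    simp only [s]
    rw [← Spec.map_comp_assoc, c₄, Spec.map_id, Category.id_comp]
  let H := Γ((Scheme.Modules.pullback (z (Spec (.of S)))).obj N, ⊤)
  let H₂ := Γ((Scheme.Modules.pullback (z (Spec (.of (S ⊗[R] S))))).obj N, ⊤)
  let H₃ := Γ((Scheme.Modules.pullback (z (Spec (.of ((S ⊗[R] S) ⊗[R] S))))).obj N, ⊤)
  let i₁ : H →+ H₂ := G.tw hz u s (inclL R S) rfl
  let i₂ : H →+ H₂ := G.tw hz u s (inclR R S) (SpecMap_comp_comp_eq hu c₆)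
  let j₁₂ : H₂ →+ H₃ := G.tw hz s (Spec.map (incl12 R S) ≫ s) (incl12 R S) rfl
  let j₁₃ : H₂ →+ H₃ := G.tw hz s (Spec.map (incl12 R S) ≫ s) (incl13 R S) h13
  let j₂₃ : H₂ →+ H₃ := G.tw hz s (Spec.map (incl12 R S) ≫ s) (incl23 R S) h23
  let μ : H₂ →+ H := G.tw hz s u (mulHom R S) hμ
  have e₁ : IsBC (Algebra.TensorProduct.includeLeft : S →ₐ[R] S ⊗[R] S).toRingHom i₁ :=
    G.isBC_tw hz hN u (inclL R S) rfl
  have e₂ (b : S) (x : H) : i₂ (b • x) = (1 ⊗ₜ[R] b : S ⊗[R] S) • i₂ x := by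
    have := G.tw_smul hz hN u s (inclR R S) (SpecMap_comp_comp_eq hu c₆) b x
    exact this
  have e₁₂ : IsBC
      (Algebra.TensorProduct.includeLeft : S ⊗[R] S →ₐ[R] (S ⊗[R] S) ⊗[R] S).toRingHom j₁₂ :=
    G.isBC_tw hz hN s (incl12 R S) rfl
  have e₁₃ (b : S) (x : H₂) : j₁₃ ((1 ⊗ₜ[R] b : S ⊗[R] S) • x) =
      (1 ⊗ₜ[R] b : (S ⊗[R] S) ⊗[R] S) • j₁₃ x := by
    have := G.tw_smul hz hN s _ (incl13 R S) h13 (1 ⊗ₜ b) x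
    exact this
  have e₂₃ (b : S) (x : H₂) : j₂₃ ((1 ⊗ₜ[R] b : S ⊗[R] S) • x) =
      (1 ⊗ₜ[R] b : (S ⊗[R] S) ⊗[R] S) • j₂₃ x := by
    have := G.tw_smul hz hN s _ (incl23 R S) h23 (1 ⊗ₜ b) x
    exact this
  have eμ (b : S) (x : H₂) : μ ((1 ⊗ₜ[R] b : S ⊗[R] S) • x) = b • μ x := by
    have := G.tw_smul hz hN s u (mulHom R S) hμ (1 ⊗ₜ b) x
    rw [(incl_tmul R S 1 b).2.2.2.2.2, one_mul] at this
    exact this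
  have ei (x : H) : i₁ x =
      res (Spec.map (inclL R S)) (hz _) N (top_le_preimage_top (Spec.map (inclL R S))) x := by
    have := G.tw_apply hz u s (inclL R S) rfl x
    rw [G.self] at this
    exact this
  refine isBC_descent e₁ e₂ e₁₂ e₁₃ e₂₃ eμ ?_ ?_ ?_ ?_ ?_ hκ hκs fun x => ?_
  · intro x
    exact (G.tw_tw hz _ _ _ _ _ rfl _ _ (hq' _ rfl) x).trans
      (G.tw_tw hz _ _ _ _ _ c₁.symm _ _ (hq' _ rfl) x).symm
  · intro x
    exact (G.tw_tw hz _ _ _ _ _ rfl _ _ (hq' _ (by rw [reassoc_of% c₆])) x).trans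
      (G.tw_tw hz _ _ _ _ _ c₂.symm _ _ (hq' _ (by rw [reassoc_of% c₆])) x).symm
  · intro x
    exact (G.tw_tw hz _ _ _ _ _ rfl _ _ (hq' _ h3) x).trans
      (G.tw_tw hz _ _ _ _ _ c₃.symm _ _ (hq' _ h3) x).symm
  · intro x
    exact (G.tw_tw hz _ _ _ _ _ c₄ _ _ (by simp) x).trans (G.tw_self hz _ _ rfl _ x)
  · intro x
    exact (G.tw_tw hz _ _ _ _ _ c₅ _ _ (by simp) x).trans (G.tw_self hz _ _ rfl _ x)
  · rw [hκr, ei]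
    have := G.tw_apply hz u s (inclR R S) (SpecMap_comp_comp_eq hu c₆) x
    exact ⟨fun h => h.trans this.symm, fun h => h.trans this⟩

lemma exists_lift_tensorProduct [Mono j] [Mono u] [IsOpenImmersion u]
    (hu : u ≫ p = Spec.map (CommRingCat.ofHom (algebraMap R S)) ≫ j)
    {X : Scheme.{u}} (x y : X ⟶ P) (h : x ≫ p = y ≫ p) (hx : Set.range x ⊆ Set.range u)
    (hy : Set.range y ⊆ Set.range u) :
    ∃ m : X ⟶ Spec (.of (S ⊗[R] S)),
      m ≫ Spec.map (inclL R S) ≫ u = x ∧ m ≫ Spec.map (inclR R S) ≫ u = y := by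
  have hP := isPullback_SpecMap_of_isPushout _ _ (inclL R S) (inclR R S)
    (CommRingCat.isPushout_tensorProduct R S S)
  have hx' := IsOpenImmersion.lift_fac u x hx
  have hy' := IsOpenImmersion.lift_fac u y hy
  refine ⟨hP.lift (IsOpenImmersion.lift u x hx) (IsOpenImmersion.lift u y hy) ?_, ?_, ?_⟩
  · rw [← cancel_mono j, Category.assoc, Category.assoc, ← hu, ← Category.assoc, ← Category.assoc,
      hx', hy', h]
  · rw [hP.lift_fst_assoc, hx']
  · rw [hP.lift_snd_assoc, hy']

end

section

/-- The morphism whose kernel is the module with the descent datum `G`. -/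
def diff : (Scheme.Modules.pushforward p).obj ((Scheme.Modules.pullback (z P)).obj N) ⟶
    (Scheme.Modules.pushforward (pullback.fst p p ≫ p)).obj
      ((Scheme.Modules.pullback (z (pullback p p))).obj N) :=
  pushRes p (pullback.fst p p) rfl (hz _) N -
    pushRes p (pullback.snd p p) pullback.condition.symm (hz _) N ≫
      (Scheme.Modules.pushforward (pullback.fst p p ≫ p)).map
        (G.Ψ (pullback.fst p p) (pullback.snd p p) pullback.condition)

lemma pushApp_comp_diff {M : Q.Modules}
    (k : M ⟶ (Scheme.Modules.pushforward p).obj ((Scheme.Modules.pullback (z P)).obj N))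
    (V : Q.Opens) (x : Γ(M, V)) : pushApp (k ≫ G.diff hz) V x =
      res (pullback.fst p p) (hz _) N (preimage_le_of_comp_eq rfl V) (pushApp k V x) -
      (G.Ψ (pullback.fst p p) (pullback.snd p p) pullback.condition).app _
        (res (pullback.snd p p) (hz _) N
        (preimage_le_of_comp_eq pullback.condition.symm V) (pushApp k V x)) := by
  rw [diff, Preadditive.comp_sub, pushApp_sub, ← Category.assoc, pushApp_comp_map,
    pushApp_comp_pushRes, pushApp_comp_pushRes]

/-- The module obtained from a descent datum. -/
def descended : Q.Modules := kernel (G.diff hz)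

/-- The inclusion of the module obtained from a descent datum. -/
def descendedι : G.descended hz ⟶
    (Scheme.Modules.pushforward p).obj ((Scheme.Modules.pullback (z P)).obj N) :=
  kernel.ι (G.diff hz)

instance : Mono (G.descendedι hz) := inferInstanceAs (Mono (kernel.ι (G.diff hz)))

lemma res_descendedι {V : Q.Opens} (s : Γ(G.descended hz, V)) {X : Scheme.{u}} (x y : X ⟶ P)
    {r : X ⟶ Q} (hx : x ≫ p = r) (hy : y ≫ p = r)
    (O : X.Opens) (e₁ : O ≤ x ⁻¹ᵁ (p ⁻¹ᵁ V : P.Opens)) (e₂ : O ≤ y ⁻¹ᵁ (p ⁻¹ᵁ V : P.Opens)) :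
    res x (hz _) N e₁ (pushApp (G.descendedι hz) V s) =
      (G.Ψ x y (hx.trans hy.symm)).app O (res y (hz _) N e₂ (pushApp (G.descendedι hz) V s)) := by
  have hs := G.pushApp_comp_diff hz (G.descendedι hz) V s
  rw [show G.descendedι hz ≫ G.diff hz = 0 from kernel.condition _, pushApp_zero, eq_comm,
    sub_eq_zero] at hs
  let l : X ⟶ pullback p p := pullback.lift x y (hx.trans hy.symm)
  have hl₁ : l ≫ pullback.fst p p = x := pullback.lift_fst _ _ _
  have hl₂ : l ≫ pullback.snd p p = y := pullback.lift_snd _ _ _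
  have hl : l ≫ pullback.fst p p ≫ p = r := by
    rw [pullback.lift_fst_assoc, hx]
  have e : O ≤ l ⁻¹ᵁ ((pullback.fst p p ≫ p) ⁻¹ᵁ V : (pullback p p).Opens) := by
    subst hx
    rw [← Scheme.Hom.comp_preimage, hl]
    exact e₁
  have h3 := congrArg (res l (hz _) N e) hs
  rw [← ph_res l (hz _) (hz _), G.ph_Ψ l (hz _) _ _ _ hl₁ hl₂ (hx.trans hy.symm),
    res_res (pullback.fst p p) l hl₁ (hz _) (hz _) N _ e e₁,
    res_res (pullback.snd p p) l hl₂ (hz _) (hz _) N _ e e₂] at h3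
  exact h3

/-- The part of `P ×_Q P` over `V` maps to `Spec (S ⊗[R] S)`, so the gluing condition on that affine
scheme pulls back to the one that defines the kernel. -/
lemma exists_descendedι_eq {R S : Type u} [CommRing R] [CommRing S] [Algebra R S]
    {u : Spec (.of S) ⟶ P} {j : Spec (.of R) ⟶ Q} [Mono j] [IsOpenImmersion u]
    (hu : u ≫ p = Spec.map (CommRingCat.ofHom (algebraMap R S)) ≫ j) {V : Q.Opens}
    (hV : Set.range u = p ⁻¹' V) (e : (⊤ : (Spec (.of S)).Opens) ≤ u ⁻¹ᵁ (p ⁻¹ᵁ V : P.Opens))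
    (s : Γ((Scheme.Modules.pullback (z P)).obj N, p ⁻¹ᵁ V))
    (hs : res (Spec.map (inclL R S)) (hz _) N (top_le_preimage_top (Spec.map (inclL R S)))
        (res u (hz _) N e s) =
      (G.Ψ (Spec.map (inclL R S) ≫ u) (Spec.map (inclR R S) ≫ u)
        (SpecMap_comp_comp_eq hu (incl_comp R S).2.2.2.2.2)).app ⊤
      (res (Spec.map (inclR R S)) (hz _) N (top_le_preimage_top (Spec.map (inclR R S)))
        (res u (hz _) N e s))) :
    ∃ y, pushApp (G.descendedι hz) V y = s := by
  refine exists_kernel_app_eq (G.diff hz) V s ?_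
  have h0 := G.pushApp_comp_diff hz (𝟙 _) V s
  rw [Category.id_comp] at h0
  refine h0.trans (sub_eq_zero_of_eq ?_)
  change res (pullback.fst p p) (hz _) N _ s = (G.Ψ _ _ _).app _ (res (pullback.snd p p) (hz _) N _ s)
  let r := pullback.fst p p ≫ p
  let i : ((r ⁻¹ᵁ V : (pullback p p).Opens) : Scheme.{u}) ⟶ pullback p p := (r ⁻¹ᵁ V).ι
  have ei : (⊤ : ((r ⁻¹ᵁ V : (pullback p p).Opens) : Scheme.{u}).Opens) ≤
      i ⁻¹ᵁ (r ⁻¹ᵁ V : (pullback p p).Opens) := fun x _ => x.2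
  have ei' : (r ⁻¹ᵁ V : (pullback p p).Opens) ≤ i ''ᵁ ⊤ := fun x hx => ⟨⟨x, hx⟩, trivial, rfl⟩
  refine (bijective_res_of_isOpenImmersion i (hz _) N ei ei').injective ?_
  have hc : (i ≫ pullback.fst p p) ≫ p = (i ≫ pullback.snd p p) ≫ p := by
    rw [Category.assoc, Category.assoc, pullback.condition]
  have hr₁ (x) : p ((i ≫ pullback.fst p p) x) ∈ V := x.2
  have hr₂ (x) : p ((i ≫ pullback.snd p p) x) ∈ V := by
    have : p ((i ≫ pullback.snd p p) x) = p ((i ≫ pullback.fst p p) x) :=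
      congr(($hc.symm : _ ⟶ _) x)
    rw [this]
    exact hr₁ x
  obtain ⟨m, hm₁, hm₂⟩ := exists_lift_tensorProduct hu _ _ hc
    (by rw [hV]; rintro _ ⟨x, rfl⟩; exact hr₁ x) (by rw [hV]; rintro _ ⟨x, rfl⟩; exact hr₂ x)
  have e₁ : (⊤ : ((r ⁻¹ᵁ V : (pullback p p).Opens) : Scheme.{u}).Opens) ≤
    (i ≫ pullback.fst p p) ⁻¹ᵁ (p ⁻¹ᵁ V : P.Opens) := fun x _ => hr₁ x
  have e₂ : (⊤ : ((r ⁻¹ᵁ V : (pullback p p).Opens) : Scheme.{u}).Opens) ≤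
    (i ≫ pullback.snd p p) ⁻¹ᵁ (p ⁻¹ᵁ V : P.Opens) := fun x _ => hr₂ x
  have eL : (⊤ : (Spec (.of (S ⊗[R] S))).Opens) ≤
      (Spec.map (inclL R S) ≫ u) ⁻¹ᵁ (p ⁻¹ᵁ V : P.Opens) := fun x _ => e trivial
  have eR : (⊤ : (Spec (.of (S ⊗[R] S))).Opens) ≤
      (Spec.map (inclR R S) ≫ u) ⁻¹ᵁ (p ⁻¹ᵁ V : P.Opens) := fun x _ => e trivial
  have em := top_le_preimage_top m
  rw [res_res u (Spec.map (inclL R S)) rfl (hz _) (hz _) N e _ eL,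
    res_res u (Spec.map (inclR R S)) rfl (hz _) (hz _) N e _ eR] at hs
  have h3 := congrArg (res m (hz _) N em) hs
  rw [← ph_res m (hz _) (hz _), G.ph_Ψ m (hz _) _ _ _ hm₁ hm₂ hc,
    res_res _ m hm₁ (hz _) (hz _) N _ em e₁, res_res _ m hm₂ (hz _) (hz _) N _ em e₂] at h3
  rw [← ph_res i (hz _) (hz _), G.ph_Ψ i (hz _) _ _ _ rfl rfl hc,
    res_res _ i rfl (hz _) (hz _) N _ ei e₁, res_res _ i rfl (hz _) (hz _) N _ ei e₂]
  exact h3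

/-- The pullback of the module obtained from a descent datum. -/
def counit : (Scheme.Modules.pullback p).obj (G.descended hz) ⟶
    (Scheme.Modules.pullback (z P)).obj N :=
  ((Scheme.Modules.pullbackPushforwardAdjunction p).homEquiv _ _).symm (G.descendedι hz)

lemma unit_counit : unit p (G.descended hz) ≫ (Scheme.Modules.pushforward p).map (G.counit hz) =
    G.descendedι hz := by
  rw [counit, unit, ← Adjunction.homEquiv_unit, Equiv.apply_symm_apply]

lemma counit_app_sec {V : Q.Opens} {O : P.Opens} (e : O ≤ p ⁻¹ᵁ V) (x) :
    (G.counit hz).app O (sec p (G.descended hz) e x) =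
      ((Scheme.Modules.pullback (z P)).obj N).presheaf.map (homOfLE e).op
        (pushApp (G.descendedι hz) V x) := by
  rw [sec_apply, app_map, ← pushApp_unit, ← pushApp_comp_map, unit_counit]

/-- The counit is compatible with the descent data: the canonical one on the pullback and the given
one. -/
lemma ph_counit {X : Scheme.{u}} (x y : X ⟶ P) {r : X ⟶ Q} (hx : x ≫ p = r) (hy : y ≫ p = r) :
    ph x hx (hz _) (G.counit hz) =
      ph y hy (hz _) (G.counit hz) ≫ G.Ψ x y (hx.trans hy.symm) := by
  refine pullback_hom_ext (pushApp_ext fun V s => ?_)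
  rw [pushApp_comp_map, pushApp_comp_map, pushApp_unit, ← sec_self, app_comp]
  have h1 := res_sec x hx (G.descended hz) (preimage_le_self p V) (preimage_le_of_comp_eq hx V)
    (preimage_le_self r V) s
  have h2 := res_sec y hy (G.descended hz) (preimage_le_self p V) (preimage_le_of_comp_eq hy V)
    (preimage_le_self r V) s
  have h3 := G.counit_app_sec hz (preimage_le_self p V) s
  rw [map_self] at h3
  have h4 := ph_res x hx (hz _) (G.counit hz) (preimage_le_of_comp_eq hx V)
    (sec p (G.descended hz) (preimage_le_self p V) s)
  have h5 := ph_res y hy (hz _) (G.counit hz) (preimage_le_of_comp_eq hy V)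
    (sec p (G.descended hz) (preimage_le_self p V) s)
  rw [h1, h3] at h4
  rw [h2, h3] at h5
  rw [h4, h5]
  exact G.res_descendedι hz s x y hx hy _ _ _

variable [IsAffineHom p] [Flat p]

/-- Sections of the kernel over an affine open are the elements fixed by the descent datum; by
effectivity of descent, extending scalars recovers all sections upstairs. -/
lemma isBC_descendedι (hN : N.IsQuasicoherent) {V : Q.Opens} (hV : IsAffineOpen V)
    (h : (V : Set Q) ⊆ Set.range p) :
    IsBC (p.app V).hom (pushApp (G.descendedι hz) V) := by
  have hpV : IsAffineOpen (p ⁻¹ᵁ V) := hV.preimage p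
  let R : Type u := Γ(Q, V)
  let S : Type u := Γ(P, p ⁻¹ᵁ V)
  let : Algebra R S := (p.app V).hom.toAlgebra
  have : Module.FaithfullyFlat R S := faithfullyFlat_app p hV hpV h
  let u : Spec (.of S) ⟶ P := hpV.fromSpec
  let j : Spec (.of R) ⟶ Q := hV.fromSpec
  have : Mono j := inferInstanceAs (Mono hV.fromSpec)
  have : IsOpenImmersion u := inferInstanceAs (IsOpenImmersion hpV.fromSpec)
  have hu : u ≫ p = Spec.map (CommRingCat.ofHom (algebraMap R S)) ≫ j := by
    have h3 : hpV.fromSpec ≫ p = Spec.map (p.app V) ≫ hV.fromSpec := by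
      rw [← appLE_self_eq, hV.SpecMap_appLE_fromSpec p hpV]
    exact h3
  have e : (⊤ : (Spec (.of S)).Opens) ≤ u ⁻¹ᵁ (p ⁻¹ᵁ V : P.Opens) := top_le_fromSpec_preimage hpV
  have hb : IsBC (RingHom.id S) (res u (hz _) N e) := isBC_res_fromSpec hpV (hz _) N
  have hb' : Function.Bijective (res u (hz _) N e) :=
    bijective_res_of_isOpenImmersion u (hz _) N e (le_fromSpec_image_top hpV)
  have key : IsBC (algebraMap R S) ((res u (hz _) N e).comp (pushApp (G.descendedι hz) V)) := by
    refine G.isBC_of_tw_eq hz hN hu (hb'.injective.comp (pushApp_injective _ V))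
      (fun r x => ?_) fun x => ?_
    · rw [AddMonoidHom.comp_apply, pushApp_smul, AddMonoidHom.comp_apply]
      exact hb.smul _ _
    · constructor
      · rintro ⟨y, rfl⟩
        rw [AddMonoidHom.comp_apply]
        have eL : (⊤ : (Spec (.of (S ⊗[R] S))).Opens) ≤
          (Spec.map (inclL R S) ≫ u) ⁻¹ᵁ (p ⁻¹ᵁ V : P.Opens) := fun x _ => e trivial
        have eR : (⊤ : (Spec (.of (S ⊗[R] S))).Opens) ≤
          (Spec.map (inclR R S) ≫ u) ⁻¹ᵁ (p ⁻¹ᵁ V : P.Opens) := fun x _ => e trivial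
        rw [res_res u (Spec.map (inclL R S)) rfl (hz _) (hz _) N e _ eL,
          res_res u (Spec.map (inclR R S)) rfl (hz _) (hz _) N e _ eR]
        exact G.res_descendedι hz y _ _ (SpecMap_comp_comp_eq hu (incl_comp R S).2.2.2.2.2) rfl _ eL eR
      · intro hx
        obtain ⟨s, rfl⟩ := hb'.surjective x
        obtain ⟨y, hy⟩ := G.exists_descendedι_eq hz hu (V := V) hpV.range_fromSpec e s hx
        exact ⟨y, congrArg _ hy⟩
  refine IsBC.of_comp_bijective (τ := RingHom.id S) (ψ' := res u (hz _) N e) ?_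
    Function.bijective_id hb' hb.smul
  rw [RingHom.id_comp]
  exact key

variable [Surjective p]

/-- Compatibility with passage to `D(f)` holds upstairs and is reflected by the faithfully flat
extension of the functions on `D(f)`. -/
lemma isQuasicoherent_descended (hN : N.IsQuasicoherent) : (G.descended hz).IsQuasicoherent := by
  refine isQuasicoherent_of_isBC_basicOpen _ fun V hV f => ?_
  have hr (W : Q.Opens) : (W : Set Q) ⊆ Set.range p := fun x _ => p.surjective x
  have h1 := G.isBC_descendedι hz hN hV (hr V)
  have h2 := G.isBC_descendedι hz hN (hV.basicOpen f) (hr _)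
  have h3 := isBC_restrict (qcoh_pullback (z P) hN) (hV.preimage p) ((hV.basicOpen f).preimage p)
    (preimage_mono p (Q.basicOpen_le f))
  let R : Type u := Γ(Q, V)
  let R' : Type u := Γ(Q, Q.basicOpen f)
  let R'' : Type u := Γ(P, p ⁻¹ᵁ Q.basicOpen f)
  let : Algebra R R' := (Q.presheaf.map (homOfLE (Q.basicOpen_le f)).op).hom.toAlgebra
  let : Algebra R' R'' := (p.app (Q.basicOpen f)).hom.toAlgebra
  have : Module.FaithfullyFlat R' R'' :=
    faithfullyFlat_app p (hV.basicOpen f) ((hV.basicOpen f).preimage p) (hr _)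
  refine IsBC.of_comp_faithfullyFlat (R := R) (R' := R') (R'' := R'') h2 ?_
    (map_smul_opens _ (Q.basicOpen_le f))
  have h4 := h1.comp h3
  have e1 : (P.presheaf.map (homOfLE (preimage_mono p (Q.basicOpen_le f))).op).hom.comp
      (p.app V).hom = (algebraMap R' R'').comp (algebraMap R R') :=
    congrArg CommRingCat.Hom.hom (p.naturality (homOfLE (Q.basicOpen_le f)).op).symm
  rw [e1] at h4
  convert h4 using 1
  ext x
  exact pushApp_restrict (G.descendedι hz) V (Q.basicOpen_le f) x

/-- Over small affine opens both sides are base changes of the same module of descended sections. -/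
lemma isIso_counit (hN : N.IsQuasicoherent) : IsIso (G.counit hz) := by
  refine isIso_of_isBasis (B := {O | IsAffineOpen O ∧ ∃ V : Q.Opens, IsAffineOpen V ∧
    O ≤ p ⁻¹ᵁ V}) ?_ _ ?_
  · rw [TopologicalSpace.Opens.isBasis_iff_nbhd]
    intro O x hx
    obtain ⟨V, hV, hxV, -⟩ := exists_isAffineOpen_mem_and_subset (U := (⊤ : Q.Opens)) (x := p x)
      trivial
    obtain ⟨O', hO', hxO', h⟩ := exists_isAffineOpen_mem_and_subset (U := O ⊓ p ⁻¹ᵁ V) (x := x)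
      ⟨hx, hxV⟩
    exact ⟨O', ⟨hO', V, hV, fun y hy => (h hy).2⟩, hxO', fun y hy => (h hy).1⟩
  · rintro O ⟨hO, V, hV, e⟩
    have h1 := isBC_sec p (G.isQuasicoherent_descended hz hN) hV hO e
    have h2 := (G.isBC_descendedι hz hN hV fun x _ => p.surjective x).comp
      (isBC_restrict (qcoh_pullback (z P) hN) (hV.preimage p) hO e)
    let l : Γ((Scheme.Modules.pullback p).obj (G.descended hz), O) →ₗ[Γ(P, O)]
        Γ((Scheme.Modules.pullback (z P)).obj N, O) :=
      { toFun := (G.counit hz).app O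
        map_add' := map_add _
        map_smul' := fun r x => Scheme.Modules.Hom.app_smul _ r x }
    exact IsBC.bijective_of_comp h1 h2 l fun x => G.counit_app_sec hz e x

lemma isCoherent_descended (hN : N.IsQuasicoherent)
    (hf : ∀ V : Q.Opens, IsAffineOpen V →
      Module.Finite Γ(P, p ⁻¹ᵁ V) Γ((Scheme.Modules.pullback (z P)).obj N, p ⁻¹ᵁ V)) :
    IsCoherent (G.descended hz) := by
  refine ⟨G.isQuasicoherent_descended hz hN, fun V hV => ?_⟩
  have h1 := G.isBC_descendedι hz hN hV (fun x _ => p.surjective x)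
  let R : Type u := Γ(Q, V)
  let R' : Type u := Γ(P, p ⁻¹ᵁ V)
  let : Algebra R R' := (p.app V).hom.toAlgebra
  have : Module.FaithfullyFlat R R' :=
    faithfullyFlat_app p hV (hV.preimage p) (fun x _ => p.surjective x)
  have := hf V hV
  exact IsBC.finite_of_faithfullyFlat (R := R) (S := R') h1

end

end Gluing

end TwistedSheaf

/-! ### Descent of isomorphisms between pullbacks. -/

namespace TwistedSheaf

section

variable {X : Scheme.{u}}

lemma smulEnd_sum {κ : Type*} (M : X.Modules) (s : Finset κ) (r : κ → Γ(X, ⊤)) :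
    smulEnd M (∑ k ∈ s, r k) = ∑ k ∈ s, smulEnd M (r k) := by
  let F : Γ(X, ⊤) →+ (M ⟶ M) :=
    { toFun := smulEnd M
      map_zero' := smulEnd_zero M
      map_add' := smulEnd_add M }
  exact map_sum F r s

end

section

variable {P Q V W : Scheme.{u}} {p : P ⟶ Q} [IsAffineHom p] [Flat p] {a : Q ⟶ V}
  {b : Q ⟶ W} {M : V.Modules} {N : W.Modules}

lemma exists_ph_eq (hN : N.IsQuasicoherent)
    (hB : DescentBasis p ((Scheme.Modules.pullback b).obj N)) {a' : P ⟶ V} {b' : P ⟶ W}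
    (ha : p ≫ a = a') (hb : p ≫ b = b')
    (v : (Scheme.Modules.pullback a').obj M ⟶ (Scheme.Modules.pullback b').obj N)
    (hv : ∀ {T : Scheme.{u}} (g₁ g₂ : T ⟶ P) (r : T ⟶ Q) (_ : g₁ ≫ p = r) (_ : g₂ ≫ p = r)
      {a'' : T ⟶ V} {b'' : T ⟶ W} (ha₁ : g₁ ≫ a' = a'') (ha₂ : g₂ ≫ a' = a'')
      (hb₁ : g₁ ≫ b' = b'') (hb₂ : g₂ ≫ b' = b''), ph g₁ ha₁ hb₁ v = ph g₂ ha₂ hb₂ v) :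
    ∃ φ : (Scheme.Modules.pullback a).obj M ⟶ (Scheme.Modules.pullback b).obj N,
      ph p ha hb φ = v := by
  obtain ⟨φ, hφ⟩ := exists_pullback_map_eq (M := (Scheme.Modules.pullback a).obj M)
    (N := (Scheme.Modules.pullback b).obj N) (qcoh_pullback b hN) hB
    ((pbC p ha M).hom ≫ v ≫ (pbC p hb N).inv) fun {T} g₁ g₂ r h₁ h₂ => by
      have ha₁ : g₁ ≫ a' = r ≫ a := by rw [← ha, ← h₁, Category.assoc]
      have ha₂ : g₂ ≫ a' = r ≫ a := by rw [← ha, ← h₂, Category.assoc]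
      have hb₁ : g₁ ≫ b' = r ≫ b := by rw [← hb, ← h₁, Category.assoc]
      have hb₂ : g₂ ≫ b' = r ≫ b := by rw [← hb, ← h₂, Category.assoc]
      have key (g : T ⟶ P) (h : g ≫ p = r) (ha₁ : g ≫ a' = r ≫ a) (hb₁ : g ≫ b' = r ≫ b) :
          ph g h h ((pbC p ha M).hom ≫ v ≫ (pbC p hb N).inv) =
            (pbC r rfl M).hom ≫ ph g ha₁ hb₁ v ≫ (pbC r rfl N).inv := by
        have e₁ := pbC_comp p g h ha ha₁ M
        have e₂ := pbC_comp p g h hb hb₁ N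
        have e₁' : (pbC g h _).inv ≫ (Scheme.Modules.pullback g).map (pbC p ha M).hom =
            (pbC r rfl M).hom ≫ (pbC g ha₁ M).inv := by
          rw [Iso.inv_comp_eq, ← Category.assoc, Iso.eq_comp_inv]
          exact e₁
        have e₂' : (Scheme.Modules.pullback g).map (pbC p hb N).inv ≫ (pbC g h _).hom =
            (pbC g hb₁ N).hom ≫ (pbC r rfl N).inv := by
          rw [Iso.eq_comp_inv, Category.assoc]
          refine (congrArg (fun w => (Scheme.Modules.pullback g).map (pbC p hb N).inv ≫ w)
            e₂.symm).trans ?_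
          rw [← Functor.map_comp_assoc, Iso.inv_hom_id, CategoryTheory.Functor.map_id,
            Category.id_comp]
        rw [ph_eq, ph_eq, Functor.map_comp, Functor.map_comp, Category.assoc, Category.assoc,
          reassoc_of% e₁', e₂']
        simp only [Category.assoc]
      rw [key g₁ h₁ ha₁ hb₁, key g₂ h₂ ha₂ hb₂, hv g₁ g₂ r h₁ h₂ ha₁ ha₂ hb₁ hb₂]
  refine ⟨φ, ?_⟩
  rw [ph_eq, hφ]
  simp
lemma exists_iso_ph_eq (hM : M.IsQuasicoherent) (hN : N.IsQuasicoherent)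
    (hB : DescentBasis p ((Scheme.Modules.pullback a).obj M))
    (hB' : DescentBasis p ((Scheme.Modules.pullback b).obj N)) {a' : P ⟶ V} {b' : P ⟶ W}
    (ha : p ≫ a = a') (hb : p ≫ b = b')
    (v : (Scheme.Modules.pullback a').obj M ≅ (Scheme.Modules.pullback b').obj N)
    (hv : ∀ {T : Scheme.{u}} (g₁ g₂ : T ⟶ P) (r : T ⟶ Q) (_ : g₁ ≫ p = r) (_ : g₂ ≫ p = r)
      {a'' : T ⟶ V} {b'' : T ⟶ W} (ha₁ : g₁ ≫ a' = a'') (ha₂ : g₂ ≫ a' = a'')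
      (hb₁ : g₁ ≫ b' = b'') (hb₂ : g₂ ≫ b' = b''), ph g₁ ha₁ hb₁ v.hom = ph g₂ ha₂ hb₂ v.hom) :
    ∃ φ : (Scheme.Modules.pullback a).obj M ≅ (Scheme.Modules.pullback b).obj N,
      ph p ha hb φ.hom = v.hom := by
  obtain ⟨φ, hφ⟩ := exists_ph_eq hN hB' ha hb v.hom hv
  obtain ⟨ψ, hψ⟩ := exists_ph_eq hM hB hb ha v.inv
    fun {T} g₁ g₂ r h₁ h₂ {a'' b''} ha₁ ha₂ hb₁ hb₂ => by
      have h := hv g₁ g₂ r h₁ h₂ hb₁ hb₂ ha₁ ha₂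
      have e (g : T ⟶ P) (h₁ : g ≫ a' = b'') (h₂ : g ≫ b' = a'') :
          ph g h₁ h₂ v.hom ≫ ph g h₂ h₁ v.inv = 𝟙 _ := by
        rw [← ph_comp, Iso.hom_inv_id, ph_id]
      have e' (g : T ⟶ P) (h₁ : g ≫ a' = b'') (h₂ : g ≫ b' = a'') :
          ph g h₂ h₁ v.inv ≫ ph g h₁ h₂ v.hom = 𝟙 _ := by
        rw [← ph_comp, Iso.inv_hom_id, ph_id]
      rw [← Category.comp_id (ph g₁ ha₁ hb₁ v.inv), ← e g₂ hb₂ ha₂, ← h, ← Category.assoc,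
        e' g₁ hb₁ ha₁, Category.id_comp]
  refine ⟨⟨φ, ψ, ?_, ?_⟩, hφ⟩
  · apply Sheaf.ph_injective hM hB ha ha
    rw [ph_comp p ha hb ha, hφ, hψ, Iso.hom_inv_id, ph_id]
  · apply Sheaf.ph_injective hN hB' hb hb
    rw [ph_comp p hb ha hb, hφ, hψ, Iso.inv_hom_id, ph_id]

end

/-! ### Free modules and matrices -/

section

/-- The free module of rank `n` on the spectrum of a ring. -/
def freeSpec (R : CommRingCat.{u}) (n : ℕ) : (Spec R).Modules := tilde (.of R (Fin n → R))

lemma qcoh_freeSpec (R : CommRingCat.{u}) (n : ℕ) : (freeSpec R n).IsQuasicoherent :=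
  inferInstanceAs (tilde (R := R) (.of R (Fin n → R))).IsQuasicoherent

/-- The endomorphism of a free module defined by a matrix. -/
def linSpec (R : CommRingCat.{u}) {n : ℕ} (A : Matrix (Fin n) (Fin n) R) :
    freeSpec R n ⟶ freeSpec R n :=
  (tilde.functor R).map (ModuleCat.ofHom (Matrix.toLin' A))

section

variable (R : CommRingCat.{u}) {n : ℕ}

lemma linSpec_comp (A B : Matrix (Fin n) (Fin n) R) :
    linSpec R A ≫ linSpec R B = linSpec R (B * A) := by
  refine ((tilde.functor R).map_comp (ModuleCat.ofHom (Matrix.toLin' A))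
    (ModuleCat.ofHom (Matrix.toLin' B))).symm.trans ?_
  rw [← ModuleCat.ofHom_comp, ← Matrix.toLin'_mul]
  rfl

lemma linSpec_one : linSpec R (1 : Matrix (Fin n) (Fin n) R) = 𝟙 _ := by
  rw [linSpec, Matrix.toLin'_one]
  exact CategoryTheory.Functor.map_id _ _

lemma linSpec_zero : linSpec R (0 : Matrix (Fin n) (Fin n) R) = 0 := by
  rw [linSpec, map_zero]
  exact (tilde.functor R).map_zero _ _

lemma linSpec_add (A B : Matrix (Fin n) (Fin n) R) :
    linSpec R (A + B) = linSpec R A + linSpec R B := by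
  rw [linSpec, map_add, ModuleCat.ofHom_add]
  exact (tilde.functor R).map_add

end

lemma IsBC.pi {R S : Type u} [CommRing R] [CommRing S] (σ : R →+* S) (n : ℕ) :
    IsBC (M := Fin n → R) (N := Fin n → S) σ (σ.toAddMonoidHom.compLeft (Fin n)) where
  smul r x := by
    ext i
    exact map_mul σ _ _
  exists_lift Q _ _ χ hχ := by
    refine ⟨(Pi.basisFun S (Fin n)).constr S (fun i => χ (Pi.single i 1)), fun v => ?_⟩
    rw [Module.Basis.constr_apply_fintype]
    have hv : v = ∑ i, v i • (Pi.single i (1 : R) : Fin n → R) := by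
      conv_lhs => rw [← Finset.univ_sum_single v]
      refine Finset.sum_congr rfl fun i _ => ?_
      rw [← Pi.single_smul, smul_eq_mul, mul_one]
    conv_rhs => rw [hv, map_sum]
    refine Finset.sum_congr rfl fun i _ => ?_
    rw [hχ]
    rfl
  hom_ext Q _ _ f g h := by
    refine (Pi.basisFun S (Fin n)).ext fun i => ?_
    have h1 := h (Pi.single i 1)
    have h2 : (σ.toAddMonoidHom.compLeft (Fin n)) (Pi.single i (1 : R)) =
        Pi.basisFun S (Fin n) i := by
      ext k
      rw [Pi.basisFun_apply]
      by_cases hk : k = i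
      · subst hk
        simp
      · simp [hk]
    rwa [h2] at h1

/-- The ring of integers, in the universe `u`. -/
def baseRing : CommRingCat.{u} := .of (ULift.{u} ℤ)

/-- The terminal scheme. -/
abbrev base : Scheme.{u} := Spec baseRing

/-- `base` is terminal. -/
def baseIsTerminal : IsTerminal base.{u} := specULiftZIsTerminal

/-- The morphism to the terminal scheme. -/
def toBase (X : Scheme.{u}) : X ⟶ base := baseIsTerminal.from X

lemma comp_toBase {X Y : Scheme.{u}} (g : X ⟶ Y) : g ≫ toBase Y = toBase X :=
  baseIsTerminal.hom_ext _ _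

/-- The unique ring homomorphism from the ring of integers. -/
def fromBaseRing (B : CommRingCat.{u}) : baseRing.{u} ⟶ B :=
  CommRingCat.ofHom ((Int.castRingHom B).comp (ULift.ringEquiv (R := ℤ)).toRingHom)

/-- The free module of rank `n` on the terminal scheme. -/
def freeBase (n : ℕ) : base.{u}.Modules := freeSpec _ n

lemma qcoh_freeBase (n : ℕ) : (freeBase.{u} n).IsQuasicoherent := qcoh_freeSpec _ n

/-- The endomorphism of a free module on the terminal scheme defined by a matrix. -/
def linBase {n : ℕ} (A : Matrix (Fin n) (Fin n) baseRing.{u}) : freeBase.{u} n ⟶ freeBase n :=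
  linSpec _ A

lemma linBase_comp {n : ℕ} (A B : Matrix (Fin n) (Fin n) baseRing.{u}) :
    linBase A ≫ linBase B = linBase (B * A) := linSpec_comp _ A B

lemma linBase_one {n : ℕ} : linBase (1 : Matrix (Fin n) (Fin n) baseRing.{u}) = 𝟙 _ :=
  linSpec_one _

lemma linBase_zero {n : ℕ} : linBase (0 : Matrix (Fin n) (Fin n) baseRing.{u}) = 0 :=
  linSpec_zero _

lemma linBase_add {n : ℕ} (A B : Matrix (Fin n) (Fin n) baseRing.{u}) :
    linBase (A + B) = linBase A + linBase B := linSpec_add _ A B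

lemma freeSpec_equiv {R B : CommRingCat.{u}} (φ : R ⟶ B) (n : ℕ) :
    Nonempty (Γ((Scheme.Modules.pullback (Spec.map φ)).obj (freeSpec R n), ⊤) ≃ₗ[B]
      (Fin n → B)) := by
  let N : ModuleCat.{u} R := .of R (Fin n → R)
  have h1 := isBC_sec_tilde φ N
  let e : (Fin n → R) ≃ₗ[R] Γ(tilde N, ⊤) := (tilde.isoTop N).toLinearEquiv
  have h2 := h1.of_equiv_left (ψ₁ := (sec (Spec.map φ) (tilde N)
    (top_le_preimage_top _)).comp e.toAddEquiv.toAddMonoidHom) e fun _ => rfl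
  have h3 := IsBC.pi φ.hom n
  obtain ⟨g, hg⟩ := h2.exists_lift _ _ h3.smul
  exact ⟨LinearEquiv.ofBijective g (h2.bijective_of_comp h3 g hg)⟩

lemma finite_freeSpec (R : CommRingCat.{u}) (n : ℕ) :
    Module.Finite Γ(Spec R, ⊤) Γ(freeSpec R n, ⊤) := by
  let N : ModuleCat.{u} R := .of R (Fin n → R)
  have : Module.Finite R N := inferInstanceAs (Module.Finite R (Fin n → R))
  have h1 : Module.Finite R Γ(tilde N, ⊤) := Module.Finite.equiv (tilde.isoTop N).toLinearEquiv
  exact (isBC_ΓSpecIso R (tilde N)).finite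

variable {n : ℕ} {X X' : Scheme.{u}}

/-- The free module of rank `n`. -/
abbrev free (n : ℕ) (X : Scheme.{u}) : X.Modules :=
  (Scheme.Modules.pullback (toBase X)).obj (freeBase n)

/-- The endomorphism of a free module defined by a matrix unit. -/
def unitEnd (X : Scheme.{u}) (k l : Fin n) : free n X ⟶ free n X :=
  (Scheme.Modules.pullback (toBase X)).map (linBase (Matrix.single k l 1))

lemma unitEnd_comp (k l i j : Fin n) :
    unitEnd X k l ≫ unitEnd X i j = if j = k then unitEnd X i l else 0 := by
  rw [unitEnd, unitEnd, ← Functor.map_comp, linBase_comp]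
  split_ifs with h
  · subst h
    rw [Matrix.single_mul_single_same, one_mul, unitEnd]
  · rw [Matrix.single_mul_single_of_ne _ _ _ _ h, linBase_zero, Functor.map_zero]

lemma sum_unitEnd : ∑ k, unitEnd X k k = 𝟙 (free n X) := by
  have h1 : ∑ k : Fin n, linBase (Matrix.single k k (1 : baseRing.{u})) = 𝟙 _ := by
    let F : Matrix (Fin n) (Fin n) baseRing.{u} →+ (freeBase.{u} n ⟶ freeBase n) :=
      { toFun := linBase
        map_zero' := linBase_zero
        map_add' := linBase_add }
    have h2 := map_sum F (fun k => Matrix.single k k (1 : baseRing.{u})) Finset.univ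
    refine h2.symm.trans ?_
    rw [Matrix.sum_single_one]
    exact linBase_one
  rw [← CategoryTheory.Functor.map_id, ← h1, Functor.map_sum]
  rfl

/-- The endomorphism of a free module defined by a matrix. -/
def mat (A : Matrix (Fin n) (Fin n) Γ(X, ⊤)) : free n X ⟶ free n X :=
  ∑ k, ∑ l, unitEnd X k l ≫ smulEnd _ (A k l)

/-- Reduced to products of matrix units; diagrammatic composition reverses the factors. -/
lemma mat_mul (A B : Matrix (Fin n) (Fin n) Γ(X, ⊤)) : mat A ≫ mat B = mat (B * A) := by
  have h (k l i j : Fin n) : (unitEnd X k l ≫ smulEnd _ (A k l)) ≫ unitEnd X i j ≫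
      smulEnd _ (B i j) = if j = k then unitEnd X i l ≫ smulEnd _ (B i k * A k l) else 0 := by
    rw [Category.assoc, reassoc_of% smulEnd_comp, ← smulEnd_mul, ← Category.assoc, unitEnd_comp,
      mul_comm (A k l)]
    split_ifs with h
    · rw [h]
    · rw [zero_comp]
  have h2 : mat A ≫ mat B = ∑ k, ∑ l, ∑ i, unitEnd X i l ≫ smulEnd _ (B i k * A k l) := by
    rw [mat, Preadditive.sum_comp]
    refine Finset.sum_congr rfl fun k _ => ?_
    rw [Preadditive.sum_comp]
    refine Finset.sum_congr rfl fun l _ => ?_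
    rw [mat, Preadditive.comp_sum]
    refine Finset.sum_congr rfl fun i _ => ?_
    rw [Preadditive.comp_sum]
    simp only [h, Finset.sum_ite_eq', Finset.mem_univ, if_true]
  rw [h2, mat]
  calc _ = ∑ k, ∑ i, ∑ l, unitEnd X i l ≫ smulEnd _ (B i k * A k l) :=
        Finset.sum_congr rfl fun k _ => Finset.sum_comm
    _ = ∑ i, ∑ k, ∑ l, unitEnd X i l ≫ smulEnd _ (B i k * A k l) := Finset.sum_comm
    _ = _ := by
      refine Finset.sum_congr rfl fun i _ => ?_
      rw [Finset.sum_comm]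
      refine Finset.sum_congr rfl fun l _ => ?_
      rw [Matrix.mul_apply, smulEnd_sum, Preadditive.comp_sum]

lemma mat_one : mat (1 : Matrix (Fin n) (Fin n) Γ(X, ⊤)) = 𝟙 _ := by
  rw [mat, ← sum_unitEnd]
  refine Finset.sum_congr rfl fun k _ => ?_
  rw [Finset.sum_eq_single k, Matrix.one_apply_eq, smulEnd_one, Category.comp_id]
  · intro l _ hl
    rw [Matrix.one_apply_ne hl.symm, smulEnd_zero, comp_zero]
  · exact fun h => (h (Finset.mem_univ k)).elim

lemma mat_smul (r : Γ(X, ⊤)) (A : Matrix (Fin n) (Fin n) Γ(X, ⊤)) :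
    mat (r • A) = mat A ≫ smulEnd _ r := by
  simp only [mat, Preadditive.sum_comp, Category.assoc, ← smulEnd_mul, Matrix.smul_apply,
    smul_eq_mul]
  simp only [mul_comm r]

lemma ph_sum {κ : Type*} {V W T T' : Scheme.{u}} (g : T' ⟶ T) {a : T ⟶ V} {b : T ⟶ W} {a' : T' ⟶ V}
    {b' : T' ⟶ W} (hb : g ≫ b = b') (ha : g ≫ a = a') {M : V.Modules} {N : W.Modules}
    (s : Finset κ)
    (φ : κ → ((Scheme.Modules.pullback b).obj N ⟶ (Scheme.Modules.pullback a).obj M)) :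
    ph g hb ha (∑ k ∈ s, φ k) = ∑ k ∈ s, ph g hb ha (φ k) := by
  let F : ((Scheme.Modules.pullback b).obj N ⟶ (Scheme.Modules.pullback a).obj M) →+
      ((Scheme.Modules.pullback b').obj N ⟶ (Scheme.Modules.pullback a').obj M) :=
    { toFun := ph g hb ha
      map_zero' := ph_zero g hb ha
      map_add' := ph_add g hb ha }
  exact map_sum F φ s

/-- The matrix units come from the terminal scheme and are stable under every pullback, so only the
entries move. -/
lemma ph_mat (g : X' ⟶ X) (A : Matrix (Fin n) (Fin n) Γ(X, ⊤)) :
    ph g (comp_toBase g) (comp_toBase g) (mat A) = mat (A.map g.appTop.hom) := by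
  rw [mat, ph_sum]
  refine Finset.sum_congr rfl fun k _ => ?_
  rw [ph_sum]
  refine Finset.sum_congr rfl fun l _ => ?_
  rw [ph_comp g (comp_toBase g) (comp_toBase g) (comp_toBase g), ph_smulEnd, unitEnd, ph_map]
  rfl

lemma free_equiv (B : CommRingCat.{u}) (n : ℕ) :
    Nonempty (Γ(free n (Spec B), ⊤) ≃ₗ[B] (Fin n → B)) := by
  have e : toBase (Spec B) = Spec.map (fromBaseRing B) := baseIsTerminal.hom_ext _ _
  rw [free, e]
  exact freeSpec_equiv _ n

lemma finite_free (n : ℕ) {V : X.Opens} (hV : IsAffineOpen V) :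
    Module.Finite Γ(X, V) Γ(free n X, V) := by
  have h2 : Module.Finite Γ(base.{u}, ⊤) Γ(freeBase n, ⊤) := finite_freeSpec _ n
  exact (isBC_sec (toBase X) (qcoh_freeBase n) (isAffineOpen_top base.{u}) hV
    le_top).finite

end

end TwistedSheaf

/-! ### The twisted sheaf of a matrix cocycle. -/

namespace TwistedSheaf

variable {S T : Scheme.{u}} {ι : Type t} {U : ι → Scheme.{u}} {f : ∀ i, U i ⟶ S}

lemma Cocycle.map_val_eq (α : Cocycle f) {X X' : Scheme.{u}} (s : X' ⟶ X) {i j k : ι} {a : X ⟶ U i}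
    {b : X ⟶ U j} {c : X ⟶ U k} {a' : X' ⟶ U i} {b' : X' ⟶ U j} {c' : X' ⟶ U k}
    (hab : a ≫ f i = b ≫ f j) (hbc : b ≫ f j = c ≫ f k) (ha : s ≫ a = a') (hb : s ≫ b = b')
    (hc : s ≫ c = c') (hab' : a' ≫ f i = b' ≫ f j) (hbc' : b' ≫ f j = c' ≫ f k) :
    s.appTop (α.val a b c hab hbc : Γ(X, ⊤)) = α.val a' b' c' hab' hbc' := by
  subst ha hb hc
  exact α.map_val s a b c hab hbc

lemma map_units_inv_eq {R R' : Type*} [CommRing R] [CommRing R'] (σ : R →+* R') {x : Rˣ} {y : R'ˣ}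
    (h : σ x = y) : σ (x⁻¹ : Rˣ) = (y⁻¹ : R'ˣ) := by
  have h1 : Units.map (σ : R →* R') x = y := Units.ext h
  rw [← h1, ← map_inv]
  rfl

lemma descentBasis_of_surjective {P Q : Scheme.{u}} (p : P ⟶ Q) [Surjective p] (N : Q.Modules) :
    DescentBasis p N := by
  rw [DescentBasis, TopologicalSpace.Opens.isBasis_iff_nbhd]
  intro O x hx
  obtain ⟨V, hV, hxV, hVO⟩ := exists_isAffineOpen_mem_and_subset (U := O) (x := x) hx
  exact ⟨V, ⟨hV, .inl fun y _ => p.surjective y⟩, hxV, hVO⟩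

/-- Invertible matrices `g a b` on `T ×_S T` with `g a b * g b c = α a b c • g a c`, for a morphism
`t : T ⟶ U i₀`. -/
structure MatrixCocycle (α : Cocycle f) {i₀ : ι} (t : T ⟶ U i₀) (n : ℕ) where
  g {X : Scheme.{u}} (a b : X ⟶ T) (h : (a ≫ t) ≫ f i₀ = (b ≫ t) ≫ f i₀) :
    (Matrix (Fin n) (Fin n) Γ(X, ⊤))ˣ
  map_g {X X' : Scheme.{u}} (s : X' ⟶ X) (a b : X ⟶ T) (h : (a ≫ t) ≫ f i₀ = (b ≫ t) ≫ f i₀)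
    (h' : ((s ≫ a) ≫ t) ≫ f i₀ = ((s ≫ b) ≫ t) ≫ f i₀) :
    (g a b h).val.map s.appTop.hom = (g (s ≫ a) (s ≫ b) h').val
  mul_g {X : Scheme.{u}} (a b c : X ⟶ T) (h : (a ≫ t) ≫ f i₀ = (b ≫ t) ≫ f i₀)
    (h' : (b ≫ t) ≫ f i₀ = (c ≫ t) ≫ f i₀) :
    (g a b h).val * (g b c h').val =
      (α.val (a ≫ t) (b ≫ t) (c ≫ t) h h' : Γ(X, ⊤)) • (g a c (h.trans h')).val

namespace MatrixCocycle

variable {α : Cocycle f} {i₀ : ι} {t : T ⟶ U i₀} {n : ℕ} (G : MatrixCocycle α t n)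

section

variable {X X' : Scheme.{u}} {j k : ι}

/-- The transition matrices, corrected by `α`, over `U j`. -/
def ψ (c : X ⟶ U j) (a b : X ⟶ T)
    (h : c ≫ f j = (a ≫ t) ≫ f i₀)
    (h' : (a ≫ t) ≫ f i₀ = (b ≫ t) ≫ f i₀) : free n X ⟶ free n X :=
  mat (G.g a b h').val ≫ smulEnd _ ((α.val c (a ≫ t) (b ≫ t) h h')⁻¹ : Γ(X, ⊤)ˣ).val

lemma ph_ψ (s : X' ⟶ X) (hs : s ≫ toBase X = toBase X') (c : X ⟶ U j) (a b : X ⟶ T)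
    (h : c ≫ f j = (a ≫ t) ≫ f i₀)
    (h' : (a ≫ t) ≫ f i₀ = (b ≫ t) ≫ f i₀) {c' : X' ⟶ U j} {a' b' : X' ⟶ T} (hc : s ≫ c = c')
    (ha : s ≫ a = a') (hb : s ≫ b = b') (h₁ : c' ≫ f j = (a' ≫ t) ≫ f i₀)
    (h₁' : (a' ≫ t) ≫ f i₀ = (b' ≫ t) ≫ f i₀) :
    ph s hs hs (G.ψ c a b h h') = G.ψ c' a' b' h₁ h₁' := by
  subst hc ha hb
  rw [ψ, ψ, ph_comp s hs hs hs, ph_smulEnd]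
  have e1 := ph_mat s (G.g a b h').val
  have e2 := map_units_inv_eq s.appTop.hom (α.map_val_eq s h h' rfl
    (Category.assoc s a t).symm (Category.assoc s b t).symm h₁ h₁')
  rw [G.map_g s a b h' h₁'] at e1
  exact congr_arg₂ (fun u v => u ≫ smulEnd _ v) e1 e2

/-- The relation for `α` on the quadruple `(c, a, b, d)` shows that the correction by the inverse of
`α_{cab}` removes the twist from `mul_g`. So over each `U j` the corrected matrices form an honest
descent datum. -/
lemma ψ_comp (c : X ⟶ U j) (a b d : X ⟶ T) (h : c ≫ f j = (a ≫ t) ≫ f i₀)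
    (h' : (a ≫ t) ≫ f i₀ = (b ≫ t) ≫ f i₀) (h'' : (b ≫ t) ≫ f i₀ = (d ≫ t) ≫ f i₀) :
    G.ψ c b d (h.trans h') h'' ≫ G.ψ c a b h h' = G.ψ c a d h (h'.trans h'') := by
  rw [ψ, ψ, ψ, Category.assoc, reassoc_of% smulEnd_comp, ← smulEnd_mul, ← Category.assoc, mat_mul,
    G.mul_g, mat_smul, Category.assoc, ← smulEnd_mul]
  congr 2
  have h := α.cocycle c (a ≫ t) (b ≫ t) (d ≫ t) h h' h''
  rw [← Units.val_mul, ← Units.val_mul]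
  congr 1
  rw [eq_inv_iff_mul_eq_one, mul_assoc, mul_comm _ (α.val c _ _ _ _), ← mul_assoc, h,
    mul_mul_mul_comm, mul_inv_cancel, mul_inv_cancel, one_mul]

/-- It is idempotent by `ψ_comp` and invertible as the product of an invertible matrix and a unit.
-/
lemma ψ_self (c : X ⟶ U j) (a : X ⟶ T) (h : c ≫ f j = (a ≫ t) ≫ f i₀) :
    G.ψ c a a h rfl = 𝟙 _ := by
  have h1 := G.ψ_comp c a a a h rfl rfl
  let v : Γ(X, ⊤)ˣ := α.val c (a ≫ t) (a ≫ t) h rfl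
  have h2 : G.ψ c a a h rfl ≫ (smulEnd _ v.val ≫ mat (G.g a a rfl)⁻¹.val) = 𝟙 _ := by
    rw [ψ, Category.assoc, ← Category.assoc (smulEnd _ _), ← smulEnd_mul, Units.inv_mul,
      smulEnd_one, Category.id_comp, mat_mul, Units.inv_mul, mat_one]
  have h3 := congr($h1 ≫ (smulEnd _ v.val ≫ mat (G.g a a rfl)⁻¹.val))
  rwa [Category.assoc, h2, Category.comp_id] at h3

/-- Multiplication by `α_{cda}` carries the descent datum over `U k` to the one over `U j`. This
produces the gluing isomorphisms of the twisted sheaf. -/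
lemma ψ_comp_smulEnd (c : X ⟶ U j) (d : X ⟶ U k) (a b : X ⟶ T) (hcd : c ≫ f j = d ≫ f k)
    (h : d ≫ f k = (a ≫ t) ≫ f i₀) (h' : (a ≫ t) ≫ f i₀ = (b ≫ t) ≫ f i₀) :
    G.ψ d a b h h' ≫ smulEnd _ (α.val c d (a ≫ t) hcd h).val =
      G.ψ c a b (hcd.trans h) h' ≫ smulEnd _ (α.val c d (b ≫ t) hcd (h.trans h')).val := by
  rw [ψ, ψ, Category.assoc, Category.assoc, ← smulEnd_mul, ← smulEnd_mul]
  congr 2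
  have h := α.cocycle c d (a ≫ t) (b ≫ t) hcd h h'
  rw [← Units.val_mul, ← Units.val_mul]
  congr 1
  rw [inv_mul_eq_iff_eq_mul, mul_left_comm, eq_inv_mul_iff_mul_eq]
  exact h.symm

end

variable [IsAffineHom (t ≫ f i₀)] [Flat (t ≫ f i₀)] [Surjective (t ≫ f i₀)]

/-- The descent datum for the module over `U j`. -/
def gluing (j : ι) : Gluing (pullback.fst (f j) (t ≫ f i₀)) toBase (freeBase.{u} n) where
  Ψ x y h := G.ψ (x ≫ pullback.fst _ _) (x ≫ pullback.snd _ _) (y ≫ pullback.snd _ _)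
    (by simp only [Category.assoc, pullback.condition])
    (by
      simp only [Category.assoc, ← pullback.condition]
      rw [← Category.assoc, h, Category.assoc])
  ph_Ψ s hs x y h x' y' hx hy h' := G.ph_ψ s hs _ _ _ _ _ (by rw [← hx, Category.assoc])
    (by rw [← hx, Category.assoc]) (by rw [← hy, Category.assoc]) _ _
  comp x y w h h' := by
    have e (y' : _) (hy : y ≫ pullback.fst (f j) (t ≫ f i₀) = y') (h₁ h₂ h₃ h₄) :
        G.ψ (y ≫ pullback.fst (f j) (t ≫ f i₀)) (y ≫ pullback.snd _ _) (w ≫ pullback.snd _ _)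
          h₁ h₂ = G.ψ y' (y ≫ pullback.snd _ _) (w ≫ pullback.snd _ _) h₃ h₄ := by
      subst hy
      rfl
    have h₁ := h.symm =≫ f j
    simp only [Category.assoc, pullback.condition] at h₁
    have h₂ := h'.symm =≫ f j
    simp only [Category.assoc, pullback.condition] at h₂
    rw [e _ h.symm _ _ (by simp [pullback.condition, h₁]) (by simp [h₂])]
    exact G.ψ_comp _ _ _ _ _ _ _
  self x := G.ψ_self _ _ _

/-- The components of the twisted sheaf of a matrix cocycle. -/
def obj (j : ι) : (U j).Modules := (G.gluing j).descended comp_toBase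

/-- The counit of the descent. -/
def counit (j : ι) : (Scheme.Modules.pullback (pullback.fst (f j) (t ≫ f i₀))).obj (G.obj j) ⟶
    free n (pullback (f j) (t ≫ f i₀)) := (G.gluing j).counit comp_toBase

instance (j : ι) : IsIso (G.counit j) :=
  (G.gluing j).isIso_counit comp_toBase (qcoh_freeBase n)

lemma isCoherent_obj (j : ι) : IsCoherent (G.obj j) :=
  (G.gluing j).isCoherent_descended comp_toBase (qcoh_freeBase n) fun _ hV =>
    finite_free n (hV.preimage _)

section

variable {X X' : Scheme.{u}} {i j k : ι}

/-- The trivialization of the components. -/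
def ε (c : X ⟶ U j) (a : X ⟶ T) (h : c ≫ f j = a ≫ t ≫ f i₀) :
    (Scheme.Modules.pullback c).obj (G.obj j) ⟶ free n X :=
  ph (pullback.lift c a h) (pullback.lift_fst _ _ _) (comp_toBase _)
    (G.counit j)

instance (c : X ⟶ U j) (a : X ⟶ T) (h : c ≫ f j = a ≫ t ≫ f i₀) : IsIso (G.ε c a h) :=
  (phIso (pullback.lift c a h) (pullback.lift_fst _ _ _) (comp_toBase _)
    (asIso (G.counit j))).isIso_hom

omit [IsAffineHom (t ≫ f i₀)] [Flat (t ≫ f i₀)] [Surjective (t ≫ f i₀)] in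
lemma ph_ε (s : X' ⟶ X) (c : X ⟶ U j) (a : X ⟶ T) (h : c ≫ f j = a ≫ t ≫ f i₀) {c' : X' ⟶ U j}
    {a' : X' ⟶ T} (hc : s ≫ c = c') (ha : s ≫ a = a') (h' : c' ≫ f j = a' ≫ t ≫ f i₀) :
    ph s hc (comp_toBase s) (G.ε c a h) = G.ε c' a' h' := by
  subst hc ha
  have e : s ≫ pullback.lift c a h = pullback.lift (s ≫ c) (s ≫ a) h' :=
    pullback.hom_ext (by rw [Category.assoc, pullback.lift_fst, pullback.lift_fst])
      (by rw [Category.assoc, pullback.lift_snd, pullback.lift_snd])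
  rw [ε, ε, ph_ph _ s _ _ _ _ e]

omit [IsAffineHom (t ≫ f i₀)] [Flat (t ≫ f i₀)] [Surjective (t ≫ f i₀)] in
lemma ε_eq (c : X ⟶ U j) (a b : X ⟶ T) (h : c ≫ f j = a ≫ t ≫ f i₀) (h' : c ≫ f j = b ≫ t ≫ f i₀) :
    G.ε c a h = G.ε c b h' ≫ G.ψ c a b (by simp [h]) (by simp [← h, h']) := by
  have := (G.gluing j).ph_counit comp_toBase (pullback.lift c a h) (pullback.lift c b h')
    (pullback.lift_fst _ _ _) (pullback.lift_fst _ _ _)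
  refine this.trans (congrArg (fun w => G.ε c b h' ≫ w) ?_)
  have e {c₁ c₂ : X ⟶ U j} {a₁ a₂ b₁ b₂ : X ⟶ T} (hc : c₁ = c₂) (ha : a₁ = a₂) (hb : b₁ = b₂)
      (h₁ h₂ h₃ h₄) : G.ψ c₁ a₁ b₁ h₁ h₂ = G.ψ c₂ a₂ b₂ h₃ h₄ := by
    subst hc ha hb
    rfl
  exact e (pullback.lift_fst _ _ _) (pullback.lift_snd _ _ _) (pullback.lift_snd _ _ _) _ _ _ _

/-- Multiplication by a unit. -/
def smulIso (M : X.Modules) (v : Γ(X, ⊤)ˣ) : M ≅ M where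
  hom := smulEnd M v.val
  inv := smulEnd M (v⁻¹ : Γ(X, ⊤)ˣ).val
  hom_inv_id := by rw [← smulEnd_mul, Units.mul_inv, smulEnd_one]
  inv_hom_id := by rw [← smulEnd_mul, Units.inv_mul, smulEnd_one]

-- The condition on the gluing isomorphism does not depend on the lift to `T`: changing the lift
-- changes both trivializations by `ψ`, and `ψ_comp_smulEnd` compares them.
omit [IsAffineHom (t ≫ f i₀)] [Flat (t ≫ f i₀)] [Surjective (t ≫ f i₀)] in
lemma φ_aux (c : X ⟶ U i) (d : X ⟶ U j) (a b : X ⟶ T) (h : c ≫ f i = d ≫ f j)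
    (h₁ : c ≫ f i = a ≫ t ≫ f i₀) (h₂ : d ≫ f j = a ≫ t ≫ f i₀)
    (k₁ : c ≫ f i = b ≫ t ≫ f i₀) (k₂ : d ≫ f j = b ≫ t ≫ f i₀)
    (h₄ : d ≫ f j = (a ≫ t) ≫ f i₀) (k₄ : d ≫ f j = (b ≫ t) ≫ f i₀)
    {φ : (Scheme.Modules.pullback d).obj (G.obj j) ⟶ (Scheme.Modules.pullback c).obj (G.obj i)}
    (hφ : φ ≫ G.ε c b k₁ = G.ε d b k₂ ≫ smulEnd _ (α.val c d (b ≫ t) h k₄).val) :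
    φ ≫ G.ε c a h₁ = G.ε d a h₂ ≫ smulEnd _ (α.val c d (a ≫ t) h h₄).val := by
  have e := G.ψ_comp_smulEnd c d a b h h₄ (h₄.symm.trans k₄)
  rw [G.ε_eq c a b h₁ k₁, reassoc_of% hφ, G.ε_eq d a b h₂ k₂, smulEnd_comp]
  exact (congrArg (fun w => G.ε d b k₂ ≫ w) e.symm).trans (Category.assoc _ _ _).symm

omit [IsAffineHom (t ≫ f i₀)] [Flat (t ≫ f i₀)] [Surjective (t ≫ f i₀)] in
lemma ph_ε_smulEnd (s : X' ⟶ X) (c : X ⟶ U i) (d : X ⟶ U j) (a : X ⟶ T) (h : c ≫ f i = d ≫ f j)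
    (h₂ : d ≫ f j = a ≫ t ≫ f i₀) (h₄ : d ≫ f j = (a ≫ t) ≫ f i₀)
    {c' : X' ⟶ U i} {d' : X' ⟶ U j} {a' : X' ⟶ T} (hc : s ≫ c = c') (hd : s ≫ d = d')
    (ha : s ≫ a = a') (h' : c' ≫ f i = d' ≫ f j)
    (h₂' : d' ≫ f j = a' ≫ t ≫ f i₀) (h₄' : d' ≫ f j = (a' ≫ t) ≫ f i₀) :
    ph s hd (comp_toBase s) (G.ε d a h₂ ≫ smulEnd _ (α.val c d (a ≫ t) h h₄).val) =
      G.ε d' a' h₂' ≫ smulEnd _ (α.val c' d' (a' ≫ t) h' h₄').val := by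
  rw [ph_comp s hd (comp_toBase s) (comp_toBase s), G.ph_ε s d a h₂ hd ha h₂', ph_smulEnd]
  congr 2
  exact α.map_val_eq s h h₄ hc hd (by rw [← Category.assoc, ha]) h' h₄'

/-- The defining property of the gluing isomorphisms. -/
def IsGlue (c : X ⟶ U i) (d : X ⟶ U j) (_ : c ≫ f i = d ≫ f j)
    (φ : (Scheme.Modules.pullback d).obj (G.obj j) ⟶ (Scheme.Modules.pullback c).obj (G.obj i)) :
    Prop :=
  ∀ {X' : Scheme.{u}} (s : X' ⟶ X) {c' : X' ⟶ U i} {d' : X' ⟶ U j} (hc : s ≫ c = c')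
    (hd : s ≫ d = d') (a : X' ⟶ T) (h₁ : c' ≫ f i = a ≫ t ≫ f i₀) (h₂ : d' ≫ f j = a ≫ t ≫ f i₀)
    (h₃ : c' ≫ f i = d' ≫ f j) (h₄ : d' ≫ f j = (a ≫ t) ≫ f i₀),
    ph s hd hc φ ≫ G.ε c' a h₁ = G.ε d' a h₂ ≫ smulEnd _ (α.val c' d' (a ≫ t) h₃ h₄).val

variable {G} in
omit [IsAffineHom (t ≫ f i₀)] [Flat (t ≫ f i₀)] [Surjective (t ≫ f i₀)] in
lemma IsGlue.ph {c : X ⟶ U i} {d : X ⟶ U j} {h : c ≫ f i = d ≫ f j}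
    {φ : (Scheme.Modules.pullback d).obj (G.obj j) ⟶ (Scheme.Modules.pullback c).obj (G.obj i)}
    (hφ : G.IsGlue c d h φ) (s : X' ⟶ X) {c' : X' ⟶ U i} {d' : X' ⟶ U j} (hc : s ≫ c = c')
    (hd : s ≫ d = d') (h' : c' ≫ f i = d' ≫ f j) :
    G.IsGlue c' d' h' (TwistedSheaf.ph s hd hc φ) := by
  intro X'' s' c'' d'' hc' hd' a h₁ h₂ h₃ h₄
  rw [ph_ph s s' hd hc hd' hc' rfl]
  exact hφ (s' ≫ s) _ _ a h₁ h₂ h₃ h₄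

lemma eq_of_forall (c : X ⟶ U i) (d : X ⟶ U j)
    {φ φ' : (Scheme.Modules.pullback d).obj (G.obj j) ⟶ (Scheme.Modules.pullback c).obj (G.obj i)}
    (h : ∀ {X' : Scheme.{u}} (s : X' ⟶ X) {c' : X' ⟶ U i} {d' : X' ⟶ U j} (hc : s ≫ c = c')
      (hd : s ≫ d = d') (a : X' ⟶ T) (_ : c' ≫ f i = a ≫ t ≫ f i₀),
      ph s hd hc φ = ph s hd hc φ') : φ = φ' := by
  have hp := pullback.condition (f := c ≫ f i) (g := t ≫ f i₀)
  rw [← Category.assoc] at hp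
  exact Sheaf.ph_injective (p := pullback.fst (c ≫ f i) (t ≫ f i₀)) (G.isCoherent_obj i).1
    (descentBasis_of_surjective _ _) rfl rfl (h _ rfl rfl (pullback.snd _ _) hp)

/-- On `X ×_S T` both modules are trivialized by `ε`, and the isomorphism is multiplication by
`α_{cda}`. Independence of the lift `a` is the compatibility needed for descent to `X`. -/
lemma exists_φ (c : X ⟶ U i) (d : X ⟶ U j) (h : c ≫ f i = d ≫ f j) :
    ∃ φ : (Scheme.Modules.pullback d).obj (G.obj j) ≅ (Scheme.Modules.pullback c).obj (G.obj i),
      G.IsGlue c d h φ.hom := by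
  let p := pullback.fst (c ≫ f i) (t ≫ f i₀)
  let a := pullback.snd (c ≫ f i) (t ≫ f i₀)
  have hp : (p ≫ c) ≫ f i = a ≫ t ≫ f i₀ := by
    rw [Category.assoc]
    exact pullback.condition
  have hcd : (p ≫ c) ≫ f i = (p ≫ d) ≫ f j := by
    rw [Category.assoc]
    exact (congrArg (fun w => p ≫ w) h).trans (Category.assoc _ _ _).symm
  have hp' : (p ≫ d) ≫ f j = a ≫ t ≫ f i₀ := hcd.symm.trans hp
  have hp'' : (p ≫ d) ≫ f j = (a ≫ t) ≫ f i₀ := by rw [hp', Category.assoc]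
  let v : (Scheme.Modules.pullback (p ≫ d)).obj (G.obj j) ≅
      (Scheme.Modules.pullback (p ≫ c)).obj (G.obj i) :=
    asIso (G.ε (p ≫ d) a hp') ≪≫ smulIso _ (α.val (p ≫ c) (p ≫ d) (a ≫ t) hcd hp'') ≪≫
      (asIso (G.ε (p ≫ c) a hp)).symm
  have hv : v.hom ≫ G.ε (p ≫ c) a hp =
      G.ε (p ≫ d) a hp' ≫ smulEnd _ (α.val (p ≫ c) (p ≫ d) (a ≫ t) hcd hp'').val := by
    simp [v, smulIso]
  have hs {X' : Scheme.{u}} (s : X' ⟶ _) {c' : X' ⟶ U i} {d' : X' ⟶ U j} (hc : s ≫ p ≫ c = c')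
      (hd : s ≫ p ≫ d = d') (b : X' ⟶ T) (h₁ : c' ≫ f i = b ≫ t ≫ f i₀)
      (h₂ : d' ≫ f j = b ≫ t ≫ f i₀) (h₃ : c' ≫ f i = d' ≫ f j) (h₄ : d' ≫ f j = (b ≫ t) ≫ f i₀) :
      ph s hd hc v.hom ≫ G.ε c' b h₁ =
        G.ε d' b h₂ ≫ smulEnd _ (α.val c' d' (b ≫ t) h₃ h₄).val := by
    have k₁ : c' ≫ f i = (s ≫ a) ≫ t ≫ f i₀ := by rw [← hc, Category.assoc, hp, Category.assoc]
    have k₂ : d' ≫ f j = (s ≫ a) ≫ t ≫ f i₀ := h₃.symm.trans k₁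
    have k₄ : d' ≫ f j = ((s ≫ a) ≫ t) ≫ f i₀ := by rw [k₂, Category.assoc (s ≫ a)]
    refine G.φ_aux c' d' b (s ≫ a) h₃ h₁ h₂ k₁ k₂ h₄ k₄ ?_
    have := congrArg (TwistedSheaf.ph s hd (comp_toBase s)) hv
    rwa [ph_comp s hd hc (comp_toBase s), G.ph_ε s _ a hp hc rfl k₁,
      G.ph_ε_smulEnd s _ _ a hcd hp' hp'' hc hd rfl h₃ k₂ k₄] at this
  obtain ⟨φ, hφ⟩ := exists_iso_ph_eq (p := p) (a := d) (b := c) (G.isCoherent_obj j).1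
    (G.isCoherent_obj i).1 (descentBasis_of_surjective _ _) (descentBasis_of_surjective _ _)
    rfl rfl v (by
      intro X' g₁ g₂ r h₁ h₂ d' c' hd₁ hd₂ hc₁ hc₂
      have h₃ : c' ≫ f i = d' ≫ f j := by rw [← hc₁, ← hd₁, Category.assoc, hcd, Category.assoc g₁]
      have k₁ : c' ≫ f i = (g₁ ≫ a) ≫ t ≫ f i₀ := by
        rw [← hc₁, Category.assoc, hp, Category.assoc]
      have k₂ : d' ≫ f j = (g₁ ≫ a) ≫ t ≫ f i₀ := h₃.symm.trans k₁
      have k₄ : d' ≫ f j = ((g₁ ≫ a) ≫ t) ≫ f i₀ := by rw [k₂, Category.assoc (g₁ ≫ a)]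
      rw [← cancel_mono (G.ε c' (g₁ ≫ a) k₁), hs g₁ hc₁ hd₁ _ k₁ k₂ h₃ k₄,
        hs g₂ hc₂ hd₂ _ k₁ k₂ h₃ k₄])
  refine ⟨φ, fun {X'} s {c' d'} hc hd b h₁ h₂ h₃ h₄ => ?_⟩
  have e := hs (pullback.lift (f := c ≫ f i) (g := t ≫ f i₀) s b
    (by rw [← h₁, ← hc, Category.assoc])) (c' := c') (d' := d') (by
      rw [← Category.assoc]
      exact (congrArg (fun w => w ≫ c) (pullback.lift_fst _ _ _)).trans hc) (by
      rw [← Category.assoc]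
      exact (congrArg (fun w => w ≫ d) (pullback.lift_fst _ _ _)).trans hd) b h₁ h₂ h₃ h₄
  rw [← hφ, ph_ph p _ rfl rfl _ _ (pullback.lift_fst _ _ _)] at e
  exact e

/-- The gluing isomorphisms of the twisted sheaf of a matrix cocycle. -/
def φ (c : X ⟶ U i) (d : X ⟶ U j) (h : c ≫ f i = d ≫ f j) :
    (Scheme.Modules.pullback d).obj (G.obj j) ≅ (Scheme.Modules.pullback c).obj (G.obj i) :=
  (G.exists_φ c d h).choose

lemma isGlue_φ (c : X ⟶ U i) (d : X ⟶ U j) (h : c ≫ f i = d ≫ f j) :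
    G.IsGlue c d h (G.φ c d h).hom := (G.exists_φ c d h).choose_spec

variable {G} in
lemma IsGlue.eq {c : X ⟶ U i} {d : X ⟶ U j} {h : c ≫ f i = d ≫ f j}
    {φ φ' : (Scheme.Modules.pullback d).obj (G.obj j) ⟶ (Scheme.Modules.pullback c).obj (G.obj i)}
    (hφ : G.IsGlue c d h φ) (hφ' : G.IsGlue c d h φ') : φ = φ' := by
  refine G.eq_of_forall c d fun {X'} s {c' d'} hc hd a h₁ => ?_
  have h₃ : c' ≫ f i = d' ≫ f j := by rw [← hc, ← hd, Category.assoc, h, Category.assoc]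
  have h₂ : d' ≫ f j = a ≫ t ≫ f i₀ := h₃.symm.trans h₁
  have h₄ : d' ≫ f j = (a ≫ t) ≫ f i₀ := by rw [h₂, Category.assoc]
  rw [← cancel_mono (G.ε c' a h₁), hφ s hc hd a h₁ h₂ h₃ h₄, hφ' s hc hd a h₁ h₂ h₃ h₄]

/-- The twisted sheaf of a matrix cocycle. -/
def sheaf : Sheaf f α where
  obj := G.obj
  φ a b h := G.φ a b h
  pullHom_φ g i j a b h := by
    have h' : (g ≫ a) ≫ f i = (g ≫ b) ≫ f j := by rw [Category.assoc, Category.assoc, h]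
    rw [← ph_rfl]
    exact IsGlue.eq (h := h') (IsGlue.ph (h := h) (G.isGlue_φ a b h) g rfl rfl h')
      (G.isGlue_φ _ _ h')
  φ_comp {X i j k} a b c hab hbc := by
    refine G.eq_of_forall a c fun {X'} s {a' c'} ha hc x hx => ?_
    have e₁ : a' ≫ f i = (s ≫ b) ≫ f j := by rw [← ha, Category.assoc, Category.assoc, hab]
    have e₂ : (s ≫ b) ≫ f j = c' ≫ f k := by rw [← hc, Category.assoc, Category.assoc, hbc]
    have x₂ : (s ≫ b) ≫ f j = x ≫ t ≫ f i₀ := e₁.symm.trans hx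
    have x₃ : c' ≫ f k = x ≫ t ≫ f i₀ := e₂.symm.trans x₂
    have y₂ : (s ≫ b) ≫ f j = (x ≫ t) ≫ f i₀ := by rw [x₂, Category.assoc]
    have y₃ : c' ≫ f k = (x ≫ t) ≫ f i₀ := by rw [x₃, Category.assoc]
    have h₁ := G.isGlue_φ a b hab s ha rfl x hx x₂ e₁ y₂
    have h₂ := G.isGlue_φ b c hbc s rfl hc x x₂ x₃ e₂ y₃
    have h₃ := G.isGlue_φ a c (hab.trans hbc) s ha hc x hx x₃ (e₁.trans e₂) y₃
    have h₄ : s.appTop (α.val a b c hab hbc : Γ(X, ⊤)) = α.val a' (s ≫ b) c' e₁ e₂ :=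
      α.map_val_eq s hab hbc ha rfl hc e₁ e₂
    rw [ph_comp s hc rfl ha, ph_comp s hc ha ha, ph_smulEnd, h₄, ← cancel_mono (G.ε a' x hx),
      Category.assoc, h₁, reassoc_of% h₂, Category.assoc, smulEnd_comp (G.ε a' x hx), reassoc_of% h₃,
      ← smulEnd_mul, ← smulEnd_mul]
    -- Each gluing isomorphism acts by a value of `α` whose last index is `x`; the relation on `(a,
    -- b, c, x)` leaves exactly `α_{abc}`.
    have h₅ := congrArg Units.val (α.cocycle a' (s ≫ b) c' (x ≫ t) e₁ e₂ y₃)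
    rw [Units.val_mul, Units.val_mul] at h₅
    exact congrArg (fun w => G.ε c' x x₃ ≫ smulEnd _ w) h₅

/-- The coherent twisted sheaf of a matrix cocycle. -/
def coh : Coh f α := ⟨G.sheaf, G.isCoherent_obj⟩

end

end MatrixCocycle

section

variable {α : Cocycle f}

lemma MatrixCocycle.nonempty_equiv {B : Type u} [CommRing B] {i₀ : ι} {t : Spec (.of B) ⟶ U i₀}
    [IsAffineHom (t ≫ f i₀)] [Flat (t ≫ f i₀)] [Surjective (t ≫ f i₀)] {n : ℕ}
    (G : MatrixCocycle α t n) :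
    Nonempty (Γ((Scheme.Modules.pullback t).obj (G.coh.obj.obj i₀), ⊤) ≃ₗ[B] (Fin n → B)) := by
  obtain ⟨e⟩ := free_equiv (.of B) n
  let ε := G.ε t (𝟙 _) (Category.id_comp _).symm
  have h : Function.Bijective (homΓ (R := .of B) _ _ ε) := by
    refine Function.bijective_iff_has_inverse.mpr ⟨homΓ (R := .of B) _ _ (inv ε),
      fun x => ?_, fun x => ?_⟩
    · rw [homΓ_apply, homΓ_apply, ← app_comp, IsIso.hom_inv_id]
      rfl
    · rw [homΓ_apply, homΓ_apply, ← app_comp, IsIso.inv_hom_id]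
      rfl
  exact ⟨(LinearEquiv.ofBijective (homΓ (R := .of B) _ _ ε) h).trans e⟩

section

variable {S' : Scheme.{u}} {ι' : Type t'} {U' : ι' → Scheme.{u}} {f' : ∀ j, U' j ⟶ S'} {p : S' ⟶ S}
  {r : ι' → ι}

/-- A matrix cocycle along `t` is one along every lift of `t`. -/
def MatrixCocycle.pull (q : ∀ j, U' j ⟶ U (r j)) (w : ∀ j, q j ≫ f (r j) = f' j ≫ p) {j : ι'}
    {t : T ⟶ U (r j)} {n : ℕ} (G : MatrixCocycle α t n) (t₁ : T ⟶ U' j) (h : t₁ ≫ q j = t) :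
    MatrixCocycle (α.pull q w) t₁ n where
  g a b h' := G.g a b (by
    subst h
    have := pull_aux q w h'
    simpa using this)
  map_g s a b h' _ := G.map_g s a b _ _
  mul_g a b c h₁ h₂ := by
    subst h
    have k₁ := pull_aux q w h₁
    have k₂ := pull_aux q w h₂
    simp only [Category.assoc] at k₁ k₂
    have := G.mul_g a b c (by simpa using k₁) (by simpa using k₂)
    simp only [Cocycle.pull, Category.assoc]
    exact this

end

/-- The matrix cocycle of a lift of an Azumaya algebra. -/
lemma AzumayaDatum.HasClass.exists_matrixCocycle {n : ℕ} {A : AzumayaDatum f n} (hA : A.HasClass α)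
    {i₀ : ι} (t : T ⟶ U i₀) : Nonempty (MatrixCocycle α t n) := by
  obtain ⟨g, h₁, -, h₃⟩ := hA
  exact ⟨{
    g := fun a b h => g (a ≫ t) (b ≫ t) h
    map_g := fun s a b h h' => by
      rw [h₁]
      simp only [Category.assoc]
    mul_g := fun a b c h h' => h₃ _ _ _ h h' }⟩

end

end TwistedSheaf

namespace TwistedSheaf

/-! ### Supports -/

lemma IsBC.subsingleton_of_smul_eq_zero {R S : Type u} [CommRing R] [CommRing S] {M N : Type u}
    [AddCommGroup M] [Module R M] [AddCommGroup N] [Module S N] {σ : R →+* S} {ψ : M →+ N}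
    (h : IsBC σ ψ) {r : R} (hr : ∀ x : M, r • x = 0) (hu : IsUnit (σ r)) : Subsingleton N := by
  have h0 (x : M) : ψ x = 0 := by
    rw [← hu.smul_eq_zero, ← h.smul, hr, map_zero]
  have h1 : LinearMap.id = (0 : N →ₗ[S] N) := h.hom_ext _ _ _ fun x => by
    rw [h0]; simp
  exact ⟨fun x y => congr($h1 x).trans (congr($h1 y)).symm⟩

/-- Nakayama: a finite module whose fibre at the prime `ker σ` is zero is killed by an element
outside this prime. That the fibre over the residue field vanishes is tested with linear forms,
composed with the embedding of that field into `K`. -/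
lemma IsBC.exists_smul_eq_zero {R K : Type u} [CommRing R] [Field K] {M N : Type u}
    [AddCommGroup M] [Module R M] [AddCommGroup N] [Module K N] {σ : R →+* K} {ψ : M →+ N}
    (h : IsBC σ ψ) [Module.Finite R M] [Subsingleton N] : ∃ r, σ r ≠ 0 ∧ ∀ x : M, r • x = 0 := by
  obtain ⟨p, hp0⟩ : ∃ p : PrimeSpectrum R, p.asIdeal = RingHom.ker σ :=
    ⟨⟨RingHom.ker σ, RingHom.ker_isPrime σ⟩, rfl⟩
  by_contra hr
  have hp : p ∈ Module.support R M := by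
    rw [Module.mem_support_iff_of_finite]
    intro r hr'
    by_contra h0
    rw [hp0] at h0
    exact hr ⟨r, h0, fun x => Module.mem_annihilator.mp hr' x⟩
  rw [Module.mem_support_iff_nontrivial_residueField_tensorProduct] at hp
  obtain ⟨y, hy⟩ := exists_ne (0 : p.asIdeal.ResidueField ⊗[R] M)
  obtain ⟨g, hg⟩ : ∃ g : Module.Dual p.asIdeal.ResidueField (p.asIdeal.ResidueField ⊗[R] M),
      g y ≠ 0 := by
    by_contra h0
    push Not at h0
    exact hy ((Module.forall_dual_apply_eq_zero_iff _ _).mp h0)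
  let τ : p.asIdeal.ResidueField →+* K := Ideal.ResidueField.lift p.asIdeal σ hp0.le
    (fun x hx => (show σ x ≠ 0 from fun h0 => hx (hp0 ▸ h0)).isUnit)
  let χ : M →+ K := τ.toAddMonoidHom.comp (g.toAddMonoidHom.comp
    (TensorProduct.mk R p.asIdeal.ResidueField M 1).toAddMonoidHom)
  obtain ⟨w, hw⟩ := h.exists_lift K χ fun r x => by
    change τ (g (1 ⊗ₜ (r • x))) = σ r * τ (g (1 ⊗ₜ x))
    rw [TensorProduct.tmul_smul, LinearMap.map_smul_of_tower, Algebra.smul_def, map_mul]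
    congr 1
    exact Ideal.ResidueField.lift_algebraMap _ _ _ _ _
  have h1 (x : M) : g (1 ⊗ₜ x) = 0 := by
    apply τ.injective
    rw [map_zero]
    exact (hw x).symm.trans (by rw [Subsingleton.elim (ψ x) 0, map_zero])
  clear hy
  apply hg
  clear hg
  induction y with
  | zero => exact map_zero g
  | add a b ha hb =>
    rw [map_add, ha, hb, add_zero]
  | tmul k x =>
    rw [show k ⊗ₜ[R] x = k • (1 : p.asIdeal.ResidueField) ⊗ₜ[R] x by
      rw [TensorProduct.smul_tmul', smul_eq_mul, mul_one], map_smul, h1, smul_zero]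

variable {X : Scheme.{u}} {M : X.Modules}

lemma exists_restrict_eq_zero {V : X.Opens} {y : X} (hy : y ∈ V) (s : Finset Γ(M, V))
    [Subsingleton (M.presheaf.stalk y)] :
    ∃ (O : X.Opens) (i : O ≤ V), y ∈ O ∧ ∀ x ∈ s, M.presheaf.map (homOfLE i).op x = 0 := by
  classical
  induction s using Finset.induction_on with
  | empty => exact ⟨V, le_rfl, hy, by simp⟩
  | insert a s ha ih =>
    obtain ⟨O, i, hyO, hO⟩ := ih
    obtain ⟨O', hyO', ⟨⟨i'⟩⟩, ⟨⟨j⟩⟩, e⟩ := M.presheaf.germ_eq y hy hy a 0 (Subsingleton.elim _ _)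
    refine ⟨O ⊓ O', inf_le_left.trans i, ⟨hyO, hyO'⟩, fun x hx => ?_⟩
    rcases Finset.mem_insert.mp hx with rfl | hx
    · have h1 := congrArg (M.presheaf.map (homOfLE (inf_le_right : O ⊓ O' ≤ O')).op) e
      rw [map_zero, map_zero] at h1
      exact (map_map _ _ _ _).symm.trans h1
    · have h1 := congrArg (M.presheaf.map (homOfLE (inf_le_left : O ⊓ O' ≤ O)).op) (hO x hx)
      rw [map_zero] at h1
      exact (map_map _ _ _ _).symm.trans h1

lemma subsingleton_of_le (hM : M.IsQuasicoherent) {V V' : X.Opens} (hV : IsAffineOpen V)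
    (hV' : IsAffineOpen V') (i : V' ≤ V) [Subsingleton Γ(M, V)] : Subsingleton Γ(M, V') :=
  (isBC_restrict hM hV hV' i).subsingleton

/-- Finitely many generators over an affine neighbourhood die on a common smaller one, and their
restrictions still generate there. -/
lemma subsingleton_stalk_iff (hM : IsCoherent M) (y : X) : Subsingleton (M.presheaf.stalk y) ↔
    ∃ V : X.Opens, IsAffineOpen V ∧ y ∈ V ∧ Subsingleton Γ(M, V) := by
  constructor
  · intro h
    obtain ⟨V, hV, hyV, -⟩ := exists_isAffineOpen_mem_and_subset (U := ⊤) (x := y) trivial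
    have := hM.2 V hV
    obtain ⟨s, hs⟩ : (⊤ : Submodule Γ(X, V) Γ(M, V)).FG := Module.Finite.fg_top
    obtain ⟨O, i, hyO, hO⟩ := exists_restrict_eq_zero hyV s
    obtain ⟨V', hV', hyV', hV'O⟩ := exists_isAffineOpen_mem_and_subset (U := O) (x := y) hyO
    have j : V' ≤ V := le_trans hV'O i
    have hbc := isBC_restrict hM.1 hV hV' j
    refine ⟨V', hV', hyV', ?_⟩
    have h0 (x : Γ(M, V)) : M.presheaf.map (homOfLE j).op x = 0 := by
      have hx : x ∈ Submodule.span Γ(X, V) (s : Set Γ(M, V)) := hs ▸ trivial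
      induction hx using Submodule.span_induction with
      | mem x hx =>
        have h1 := congrArg (M.presheaf.map (homOfLE hV'O : V' ⟶ O).op) (hO x hx)
        rw [map_zero] at h1
        exact (map_map _ _ _ _).symm.trans h1
      | zero => exact map_zero _
      | add x y _ _ hx hy => rw [map_add, hx, hy, add_zero]
      | smul r x _ hx => exact (hbc.smul r x).trans (by
        rw [show (M.presheaf.map (homOfLE j).op).hom x = 0 from hx, smul_zero])
    have h1 : LinearMap.id = (0 : Γ(M, V') →ₗ[Γ(X, V')] Γ(M, V')) := hbc.hom_ext _ _ _ fun x => by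
      rw [show (M.presheaf.map (homOfLE j).op).hom x = 0 from h0 x]; simp
    exact ⟨fun x y => congr($h1 x).trans (congr($h1 y)).symm⟩
  · rintro ⟨V, hV, hyV, h⟩
    refine ⟨fun a b => ?_⟩
    obtain ⟨O, hOV, hyO, s, rfl⟩ := M.presheaf.exists_le_germ_eq a hyV
    obtain ⟨O', hOV', hyO', s', rfl⟩ := M.presheaf.exists_le_germ_eq b hyV
    obtain ⟨V', hV', hyV', hV'O⟩ := exists_isAffineOpen_mem_and_subset (U := O ⊓ O') (x := y)
      ⟨hyO, hyO'⟩
    have i : V' ≤ O := fun x hx => (hV'O hx).1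
    have i' : V' ≤ O' := fun x hx => (hV'O hx).2
    have := subsingleton_of_le hM.1 hV hV' (i.trans hOV)
    rw [← M.presheaf.germ_res_apply (homOfLE i) y hyV' s,
      ← M.presheaf.germ_res_apply (homOfLE i') y hyV' s']
    exact congrArg _ (Subsingleton.elim _ _)

/-- Vanishing of a stalk can be read off any field-valued point over it. Supports thereby become
compatible with pullback, restriction and the gluing isomorphisms. -/
lemma subsingleton_pullback_iff (hM : IsCoherent M) {K : Type u} [Field K] (c : Spec (.of K) ⟶ X)
    (z : Spec (.of K)) : Subsingleton Γ((Scheme.Modules.pullback c).obj M, ⊤) ↔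
      Subsingleton (M.presheaf.stalk (c z)) := by
  have hz (V : X.Opens) (h : c z ∈ V) : (⊤ : (Spec (.of K)).Opens) ≤ c ⁻¹ᵁ V := by
    intro w _
    rw [Subsingleton.elim w z]
    exact h
  rw [subsingleton_stalk_iff hM]
  constructor
  · intro h
    obtain ⟨V, hV, hyV, -⟩ := exists_isAffineOpen_mem_and_subset (U := ⊤) (x := c z) trivial
    have := hM.2 V hV
    have hbc := isBC_sec c hM.1 hV (isAffineOpen_top _) (hz V hyV)
    let e : Γ(Spec (.of K), ⊤) ≃+* K := (Scheme.ΓSpecIso (.of K)).commRingCatIsoToRingEquiv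
    let : Field Γ(Spec (.of K), ⊤) := (e.isField (Field.toIsField K)).toField
    obtain ⟨r, hr, h0⟩ := IsBC.exists_smul_eq_zero hbc
    refine ⟨X.basicOpen r, hV.basicOpen r, ?_, ?_⟩
    · have h1 : (Spec (.of K)).basicOpen (c.appLE V ⊤ (hz V hyV) r) = ⊤ :=
        Scheme.basicOpen_of_isUnit _ hr.isUnit
      have h2 : z ∈ (Spec (.of K)).basicOpen (c.appLE V ⊤ (hz V hyV) r) := by
        rw [h1]
        trivial
      rw [Scheme.basicOpen_appLE] at h2
      exact h2.2
    · exact (isBC_restrict hM.1 hV (hV.basicOpen r) (X.basicOpen_le r)).subsingleton_of_smul_eq_zero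
        h0 (X.toRingedSpace.isUnit_res_basicOpen r)
  · rintro ⟨V, hV, hyV, h⟩
    exact (isBC_sec c hM.1 hV (isAffineOpen_top _) (hz V hyV)).subsingleton

lemma nontrivial_iff_of_iso {M N : X.Modules} (e : M ≅ N) (V : X.Opens) :
    Nontrivial Γ(M, V) ↔ Nontrivial Γ(N, V) := by
  have key {M N : X.Modules} (e : M ≅ N) (h : Nontrivial Γ(M, V)) : Nontrivial Γ(N, V) := by
    refine (Function.LeftInverse.injective (g := e.inv.app V) (f := e.hom.app V)
      fun x => ?_).nontrivial
    rw [← app_comp, e.hom_inv_id]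
    rfl
  exact ⟨key e, key e.symm⟩

lemma exists_field_point (y : X) : ∃ (K : Type u) (_ : Field K) (c : Spec (.of K) ⟶ X)
    (z : Spec (.of K)), c z = y :=
  ⟨X.residueField y, inferInstance, X.fromSpecResidueField y, IsLocalRing.closedPoint _,
    X.fromSpecResidueField_apply y _⟩

namespace Coh

variable {S : Scheme.{u}} {ι : Type t} {U : ι → Scheme.{u}} {f : ∀ i, U i ⟶ S} {α : Cocycle f}

lemma nontrivial_stalk_iff (M : Coh f α) {i : ι} {K : Type u} [Field K] (c : Spec (.of K) ⟶ U i)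
    (z : Spec (.of K)) : Nontrivial ((M.obj.obj i).presheaf.stalk (c z)) ↔
      Nontrivial Γ((Scheme.Modules.pullback c).obj (M.obj.obj i), ⊤) := by
  have := subsingleton_pullback_iff (M.property i) c z
  rw [← not_subsingleton_iff_nontrivial, ← this, not_subsingleton_iff_nontrivial]

/-- Any point of the covering over the given one will do: two of them are dominated by a
field-valued point of `U i ×_S U j`, where the gluing isomorphism compares the fibres. -/
lemma mem_support_iff (M : Coh f α) {i : ι} {K : Type u} [Field K] (c : Spec (.of K) ⟶ U i)
    (z : Spec (.of K)) : f i (c z) ∈ M.obj.support ↔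
      Nontrivial Γ((Scheme.Modules.pullback c).obj (M.obj.obj i), ⊤) := by
  rw [← M.nontrivial_stalk_iff c z]
  refine ⟨?_, fun h => ⟨i, c z, rfl, h⟩⟩
  rintro ⟨j, y, hy, h⟩
  obtain ⟨w, hw₁, hw₂⟩ := Scheme.Pullback.exists_preimage_pullback (c z) y hy.symm
  obtain ⟨L, _, d, v, hv⟩ := exists_field_point w
  have h₁ : (d ≫ pullback.fst (f i) (f j)) v = c z := by rw [Scheme.Hom.comp_apply, hv, hw₁]
  have h₂ : (d ≫ pullback.snd (f i) (f j)) v = y := by rw [Scheme.Hom.comp_apply, hv, hw₂]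
  rw [← h₂, M.nontrivial_stalk_iff] at h
  rw [← h₁, M.nontrivial_stalk_iff]
  exact (nontrivial_iff_of_iso (M.obj.φ (d ≫ pullback.fst (f i) (f j))
    (d ≫ pullback.snd (f i) (f j)) (by simp [pullback.condition])) ⊤).mp h

lemma notMem_support_iff (M : Coh f α) {i : ι} (y : U i) : f i y ∉ M.obj.support ↔
    ∃ V : (U i).Opens, IsAffineOpen V ∧ y ∈ V ∧ Subsingleton Γ(M.obj.obj i, V) := by
  obtain ⟨K, _, c, z, rfl⟩ := exists_field_point y
  rw [M.mem_support_iff, ← M.nontrivial_stalk_iff c z, not_nontrivial_iff_subsingleton,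
    subsingleton_stalk_iff (M.property i)]

lemma isClosed_support (M : Coh f α) (hf : ∀ i, IsOpenMap (f i)) (hs : ∀ x, ∃ i y, f i y = x) :
    IsClosed M.obj.support := by
  rw [← isOpen_compl_iff, isOpen_iff_mem_nhds]
  intro x hx
  obtain ⟨i, y, rfl⟩ := hs x
  obtain ⟨V, hV, hyV, h⟩ := (M.notMem_support_iff y).mp hx
  refine Filter.mem_of_superset ((hf i V V.2).mem_nhds ⟨y, hyV, rfl⟩) ?_
  rintro _ ⟨y', hy', rfl⟩
  exact (M.notMem_support_iff y').mpr ⟨V, hV, hy', h⟩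

/-- Near every point either the source or the target has no nonzero sections. -/
lemma hom_eq_zero_of_disjoint {M N : Coh f α} (h : Disjoint M.obj.support N.obj.support)
    (u : M ⟶ N) : u = 0 := by
  apply ObjectProperty.hom_ext
  ext i : 1
  refine hom_ext_of_isBasis (B := {V | IsAffineOpen V ∧
    (Subsingleton Γ(M.obj.obj i, V) ∨ Subsingleton Γ(N.obj.obj i, V))}) ?_ ?_
  · rw [TopologicalSpace.Opens.isBasis_iff_nbhd]
    intro O y hy
    have key (P : Coh f α) (hP : f i y ∉ P.obj.support) : ∃ V : (U i).Opens, IsAffineOpen V ∧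
        y ∈ V ∧ V ≤ O ∧ Subsingleton Γ(P.obj.obj i, V) := by
      obtain ⟨V, hV, hyV, h⟩ := (P.notMem_support_iff y).mp hP
      obtain ⟨V', hV', hyV', hV'O⟩ := exists_isAffineOpen_mem_and_subset (U := O ⊓ V) (x := y)
        ⟨hy, hyV⟩
      exact ⟨V', hV', hyV', fun x hx => (hV'O hx).1,
        subsingleton_of_le (P.property i).1 hV hV' fun x hx => (hV'O hx).2⟩
    by_cases hM : f i y ∈ M.obj.support
    · obtain ⟨V, h₁, h₂, h₃, h₄⟩ := key N (Set.disjoint_left.mp h hM)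
      exact ⟨V, ⟨h₁, .inr h₄⟩, h₂, h₃⟩
    · obtain ⟨V, h₁, h₂, h₃, h₄⟩ := key M hM
      exact ⟨V, ⟨h₁, .inl h₄⟩, h₂, h₃⟩
  · rintro V ⟨-, hV | hV⟩ x
    · rw [Subsingleton.elim x 0, map_zero, map_zero]
    · exact Subsingleton.elim _ _

lemma support_eq_of_iso {M N : Coh f α} (e : M ≅ N) : M.obj.support = N.obj.support := by
  have key {M N : Coh f α} (e : M ≅ N) : M.obj.support ⊆ N.obj.support := by
    rintro x ⟨i, y, rfl, h⟩
    obtain ⟨K, _, c, z, rfl⟩ := exists_field_point y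
    rw [M.nontrivial_stalk_iff] at h
    rw [N.mem_support_iff]
    let e' : M.obj.obj i ≅ N.obj.obj i :=
      { hom := e.hom.hom.hom i
        inv := e.inv.hom.hom i
        hom_inv_id := congr(($(e.hom_inv_id)).hom.hom i)
        inv_hom_id := congr(($(e.inv_hom_id)).hom.hom i) }
    exact (nontrivial_iff_of_iso ((Scheme.Modules.pullback c).mapIso e') ⊤).mp h
  exact (key e).antisymm (key e.symm)

lemma mem_support_restrict (M : Coh f α) (W : S.Opens)
    (x : W.toScheme) :
    x ∈ ((restrict α W).obj M).obj.support ↔ W.ι x ∈ M.obj.support := by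
  have key {i : ι} (y : (f i ⁻¹ᵁ W).toScheme) :
      (f i ∣_ W) y ∈ ((restrict α W).obj M).obj.support ↔ W.ι ((f i ∣_ W) y) ∈ M.obj.support := by
    obtain ⟨K, _, c, z, rfl⟩ := exists_field_point y
    have h₁ := ((restrict α W).obj M).mem_support_iff (i := i) c z
    have h₂ := M.mem_support_iff (i := i) (c ≫ (f i ⁻¹ᵁ W).ι) z
    have h₃ : f i ((c ≫ (f i ⁻¹ᵁ W).ι) z) = W.ι ((f i ∣_ W) (c z)) := by
      rw [← Scheme.Hom.comp_apply, ← Scheme.Hom.comp_apply, ← Scheme.Hom.comp_apply,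
        morphismRestrict_ι, Category.assoc]
    rw [h₁, ← h₃, h₂]
    exact nontrivial_iff_of_iso (pbC c rfl (M.obj.obj i)) ⊤
  constructor
  · rintro ⟨i, y, rfl, h⟩
    exact (key y).mp ⟨i, y, rfl, h⟩
  · rintro ⟨i, y, hy, h⟩
    have hyW : y ∈ f i ⁻¹ᵁ W := by
      change f i y ∈ W
      rw [hy]
      exact x.2
    have h₁ : (f i ∣_ W) ⟨y, hyW⟩ = x :=
      Subtype.ext ((morphismRestrict_base_coe (f i) W ⟨y, hyW⟩).trans hy)
    have h₂ := (key (i := i) ⟨y, hyW⟩).mpr (by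
      rw [h₁]
      exact hy ▸ ⟨i, y, rfl, h⟩)
    exact h₁ ▸ h₂

end Coh

end TwistedSheaf

/-! ### Charts on which the cocycle is the class of an Azumaya algebra. -/

namespace TwistedSheaf

variable {S : Scheme.{u}} {ι : Type t} {U : ι → Scheme.{u}} {f : ∀ i, U i ⟶ S}

/-- A matrix cocycle for a refinement of the covering is one for the covering. -/
def MatrixCocycle.push {ι' : Type t'} {U' : ι' → Scheme.{u}} {f' : ∀ j, U' j ⟶ S} {r : ι' → ι}
    {α : Cocycle f} (q : ∀ j, U' j ⟶ U (r j)) (w : ∀ j, q j ≫ f (r j) = f' j ≫ 𝟙 S) {j : ι'}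
    {T : Scheme.{u}} {t : T ⟶ U' j} {n : ℕ} (G : MatrixCocycle (α.pull q w) t n) :
    MatrixCocycle α (t ≫ q j) n where
  g a b h := G.g a b (by simpa [w] using h)
  map_g s a b h _ := G.map_g s a b _ _
  mul_g a b c h₁ h₂ := by
    have := G.mul_g a b c (by simpa [w] using h₁) (by simpa [w] using h₂)
    simp only [Cocycle.pull, Category.assoc] at this ⊢
    exact this

/-- The standing assumptions on a cocycle for an étale covering. -/
structure Nice (α : Cocycle f) : Prop where
  noetherian : IsLocallyNoetherian S
  separated : S.IsSeparated
  compact : CompactSpace S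
  jacobson : JacobsonSpace S
  etale (i : ι) : Etale (f i)
  surj (x : S) : ∃ i y, f i y = x
  brauer : α.IsBrauer

/-- An affine open subscheme `W` with a flat cover by an affine scheme along which `α` is the class
of an Azumaya algebra. -/
structure Chart (α : Cocycle f) (W : S.Opens) where
  isAffineOpen : IsAffineOpen W
  B : Type u
  [commRing : CommRing B]
  isNoetherian : IsNoetherianRing B
  i₀ : ι
  t : Spec (.of B) ⟶ U i₀
  O : (U i₀).Opens
  isAffineOpen_O : IsAffineOpen O
  le : (⊤ : (Spec (.of B)).Opens) ≤ t ⁻¹ᵁ O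
  isAffineHom : IsAffineHom (t ≫ f i₀)
  flat : Flat (t ≫ f i₀)
  range_eq : Set.range (t ≫ f i₀) = W
  n : ℕ
  pos : 0 < n
  G : MatrixCocycle α t n

attribute [instance] Chart.commRing

/-- For a monomorphism `j`, the morphism `g` is the base change of `g ≫ j` along `j`. -/
lemma flat_of_flat_comp_mono {X Y Z : Scheme.{u}} (g : X ⟶ Y) (j : Y ⟶ Z) [Mono j]
    [Flat (g ≫ j)] : Flat g := by
  have h : IsPullback (𝟙 X) g (g ≫ j) j :=
    ⟨⟨Category.id_comp _⟩, ⟨PullbackCone.IsLimit.mk _ (fun s => s.fst) (fun s => Category.comp_id _)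
      (fun s => by rw [← cancel_mono j, Category.assoc, s.condition])
      (fun s m h₁ _ => by rw [← h₁, Category.comp_id])⟩⟩
  exact MorphismProperty.of_isPullback (P := @Flat) h inferInstance

lemma isAffineHom_of_isSeparated {T : Scheme.{u}} [IsAffine T] [S.IsSeparated] (h : T ⟶ S) :
    IsAffineHom h := by
  have : IsAffineHom (h ≫ terminal.from S) := inferInstance
  exact IsAffineHom.of_comp h (terminal.from S)

/-- A member of the refinement that carries the Azumaya datum is shrunk twice: to an affine `V₁`
mapping into `O` and into an affine open of `U`, then to the part `V` of it over an affine `W`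
contained in the open image of `V₁`. Separatedness of `S` keeps `V` affine, and the image of `V` is
all of `W`. -/
lemma Nice.exists_chart {α : Cocycle f} (hα : Nice α) {x : S} {O : S.Opens} (hx : x ∈ O) :
    ∃ W : S.Opens, x ∈ W ∧ W ≤ O ∧ Nonempty (Chart α W) := by
  obtain ⟨𝒱, r, q, w, n, A, hn, hA⟩ := hα.brauer
  have := hα.separated
  have := hα.noetherian
  obtain ⟨j, y, hy⟩ : ∃ j y, 𝒱.f j y = x :=
    (Scheme.presieve₀_mem_precoverage_iff (P := @Etale) (E := 𝒱.toPreZeroHypercover)).mp 𝒱.mem₀ |>.1 x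
  have : Etale (𝒱.f j) := 𝒱.map_prop j
  obtain ⟨O', hO', hyO', -⟩ := exists_isAffineOpen_mem_and_subset (U := (⊤ : (U (r j)).Opens))
    (x := q j y) trivial
  obtain ⟨V₁, hV₁, hyV₁, hV₁O'⟩ := exists_isAffineOpen_mem_and_subset (X := 𝒱.X j)
    (U := 𝒱.f j ⁻¹ᵁ O ⊓ q j ⁻¹ᵁ O') (x := y) ⟨by rw [← hy] at hx; exact hx, hyO'⟩
  have hV₁O (z : 𝒱.X j) (hz : z ∈ V₁) : 𝒱.f j z ∈ O := (hV₁O' hz).1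
  have hopen : IsOpen (𝒱.f j '' V₁) := (𝒱.f j).isOpenMap _ V₁.2
  obtain ⟨W, hW, hxW, hWO⟩ := exists_isAffineOpen_mem_and_subset
    (U := ⟨𝒱.f j '' V₁, hopen⟩) (x := x) ⟨y, hyV₁, hy⟩
  let V : (𝒱.X j).Opens := V₁ ⊓ 𝒱.f j ⁻¹ᵁ W
  have hV : IsAffineOpen V := by
    have : IsAffine V₁ := hV₁
    have h1 := isAffineHom_of_isSeparated (V₁.ι ≫ 𝒱.f j)
    have h2 := (hW.preimage (V₁.ι ≫ 𝒱.f j)).image_of_isOpenImmersion V₁.ι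
    have h3 : V₁.ι ''ᵁ ((V₁.ι ≫ 𝒱.f j) ⁻¹ᵁ W) = V := by
      ext z
      constructor
      · rintro ⟨z, hz, rfl⟩
        exact ⟨z.2, hz⟩
      · rintro ⟨hz, hz'⟩
        exact ⟨⟨z, hz⟩, hz', rfl⟩
    rwa [h3] at h2
  let B : Type u := Γ(𝒱.X j, V)
  let t' : Spec (.of B) ⟶ 𝒱.X j := hV.fromSpec
  have : IsOpenImmersion t' := inferInstanceAs (IsOpenImmersion hV.fromSpec)
  have ht : (t' ≫ q j) ≫ f (r j) = t' ≫ 𝒱.f j := by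
    rw [Category.assoc, w, Category.comp_id]
  have het : Etale (t' ≫ 𝒱.f j) := inferInstance
  obtain ⟨G⟩ := hA.exists_matrixCocycle t'
  have : IsLocallyNoetherian (𝒱.X j) := LocallyOfFiniteType.isLocallyNoetherian (𝒱.f j)
  refine ⟨W, hxW, fun z hz => ?_,
    ⟨⟨hW, B, IsLocallyNoetherian.component_noetherian ⟨V, hV⟩, r j,
      t' ≫ q j, O', hO', ?_, ?_, ?_, ?_, n, hn, ?_⟩⟩⟩
  · obtain ⟨z', hz', rfl⟩ := hWO hz
    exact hV₁O _ hz'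
  · intro z _
    have h1 : t' z ∈ (V : Set (𝒱.X j)) := hV.range_fromSpec ▸ ⟨z, rfl⟩
    exact (hV₁O' h1.1).2
  · exact isAffineHom_of_isSeparated _
  · rw [ht]
    infer_instance
  · rw [ht]
    have h1 : Set.range t' = V := hV.range_fromSpec
    ext z
    constructor
    · rintro ⟨z, rfl⟩
      have h2 : t' z ∈ (V : Set (𝒱.X j)) := h1 ▸ ⟨z, rfl⟩
      exact h2.2
    · intro hz
      obtain ⟨z', hz', rfl⟩ := hWO hz
      have h2 : z' ∈ Set.range t' := by
        rw [h1]
        exact ⟨hz', hz⟩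
      obtain ⟨z'', rfl⟩ := h2
      exact ⟨z'', rfl⟩
  · exact G.push q w

namespace Chart

variable {α : Cocycle f} {W : S.Opens} (C : Chart α W)

/-- The lift of `t` to the preimage of `W`. -/
def lift : Spec (.of C.B) ⟶ (f C.i₀ ⁻¹ᵁ W).toScheme :=
  IsOpenImmersion.lift (f C.i₀ ⁻¹ᵁ W).ι C.t (by
    rw [Scheme.Opens.range_ι]
    rintro _ ⟨z, rfl⟩
    have : (C.t ≫ f C.i₀) z ∈ (W : Set S) := C.range_eq ▸ ⟨z, rfl⟩
    exact this)

lemma lift_ι : C.lift ≫ (f C.i₀ ⁻¹ᵁ W).ι = C.t := IsOpenImmersion.lift_fac _ _ _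

lemma lift_comp : (C.lift ≫ f C.i₀ ∣_ W) ≫ W.ι = C.t ≫ f C.i₀ := by
  rw [Category.assoc, morphismRestrict_ι, ← Category.assoc, lift_ι]

instance : IsAffineHom (C.lift ≫ f C.i₀ ∣_ W) := by
  have : IsAffineHom ((C.lift ≫ f C.i₀ ∣_ W) ≫ W.ι) := C.lift_comp ▸ C.isAffineHom
  exact IsAffineHom.of_comp _ W.ι

instance : Flat (C.lift ≫ f C.i₀ ∣_ W) := by
  have : Flat ((C.lift ≫ f C.i₀ ∣_ W) ≫ W.ι) := C.lift_comp ▸ C.flat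
  exact flat_of_flat_comp_mono _ W.ι

instance : Surjective (C.lift ≫ f C.i₀ ∣_ W) := by
  refine ⟨fun x => ?_⟩
  obtain ⟨z, hz⟩ : (W.ι x) ∈ Set.range (C.t ≫ f C.i₀) := by
    rw [C.range_eq]
    exact x.2
  refine ⟨z, W.ι.injective ?_⟩
  rw [← hz, ← lift_comp, ← Scheme.Hom.comp_apply]

/-- The matrix cocycle over `W`. -/
def matrixCocycle : MatrixCocycle (α.restrict W) C.lift C.n :=
  C.G.pull (p := W.ι) (r := id) (fun i => (f i ⁻¹ᵁ W).ι)
    (fun i => (morphismRestrict_ι (f i) W).symm) (j := C.i₀) C.lift C.lift_ι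

/-- A twisted sheaf over `W` with a free pullback. -/
def E : Coh (fun i => f i ∣_ W) (α.restrict W) := C.matrixCocycle.coh

lemma nonempty_equiv : Nonempty (Γ((Scheme.Modules.pullback C.lift).obj (C.E.obj.obj C.i₀), ⊤)
    ≃ₗ[C.B] (Fin C.n → C.B)) := C.matrixCocycle.nonempty_equiv

/-- If a fibre were zero, some `r` not vanishing at that point would kill the pullback to `Spec B`;
but nothing nonzero kills a basis vector of a free module of positive rank. -/
lemma support_E : C.E.obj.support = Set.univ := by
  refine Set.eq_univ_of_forall fun x => ?_
  obtain ⟨y, rfl⟩ := (C.lift ≫ f C.i₀ ∣_ W).surjective x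
  obtain ⟨K, _, c, z, rfl⟩ := exists_field_point y
  have h := (C.E).mem_support_iff (i := C.i₀) (c ≫ C.lift) z
  rw [Scheme.Hom.comp_apply] at h
  rw [Scheme.Hom.comp_apply, h]
  obtain ⟨e⟩ := C.nonempty_equiv
  rw [← not_subsingleton_iff_nontrivial]
  intro hsub
  have hc : Spec.map (Spec.preimage c) = c := Spec.map_preimage c
  have hbc := isBC_res_SpecMap (Spec.preimage c) (b' := c ≫ C.lift) (by rw [hc])
    (C.E.property C.i₀).1
  have : Module.Finite C.B Γ((Scheme.Modules.pullback C.lift).obj (C.E.obj.obj C.i₀), ⊤) :=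
    Module.Finite.equiv e.symm
  obtain ⟨r, hr, h0⟩ := hbc.exists_smul_eq_zero
  have h1 := h0 (e.symm (Pi.single ⟨0, C.pos⟩ 1))
  rw [← map_smul, LinearEquiv.map_eq_zero_iff] at h1
  have h2 := congr_fun h1 ⟨0, C.pos⟩
  rw [Pi.smul_apply, Pi.single_eq_same, smul_eq_mul, mul_one, Pi.zero_apply] at h2
  exact hr (by rw [h2, map_zero])

end Chart

lemma Nice.isOpenMap {α : Cocycle f} (hα : Nice α) (i : ι) : IsOpenMap (f i) := by
  have := hα.etale i
  exact (f i).isOpenMap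

/-- The locally free twisted sheaf of a chart extends to `S`, because a localization functor is
essentially surjective. -/
lemma Nice.exists_mem_support {α : Cocycle f} (hα : Nice α) (hr : RestrictionCondition α) (x : S) :
    ∃ N : Coh f α, x ∈ N.obj.support := by
  obtain ⟨W, hxW, -, ⟨C⟩⟩ := hα.exists_chart (x := x) (O := ⊤) trivial
  have := hr W
  have := Localization.essSurj (Coh.restrict α W) (isoModulo (Coh.supportedOn α (W : Set S)ᶜ))
  obtain ⟨N, ⟨e⟩⟩ := Functor.EssSurj.mem_essImage (F := Coh.restrict α W) C.E
  refine ⟨N, ?_⟩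
  let x' : W.toScheme := ⟨x, hxW⟩
  have h := (N.mem_support_restrict W x').mp (by rw [Coh.support_eq_of_iso e, C.support_E]; trivial)
  exact h

end TwistedSheaf

/-! ### Quotients of modules by ideal sheaves. -/

namespace TwistedSheaf

section

variable {A B : Type u} [CommRing A] [CommRing B] {P Q P' Q' : Type u} [AddCommGroup P]
  [AddCommGroup Q] [AddCommGroup P'] [AddCommGroup Q'] [Module A P] [Module A Q] [Module B P']
  [Module B Q'] {σ : A →+* B} {ψP : P →+ P'} {ψQ : Q →+ Q'}

omit [Module A P] in
lemma IsBC.surjective_of_surjective (hQ : IsBC σ ψQ) {π : P → Q}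
    {π' : P' →ₗ[B] Q'} (h : ∀ x, π' (ψP x) = ψQ (π x)) (hs : Function.Surjective π) :
    Function.Surjective π' := by
  rw [← LinearMap.range_eq_top, eq_top_iff, ← hQ.span, Submodule.span_le]
  rintro _ ⟨x, rfl⟩
  obtain ⟨p, rfl⟩ := hs x
  exact ⟨ψP p, h p⟩

/-- Modulo the extended ideal, `ψP` factors through `π`. The universal property of `Q'` turns this
into a factorization of `P' → P' / J P'` through `π'`. -/
lemma IsBC.ker_le_smul_top (hP : IsBC σ ψP) (hQ : IsBC σ ψQ) {π : P →+ Q}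
    (hπ : ∀ (r : A) x, π (r • x) = r • π x)
    {π' : P' →ₗ[B] Q'} (h : ∀ x, π' (ψP x) = ψQ (π x)) (hs : Function.Surjective π)
    {J : Ideal A} (hJ : ∀ x, π x = 0 → x ∈ J • (⊤ : Submodule A P)) {p : P'} (hp : π' p = 0) :
    p ∈ J.map σ • (⊤ : Submodule B P') := by
  let N := J.map σ • (⊤ : Submodule B P')
  have h0 (x : P) (hx : π x = 0) : ψP x ∈ N := by
    refine Submodule.smul_induction_on (hJ x hx) (fun r hr y _ => ?_) fun x y hx hy => ?_
    · rw [hP.smul]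
      exact Submodule.smul_mem_smul (Ideal.mem_map_of_mem σ hr) trivial
    · rw [map_add]
      exact N.add_mem hx hy
  have h1 (x y : P) (hxy : π x = π y) : N.mkQ (ψP x) = N.mkQ (ψP y) := by
    rw [← sub_eq_zero, ← map_sub, ← map_sub, Submodule.mkQ_apply, Submodule.Quotient.mk_eq_zero]
    exact h0 _ (by rw [map_sub, hxy, sub_self])
  let g := Function.surjInv hs
  have hg (x : Q) : π (g x) = x := Function.surjInv_eq hs x
  let χ : Q →+ P' ⧸ N :=
    { toFun x := N.mkQ (ψP (g x))
      map_zero' := (h1 _ 0 (by rw [hg, map_zero])).trans (by rw [map_zero, map_zero])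
      map_add' x y := by
        rw [← map_add, ← map_add]
        exact h1 _ _ (by rw [map_add, hg, hg, hg]) }
  have hχ (x : P) : χ (π x) = N.mkQ (ψP x) := h1 _ _ (hg _)
  obtain ⟨l, hl⟩ := hQ.exists_lift _ χ fun r x => by
    obtain ⟨x, rfl⟩ := hs x
    rw [← hπ, hχ, hχ, hP.smul, map_smul]
  have h2 : l ∘ₗ π' = N.mkQ := hP.hom_ext _ _ _ fun x => by
    rw [LinearMap.comp_apply, h, hl, hχ]
  have h3 := congr($h2 p)
  rw [LinearMap.comp_apply, hp, map_zero, Submodule.mkQ_apply, eq_comm,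
    Submodule.Quotient.mk_eq_zero] at h3
  exact h3

end

section

variable {T T' : Scheme.{u}}

lemma comp_appLE_apply {X Y Z : Scheme.{u}} (p : X ⟶ Y) (g : Y ⟶ Z) {V : Z.Opens} {V' : Y.Opens}
    {O : X.Opens} (e : V' ≤ g ⁻¹ᵁ V) (e' : O ≤ p ⁻¹ᵁ V') {q : X ⟶ Z} (h : p ≫ g = q)
    (e'' : O ≤ q ⁻¹ᵁ V) (r : Γ(Z, V)) : p.appLE V' O e' (g.appLE V V' e r) = q.appLE V O e'' r := by
  subst h
  exact congr($(Scheme.Hom.appLE_comp_appLE p g V V' O e e') r)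

lemma appLE_preimage_apply {X Y : Scheme.{u}} (p : X ⟶ Y) (V : Y.Opens) (e : p ⁻¹ᵁ V ≤ p ⁻¹ᵁ V)
    (r : Γ(Y, V)) : p.appLE V (p ⁻¹ᵁ V) e r = p.app V r :=
  congr($(p.appLE_eq_app) r)

lemma appLE_comp_app_eq_zero {Z' Z : Scheme.{u}} {g : T' ⟶ T} {V : T.Opens} {V' : T'.Opens}
    (e : V' ≤ g ⁻¹ᵁ V) (p : Z' ⟶ T') (q : Z' ⟶ Z) (i : Z ⟶ T) (h : p ≫ g = q ≫ i) (r : Γ(T, V))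
    (hr : i.app V r = 0) : p.app V' (g.appLE V V' e r) = 0 := by
  have e1 : p ⁻¹ᵁ V' ≤ (p ≫ g) ⁻¹ᵁ V := fun x hx => e hx
  have e2 : p ⁻¹ᵁ V' ≤ q ⁻¹ᵁ i ⁻¹ᵁ V := by
    change _ ≤ (q ≫ i) ⁻¹ᵁ V
    rw [← h]
    exact e1
  rw [← appLE_preimage_apply p V' le_rfl, comp_appLE_apply p g e le_rfl rfl e1,
    ← comp_appLE_apply q i le_rfl e2 h.symm, appLE_preimage_apply, hr, map_zero]

lemma fromSpec_appLE_eq_zero {V' : T'.Opens} (hV' : IsAffineOpen V') {B : CommRingCat.{u}}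
    (σ : Γ(T', V') ⟶ B) {Z' : Scheme.{u}} (m : Spec B ⟶ Z') (p : Z' ⟶ T')
    (h : m ≫ p = Spec.map σ ≫ hV'.fromSpec) (s : Γ(T', V')) (hs : p.app V' s = 0) : σ s = 0 := by
  have e1 : (⊤ : (Spec B).Opens) ≤ (Spec.map σ ≫ hV'.fromSpec) ⁻¹ᵁ V' := by
    rw [Scheme.Hom.comp_preimage, hV'.fromSpec_preimage_self]
    rfl
  have e2 : (⊤ : (Spec B).Opens) ≤ m ⁻¹ᵁ p ⁻¹ᵁ V' := by
    change _ ≤ (m ≫ p) ⁻¹ᵁ V'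
    rw [h]
    exact e1
  have h1 : (Spec.map σ ≫ hV'.fromSpec).appLE V' ⊤ e1 s = 0 := by
    rw [← comp_appLE_apply m p le_rfl e2 h, appLE_preimage_apply, hs, map_zero]
  have h3 : hV'.fromSpec.appLE V' ⊤ (top_le_fromSpec_preimage hV') = (Scheme.ΓSpecIso _).inv := by
    rw [Scheme.Hom.appLE, IsAffineOpen.fromSpec_app_self, Category.assoc, ← Functor.map_comp]
    exact (congrArg _ ((Spec Γ(T', V')).presheaf.map_id _)).trans (Category.comp_id _)
  have h2 : (Spec.map σ).appLE ⊤ ⊤ le_rfl (hV'.fromSpec.appLE V' ⊤ (top_le_fromSpec_preimage hV') s) =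
      0 := (comp_appLE_apply _ _ _ _ rfl e1 s).trans h1
  rw [h3] at h2
  have h4 : (Scheme.ΓSpecIso B).inv (σ s) = 0 := by
    rw [← h2]
    have := congr($(Scheme.ΓSpecIso_inv_naturality σ) s)
    refine Eq.trans this ?_
    exact (appLE_preimage_apply (Spec.map σ) ⊤ le_rfl _).symm
  have h5 := congrArg (Scheme.ΓSpecIso B).hom h4
  simpa using h5

/-- The pulled back ideal is that of the fibre product with the closed subscheme of `J`. The
quotient by the extended ideal gives a point of this fibre product, so functions vanishing on the
latter lie in the extended ideal. -/
lemma ideal_comap_eq_map (J : T.IdealSheafData) (g : T' ⟶ T) (V : T.affineOpens)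
    (V' : T'.affineOpens) (e : V'.1 ≤ g ⁻¹ᵁ V.1) :
    (J.comap g).ideal V' = (J.ideal V).map (g.appLE V.1 V'.1 e).hom := by
  rw [Scheme.IdealSheafData.comap, Scheme.Hom.ker_apply]
  refine le_antisymm ?_ ?_
  · intro s hs
    let K := (J.ideal V).map (g.appLE V.1 V'.1 e).hom
    let σ : Γ(T', V'.1) ⟶ .of (Γ(T', V'.1) ⧸ K) := CommRingCat.ofHom (Ideal.Quotient.mk K)
    let τ : CommRingCat.of (Γ(T, V.1) ⧸ J.ideal V) ⟶ .of (Γ(T', V'.1) ⧸ K) :=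
      CommRingCat.ofHom (Ideal.quotientMap K (g.appLE V.1 V'.1 e).hom Ideal.le_comap_map)
    have hστ : CommRingCat.ofHom (Ideal.Quotient.mk (J.ideal V)) ≫ τ = g.appLE V.1 V'.1 e ≫ σ := by
      ext x
      rfl
    have hV : IsAffineOpen V.1 := V.2
    have hV' : IsAffineOpen V'.1 := V'.2
    obtain ⟨c, hc⟩ : ∃ c : Spec (.of (Γ(T, V.1) ⧸ J.ideal V)) ⟶ J.subscheme, c ≫ J.subschemeι =
        Spec.map (CommRingCat.ofHom (Ideal.Quotient.mk (J.ideal V))) ≫ hV.fromSpec :=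
      ⟨J.subschemeCover.f V, (J.subschemeCover_map_subschemeι V).trans (J.glueDataObjι_ι V)⟩
    have hm : (Spec.map σ ≫ hV'.fromSpec) ≫ g = (Spec.map τ ≫ c) ≫ J.subschemeι := by
      rw [Category.assoc, ← hV.SpecMap_appLE_fromSpec g hV' e, Category.assoc, hc,
        ← Spec.map_comp_assoc, ← Spec.map_comp_assoc, hστ]
    exact Ideal.Quotient.eq_zero_iff_mem.mp
      (fromSpec_appLE_eq_zero hV' σ (pullback.lift _ _ hm) (pullback.fst g J.subschemeι)
        (pullback.lift_fst _ _ _) s hs)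
  · rw [Ideal.map_le_iff_le_comap]
    intro r hr
    rw [← J.ker_subschemeι_app] at hr
    exact appLE_comp_app_eq_zero e _ _ _ pullback.condition r hr

/-- The sections of the ideal sheaf `J` act as zero on `Q`. -/
def IsKilledBy (J : T.IdealSheafData) (Q : T.Modules) : Prop :=
  ∀ V : T.affineOpens, ∀ r ∈ J.ideal V, ∀ q : Γ(Q, V.1), r • q = 0

/-- `π` is the quotient by a submodule of `J P`, over the open subsets of a basis. -/
def IsQuotientBy (J : T.IdealSheafData) {P Q : T.Modules} (π : P ⟶ Q) : Prop :=
  TopologicalSpace.Opens.IsBasis {V : T.Opens | ∃ hV : IsAffineOpen V,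
    Function.Surjective (π.app V) ∧
      ∀ p, π.app V p = 0 → p ∈ J.ideal ⟨V, hV⟩ • (⊤ : Submodule Γ(T, V) Γ(P, V))}

/-- A morphism on sections, as a linear map. -/
def appLinear {P Q : T.Modules} (π : P ⟶ Q) (V : T.Opens) : Γ(P, V) →ₗ[Γ(T, V)] Γ(Q, V) where
  toFun := π.app V
  map_add' := map_add _
  map_smul' r x := Scheme.Modules.Hom.app_smul _ r x

variable {J : T.IdealSheafData} {P Q R : T.Modules} {π : P ⟶ Q}

lemma IsQuotientBy.hom_ext (h : IsQuotientBy J π) {u v : Q ⟶ R} (huv : π ≫ u = π ≫ v) : u = v := by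
  refine hom_ext_of_isBasis h ?_
  rintro V ⟨hV, hs, -⟩ x
  obtain ⟨x, rfl⟩ := hs x
  exact congr(($huv).app V x)

lemma IsQuotientBy.epi (h : IsQuotientBy J π) : Epi π := ⟨fun _ _ => h.hom_ext⟩

/-- The kernel of `π` consists of sections of `J P`, which `u` kills. Together with `IsKilledBy`,
the predicate `IsQuotientBy` characterizes `P / J P` in a form stable under pullback. -/
lemma IsQuotientBy.exists_desc (h : IsQuotientBy J π) (hR : IsKilledBy J R) (u : P ⟶ R) :
    ∃ v : Q ⟶ R, π ≫ v = u := by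
  have := h.epi
  have h0 : kernel.ι π ≫ u = 0 := by
    refine hom_ext_of_isBasis h ?_
    rintro V ⟨hV, -, hker⟩ x
    have hx := hker _ (kernel_ι_app_apply π V x)
    change appLinear u V ((kernel.ι π).app V x) = 0
    refine Submodule.smul_induction_on hx (fun r hr y _ => ?_) fun x y hx hy => ?_
    · rw [map_smul]
      exact hR ⟨V, hV⟩ r hr _
    · rw [map_add, hx, hy, add_zero]
  exact ⟨Abelian.epiDesc π u h0, Abelian.comp_epiDesc π u h0⟩

lemma exists_affine_le (g : T' ⟶ T) {O : T'.Opens} {y : T'} (hy : y ∈ O) {V : T.Opens}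
    (hV : g y ∈ V) : ∃ V' : T'.Opens, IsAffineOpen V' ∧ y ∈ V' ∧ V' ≤ O ∧ V' ≤ g ⁻¹ᵁ V := by
  obtain ⟨V', hV', hyV', h⟩ := exists_isAffineOpen_mem_and_subset (U := O ⊓ g ⁻¹ᵁ V) (x := y)
    ⟨hy, hV⟩
  exact ⟨V', hV', hyV', fun x hx => (h hx).1, fun x hx => (h hx).2⟩

lemma IsKilledBy.pullback (h : IsKilledBy J Q) (hQ : Q.IsQuasicoherent) (g : T' ⟶ T) :
    IsKilledBy (J.comap g) ((Scheme.Modules.pullback g).obj Q) := by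
  intro V r hr q
  refine section_ext _ _ _ fun y hy => ?_
  obtain ⟨O, hO, hyO, -⟩ := exists_isAffineOpen_mem_and_subset (U := (⊤ : T.Opens)) (x := g y) trivial
  obtain ⟨V', hV', hyV', hV'V, e⟩ := exists_affine_le g hy hyO
  refine ⟨V', hV'V, hyV', ?_⟩
  rw [map_smul_opens, map_zero]
  have hr' : T'.presheaf.map (homOfLE hV'V).op r ∈ (J.comap g).ideal ⟨V', hV'⟩ :=
    (J.comap g).ideal_le_comap_ideal (U := ⟨V', hV'⟩) (V := V) hV'V hr
  have key : ∀ s ∈ (J.comap g).ideal ⟨V', hV'⟩, ∀ z : Γ((Scheme.Modules.pullback g).obj Q, V'),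
      s • z = 0 := by
    intro s hs z
    have hbc := isBC_sec g hQ hO hV' e
    rw [ideal_comap_eq_map J g ⟨O, hO⟩ ⟨V', hV'⟩ e] at hs
    have hz : z ∈ Submodule.span Γ(T', V') (Set.range (sec g Q e)) := hbc.span ▸ trivial
    have hle : Ideal.map (g.appLE O V' e).hom (J.ideal ⟨O, hO⟩) ≤
        Module.annihilator Γ(T', V') Γ((Scheme.Modules.pullback g).obj Q, V') := by
      rw [Ideal.map_le_iff_le_comap]
      intro a ha
      rw [Ideal.mem_comap, Module.mem_annihilator]
      intro w
      have hw : w ∈ Submodule.span Γ(T', V') (Set.range (sec g Q e)) := hbc.span ▸ trivial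
      induction hw using Submodule.span_induction with
      | mem x hx =>
        obtain ⟨x, rfl⟩ := hx
        exact (sec_smul g Q e a x).symm.trans (by rw [h ⟨O, hO⟩ a ha, map_zero])
      | zero => exact smul_zero _
      | add x y _ _ hx hy => rw [smul_add, hx, hy, add_zero]
      | smul b x _ hx => rw [smul_comm, hx, smul_zero]
    exact Module.mem_annihilator.mp (hle hs) z
  exact key _ hr' _

/-- Right exactness of base change over small affine opens. -/
lemma IsQuotientBy.pullback (h : IsQuotientBy J π) (hP : P.IsQuasicoherent)
    (hQ : Q.IsQuasicoherent) (g : T' ⟶ T) :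
    IsQuotientBy (J.comap g) ((Scheme.Modules.pullback g).map π) := by
  rw [IsQuotientBy, TopologicalSpace.Opens.isBasis_iff_nbhd]
  intro O' y hy
  obtain ⟨_, ⟨V, ⟨hV, hs, hker⟩, rfl⟩, hyV, -⟩ :=
    h.exists_subset_of_mem_open (show g y ∈ (⊤ : T.Opens) from trivial) (⊤ : T.Opens).2
  obtain ⟨V', hV', hyV', hV'O, e⟩ := exists_affine_le g hy hyV
  have h1 := isBC_sec g hP hV hV' e
  have h2 := isBC_sec g hQ hV hV' e
  have h3 (x : Γ(P, V)) : appLinear ((Scheme.Modules.pullback g).map π) V' (sec g P e x) =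
      sec g Q e ((π.app V).hom x) := sec_map g π e x
  refine ⟨V', ⟨hV', h2.surjective_of_surjective h3 hs, fun p hp => ?_⟩, hyV', hV'O⟩
  rw [ideal_comap_eq_map J g ⟨V, hV⟩ ⟨V', hV'⟩ e]
  exact h1.ker_le_smul_top h2 (fun r x => Scheme.Modules.Hom.app_smul π r x) h3 hs hker hp

end

end TwistedSheaf

namespace TwistedSheaf

section

variable {A B : Type u} [CommRing A] [CommRing B] {P Q P' Q' : Type u} [AddCommGroup P]
  [AddCommGroup Q] [AddCommGroup P'] [AddCommGroup Q'] [Module A P] [Module A Q] [Module B P']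
  [Module B Q'] {σ : A →+* B} {ψP : P →+ P'} {ψQ : Q →+ Q'}

/-- Base change of the quotient of a module by an ideal. -/
lemma IsBC.quotient (hP : IsBC σ ψP) (hψ : ∀ (r : A) x, ψQ (r • x) = σ r • ψQ x)
    (π : P →ₗ[A] Q) (π' : P' →ₗ[B] Q') (h : ∀ x, π' (ψP x) = ψQ (π x))
    (hs : Function.Surjective π) (hs' : Function.Surjective π')
    {J : Ideal A} (hJ : ∀ r ∈ J, ∀ q : Q, r • q = 0)
    (hker : ∀ x, π' x = 0 → x ∈ J.map σ • (⊤ : Submodule B P')) : IsBC σ ψQ where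
  smul := hψ
  exists_lift L _ _ χ hχ := by
    obtain ⟨F, hF⟩ := hP.exists_lift L (χ.comp π.toAddMonoidHom) fun r x => by
      simp [hχ]
    have h0 (r : A) (hr : r ∈ J) (x : P') : F (σ r • x) = 0 := by
      have hx : x ∈ Submodule.span B (Set.range ψP) := hP.span ▸ trivial
      induction hx using Submodule.span_induction with
      | mem x hx =>
        obtain ⟨x, rfl⟩ := hx
        rw [← hP.smul, hF]
        change χ (π (r • x)) = 0
        rw [map_smul, hJ r hr, map_zero]
      | zero => rw [smul_zero, map_zero]
      | add x y _ _ hx hy => rw [smul_add, map_add, hx, hy, add_zero]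
      | smul b x _ hx => rw [smul_comm, map_smul, hx, smul_zero]
    have h1 : LinearMap.ker π' ≤ LinearMap.ker F := by
      intro x hx
      refine Submodule.smul_induction_on (hker x hx) (fun b hb y _ => ?_) fun x y hx hy =>
        add_mem hx hy
      rw [LinearMap.mem_ker]
      induction hb using Submodule.span_induction with
      | mem b hb =>
        obtain ⟨r, hr, rfl⟩ := hb
        exact h0 r hr y
      | zero => rw [zero_smul, map_zero]
      | add x z _ _ hx hz => rw [add_smul, map_add, hx, hz, add_zero]
      | smul b x _ hx => rw [smul_eq_mul, mul_smul, map_smul, hx, smul_zero]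
    refine ⟨(LinearMap.ker π').liftQ F h1 ∘ₗ (π'.quotKerEquivOfSurjective hs').symm.toLinearMap,
      fun x => ?_⟩
    obtain ⟨x, rfl⟩ := hs x
    have h2 : (π'.quotKerEquivOfSurjective hs').symm (ψQ (π x)) =
        (LinearMap.ker π').mkQ (ψP x) := by
      rw [LinearEquiv.symm_apply_eq, ← h]
      rfl
    rw [LinearMap.comp_apply]
    change (LinearMap.ker π').liftQ F h1 ((π'.quotKerEquivOfSurjective hs').symm (ψQ (π x))) = _
    rw [h2]
    exact hF x
  hom_ext L _ _ f g hfg := by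
    have h1 : f ∘ₗ π' = g ∘ₗ π' := hP.hom_ext _ _ _ fun x => by
      rw [LinearMap.comp_apply, LinearMap.comp_apply, h, hfg]
    ext x
    obtain ⟨x, rfl⟩ := hs' x
    exact congr($h1 x)

lemma IsBC.surjective (hP : IsBC σ ψP) (hσ : Function.Surjective σ) : Function.Surjective ψP := by
  intro y
  have hy : y ∈ Submodule.span B (Set.range ψP) := hP.span ▸ trivial
  induction hy using Submodule.span_induction with
  | mem x hx => exact hx
  | zero => exact ⟨0, map_zero _⟩
  | add x y _ _ hx hy =>
    obtain ⟨x, rfl⟩ := hx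
    obtain ⟨y, rfl⟩ := hy
    exact ⟨x + y, map_add _ _ _⟩
  | smul b x _ hx =>
    obtain ⟨x, rfl⟩ := hx
    obtain ⟨b, rfl⟩ := hσ b
    exact ⟨b • x, hP.smul _ _⟩

lemma IsBC.mem_ker_smul_top (hP : IsBC σ ψP) (hσ : Function.Surjective σ) {x : P}
    (hx : ψP x = 0) : x ∈ RingHom.ker σ • (⊤ : Submodule A P) := by
  let I := RingHom.ker σ
  let e := RingHom.quotientKerEquivOfSurjective hσ
  let : Module B (P ⧸ I • (⊤ : Submodule A P)) := Module.compHom _ e.symm.toRingHom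
  obtain ⟨F, hF⟩ := hP.exists_lift (P ⧸ I • (⊤ : Submodule A P))
    (I • (⊤ : Submodule A P)).mkQ.toAddMonoidHom fun r y => by
      have h1 : e.symm (σ r) = Ideal.Quotient.mk _ r := by
        rw [RingEquiv.symm_apply_eq]
        rfl
      change _ = e.symm (σ r) • (I • (⊤ : Submodule A P)).mkQ y
      rw [h1]
      rfl
  have h2 := hF x
  rw [hx, map_zero] at h2
  exact (Submodule.Quotient.mk_eq_zero _).mp h2.symm

end

section

variable {T : Scheme.{u}}

lemma sec_preimage {T' : Scheme.{u}} (g : T' ⟶ T) (M : T.Modules) (V : T.Opens)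
    (e : g ⁻¹ᵁ V ≤ g ⁻¹ᵁ V) (x : Γ(M, V)) : sec g M e x = eta g M V x := by
  rw [sec_apply]
  exact map_self _ _ _

/-- The quotient of a coherent module by an ideal sheaf. -/
lemma exists_quotient (J : T.IdealSheafData) {M : T.Modules} (hM : IsCoherent M) :
    ∃ (Q : T.Modules) (π : M ⟶ Q), IsCoherent Q ∧ IsKilledBy J Q ∧ IsQuotientBy J π := by
  -- The quotient is `i_* i^* M`, for the closed immersion `i` defined by `J`.
  let i := J.subschemeι
  let Q := (Scheme.Modules.pushforward i).obj ((Scheme.Modules.pullback i).obj M)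
  let π : M ⟶ Q := (Scheme.Modules.pullbackPushforwardAdjunction i).unit.app M
  have hπ (V : T.Opens) (x : Γ(M, V)) : π.app V x = sec i M (le_refl (i ⁻¹ᵁ V)) x :=
    (sec_preimage i M V le_rfl x).symm
  have hσ (V : T.Opens) (hV : IsAffineOpen V) :
      Function.Surjective (i.appLE V (i ⁻¹ᵁ V) le_rfl).hom := fun y => by
    obtain ⟨x, rfl⟩ := J.subschemeι_app_surjective ⟨V, hV⟩ y
    exact ⟨x, appLE_preimage_apply _ _ _ _⟩
  have hker (V : T.Opens) (hV : IsAffineOpen V) :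
      RingHom.ker (i.appLE V (i ⁻¹ᵁ V) le_rfl).hom = J.ideal ⟨V, hV⟩ := by
    rw [← J.ker_subschemeι_app, Scheme.Hom.appLE_eq_app]
  have hbc (V : T.Opens) (hV : IsAffineOpen V) := isBC_sec i hM.1 hV (hV.preimage i) le_rfl
  have hs (V : T.Opens) (hV : IsAffineOpen V) : Function.Surjective (π.app V) := fun y => by
    obtain ⟨x, hx⟩ := (hbc V hV).surjective (hσ V hV) y
    exact ⟨x, (hπ V x).trans hx⟩
  have hk (V : T.Opens) (hV : IsAffineOpen V) (x : Γ(M, V)) (hx : π.app V x = 0) :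
      x ∈ J.ideal ⟨V, hV⟩ • (⊤ : Submodule Γ(T, V) Γ(M, V)) := by
    rw [← hker V hV]
    exact (hbc V hV).mem_ker_smul_top (hσ V hV) ((hπ V x).symm.trans hx)
  have hkill : IsKilledBy J Q := by
    intro V r hr q
    have h1 : i.app V.1 r = 0 := by
      rw [← J.ker_subschemeι_app] at hr
      exact hr
    let q' : Γ((Scheme.Modules.pullback i).obj M, i ⁻¹ᵁ V.1) := q
    change i.app V.1 r • q' = 0
    rw [h1, zero_smul]
  refine ⟨Q, π, ⟨isQuasicoherent_of_isBC_basicOpen _ fun V hV r => ?_, fun V hV => ?_⟩, hkill, ?_⟩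
  · have hD := hV.basicOpen r
    refine (isBC_restrict hM.1 hV hD (T.basicOpen_le r)).quotient
      (map_smul_opens Q _) (appLinear π V) (appLinear π _) (fun x => app_map π _ x) (hs V hV)
      (hs _ hD) (J := J.ideal ⟨V, hV⟩) (hkill ⟨V, hV⟩) fun x hx => ?_
    have h1 := J.map_ideal (U := ⟨_, hD⟩) (V := ⟨V, hV⟩) (T.basicOpen_le r)
    have h2 := hk _ hD x hx
    rw [← h1] at h2
    exact h2
  · have := hM.2 V hV
    exact Module.Finite.of_surjective (appLinear π V) (hs V hV)
  · rw [IsQuotientBy, TopologicalSpace.Opens.isBasis_iff_nbhd]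
    intro O y hy
    obtain ⟨V, hV, hyV, hVO⟩ := exists_isAffineOpen_mem_and_subset hy
    exact ⟨V, ⟨hV, hs V hV, hk V hV⟩, hyV, hVO⟩

end

end TwistedSheaf

/-! ### Quotients of twisted sheaves and their supports. -/

namespace TwistedSheaf

variable {S : Scheme.{u}} {ι : Type t} {U : ι → Scheme.{u}} {f : ∀ i, U i ⟶ S} {α : Cocycle f}

section Quotient

variable (M : Sheaf f α) (I : S.IdealSheafData) (Q : ∀ i, (U i).Modules) (π : ∀ i, M.obj i ⟶ Q i)

/-- The ideals pulled back through `U i` and through `U j` agree on `T`, as both come from `S`. So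
the target is killed by the ideal that defines the source, and `φ` passes to the quotients. -/
lemma exists_quotient_hom
    (hM : ∀ i, (M.obj i).IsQuasicoherent) (hQ : ∀ i, (Q i).IsQuasicoherent)
    (hk : ∀ i, IsKilledBy (I.comap (f i)) (Q i)) (hq : ∀ i, IsQuotientBy (I.comap (f i)) (π i))
    {T : Scheme.{u}} {i j : ι} (a : T ⟶ U i) (b : T ⟶ U j) (h : a ≫ f i = b ≫ f j)
    (φ : (Scheme.Modules.pullback b).obj (M.obj j) ⟶ (Scheme.Modules.pullback a).obj (M.obj i)) :
    ∃ v : (Scheme.Modules.pullback b).obj (Q j) ⟶ (Scheme.Modules.pullback a).obj (Q i),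
      (Scheme.Modules.pullback b).map (π j) ≫ v = φ ≫ (Scheme.Modules.pullback a).map (π i) := by
  refine ((hq j).pullback (hM j) (hQ j) b).exists_desc ?_ _
  have h1 := (hk i).pullback (hQ i) a
  rw [← Scheme.IdealSheafData.comap_comp, h, Scheme.IdealSheafData.comap_comp] at h1
  exact h1

lemma epi_pullback_map
    (hM : ∀ i, (M.obj i).IsQuasicoherent) (hQ : ∀ i, (Q i).IsQuasicoherent)
    (hq : ∀ i, IsQuotientBy (I.comap (f i)) (π i))
    {T : Scheme.{u}} {j : ι} (b : T ⟶ U j) : Epi ((Scheme.Modules.pullback b).map (π j)) :=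
  ((hq j).pullback (hM j) (hQ j) b).epi

/-- The quotient of a twisted sheaf by an ideal sheaf on the base. -/
lemma Coh.exists_quotient (M : Coh f α) (I : S.IdealSheafData) :
    ∃ (Q : Coh f α) (π : M ⟶ Q), (∀ i, IsKilledBy (I.comap (f i)) (Q.obj.obj i)) ∧
      ∀ i, IsQuotientBy (I.comap (f i)) (π.hom.hom i) := by
  choose Q π hQ hk hq using fun i => TwistedSheaf.exists_quotient (I.comap (f i)) (M.property i)
  have hM i := (M.property i).1
  have hQ' i := (hQ i).1
  have ex {T : Scheme.{u}} {i j : ι} (a : T ⟶ U i) (b : T ⟶ U j) (h : a ≫ f i = b ≫ f j) :=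
    exists_quotient_hom M.obj I Q π hM hQ' hk hq a b h
  have he {T : Scheme.{u}} {j : ι} (b : T ⟶ U j) := epi_pullback_map M.obj I Q π hM hQ' hq b
  let v {T : Scheme.{u}} {i j : ι} (a : T ⟶ U i) (b : T ⟶ U j) (h : a ≫ f i = b ≫ f j) :=
    (ex a b h (M.obj.φ a b h).hom).choose
  have hv {T : Scheme.{u}} {i j : ι} (a : T ⟶ U i) (b : T ⟶ U j) (h : a ≫ f i = b ≫ f j) :
      (Scheme.Modules.pullback b).map (π j) ≫ v a b h =
        (M.obj.φ a b h).hom ≫ (Scheme.Modules.pullback a).map (π i) :=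
    (ex a b h (M.obj.φ a b h).hom).choose_spec
  let w {T : Scheme.{u}} {i j : ι} (a : T ⟶ U i) (b : T ⟶ U j) (h : a ≫ f i = b ≫ f j) :=
    (ex b a h.symm (M.obj.φ a b h).inv).choose
  have hw {T : Scheme.{u}} {i j : ι} (a : T ⟶ U i) (b : T ⟶ U j) (h : a ≫ f i = b ≫ f j) :
      (Scheme.Modules.pullback a).map (π i) ≫ w a b h =
        (M.obj.φ a b h).inv ≫ (Scheme.Modules.pullback b).map (π j) :=
    (ex b a h.symm (M.obj.φ a b h).inv).choose_spec
  let Q₀ : Sheaf f α :=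
    { obj := Q
      φ a b h :=
        { hom := v a b h
          inv := w a b h
          hom_inv_id := by
            have := he b
            rw [← cancel_epi ((Scheme.Modules.pullback b).map (π _)), reassoc_of% hv, hw,
              Iso.hom_inv_id_assoc, Category.comp_id]
          inv_hom_id := by
            have := he a
            rw [← cancel_epi ((Scheme.Modules.pullback a).map (π _)), reassoc_of% hw, hv,
              Iso.inv_hom_id_assoc, Category.comp_id] }
      pullHom_φ g i j a b h := by
        have := he (g ≫ b)
        have h' : (g ≫ a) ≫ f i = (g ≫ b) ≫ f j := by rw [Category.assoc, h, Category.assoc]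
        change pullHom g (v a b h) = v (g ≫ a) (g ≫ b) h'
        rw [← cancel_epi ((Scheme.Modules.pullback (g ≫ b)).map (π _)), hv, ← ph_rfl,
          ← M.obj.ph_φ g rfl rfl h h', ← ph_map g rfl (π i), ← ph_comp, ← hv, ph_comp g rfl rfl rfl, ph_map]
      φ_comp a b c hab hbc := by
        have := he c
        change v b c hbc ≫ v a b hab = v a c (hab.trans hbc) ≫ _
        rw [← cancel_epi ((Scheme.Modules.pullback c).map (π _)), reassoc_of% hv, hv,
          reassoc_of% hv, ← smulEnd_comp, ← Category.assoc, M.obj.φ_comp, Category.assoc] }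
  let Q₁ : Coh f α := ⟨Q₀, hQ⟩
  let p : M.obj ⟶ Q₀ := { hom := π, comm a b h := hv a b h }
  exact ⟨Q₁, ObjectProperty.homMk p, hk, hq⟩

end Quotient

section Support

lemma eq_zero_or_isUnit_ΓSpec {K : Type u} [Field K] (r : Γ(Spec (.of K), ⊤)) : r = 0 ∨ IsUnit r := by
  let e : Γ(Spec (.of K), ⊤) ≃+* K := (Scheme.ΓSpecIso (.of K)).commRingCatIsoToRingEquiv
  let : Field Γ(Spec (.of K), ⊤) := (e.isField (Field.toIsField K)).toField
  by_cases h : r = 0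
  · exact .inl h
  · exact .inr (IsUnit.mk0 r h)

/-- Over a field the ideal is zero or everything: `π` is injective in the first case, and `Q`
vanishes in the second. -/
lemma nontrivial_quotient_iff {K : Type u} [Field K] (z : Spec (.of K))
    (J : (Spec (.of K)).IdealSheafData) {P Q : (Spec (.of K)).Modules} (π : P ⟶ Q)
    (hk : IsKilledBy J Q) (hq : IsQuotientBy J π) :
    Nontrivial Γ(Q, ⊤) ↔ Nontrivial Γ(P, ⊤) ∧ z ∈ J.support := by
  obtain ⟨_, ⟨V, ⟨hV, hs, hker⟩, rfl⟩, hzV, -⟩ :=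
    hq.exists_subset_of_mem_open (show z ∈ (⊤ : (Spec (.of K)).Opens) from trivial)
      (⊤ : (Spec (.of K)).Opens).2
  obtain rfl : V = ⊤ := by
    ext w
    exact ⟨fun _ => trivial, fun _ => (Subsingleton.elim w z) ▸ hzV⟩
  have h1 := J.mem_support_iff_of_mem (U := ⟨⊤, hV⟩) (x := z) trivial
  have hz : z ∈ J.support ↔ ∀ r ∈ J.ideal ⟨⊤, hV⟩, r = 0 := by
    rw [h1, Scheme.mem_zeroLocus_iff]
    refine forall₂_congr fun r hr => ?_
    rcases eq_zero_or_isUnit_ΓSpec r with rfl | hu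
    · simp
    · rw [Scheme.basicOpen_of_isUnit _ hu]
      refine iff_of_false (fun h => h trivial) ?_
      rintro rfl
      have hz : z ∈ (Spec (.of K)).basicOpen (0 : Γ(Spec (.of K), ⊤)) := by
        rw [Scheme.basicOpen_of_isUnit _ hu]
        trivial
      rw [Scheme.basicOpen_zero] at hz
      exact hz
  by_cases hzJ : z ∈ J.support
  · rw [and_iff_left hzJ]
    rw [hz] at hzJ
    have hinj : Function.Injective (π.app ⊤) := by
      rw [injective_iff_map_eq_zero]
      intro x hx
      refine Submodule.smul_induction_on (hker x hx) (fun r hr y _ => ?_) fun x y hx hy => ?_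
      · rw [hzJ r hr, zero_smul]
      · rw [hx, hy, add_zero]
    exact ⟨fun _ => hs.nontrivial, fun _ => hinj.nontrivial⟩
  · refine iff_of_false ?_ fun h => hzJ h.2
    rw [hz] at hzJ
    push Not at hzJ
    obtain ⟨r, hr, hr0⟩ := hzJ
    rw [not_nontrivial_iff_subsingleton]
    refine subsingleton_of_forall_eq 0 fun q => ?_
    have hu := (eq_zero_or_isUnit_ΓSpec r).resolve_left hr0
    exact (hu.smul_eq_zero).mp (hk ⟨⊤, hV⟩ r hr q)

lemma Coh.mem_support_quotient {M Q : Coh f α} {I : S.IdealSheafData} {π : M ⟶ Q}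
    (hk : ∀ i, IsKilledBy (I.comap (f i)) (Q.obj.obj i))
    (hq : ∀ i, IsQuotientBy (I.comap (f i)) (π.hom.hom i)) (hs : ∀ x, ∃ i y, f i y = x) :
    Q.obj.support = M.obj.support ∩ I.support := by
  ext x
  obtain ⟨i, y, rfl⟩ := hs x
  obtain ⟨K, _, c, z, rfl⟩ := exists_field_point y
  have h1 := nontrivial_quotient_iff z _ _ ((hk i).pullback (Q.property i).1 c)
    ((hq i).pullback (M.property i).1 (Q.property i).1 c)
  rw [Q.mem_support_iff, h1, Set.mem_inter_iff, M.mem_support_iff,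
    Scheme.IdealSheafData.support_comap, Scheme.IdealSheafData.support_comap]
  rfl

end Support

end TwistedSheaf

/-! ### Morphisms between sheaves supported at a closed point. -/

namespace TwistedSheaf

variable {S : Scheme.{u}} {ι : Type t} {U : ι → Scheme.{u}} {f : ∀ i, U i ⟶ S} {α : Cocycle f}

lemma Nice.isClosed_support (hα : Nice α) (M : Coh f α) : IsClosed M.obj.support :=
  M.isClosed_support hα.isOpenMap hα.surj

lemma Nice.exists_quotient (hα : Nice α) (M : Coh f α) {Z : Set S} (hZ : IsClosed Z) :
    ∃ (Q : Coh f α) (π : M ⟶ Q), Epi π ∧ Q.obj.support = M.obj.support ∩ Z := by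
  let I := Scheme.IdealSheafData.vanishingIdeal ⟨Z, hZ⟩
  obtain ⟨Q, π, hk, hq⟩ := Coh.exists_quotient M I
  refine ⟨Q, π, ⟨fun u v h => ?_⟩, ?_⟩
  · apply ObjectProperty.hom_ext
    ext i : 1
    exact (hq i).hom_ext congr(($h).hom.hom i)
  · rw [Coh.mem_support_quotient hk hq hα.surj]
    simp [I]

lemma Coh.support_eq_empty {M : Coh f α} (h : 𝟙 M = 0) : M.obj.support = ∅ := by
  refine Set.eq_empty_of_forall_notMem ?_
  rintro x ⟨i, y, rfl, hy⟩
  refine (M.notMem_support_iff y).mpr ?_ ⟨i, y, rfl, hy⟩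
  obtain ⟨V, hV, hyV, -⟩ := exists_isAffineOpen_mem_and_subset (U := (⊤ : (U i).Opens)) (x := y)
    trivial
  exact ⟨V, hV, hyV, subsingleton_of_forall_eq 0 fun x => congr((($h).hom.hom i).app V x)⟩

/-- If `x` is missing from the support of `M`, the composite to the quotient of `M'` at `x` is zero
for reasons of support, so this quotient is zero. The argument uses only the categorical meaning of
an epimorphism. -/
lemma Nice.mem_support_of_epi (hα : Nice α) {M M' : Coh f α} (p : M ⟶ M') [Epi p] {x : S}
    (hx : IsClosed {x}) (h : x ∈ M'.obj.support) : x ∈ M.obj.support := by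
  by_contra hxM
  obtain ⟨Q, π, hπ, hQ⟩ := hα.exists_quotient M' hx
  have h1 : p ≫ π = 0 := Coh.hom_eq_zero_of_disjoint (by
    rw [hQ, Set.disjoint_left]
    rintro y hy ⟨-, rfl⟩
    exact hxM hy) _
  have h2 : π = 0 := by
    rw [← cancel_epi p, h1, comp_zero]
  have h3 : 𝟙 Q = 0 := by
    rw [← cancel_epi π, h2, zero_comp, zero_comp]
  have h4 := Coh.support_eq_empty h3
  rw [hQ] at h4
  exact (h4 ▸ (⟨h, rfl⟩ : x ∈ M'.obj.support ∩ {x}) : x ∈ (∅ : Set S))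

lemma Coh.isZeroOver (N : Coh f α) (O : S.Opens) (h : Disjoint N.obj.support O) :
    N.obj.IsZeroOver O := by
  intro i V hV hVO
  refine subsingleton_of_forall_eq 0 fun s => section_ext _ _ _ fun y hy => ?_
  obtain ⟨V', hV', hyV', h'⟩ := (N.notMem_support_iff y).mp (Set.disjoint_right.mp h (hVO hy))
  obtain ⟨V'', hV'', hyV'', hle⟩ := exists_isAffineOpen_mem_and_subset (U := V ⊓ V') (x := y)
    ⟨hy, hyV'⟩
  have := subsingleton_of_le (N.property i).1 hV' hV'' fun z hz => (hle hz).2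
  exact ⟨V'', fun z hz => (hle hz).1, hyV'', Subsingleton.elim _ _⟩

section Local

variable {B : Type u} [CommRing B] {i : ι} (t : Spec (.of B) ⟶ U i)

lemma finite_of_le (N : Coh f α) {O : (U i).Opens} (hO : IsAffineOpen O)
    (h : (⊤ : (Spec (.of B)).Opens) ≤ t ⁻¹ᵁ O) :
    Module.Finite B Γ((Scheme.Modules.pullback t).obj (N.obj.obj i), ⊤) := by
  have := (N.property i).2 O hO
  have h1 := isBC_sec t (N.property i).1 hO (isAffineOpen_top _) h
  have h2 : IsBC (Scheme.ΓSpecIso (.of B)).hom.hom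
      (AddMonoidHom.id Γ((Scheme.Modules.pullback t).obj (N.obj.obj i), ⊤)) :=
    .of_bijective (ConcreteCategory.bijective_of_isIso _) Function.bijective_id fun r x => by
      refine Eq.trans ?_ (smul_Spec_top (.of B) _ _ x).symm
      exact congrArg (fun s : Γ(Spec (.of B), ⊤) => s • x)
        (congr($((Scheme.ΓSpecIso (.of B)).hom_inv_id) r)).symm
  exact (h1.comp h2).finite

lemma exists_pow_smul_eq_zero {R : CommRingCat.{u}} {L : (Spec R).Modules} (hL : L.IsQuasicoherent)
    (r : R) (h : Subsingleton Γ(L, PrimeSpectrum.basicOpen r)) (x : Γ(L, ⊤)) :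
    ∃ n : ℕ, r ^ n • x = 0 := by
  have h1 : IsIso L.fromTildeΓ := inferInstance
  rw [isIso_fromTildeΓ_iff_isLocalizing] at h1
  have h2 := h1 r
  obtain ⟨⟨_, n, rfl⟩, hn⟩ := (IsLocalizedModule.eq_zero_iff (.powers r)
    ((modulesSpecToSheaf.obj L).obj.map (PrimeSpectrum.basicOpen r).leTop.op).hom (m := x)).mp
    (h.elim _ _)
  exact ⟨n, hn⟩

/-- Homomorphisms between coherent twisted sheaves with nested supports over a flat chart. -/
lemma exists_hom_ne_zero [IsNoetherianRing B] {M N : Coh f α} {O : (U i).Opens}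
    (hO : IsAffineOpen O) (h : (⊤ : (Spec (.of B)).Opens) ≤ t ⁻¹ᵁ O)
    (hMN : N.obj.support ⊆ M.obj.support) {z : Spec (.of B)} (hz : f i (t z) ∈ N.obj.support) :
    ∃ v : (Scheme.Modules.pullback t).obj (M.obj.obj i) ⟶
      (Scheme.Modules.pullback t).obj (N.obj.obj i), v ≠ 0 := by
  let P := (Scheme.Modules.pullback t).obj (M.obj.obj i)
  let Q := (Scheme.Modules.pullback t).obj (N.obj.obj i)
  have hP : Module.Finite B Γ(P, ⊤) := finite_of_le t M hO h
  have hQ : Module.Finite B Γ(Q, ⊤) := finite_of_le t N hO h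
  by_contra! h0
  have hsub : Subsingleton (Γ(P, ⊤) →ₗ[B] Γ(Q, ⊤)) := by
    refine subsingleton_of_forall_eq 0 fun w => ?_
    let e := homΓLinearEquiv (R := .of B) (qcoh_pullback t (M.property i).1 : P.IsQuasicoherent) Q
    have := h0 (e.symm w)
    exact (LinearEquiv.map_eq_zero_iff e.symm).mp this
  -- For finite modules over a Noetherian ring, vanishing of all homomorphisms yields an `r` that
  -- kills the source and is regular on the target.
  rw [IsSMulRegular.subsingleton_linearMap_iff] at hsub
  obtain ⟨r, hr, hreg⟩ := hsub
  rw [Module.mem_annihilator] at hr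
  -- On `D(r)` the source vanishes, hence so does the target by the inclusion of supports. Then
  -- every section of the target is killed by a power of `r`, and regularity makes the target zero.
  have hD : Subsingleton Γ(Q, PrimeSpectrum.basicOpen r) := by
    refine subsingleton_of_forall_eq 0 fun s => section_ext _ _ _ fun y hy => ?_
    obtain ⟨K, _, c, z', hz'⟩ := exists_field_point y
    have hcM : f i (t y) ∉ M.obj.support := by
      rw [← hz', ← Scheme.Hom.comp_apply c t, M.mem_support_iff, not_nontrivial_iff_subsingleton]
      have hc : Spec.map (Spec.preimage c) = c := Spec.map_preimage c
      have hbc := isBC_res_SpecMap (Spec.preimage c) (b' := c ≫ t) (by rw [hc]) (M.property i).1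
      refine hbc.subsingleton_of_smul_eq_zero (r := r) hr ?_
      have h1 : y ∈ PrimeSpectrum.basicOpen r := hy
      rw [← hz', ← hc] at h1
      have h2 : Spec.preimage c r ∉ z'.asIdeal := h1
      refine IsUnit.mk0 (G₀ := K) _ fun h3 => h2 ?_
      rw [h3]
      exact zero_mem _
    obtain ⟨V, hV, hyV, h1⟩ := (N.notMem_support_iff (t y)).mp fun h => hcM (hMN h)
    obtain ⟨V', hV', hyV', hV'D, e⟩ := exists_affine_le t hy hyV
    have := (isBC_sec t (N.property i).1 hV hV' e).subsingleton
    exact ⟨V', hV'D, hyV', Subsingleton.elim _ _⟩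
  have hQ0 : Subsingleton Γ(Q, ⊤) := by
    refine subsingleton_of_forall_eq 0 fun x => ?_
    obtain ⟨n, hn⟩ := exists_pow_smul_eq_zero (R := .of B) (qcoh_pullback t (N.property i).1) r hD x
    exact (hreg.pow n) (hn.trans (smul_zero _).symm)
  obtain ⟨K, _, c, z', rfl⟩ := exists_field_point z
  have h1 := N.mem_support_iff (c ≫ t) z'
  rw [Scheme.Hom.comp_apply] at h1
  rw [h1, ← not_subsingleton_iff_nontrivial] at hz
  have hc : Spec.map (Spec.preimage c) = c := Spec.map_preimage c
  exact hz (isBC_res_SpecMap (Spec.preimage c) (b' := c ≫ t) (by rw [hc])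
    (N.property i).1).subsingleton

lemma span_compat_of_isAffineOpen [IsNoetherianRing B] [Flat (t ≫ f i)] {W : S.Opens}
    (hW : IsAffineOpen W) (hr : Set.range (t ≫ f i) ⊆ W) (M N : Coh f α)
    [Module.Finite B Γ((Scheme.Modules.pullback t).obj (M.obj.obj i), ⊤)] :
    Submodule.span B {v : (Scheme.Modules.pullback t).obj (M.obj.obj i) ⟶
      (Scheme.Modules.pullback t).obj (N.obj.obj i) | Sheaf.Compat M.obj N.obj t v} = ⊤ := by
  have hr' : Set.range (t ≫ f i) ⊆ Set.range hW.fromSpec := by rwa [hW.range_fromSpec]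
  let l := IsOpenImmersion.lift hW.fromSpec (t ≫ f i) hr'
  have hl : l ≫ hW.fromSpec = t ≫ f i := IsOpenImmersion.lift_fac _ _ _
  have hflat : Flat l := by
    have : Flat (l ≫ hW.fromSpec) := hl ▸ inferInstance
    exact flat_of_flat_comp_mono l hW.fromSpec
  let φ : Γ(S, W) ⟶ .of B := Spec.preimage l
  have hφ : Spec.map φ = l := Spec.map_preimage l
  let A : Type u := Γ(S, W)
  let : Algebra A B := φ.hom.toAlgebra
  have : Module.Flat A B := by
    have h1 : Flat (Spec.map φ) := hφ ▸ hflat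
    exact Flat.SpecMap_iff.mp h1
  have ht : t ≫ f i = Spec.map (CommRingCat.ofHom (algebraMap A B)) ≫ hW.fromSpec := by
    rw [← hl, ← hφ]
    rfl
  have : Module.FinitePresentation B Γ((Scheme.Modules.pullback t).obj (M.obj.obj i), ⊤) :=
    Module.finitePresentation_of_finite _ _
  exact Sheaf.span_compat (M := M.obj) (N := N.obj) (j := hW.fromSpec)
    (M.property i).1 (N.property i).1 ht

end Local

/-- Over a chart around `x` the pullbacks have a nonzero homomorphism. Compatible homomorphisms
span, so one of them is nonzero, and it descends to all of `S` since `N` vanishes off `x`. -/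
lemma Nice.exists_hom_ne_zero (hα : Nice α) {M N : Coh f α} {x : S} (hx : IsClosed {x})
    (hM : M.obj.support = {x}) (hN : N.obj.support = {x}) : ∃ u : M ⟶ N, u ≠ 0 := by
  obtain ⟨W, hxW, -, ⟨C⟩⟩ := hα.exists_chart (x := x) (O := ⊤) trivial
  have := C.isNoetherian
  have := C.isAffineHom
  have := C.flat
  obtain ⟨z, hz⟩ : x ∈ Set.range (C.t ≫ f C.i₀) := C.range_eq ▸ hxW
  obtain ⟨v, hv⟩ := TwistedSheaf.exists_hom_ne_zero C.t C.isAffineOpen_O C.le (M := M) (N := N)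
    (by rw [hM, hN]) (z := z) (by
      rw [← Scheme.Hom.comp_apply, hz, hN]
      rfl)
  have := finite_of_le C.t M C.isAffineOpen_O C.le
  have hspan := span_compat_of_isAffineOpen C.t C.isAffineOpen C.range_eq.le M N
  obtain ⟨w, hw, hw0⟩ : ∃ w, Sheaf.Compat M.obj N.obj C.t w ∧ w ≠ 0 := by
    by_contra! hcon
    have h1 : v ∈ (⊤ : Submodule C.B _) := trivial
    rw [← hspan] at h1
    refine hv ?_
    clear hv
    induction h1 using Submodule.span_induction with
    | mem x hx => exact hcon x hx
    | zero => rfl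
    | add x y _ _ hx hy => rw [hx, hy, add_zero]
    | smul b x _ hx => rw [hx, smul_zero]
  obtain ⟨u, hu⟩ := Sheaf.exists_hom_of_compat (M := M.obj) (N := N.obj) (fun i => (N.property i).1)
    (W₀ := ⟨{x}ᶜ, hx.isOpen_compl⟩) (W₁ := W) (by
      ext y
      by_cases hy : y = x
      · exact ⟨fun _ => trivial, fun _ => .inl (hy ▸ hxW)⟩
      · exact ⟨fun _ => trivial, fun _ => .inr hy⟩)
    (N.isZeroOver _ (by rw [hN]; exact disjoint_compl_right)) (by rw [C.range_eq]) hw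
  refine ⟨ObjectProperty.homMk u, fun h => hw0 ?_⟩
  have h1 : u.hom C.i₀ = 0 := congr(($h).hom.hom C.i₀)
  rw [← hu, h1, Functor.map_zero]

end TwistedSheaf

/-! ### The homeomorphism defined by an equivalence. -/

namespace TwistedSheaf

section Meets

variable {C : Type*} [Category C] [HasZeroMorphisms C] {D : Type*} [Category D]
  [HasZeroMorphisms D]

/-- There is a nonzero morphism between quotients of `M` and `N`. -/
def Meets (M N : C) : Prop :=
  ∃ (M' N' : C) (p : M ⟶ M') (q : N ⟶ N') (v : M' ⟶ N'), Epi p ∧ Epi q ∧ v ≠ 0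

lemma Meets.map (F : C ≌ D) {M N : C} (h : Meets M N) :
    Meets (F.functor.obj M) (F.functor.obj N) := by
  obtain ⟨M', N', p, q, v, hp, hq, hv⟩ := h
  refine ⟨_, _, F.functor.map p, F.functor.map q, F.functor.map v, inferInstance, inferInstance,
    fun h => hv (F.functor.map_injective (h.trans (F.functor.map_zero _ _).symm))⟩

lemma Meets.of_iso {M N M₁ N₁ : C} (h : Meets M N) (e : M₁ ≅ M) (e' : N₁ ≅ N) : Meets M₁ N₁ := by
  obtain ⟨M', N', p, q, v, hp, hq, hv⟩ := h
  exact ⟨_, _, e.hom ≫ p, e'.hom ≫ q, v, epi_comp _ _, epi_comp _ _, hv⟩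

lemma meets_obj_iff (F : C ≌ D) {M : D} {N : C} :
    Meets M (F.functor.obj N) ↔ Meets (F.inverse.obj M) N :=
  ⟨fun h => (h.map F.symm).of_iso (Iso.refl _) (F.unitIso.app N),
    fun h => (h.map F).of_iso (F.counitIso.app M).symm (Iso.refl _)⟩

end Meets

section

variable {S : Scheme.{u}} {ι : Type t} {U : ι → Scheme.{u}} {f : ∀ i, U i ⟶ S} {α : Cocycle f}

/-- By compactness every nonempty closed set contains a closed point. At such a point of the
intersection both sheaves have quotients with this point as support; conversely, closed points in
the support of a quotient lie in the support of the sheaf. -/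
lemma Nice.meets_iff (hα : Nice α) {M N : Coh f α} :
    Meets M N ↔ (M.obj.support ∩ N.obj.support).Nonempty := by
  have := hα.compact
  have hMN := (hα.isClosed_support M).inter (hα.isClosed_support N)
  constructor
  · rintro ⟨M', N', p, q, v, hp, hq, hv⟩
    have h1 : (M'.obj.support ∩ N'.obj.support).Nonempty := by
      rw [Set.nonempty_iff_ne_empty]
      exact fun h => hv (Coh.hom_eq_zero_of_disjoint (Set.disjoint_iff_inter_eq_empty.mpr h) v)
    obtain ⟨x, hx, hcl⟩ :=
      ((hα.isClosed_support M').inter (hα.isClosed_support N')).exists_closed_singleton h1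
    exact ⟨x, hα.mem_support_of_epi p hcl hx.1, hα.mem_support_of_epi q hcl hx.2⟩
  · intro h
    obtain ⟨x, hx, hcl⟩ := hMN.exists_closed_singleton h
    obtain ⟨M', p, hp, hM'⟩ := hα.exists_quotient M hcl
    obtain ⟨N', q, hq, hN'⟩ := hα.exists_quotient N hcl
    obtain ⟨v, hv⟩ := hα.exists_hom_ne_zero hcl
      (hM'.trans (Set.inter_eq_right.mpr (Set.singleton_subset_iff.mpr hx.1)))
      (hN'.trans (Set.inter_eq_right.mpr (Set.singleton_subset_iff.mpr hx.2)))
    exact ⟨M', N', p, q, v, hp, hq, hv⟩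

/-- A sheaf whose support contains the generic point is cut down to `Z`. -/
lemma Nice.exists_support_eq (hα : Nice α) (hr : RestrictionCondition α) {Z : Set S}
    (hZ : IsClosed Z) {x : S} (h : closure {x} = Z) : ∃ K : Coh f α, K.obj.support = Z := by
  obtain ⟨N, hN⟩ := hα.exists_mem_support hr x
  obtain ⟨K, -, -, hK⟩ := hα.exists_quotient N hZ
  refine ⟨K, hK.trans (Set.inter_eq_right.mpr ?_)⟩
  rw [← h]
  exact closure_minimal (Set.singleton_subset_iff.mpr hN) (hα.isClosed_support N)

/-- If the inclusion fails, the Jacobson property gives a closed point of the support of `M` outside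
the union, and a sheaf supported at this point is a counterexample. Finiteness makes the union
closed. -/
lemma Nice.support_subset_iff (hα : Nice α) (hr : RestrictionCondition α) {κ : Type*} [Finite κ]
    {M : Coh f α} {N : κ → Coh f α} : M.obj.support ⊆ ⋃ j, (N j).obj.support ↔
      ∀ K : Coh f α, Meets K M → ∃ j, Meets K (N j) := by
  have := hα.jacobson
  simp_rw [hα.meets_iff]
  constructor
  · rintro h K ⟨x, hxK, hxM⟩
    obtain ⟨j, hj⟩ := Set.mem_iUnion.mp (h hxM)
    exact ⟨j, x, hxK, hj⟩
  · intro h x hx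
    by_contra hxN
    have hcl : IsClosed (⋃ j, (N j).obj.support) :=
      isClosed_iUnion_of_finite fun j => hα.isClosed_support (N j)
    have h1 := closure_inter_closedPoints (hα.isClosed_support M)
    rw [← h1] at hx
    obtain ⟨y, hyN, hyM, hy⟩ := mem_closure_iff.mp hx _ hcl.isOpen_compl hxN
    have hy : IsClosed {y} := hy
    obtain ⟨K, hK⟩ := hα.exists_support_eq hr hy (x := y) hy.closure_eq
    obtain ⟨j, z, hzK, hz⟩ := h K ⟨y, by rw [hK]; rfl, hyM⟩
    rw [hK] at hzK
    obtain rfl : z = y := hzK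
    exact hyN (Set.mem_iUnion.mpr ⟨j, hz⟩)

end

section

variable {X Y : Scheme.{u}} {ι : Type t} {U : ι → Scheme.{u}} {f : ∀ i, U i ⟶ X}
  {κ : Type t'} {V : κ → Scheme.{u}} {g : ∀ i, V i ⟶ Y} {α : Cocycle f} {β : Cocycle g}

lemma support_subset_iff_map (hα : Nice α) (hβ : Nice β) (hrα : RestrictionCondition α)
    (hrβ : RestrictionCondition β) (F : Coh f α ≌ Coh g β) {I : Type*} [Finite I] {M : Coh f α}
    {N : I → Coh f α} : M.obj.support ⊆ ⋃ j, (N j).obj.support ↔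
      (F.functor.obj M).obj.support ⊆ ⋃ j, (F.functor.obj (N j)).obj.support := by
  rw [hα.support_subset_iff hrα, hβ.support_subset_iff hrβ (N := fun j => F.functor.obj (N j))]
  simp_rw [meets_obj_iff]
  refine ⟨fun h K => h _, fun h K hK => ?_⟩
  have e : K ≅ F.inverse.obj (F.functor.obj K) := F.unitIso.app K
  obtain ⟨j, hj⟩ := h (F.functor.obj K) (hK.of_iso e.symm (Iso.refl _))
  exact ⟨j, hj.of_iso e (Iso.refl _)⟩

lemma support_subset_iff_map₁ (hα : Nice α) (hβ : Nice β) (hrα : RestrictionCondition α)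
    (hrβ : RestrictionCondition β) (F : Coh f α ≌ Coh g β) {M N : Coh f α} :
    M.obj.support ⊆ N.obj.support ↔
      (F.functor.obj M).obj.support ⊆ (F.functor.obj N).obj.support := by
  have h := support_subset_iff_map hα hβ hrα hrβ F (I := Unit) (M := M) (N := fun _ => N)
  rwa [Set.iUnion_const, Set.iUnion_const] at h

/-- The compatibility of a map of spaces with the supports of twisted sheaves. -/
def PreservesSupport (F : Coh f α ≌ Coh g β) (h : X → Y) : Prop :=
  ∀ (M : Coh f α) (x : X), x ∈ M.obj.support ↔ h x ∈ (F.functor.obj M).obj.support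

/-- A point `x` is encoded by a sheaf `K` with support the closure of `x`. Inclusions into finite
unions of supports are preserved, so the support of `F K` is again irreducible; its generic point is
the image of `x`. -/
lemma exists_preservesSupport (hα : Nice α) (hβ : Nice β) (hrα : RestrictionCondition α)
    (hrβ : RestrictionCondition β) (F : Coh f α ≌ Coh g β) : ∃ h : X → Y, PreservesSupport F h := by
  have key (x : X) : ∃ y : Y, ∀ M : Coh f α,
      x ∈ M.obj.support ↔ y ∈ (F.functor.obj M).obj.support := by
    obtain ⟨K, hK⟩ := hα.exists_support_eq hrα (isClosed_closure (s := {x})) rfl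
    have hxK : x ∈ K.obj.support := hK ▸ subset_closure rfl
    have hx (M : Coh f α) : x ∈ M.obj.support ↔ K.obj.support ⊆ M.obj.support := by
      rw [hK, (hα.isClosed_support M).closure_subset_iff, Set.singleton_subset_iff]
    let Z := (F.functor.obj K).obj.support
    have hZ : IsClosed Z := hβ.isClosed_support _
    have hirr : IsIrreducible Z := by
      refine ⟨?_, isPreirreducible_iff_isClosed_union_isClosed.mpr fun Z₁ Z₂ h₁ h₂ h => ?_⟩
      · rw [Set.nonempty_iff_ne_empty]
        intro h0
        -- Emptiness of a support is inclusion in the union of an empty family.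
        have h1 := (support_subset_iff_map hα hβ hrα hrβ F (I := Empty) (M := K)
          (N := fun j => j.elim)).mpr (by change Z ⊆ _; rw [h0]; exact Set.empty_subset _)
        rw [Set.iUnion_of_empty] at h1
        exact h1 hxK
      · obtain ⟨Q₁, -, -, hQ₁⟩ := hβ.exists_quotient (F.functor.obj K) h₁
        obtain ⟨Q₂, -, -, hQ₂⟩ := hβ.exists_quotient (F.functor.obj K) h₂
        -- A decomposition of the support of `F K` into two closed pieces is carried back to sheaves
        -- on `X`; one of these contains the point `x` in its support, so its piece is everything.
        let Q : Bool → Coh f α := fun b => F.inverse.obj (bif b then Q₁ else Q₂)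
        have e (R : Coh g β) : (F.functor.obj (F.inverse.obj R)).obj.support = R.obj.support :=
          Coh.support_eq_of_iso (F.counitIso.app R)
        have h1 := (support_subset_iff_map hα hβ hrα hrβ F (M := K) (N := Q)).mpr (by
          intro y hy
          rw [Set.mem_iUnion]
          rcases h hy with hy' | hy'
          · exact ⟨true, by rw [e]; exact hQ₁ ▸ ⟨hy, hy'⟩⟩
          · exact ⟨false, by rw [e]; exact hQ₂ ▸ ⟨hy, hy'⟩⟩)
        obtain ⟨b, hb⟩ := Set.mem_iUnion.mp (h1 hxK)
        have h2 := (support_subset_iff_map₁ hα hβ hrα hrβ F).mp ((hx _).mp hb)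
        rw [e] at h2
        cases b
        · exact .inr fun y hy => (hQ₂ ▸ h2 hy : y ∈ Z ∩ Z₂).2
        · exact .inl fun y hy => (hQ₁ ▸ h2 hy : y ∈ Z ∩ Z₁).2
    refine ⟨hirr.genericPoint, fun M => ?_⟩
    rw [hx, support_subset_iff_map₁ hα hβ hrα hrβ F]
    have h1 : closure {hirr.genericPoint} = Z := hirr.closure_genericPoint hZ
    change Z ⊆ _ ↔ _
    generalize hirr.genericPoint = y at h1 ⊢
    rw [← h1, (hβ.isClosed_support _).closure_subset_iff, Set.singleton_subset_iff]
  choose h hh using key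
  exact ⟨h, fun M x => hh x M⟩

/-- Closures of points are supports, and the space is T0. -/
lemma eq_of_support_iff (hα : Nice α) (hrα : RestrictionCondition α) {x y : X}
    (h : ∀ M : Coh f α, x ∈ M.obj.support ↔ y ∈ M.obj.support) : x = y := by
  have key (x y : X) (h : ∀ M : Coh f α, x ∈ M.obj.support → y ∈ M.obj.support) : x ⤳ y := by
    obtain ⟨K, hK⟩ := hα.exists_support_eq hrα (isClosed_closure (s := {x})) rfl
    rw [specializes_iff_mem_closure, ← hK]
    exact h K (hK ▸ subset_closure rfl)
  exact ((key x y fun M => (h M).mp).antisymm (key y x fun M => (h M).mpr)).eq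

lemma PreservesSupport.comp_symm {F : Coh f α ≌ Coh g β} {h : X → Y} (hh : PreservesSupport F h)
    {h' : Y → X} (hh' : PreservesSupport F.symm h') (hα : Nice α) (hrα : RestrictionCondition α)
    (x : X) : h' (h x) = x :=
  eq_of_support_iff hα hrα fun M => by
    have e : (F.inverse.obj (F.functor.obj M)).obj.support = M.obj.support :=
      Coh.support_eq_of_iso (F.unitIso.app M).symm
    have h1 : x ∈ M.obj.support ↔ h' (h x) ∈ (F.inverse.obj (F.functor.obj M)).obj.support :=
      (hh M x).trans (hh' _ _)
    rw [h1, e]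

lemma PreservesSupport.image_support {F : Coh f α ≌ Coh g β} {h : X → Y}
    (hh : PreservesSupport F h) (hs : Function.Surjective h) (M : Coh f α) :
    h '' M.obj.support = (F.functor.obj M).obj.support := by
  ext y
  obtain ⟨x, rfl⟩ := hs y
  rw [← hh]
  constructor
  · rintro ⟨x', hx', e⟩
    rw [hh, ← e, ← hh]
    exact hx'
  · exact fun hx => ⟨x, hx, rfl⟩

/-- On a Noetherian space a closed set is a finite union of irreducible ones, each of which is a
support. -/
lemma PreservesSupport.isClosedMap {F : Coh f α ≌ Coh g β} {h : X → Y}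
    (hh : PreservesSupport F h) (hs : Function.Surjective h) (hα : Nice α) (hβ : Nice β)
    (hrα : RestrictionCondition α) : IsClosedMap h := by
  intro Z hZ
  have := hα.noetherian
  have := hα.compact
  have : IsNoetherian X := {}
  obtain ⟨T, hT, hcl, hirr, rfl⟩ :=
    TopologicalSpace.NoetherianSpace.exists_finite_set_isClosed_irreducible hZ
  rw [Set.image_sUnion, Set.sUnion_image]
  refine hT.isClosed_biUnion fun Z hZT => ?_
  obtain ⟨K, hK⟩ := hα.exists_support_eq hrα (hcl Z hZT)
    ((hirr Z hZT).closure_genericPoint (hcl Z hZT))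
  rw [← hK, hh.image_support hs]
  exact hβ.isClosed_support _

/-- An equivalence between categories of coherent twisted sheaves induces a homeomorphism. -/
lemma exists_homeomorph (hα : Nice α) (hβ : Nice β) (hrα : RestrictionCondition α)
    (hrβ : RestrictionCondition β) (F : Coh f α ≌ Coh g β) :
    ∃ h : X ≃ₜ Y, PreservesSupport F h := by
  obtain ⟨h, hh⟩ := exists_preservesSupport hα hβ hrα hrβ F
  obtain ⟨h', hh'⟩ := exists_preservesSupport hβ hα hrβ hrα F.symm
  have e₁ : Function.LeftInverse h' h := hh.comp_symm hh' hα hrα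
  have e₂ : Function.RightInverse h' h := hh'.comp_symm (F := F.symm) (h' := h) hh hβ hrβ
  have c : IsClosedMap h := hh.isClosedMap e₂.surjective hα hβ hrα
  have c' : IsClosedMap h' := hh'.isClosedMap e₁.surjective hβ hα hrβ
  refine ⟨⟨⟨h, h', e₁, e₂⟩, ?_, ?_⟩, hh⟩
  · refine continuous_iff_isClosed.mpr fun Z hZ => ?_
    have := c' Z hZ
    rwa [Set.image_eq_preimage_of_inverse e₂ e₁] at this
  · refine continuous_iff_isClosed.mpr fun Z hZ => ?_
    have := c Z hZ
    rwa [Set.image_eq_preimage_of_inverse e₁ e₂] at this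

lemma PreservesSupport.eq (hβ : Nice β) (hrβ : RestrictionCondition β) {F : Coh f α ≌ Coh g β}
    {h h' : X → Y} (hh : PreservesSupport F h) (hh' : PreservesSupport F h') : h = h' := by
  funext x
  refine eq_of_support_iff hβ hrβ fun N => ?_
  have e : (F.functor.obj (F.inverse.obj N)).obj.support = N.obj.support :=
    Coh.support_eq_of_iso (F.counitIso.app N)
  rw [← e]
  exact (hh (F.inverse.obj N) x).symm.trans (hh' (F.inverse.obj N) x)

end

end TwistedSheaf

/-! ### The centre of the category over a chart. -/

namespace TwistedSheaf

section Algebra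

variable {B : Type u} [CommRing B] {P Q : Type u} [AddCommGroup P] [AddCommGroup Q] [Module B P]
  [Module B Q] {n : ℕ}

/-- With `l x₀ = 1`, commuting with the rank-one endomorphism `y ↦ l y • x` and evaluating at `x₀`
gives `v x = l (v x₀) • x`. -/
lemma exists_eq_smul_of_commute (hn : 0 < n) (e : P ≃ₗ[B] (Fin n → B)) (v : P → P)
    (h : ∀ (w : P →ₗ[B] P) x, v (w x) = w (v x)) : ∃ b : B, ∀ x, v x = b • x := by
  let k : Fin n := ⟨0, hn⟩
  let l : P →ₗ[B] B := LinearMap.proj k ∘ₗ e.toLinearMap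
  let x₀ : P := e.symm (Pi.single k 1)
  have hl : l x₀ = 1 := by simp [l, x₀]
  refine ⟨l (v x₀), fun x => ?_⟩
  have := h (l.smulRight x) x₀
  simpa [hl] using this

/-- Every `y` is the value at `x₀` of a linear map from the free module, so the scalar found there
is imposed on `Q`. -/
lemma eq_smul_of_commute (hn : 0 < n) (e : P ≃ₗ[B] (Fin n → B)) (b : B) (v : Q → Q)
    (h : ∀ (w : P →ₗ[B] Q) x, v (w x) = w (b • x)) (y : Q) : v y = b • y := by
  let k : Fin n := ⟨0, hn⟩
  let l : P →ₗ[B] B := LinearMap.proj k ∘ₗ e.toLinearMap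
  let x₀ : P := e.symm (Pi.single k 1)
  have hl : l x₀ = 1 := by simp [l, x₀]
  have := h (l.smulRight y) x₀
  rw [map_smul] at this
  simpa [hl] using this

/-- The coordinate `l` extends to the base change and takes the value `1` at `ψ x₀`, so the scalars
can be read off there. -/
lemma IsBC.eq_of_smul_eq {B' : Type u} [CommRing B'] {P' : Type u} [AddCommGroup P'] [Module B' P']
    {σ : B →+* B'} {ψ : P →+ P'} (hψ : IsBC σ ψ) (hn : 0 < n) (e : P ≃ₗ[B] (Fin n → B))
    {r s : B'} (h : ∀ x : P', r • x = s • x) : r = s := by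
  let k : Fin n := ⟨0, hn⟩
  let l : P →ₗ[B] B := LinearMap.proj k ∘ₗ e.toLinearMap
  let x₀ : P := e.symm (Pi.single k 1)
  have hl : l x₀ = 1 := by simp [l, x₀]
  obtain ⟨F, hF⟩ := hψ.exists_lift B' (σ.toAddMonoidHom.comp l.toAddMonoidHom) fun r x => by
    simp
  have h1 : F (ψ x₀) = 1 := by
    rw [hF]
    change σ (l x₀) = 1
    rw [hl, map_one]
  have h2 := congrArg F (h (ψ x₀))
  rwa [map_smul, map_smul, h1, smul_eq_mul, smul_eq_mul, mul_one, mul_one] at h2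

lemma exists_algebraMap_eq {A : Type u} [CommRing A] [Algebra A B] [Module.FaithfullyFlat A B]
    {b : B} (h : b ⊗ₜ[A] (1 : B) = (1 : B) ⊗ₜ[A] b) : ∃ a : A, algebraMap A B a = b := by
  have h₀ : IsBC (algebraMap A B) (algebraMap A B).toAddMonoidHom :=
    .of_isBaseChange rfl (IsBaseChange.linearMap A B) fun _ => rfl
  have h₁ : IsBC (Algebra.TensorProduct.includeLeft : B →ₐ[A] B ⊗[A] B).toRingHom
      (Algebra.TensorProduct.includeLeft : B →ₐ[A] B ⊗[A] B).toRingHom.toAddMonoidHom :=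
    .of_isBaseChange rfl (IsBaseChange.linearMap B (B ⊗[A] B)) fun _ => rfl
  refine exists_of_faithfullyFlat h₀ h₁
    (ρ₂ := (Algebra.TensorProduct.includeRight : B →ₐ[A] B ⊗[A] B).toRingHom.toAddMonoidHom)
    (fun s x => ?_) (fun x => ?_) b h
  · exact (Algebra.TensorProduct.includeRight : B →ₐ[A] B ⊗[A] B).map_mul s x
  · exact ((Algebra.TensorProduct.includeLeft : B →ₐ[A] B ⊗[A] B).commutes x).trans
      ((Algebra.TensorProduct.includeRight : B →ₐ[A] B ⊗[A] B).commutes x).symm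

end Algebra

section

variable {S : Scheme.{u}} {ι : Type t} {U : ι → Scheme.{u}} {f : ∀ i, U i ⟶ S} {α : Cocycle f}
  {B : Type u} [CommRing B] {i : ι} {t : Spec (.of B) ⟶ U i} {n : ℕ}

lemma Sheaf.compat_map {M N : Sheaf f α} (w : M ⟶ N) :
    Compat M N t ((Scheme.Modules.pullback t).map (w.hom i)) := by
  intro T' a b a' b' ha hb h
  rw [ph_map, ph_map, w.comm]

lemma scalar_hom (M : Coh f α) (s : Γ(S, ⊤)) (i : ι) :
    (M.scalar s).hom.hom i = smulEnd (M.obj.obj i) ((f i).appTop s) := rfl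

lemma pullback_map_scalar (M : Coh f α) (s : Γ(S, ⊤)) :
    (Scheme.Modules.pullback t).map ((M.scalar s).hom.hom i) =
      smulEnd _ ((t ≫ f i).appTop s) := by
  rw [scalar_hom, pullback_map_smulEnd, Scheme.Hom.comp_appTop]
  rfl

lemma smulEnd_ext_of_free {R : CommRingCat.{u}} {E : (U i).Modules} (hE : E.IsQuasicoherent)
    (hn : 0 < n) (e : Γ((Scheme.Modules.pullback t).obj E, ⊤) ≃ₗ[B] (Fin n → B))
    (φ : CommRingCat.of B ⟶ R) {t' : Spec R ⟶ U i} (ht' : Spec.map φ ≫ t = t') {r s : Γ(Spec R, ⊤)}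
    (h : smulEnd ((Scheme.Modules.pullback t').obj E) r = smulEnd _ s) : r = s := by
  have hbc := isBC_res_SpecMap φ ht' hE
  have h1 : (Scheme.ΓSpecIso R).hom r = (Scheme.ΓSpecIso R).hom s := by
    refine hbc.eq_of_smul_eq hn e fun x => ?_
    have h2 := congr(($h).app ⊤ x)
    rw [smulEnd_app_apply, smulEnd_app_apply] at h2
    have h3 (r : Γ(Spec R, ⊤)) : (Spec R).presheaf.map
        (homOfLE (le_top : (⊤ : (Spec R).Opens) ≤ ⊤)).op r = r :=
      congr($((Spec R).presheaf.map_id (Opposite.op ⊤)) r)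
    rw [h3, h3] at h2
    have h4 (r : Γ(Spec R, ⊤)) : (Scheme.ΓSpecIso R).inv ((Scheme.ΓSpecIso R).hom r) = r :=
      congr($((Scheme.ΓSpecIso R).hom_inv_id) r)
    rw [smul_Spec_top, smul_Spec_top, h4, h4]
    exact h2
  have h5 := congrArg (Scheme.ΓSpecIso R).inv h1
  simpa using h5

lemma scalar_injective (E : Coh f α) (hn : 0 < n)
    (e : Γ((Scheme.Modules.pullback t).obj (E.obj.obj i), ⊤) ≃ₗ[B] (Fin n → B))
    (hinj : Function.Injective (t ≫ f i).appTop) {r s : Γ(S, ⊤)} (h : E.scalar r = E.scalar s) :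
    r = s := by
  refine hinj (smulEnd_ext_of_free (E.property i).1 hn e (𝟙 _) (t' := t) (by simp) ?_)
  rw [← pullback_map_scalar E r, ← pullback_map_scalar E s, h]

variable [IsAffine S] [IsNoetherianRing B] [IsAffineHom (t ≫ f i)] [Flat (t ≫ f i)]
  [Surjective (t ≫ f i)]

omit [IsNoetherianRing B] [IsAffineHom (t ≫ f i)] in
lemma appTop_comp_faithfullyFlat :
    ((t ≫ f i).appTop ≫ (Scheme.ΓSpecIso (.of B)).hom).hom.FaithfullyFlat := by
  rw [CommRingCat.hom_comp]
  refine RingHom.FaithfullyFlat.stableUnderComposition _ _ ?_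
    (.of_bijective (ConcreteCategory.bijective_of_isIso (Scheme.ΓSpecIso (.of B)).hom))
  exact faithfullyFlat_app (t ≫ f i) (isAffineOpen_top S) (isAffineOpen_top _)
    fun x _ => (t ≫ f i).surjective x

omit [IsNoetherianRing B] [IsAffineHom (t ≫ f i)] in
lemma appTop_injective : Function.Injective (t ≫ f i).appTop := by
  have h := (appTop_comp_faithfullyFlat (f := f) (t := t)).injective
  rw [CommRingCat.hom_comp, RingHom.coe_comp] at h
  exact h.of_comp

/-- For a homomorphism that descends this is naturality; such homomorphisms span, and the relation
is `B`-linear in `w`. -/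
lemma commute_of_natTrans (z : 𝟭 (Coh f α) ⟶ 𝟭 (Coh f α)) (M N : Coh f α)
    [Module.Finite B Γ((Scheme.Modules.pullback t).obj (M.obj.obj i), ⊤)]
    (w : (Scheme.Modules.pullback t).obj (M.obj.obj i) ⟶
      (Scheme.Modules.pullback t).obj (N.obj.obj i)) :
    (Scheme.Modules.pullback t).map ((z.app M).hom.hom i) ≫ w =
      w ≫ (Scheme.Modules.pullback t).map ((z.app N).hom.hom i) := by
  have hw : w ∈ (⊤ : Submodule B _) := trivial
  rw [← span_compat_of_isAffineOpen t (isAffineOpen_top S) (fun _ _ => trivial) M N] at hw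
  induction hw using Submodule.span_induction with
  | mem w hw =>
    obtain ⟨u, rfl⟩ := Sheaf.exists_hom_of_compat (M := M.obj) (N := N.obj)
      (fun i => (N.property i).1) (W₀ := ⊥) (W₁ := ⊤) (by simp) (Sheaf.isZeroOver_bot _)
      (fun x _ => (t ≫ f i).surjective x) hw
    have h1 := z.naturality (ObjectProperty.homMk u : M ⟶ N)
    have h2 : u.hom i ≫ (z.app N).hom.hom i = (z.app M).hom.hom i ≫ u.hom i :=
      congr(($h1).hom.hom i)
    rw [← Functor.map_comp, ← Functor.map_comp, h2]
  | zero => rw [comp_zero, zero_comp]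
  | add x y _ _ hx hy => rw [Preadditive.comp_add, Preadditive.add_comp, hx, hy]
  | smul b x _ hx =>
    have h1 := homSpec_smul (R := .of B) b x
    have h2 := smulEnd_comp ((Scheme.Modules.pullback t).map ((z.app N).hom.hom i))
      ((Scheme.ΓSpecIso (.of B)).inv b)
    refine (congrArg (_ ≫ ·) h1).trans (.trans ?_ (congrArg (· ≫ _) h1).symm)
    rw [← Category.assoc, hx, Category.assoc, Category.assoc]
    exact congrArg (x ≫ ·) h2.symm

-- Compatibility with the gluing on `Spec (B ⊗[A] B)` says that `b ⊗ 1` and `1 ⊗ b` act equally on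
-- the pullback of `E`. It is a base change of a free module of positive rank, so they are equal and
-- `b` comes from `A`.
omit [IsNoetherianRing B] [IsAffineHom (t ≫ f i)] in
lemma exists_appTop_eq (E : Coh f α) (hn : 0 < n)
    (e : Γ((Scheme.Modules.pullback t).obj (E.obj.obj i), ⊤) ≃ₗ[B] (Fin n → B)) (b : B)
    (h : Sheaf.Compat E.obj E.obj t (smulEnd _ ((Scheme.ΓSpecIso (.of B)).inv b))) :
    ∃ s : Γ(S, ⊤), (t ≫ f i).appTop s = (Scheme.ΓSpecIso (.of B)).inv b := by
  let φ : Γ(S, ⊤) ⟶ .of B := (t ≫ f i).appTop ≫ (Scheme.ΓSpecIso (.of B)).hom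
  have hφ : φ.hom.FaithfullyFlat := appTop_comp_faithfullyFlat
  have hφ' : (t ≫ f i).appTop = φ ≫ (Scheme.ΓSpecIso (.of B)).inv := by simp [φ]
  clear_value φ
  let A : Type u := Γ(S, ⊤)
  let : Algebra A B := φ.hom.toAlgebra
  have : Module.FaithfullyFlat A B := hφ
  obtain ⟨c₁, c₂, c₃, c₄, c₅, c₆⟩ := incl_comp A B
  have c₆' : φ ≫ inclL A B = φ ≫ inclR A B := c₆
  have hp : (Spec.map (inclL A B) ≫ t) ≫ f i = (Spec.map (inclR A B) ≫ t) ≫ f i := by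
    rw [Category.assoc, Category.assoc]
    refine ext_of_isAffine ?_
    rw [Scheme.Hom.comp_appTop _ (t ≫ f i), Scheme.Hom.comp_appTop _ (t ≫ f i), hφ',
      Category.assoc, Category.assoc, ← Scheme.ΓSpecIso_inv_naturality (inclL A B),
      ← Scheme.ΓSpecIso_inv_naturality (inclR A B), reassoc_of% c₆']
  have h1 := h (Spec.map (inclL A B)) (Spec.map (inclR A B)) _ _ rfl rfl hp
  rw [ph_smulEnd, ph_smulEnd, smulEnd_comp, cancel_epi] at h1
  have h2 := smulEnd_ext_of_free (E.property i).1 hn e (inclL A B) rfl h1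
  have h3 (ψ : CommRingCat.of B ⟶ .of (B ⊗[A] B)) : (Spec.map ψ).appTop
      ((Scheme.ΓSpecIso (.of B)).inv b) = (Scheme.ΓSpecIso _).inv (ψ b) :=
    congr($(Scheme.ΓSpecIso_inv_naturality ψ) b).symm
  rw [h3, h3] at h2
  have h4 : inclL A B b = inclR A B b :=
    (ConcreteCategory.bijective_of_isIso (Scheme.ΓSpecIso (.of (B ⊗[A] B))).inv).injective h2
  obtain ⟨s, hs⟩ := exists_algebraMap_eq (A := A) h4
  exact ⟨s, by
    rw [← hs, hφ']
    rfl⟩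

omit [IsNoetherianRing B] in
lemma eq_smulEnd_of_app_eq_smul {L : (Spec (.of B)).Modules} (hL : L.IsQuasicoherent) (v : L ⟶ L)
    (b : B) (h : ∀ x : Γ(L, ⊤), v.app ⊤ x = b • x) :
    v = smulEnd L ((Scheme.ΓSpecIso (.of B)).inv b) := by
  have : v = b • 𝟙 L := by
    apply (homΓLinearEquiv (R := .of B) hL L).injective
    ext x
    rw [map_smul]
    exact h x
  exact this.trans ((homSpec_smul (R := .of B) b (𝟙 L)).trans (Category.id_comp _))

/-- Every natural endomorphism of the identity functor of `Coh(S, α)` is the multiplication by a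
function on `S`, for an affine `S` on which `α` is split by a flat cover. -/
lemma exists_natTrans_eq_scalar (E : Coh f α) (hn : 0 < n)
    (e : Γ((Scheme.Modules.pullback t).obj (E.obj.obj i), ⊤) ≃ₗ[B] (Fin n → B))
    (z : 𝟭 (Coh f α) ⟶ 𝟭 (Coh f α)) : ∃ s : Γ(S, ⊤), ∀ M, z.app M = M.scalar s := by
  have : Module.Finite B Γ((Scheme.Modules.pullback t).obj (E.obj.obj i), ⊤) :=
    Module.Finite.equiv e.symm
  have hP := qcoh_pullback t (E.property i).1
  have hc (N : Coh f α) (w : Γ((Scheme.Modules.pullback t).obj (E.obj.obj i), ⊤) →ₗ[B]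
      Γ((Scheme.Modules.pullback t).obj (N.obj.obj i), ⊤)) (x) :
      ((Scheme.Modules.pullback t).map ((z.app N).hom.hom i)).app ⊤ (w x) =
        w (((Scheme.Modules.pullback t).map ((z.app E).hom.hom i)).app ⊤ x) := by
    let w' := (homΓLinearEquiv (R := .of B) hP _).symm w
    have hw : homΓLinearEquiv (R := .of B) hP _ w' = w := LinearEquiv.apply_symm_apply _ _
    have h1 := commute_of_natTrans (t := t) z E N w'
    have h2 := congr(($h1).app ⊤ x)
    rw [← hw]
    exact h2.symm
  -- The scalar is found on the free pullback of `E`, and the maps from `E` then force it on every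
  -- `N`.
  obtain ⟨b, hb⟩ := exists_eq_smul_of_commute hn e _ (hc E)
  have hv := eq_smulEnd_of_app_eq_smul hP _ b hb
  obtain ⟨s, hs⟩ := exists_appTop_eq E hn e b (hv ▸ Sheaf.compat_map (z.app E).hom)
  refine ⟨s, fun N => ?_⟩
  apply ObjectProperty.hom_ext
  -- The flat cover is surjective here, so no vanishing of `N` is required: `W₀` is empty.
  refine Sheaf.hom_ext_of_pullback (t := t) (i₀ := i) (fun i => (N.property i).1) (W₀ := ⊥)
    (W₁ := ⊤) (by simp) (Sheaf.isZeroOver_bot _) (fun x _ => (t ≫ f i).surjective x) ?_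
  refine (eq_smulEnd_of_app_eq_smul (qcoh_pullback t (N.property i).1) _ b
    (eq_smul_of_commute hn e b _ fun w x => by rw [hc N, hb])).trans ?_
  rw [← hs]
  exact (pullback_map_scalar N s).symm

end

end TwistedSheaf

/-! ### Restriction between open subschemes. -/

namespace TwistedSheaf

section Modules

variable {T X : Scheme.{u}} (g : T ⟶ X) [IsOpenImmersion g] {M N : X.Modules}

lemma app_image_eq {u v : M ⟶ N}
    (h : (Scheme.Modules.pullback g).map u = (Scheme.Modules.pullback g).map v) (V : T.Opens) :
    u.app (g ''ᵁ V) = v.app (g ''ᵁ V) := by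
  have h1 : (Scheme.Modules.restrictFunctor g).map u = (Scheme.Modules.restrictFunctor g).map v := by
    let e := Scheme.Modules.restrictFunctorIsoPullback g
    rw [← cancel_mono (e.hom.app N)]
    exact (e.hom.naturality u).trans ((congrArg (_ ≫ ·) h).trans (e.hom.naturality v).symm)
  ext x
  exact congr(($h1).app V x)

lemma app_eq_of_le {u v : M ⟶ N}
    (h : (Scheme.Modules.pullback g).map u = (Scheme.Modules.pullback g).map v) {V : X.Opens}
    (hV : V ≤ g.opensRange) : u.app V = v.app V := by
  have h1 : g ''ᵁ g ⁻¹ᵁ V = V := by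
    rw [g.image_preimage_eq_opensRange_inf, inf_eq_right.mpr hV]
  rw [← h1]
  exact app_image_eq g h _

end Modules

variable {S : Scheme.{u}} {ι : Type t} {U : ι → Scheme.{u}} {f : ∀ i, U i ⟶ S} {α α' : Cocycle f}

/-- An isomorphism of twisted sheaves, from its components. -/
def Sheaf.isoMk {M N : Sheaf f α} (e : ∀ i, M.obj i ≅ N.obj i)
    (comm : ∀ {T : Scheme.{u}} {i j : ι} (a : T ⟶ U i) (b : T ⟶ U j) (h : a ≫ f i = b ≫ f j),
      (Scheme.Modules.pullback b).map (e j).hom ≫ (N.φ a b h).hom =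
        (M.φ a b h).hom ≫ (Scheme.Modules.pullback a).map (e i).hom) : M ≅ N where
  hom := ⟨fun i => (e i).hom, comm⟩
  inv := ⟨fun i => (e i).inv, fun a b h => by
    rw [← cancel_mono ((Scheme.Modules.pullback a).map (e _).hom), Category.assoc, Category.assoc,
      ← comm, ← CategoryTheory.Functor.map_comp, Iso.inv_hom_id, CategoryTheory.Functor.map_id,
      Category.comp_id, ← Category.assoc, ← CategoryTheory.Functor.map_comp, Iso.inv_hom_id,
      CategoryTheory.Functor.map_id, Category.id_comp]⟩
  hom_inv_id := by
    ext i : 1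
    exact (e i).hom_inv_id
  inv_hom_id := by
    ext i : 1
    exact (e i).inv_hom_id

/-- Equal cocycles have the same twisted sheaves. -/
def Sheaf.congr (h : ∀ {T : Scheme.{u}} {i j k : ι} (a : T ⟶ U i) (b : T ⟶ U j) (c : T ⟶ U k)
    (hab : a ≫ f i = b ≫ f j) (hbc : b ≫ f j = c ≫ f k),
      α.val a b c hab hbc = α'.val a b c hab hbc) : Sheaf f α ⥤ Sheaf f α' where
  obj M :=
    { obj := M.obj
      φ := M.φ
      pullHom_φ := M.pullHom_φ
      φ_comp a b c hab hbc := by rw [M.φ_comp, h] }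
  map u := ⟨u.hom, u.comm⟩

section

variable {S' : Scheme.{u}} {ι' : Type t'} {U' : ι' → Scheme.{u}} {f' : ∀ j, U' j ⟶ S'} {p : S' ⟶ S}
  {r : ι' → ι}

lemma Sheaf.pull_φ_hom (M : Sheaf f α) (q : ∀ j, U' j ⟶ U (r j))
    (w : ∀ j, q j ≫ f (r j) = f' j ≫ p) {T : Scheme.{u}} {i j : ι'} (a : T ⟶ U' i) (b : T ⟶ U' j)
    (h : a ≫ f' i = b ≫ f' j) {a' : T ⟶ U (r i)} {b' : T ⟶ U (r j)} (ha : a ≫ q i = a')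
    (hb : b ≫ q j = b') (h' : a' ≫ f (r i) = b' ≫ f (r j)) :
    ((M.pull q w).φ a b h).hom = (pbC b hb (M.obj (r j))).hom ≫ (M.φ a' b' h').hom ≫
      (pbC a ha (M.obj (r i))).inv := by
  subst ha hb
  rw [pbC_eq, pbC_eq, pbIso_rfl, pbIso_rfl]
  rfl

end

lemma comp_conj_eq {C : Type*} [Category C] {a b c d a' b' c' d' : C} {x : a ⟶ b} {p : b ≅ d}
    {r : a ≅ c} {s : c ≅ d} {x' : a' ⟶ b'} {p' : b' ≅ d'} {r' : a' ≅ c'} {s' : c' ≅ d'}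
    (h : x ≫ p.hom = r.hom ≫ s.hom) (h' : x' ≫ p'.hom = r'.hom ≫ s'.hom) (φ : d ⟶ d') :
    x ≫ p.hom ≫ φ ≫ p'.inv = (r.hom ≫ (s.hom ≫ φ ≫ s'.inv) ≫ r'.inv) ≫ x' := by
  rw [reassoc_of% h, ← cancel_mono p'.hom]
  simp [h']

section Restrict

variable {O O' O'' : S.Opens}

lemma homOfLE_restrict (h : O' ≤ O) (i : ι) :
    (U i).homOfLE (preimage_mono (f i) h) ≫ f i ∣_ O = f i ∣_ O' ≫ S.homOfLE h := by
  rw [← cancel_mono O.ι]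
  simp [morphismRestrict_ι]

/-- The restriction of twisted sheaves over an open subscheme to a smaller one. -/
def Sheaf.restrictLE (α : Cocycle f) (h : O' ≤ O) :
    Sheaf (fun i => f i ∣_ O) (α.restrict O) ⥤ Sheaf (fun i => f i ∣_ O') (α.restrict O') :=
  Sheaf.pullFunctor (p := S.homOfLE h) (r := id) (α.restrict O)
    (fun i => (U i).homOfLE (preimage_mono (f i) h)) (homOfLE_restrict h) ⋙
  Sheaf.congr fun a b c hab hbc => by
    simp only [Cocycle.restrict, Cocycle.pull, Category.assoc, Scheme.homOfLE_ι, id]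

/-- The restriction of coherent twisted sheaves over an open subscheme to a smaller one. -/
def Coh.restrictLE (α : Cocycle f) (h : O' ≤ O) :
    Coh (fun i => f i ∣_ O) (α.restrict O) ⥤ Coh (fun i => f i ∣_ O') (α.restrict O') :=
  ObjectProperty.lift _ (ObjectProperty.ι _ ⋙ Sheaf.restrictLE α h)
    (fun M i => (M.property i).pullback ((U i).homOfLE (preimage_mono (f i) h)))

lemma Coh.restrictLE_map_hom (h : O' ≤ O) {M N : Coh (fun i => f i ∣_ O) (α.restrict O)}
    (u : M ⟶ N) (i : ι) : ((Coh.restrictLE α h).map u).hom.hom i =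
      (Scheme.Modules.pullback ((U i).homOfLE (preimage_mono (f i) h))).map (u.hom.hom i) := rfl

/-- Restriction to an open subscheme and then to a smaller one. -/
def Coh.restrictIso (α : Cocycle f) (h : O' ≤ O) :
    Coh.restrict α O ⋙ Coh.restrictLE α h ≅ Coh.restrict α O' :=
  NatIso.ofComponents (fun M => ObjectProperty.isoMk _ (Sheaf.isoMk
    (M := ((Coh.restrict α O ⋙ Coh.restrictLE α h).obj M).obj) (N := ((Coh.restrict α O').obj M).obj)
    (fun i => pbC ((U i).homOfLE (preimage_mono (f i) h)) (Scheme.homOfLE_ι _ _) (M.obj.obj i))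
    (by
      intro T i j a b hab
      have hb : (b ≫ (U j).homOfLE (preimage_mono (f j) h)) ≫ (f j ⁻¹ᵁ O).ι =
        b ≫ (f j ⁻¹ᵁ O').ι := by rw [Category.assoc, Scheme.homOfLE_ι]
      have ha : (a ≫ (U i).homOfLE (preimage_mono (f i) h)) ≫ (f i ⁻¹ᵁ O).ι =
        a ≫ (f i ⁻¹ᵁ O').ι := by rw [Category.assoc, Scheme.homOfLE_ι]
      have hf := pull_aux (p := O'.ι) (r := id) (f := f) (fun i => (f i ⁻¹ᵁ O').ι)
        (fun i => (morphismRestrict_ι (f i) O').symm) hab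
      -- Both gluing isomorphisms are conjugate to the same `M.φ`; the conjugating isomorphisms
      -- differ by the associativity squares `h4` and `h5`.
      have h1 := M.obj.pull_φ_hom (p := O'.ι) (r := id) (fun i => (f i ⁻¹ᵁ O').ι)
        (fun i => (morphismRestrict_ι (f i) O').symm) a b hab rfl rfl hf
      have hab' : (a ≫ (U i).homOfLE (preimage_mono (f i) h)) ≫ f i ∣_ O =
          (b ≫ (U j).homOfLE (preimage_mono (f j) h)) ≫ f j ∣_ O :=
        pull_aux (p := S.homOfLE h) (r := id) (f := fun i => f i ∣_ O)
          (fun i => (U i).homOfLE (preimage_mono (f i) h)) (homOfLE_restrict h) hab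
      have h2 := M.obj.pull_φ_hom (p := O.ι) (r := id) (fun i => (f i ⁻¹ᵁ O).ι)
        (fun i => (morphismRestrict_ι (f i) O).symm) _ _ hab' ha hb hf
      have h3 := ((Coh.restrict α O).obj M).obj.pull_φ_hom (p := S.homOfLE h) (r := id)
        (fun i => (U i).homOfLE (preimage_mono (f i) h)) (homOfLE_restrict h) a b hab rfl rfl hab'
      have h4 := pbC_comp ((U j).homOfLE (preimage_mono (f j) h)) b rfl
        (Scheme.homOfLE_ι _ _) rfl (M.obj.obj j)
      have h5 := pbC_comp ((U i).homOfLE (preimage_mono (f i) h)) a rfl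
        (Scheme.homOfLE_ι _ _) rfl (M.obj.obj i)
      refine (congrArg (_ ≫ ·) h1).trans (.trans ?_ (congrArg (· ≫ _) h3).symm)
      refine (comp_conj_eq h4 h5 (M.obj.φ _ _ hf).hom).trans ?_
      exact congrArg (fun z => (_ ≫ z ≫ _) ≫ _) h2.symm)))
    (fun u => by
      apply ObjectProperty.hom_ext
      ext i : 1
      exact pbC_naturality _ _ _)

lemma Coh.restrictLE_scalar (h : O' ≤ O) (M : Coh (fun i => f i ∣_ O) (α.restrict O))
    (s : Γ(O, ⊤)) : (Coh.restrictLE α h).map (M.scalar s) =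
      ((Coh.restrictLE α h).obj M).scalar ((S.homOfLE h).appTop s) := by
  apply ObjectProperty.hom_ext
  ext i : 1
  rw [Coh.restrictLE_map_hom, scalar_hom, scalar_hom, pullback_map_smulEnd]
  have h1 : ((U i).homOfLE (preimage_mono (f i) h)).appTop ((f i ∣_ O).appTop s) =
      (f i ∣_ O').appTop ((S.homOfLE h).appTop s) := by
    rw [← ConcreteCategory.comp_apply, ← ConcreteCategory.comp_apply, ← Scheme.Hom.comp_appTop,
      ← Scheme.Hom.comp_appTop, homOfLE_restrict]
  rw [h1]
  rfl

/-- Morphisms of twisted sheaves that are locally equal are equal. -/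
lemma Coh.hom_ext_of_restrictLE {M N : Coh (fun i => f i ∣_ O) (α.restrict O)} {u v : M ⟶ N}
    (h : ∀ x ∈ O, ∃ (O' : S.Opens) (hO : O' ≤ O), x ∈ O' ∧
      (Coh.restrictLE α hO).map u = (Coh.restrictLE α hO).map v) : u = v := by
  apply ObjectProperty.hom_ext
  ext i : 1
  refine hom_ext_of_isBasis (B := {V | (u.hom.hom i).app V = (v.hom.hom i).app V}) ?_
    fun V hV x => by
      have hV : (u.hom.hom i).app V = (v.hom.hom i).app V := hV
      rw [hV]
  rw [TopologicalSpace.Opens.isBasis_iff_nbhd]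
  intro V y hy
  obtain ⟨O', hO, hyO, e⟩ := h (f i ((f i ⁻¹ᵁ O).ι y)) y.2
  refine ⟨V ⊓ ((U i).homOfLE (preimage_mono (f i) hO)).opensRange, ?_, ⟨hy, ?_⟩, inf_le_left⟩
  · refine app_eq_of_le ((U i).homOfLE (preimage_mono (f i) hO)) ?_ inf_le_right
    exact congr(($e).hom.hom i)
  · refine ⟨⟨(f i ⁻¹ᵁ O).ι y, hyO⟩, ?_⟩
    apply Subtype.ext
    exact Scheme.homOfLE_apply _ _

end Restrict

end TwistedSheaf

/-! ### Direct sums and additivity of equivalences. -/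

namespace TwistedSheaf

lemma IsBC.of_total {R S : Type u} [CommRing R] [CommRing S] {M M₁ M₂ N N₁ N₂ : Type u}
    [AddCommGroup M] [AddCommGroup M₁] [AddCommGroup M₂] [AddCommGroup N] [AddCommGroup N₁]
    [AddCommGroup N₂] [Module R M] [Module R M₁] [Module R M₂] [Module S N] [Module S N₁]
    [Module S N₂] {σ : R →+* S} {ψ : M →+ N} {ψ₁ : M₁ →+ N₁} {ψ₂ : M₂ →+ N₂} (h₁ : IsBC σ ψ₁)
    (h₂ : IsBC σ ψ₂) (hψ : ∀ (r : R) x, ψ (r • x) = σ r • ψ x)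
    (i₁ : M₁ →ₗ[R] M) (i₂ : M₂ →ₗ[R] M) (p₁ : M →ₗ[R] M₁) (p₂ : M →ₗ[R] M₂)
    (i₁' : N₁ →ₗ[S] N) (i₂' : N₂ →ₗ[S] N) (p₁' : N →ₗ[S] N₁) (p₂' : N →ₗ[S] N₂)
    (hi₁ : ∀ x, ψ (i₁ x) = i₁' (ψ₁ x)) (hi₂ : ∀ x, ψ (i₂ x) = i₂' (ψ₂ x))
    (hp₁ : ∀ x, p₁' (ψ x) = ψ₁ (p₁ x)) (hp₂ : ∀ x, p₂' (ψ x) = ψ₂ (p₂ x))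
    (ht : ∀ x, i₁ (p₁ x) + i₂ (p₂ x) = x) (ht' : ∀ y, i₁' (p₁' y) + i₂' (p₂' y) = y) :
    IsBC σ ψ where
  smul := hψ
  exists_lift Q _ _ χ hχ := by
    obtain ⟨F₁, hF₁⟩ := h₁.exists_lift Q (χ.comp i₁.toAddMonoidHom) fun r x => by simp [hχ]
    obtain ⟨F₂, hF₂⟩ := h₂.exists_lift Q (χ.comp i₂.toAddMonoidHom) fun r x => by simp [hχ]
    refine ⟨F₁ ∘ₗ p₁' + F₂ ∘ₗ p₂', fun x => ?_⟩
    rw [LinearMap.add_apply, LinearMap.comp_apply, LinearMap.comp_apply, hp₁, hp₂, hF₁, hF₂]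
    conv_rhs => rw [← ht x, map_add]
    rfl
  hom_ext Q _ _ F G h := by
    have e₁ := h₁.hom_ext Q (F ∘ₗ i₁') (G ∘ₗ i₁') fun x => by
      rw [LinearMap.comp_apply, LinearMap.comp_apply, ← hi₁, h]
    have e₂ := h₂.hom_ext Q (F ∘ₗ i₂') (G ∘ₗ i₂') fun x => by
      rw [LinearMap.comp_apply, LinearMap.comp_apply, ← hi₂, h]
    ext y
    rw [← ht' y, map_add, map_add]
    exact congrArg₂ (· + ·) (LinearMap.congr_fun e₁ _) (LinearMap.congr_fun e₂ _)

section

variable {X : Scheme.{u}} {M N : X.Modules}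

lemma biprod_total_apply (V : X.Opens) (x : Γ(M ⊞ N, V)) :
    appLinear (biprod.inl : M ⟶ M ⊞ N) V (appLinear (biprod.fst : M ⊞ N ⟶ M) V x) +
      appLinear (biprod.inr : N ⟶ M ⊞ N) V (appLinear (biprod.snd : M ⊞ N ⟶ N) V x) = x :=
  congr(($(biprod.total (X := M) (Y := N))).app V x)

lemma IsCoherent.biprod (hM : IsCoherent M) (hN : IsCoherent N) : IsCoherent (M ⊞ N) := by
  refine ⟨isQuasicoherent_of_isBC_basicOpen _ fun V hV r => ?_, fun V hV => ?_⟩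
  · have hle := X.basicOpen_le r
    exact IsBC.of_total (isBC_restrict hM.1 hV (hV.basicOpen r) hle)
      (isBC_restrict hN.1 hV (hV.basicOpen r) hle) (fun r x => map_smul_opens _ hle r x)
      (appLinear biprod.inl _) (appLinear biprod.inr _) (appLinear biprod.fst _)
      (appLinear biprod.snd _) (appLinear biprod.inl _) (appLinear biprod.inr _)
      (appLinear biprod.fst _) (appLinear biprod.snd _) (fun x => (app_map _ hle x).symm)
      (fun x => (app_map _ hle x).symm) (fun x => app_map _ hle x) (fun x => app_map _ hle x)
      (biprod_total_apply _) (biprod_total_apply _)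
  · have := hM.2 V hV
    have := hN.2 V hV
    refine Module.Finite.of_surjective ((appLinear (biprod.inl : M ⟶ M ⊞ N) V).coprod
      (appLinear (biprod.inr : N ⟶ M ⊞ N) V)) fun x => ⟨(appLinear (biprod.fst : M ⊞ N ⟶ M) V x,
        appLinear (biprod.snd : M ⊞ N ⟶ N) V x), ?_⟩
    rw [LinearMap.coprod_apply]
    exact biprod_total_apply V x

end

variable {S : Scheme.{u}} {ι : Type t} {U : ι → Scheme.{u}} {f : ∀ i, U i ⟶ S} {α : Cocycle f}

/-- A morphism between pullbacks of biproducts, from its diagonal components. -/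
def pullDiag {T V W : Scheme.{u}} (a : T ⟶ V) (b : T ⟶ W) {M N : V.Modules} {M' N' : W.Modules}
    (φ : (Scheme.Modules.pullback b).obj M' ⟶ (Scheme.Modules.pullback a).obj M)
    (ψ : (Scheme.Modules.pullback b).obj N' ⟶ (Scheme.Modules.pullback a).obj N) :
    (Scheme.Modules.pullback b).obj (M' ⊞ N') ⟶ (Scheme.Modules.pullback a).obj (M ⊞ N) :=
  (Scheme.Modules.pullback b).map biprod.fst ≫ φ ≫ (Scheme.Modules.pullback a).map biprod.inl +
    (Scheme.Modules.pullback b).map biprod.snd ≫ ψ ≫ (Scheme.Modules.pullback a).map biprod.inr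

section

variable {T V W Z : Scheme.{u}} {a : T ⟶ V} {b : T ⟶ W} {c : T ⟶ Z} {M N : V.Modules}
  {M' N' : W.Modules} {M'' N'' : Z.Modules}
  (φ : (Scheme.Modules.pullback b).obj M' ⟶ (Scheme.Modules.pullback a).obj M)
  (ψ : (Scheme.Modules.pullback b).obj N' ⟶ (Scheme.Modules.pullback a).obj N)

lemma pullback_map_biprod (a : T ⟶ V) (M N : V.Modules) :
    ((Scheme.Modules.pullback a).map (biprod.inl : M ⟶ M ⊞ N) ≫
      (Scheme.Modules.pullback a).map biprod.fst = 𝟙 _) ∧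
    ((Scheme.Modules.pullback a).map (biprod.inl : M ⟶ M ⊞ N) ≫
      (Scheme.Modules.pullback a).map biprod.snd = 0) ∧
    ((Scheme.Modules.pullback a).map (biprod.inr : N ⟶ M ⊞ N) ≫
      (Scheme.Modules.pullback a).map biprod.fst = 0) ∧
    ((Scheme.Modules.pullback a).map (biprod.inr : N ⟶ M ⊞ N) ≫
      (Scheme.Modules.pullback a).map biprod.snd = 𝟙 _) := by
  simp [← Functor.map_comp]

lemma pullDiag_comp (φ' : (Scheme.Modules.pullback c).obj M'' ⟶ (Scheme.Modules.pullback b).obj M')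
    (ψ' : (Scheme.Modules.pullback c).obj N'' ⟶ (Scheme.Modules.pullback b).obj N') :
    pullDiag b c φ' ψ' ≫ pullDiag a b φ ψ = pullDiag a c (φ' ≫ φ) (ψ' ≫ ψ) := by
  obtain ⟨h₁, h₂, h₃, h₄⟩ := pullback_map_biprod b M' N'
  simp only [pullDiag, Preadditive.add_comp, Preadditive.comp_add, Category.assoc, reassoc_of% h₁,
    reassoc_of% h₂, reassoc_of% h₃, reassoc_of% h₄, zero_comp, comp_zero, add_zero, zero_add]

lemma pullDiag_smulEnd (r : Γ(T, ⊤)) :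
    pullDiag a b (φ ≫ smulEnd _ r) (ψ ≫ smulEnd _ r) = pullDiag a b φ ψ ≫ smulEnd _ r := by
  simp only [pullDiag, Preadditive.add_comp, Category.assoc, smulEnd_comp]

lemma pullDiag_id : pullDiag a a (𝟙 ((Scheme.Modules.pullback a).obj M))
    (𝟙 ((Scheme.Modules.pullback a).obj N)) = 𝟙 _ := by
  simp only [pullDiag, Category.id_comp, ← Functor.map_comp, ← Functor.map_add, biprod.total,
    CategoryTheory.Functor.map_id]

lemma ph_pullDiag {T' : Scheme.{u}} (g : T' ⟶ T) {a' : T' ⟶ V} {b' : T' ⟶ W} (hb : g ≫ b = b')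
    (ha : g ≫ a = a') :
    ph g hb ha (pullDiag a b φ ψ) = pullDiag a' b' (ph g hb ha φ) (ph g hb ha ψ) := by
  rw [pullDiag, ph_add, ph_comp g hb hb ha, ph_comp g hb hb ha, ph_comp g hb ha ha,
    ph_comp g hb ha ha, ph_map, ph_map, ph_map, ph_map, pullDiag]

end

/-- The direct sum of two twisted sheaves. -/
def Sheaf.sum (M N : Sheaf f α) : Sheaf f α where
  obj i := M.obj i ⊞ N.obj i
  φ a b h :=
    { hom := pullDiag a b (M.φ a b h).hom (N.φ a b h).hom
      inv := pullDiag b a (M.φ a b h).inv (N.φ a b h).inv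
      hom_inv_id := by
        rw [pullDiag_comp, Iso.hom_inv_id, Iso.hom_inv_id, pullDiag_id]
      inv_hom_id := by
        rw [pullDiag_comp, Iso.inv_hom_id, Iso.inv_hom_id, pullDiag_id] }
  pullHom_φ g i j a b h := by
    rw [← ph_rfl, ph_pullDiag, M.ph_φ g rfl rfl h (by rw [Category.assoc, h, Category.assoc]),
      N.ph_φ g rfl rfl h (by rw [Category.assoc, h, Category.assoc])]
  φ_comp a b c hab hbc := by
    rw [pullDiag_comp, M.φ_comp, N.φ_comp, pullDiag_smulEnd]

lemma pullDiag_fst {T V W : Scheme.{u}} {a : T ⟶ V} {b : T ⟶ W} {M N : V.Modules}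
    {M' N' : W.Modules} (φ : (Scheme.Modules.pullback b).obj M' ⟶ (Scheme.Modules.pullback a).obj M)
    (ψ : (Scheme.Modules.pullback b).obj N' ⟶ (Scheme.Modules.pullback a).obj N) :
    (pullDiag a b φ ψ ≫ (Scheme.Modules.pullback a).map biprod.fst =
      (Scheme.Modules.pullback b).map biprod.fst ≫ φ) ∧
    (pullDiag a b φ ψ ≫ (Scheme.Modules.pullback a).map biprod.snd =
      (Scheme.Modules.pullback b).map biprod.snd ≫ ψ) ∧
    ((Scheme.Modules.pullback b).map biprod.inl ≫ pullDiag a b φ ψ =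
      φ ≫ (Scheme.Modules.pullback a).map biprod.inl) ∧
    ((Scheme.Modules.pullback b).map biprod.inr ≫ pullDiag a b φ ψ =
      ψ ≫ (Scheme.Modules.pullback a).map biprod.inr) := by
  obtain ⟨h₁, h₂, h₃, h₄⟩ := pullback_map_biprod a M N
  obtain ⟨h₁', h₂', h₃', h₄'⟩ := pullback_map_biprod b M' N'
  simp only [pullDiag, Preadditive.add_comp, Preadditive.comp_add, Category.assoc, h₁,
    h₂, h₃, h₄, reassoc_of% h₁', reassoc_of% h₂', reassoc_of% h₃', reassoc_of% h₄', zero_comp,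
    comp_zero, add_zero, zero_add, Category.comp_id, and_self]

/-- The direct sum of two coherent twisted sheaves, with its projections and injections. -/
def Coh.bicone (M N : Coh f α) : BinaryBicone M N where
  pt := ⟨M.obj.sum N.obj, fun i => (M.property i).biprod (N.property i)⟩
  fst := ObjectProperty.homMk ⟨fun _ => biprod.fst, fun _ _ _ => (pullDiag_fst _ _).1.symm⟩
  snd := ObjectProperty.homMk ⟨fun _ => biprod.snd, fun _ _ _ => (pullDiag_fst _ _).2.1.symm⟩
  inl := ObjectProperty.homMk ⟨fun _ => biprod.inl, fun _ _ _ => (pullDiag_fst _ _).2.2.1⟩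
  inr := ObjectProperty.homMk ⟨fun _ => biprod.inr, fun _ _ _ => (pullDiag_fst _ _).2.2.2⟩
  inl_fst := by
    apply ObjectProperty.hom_ext
    ext i : 1
    exact biprod.inl_fst
  inl_snd := by
    apply ObjectProperty.hom_ext
    ext i : 1
    exact biprod.inl_snd
  inr_fst := by
    apply ObjectProperty.hom_ext
    ext i : 1
    exact biprod.inr_fst
  inr_snd := by
    apply ObjectProperty.hom_ext
    ext i : 1
    exact biprod.inr_snd

/-- An equivalence is not assumed additive. It preserves products, and addition of morphisms is
recovered from biproducts. -/
instance : HasBinaryBiproducts (Coh f α) where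
  has_binary_biproduct M N := .mk ⟨Coh.bicone M N, isBinaryBilimitOfTotal _ (by
    apply ObjectProperty.hom_ext
    ext i : 1
    exact biprod.total)⟩

/-- Equivalences of categories of coherent twisted sheaves are additive. -/
instance {S' : Scheme.{u}} {κ : Type t'} {V : κ → Scheme.{u}} {g : ∀ i, V i ⟶ S'} {β : Cocycle g}
    (F : Coh f α ≌ Coh g β) : F.functor.Additive := by
  have := preservesBinaryBiproducts_of_preservesBinaryProducts F.functor
  exact Functor.additive_of_preservesBinaryBiproducts F.functor

end TwistedSheaf

/-! ### Multiplication by functions under the equivalences over open subsets. -/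

namespace TwistedSheaf

lemma isoModulo_map {C D : Type*} [Category C] [Category D] [Preadditive C] [Preadditive D]
    (F : C ≌ D) {P : ObjectProperty C} {Q : ObjectProperty D} (h : ∀ X, P X → Q (F.functor.obj X))
    {X Y : C} {u : X ⟶ Y} (hu : isoModulo P u) : isoModulo Q (F.functor.map u) := by
  obtain ⟨⟨c, ⟨hc⟩, hP⟩, d, ⟨hd⟩, hP'⟩ := hu
  exact ⟨⟨c.map F.functor, ⟨c.mapIsLimit hc F.functor⟩, h _ hP⟩,
    ⟨d.map F.functor, ⟨d.mapIsColimit hd F.functor⟩, h _ hP'⟩⟩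

section

variable {S : Scheme.{u}} {ι : Type t} {U : ι → Scheme.{u}} {f : ∀ i, U i ⟶ S} {α : Cocycle f}

lemma Coh.scalar_comp {M N : Coh f α} (u : M ⟶ N) (s : Γ(S, ⊤)) :
    M.scalar s ≫ u = u ≫ N.scalar s := by
  apply ObjectProperty.hom_ext
  ext i : 1
  exact smulEnd_comp _ _

lemma Coh.scalar_mul (M : Coh f α) (s s' : Γ(S, ⊤)) :
    M.scalar (s * s') = M.scalar s ≫ M.scalar s' := by
  apply ObjectProperty.hom_ext
  ext i : 1
  refine (congrArg (smulEnd _) (map_mul _ _ _)).trans ?_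
  exact smulEnd_mul _ _ _

lemma Coh.scalar_add (M : Coh f α) (s s' : Γ(S, ⊤)) :
    M.scalar (s + s') = M.scalar s + M.scalar s' := by
  apply ObjectProperty.hom_ext
  ext i : 1
  exact (congrArg (smulEnd _) (map_add _ _ _)).trans (smulEnd_add _ _ _)

end

section

variable {X Y : Scheme.{u}} {ι : Type t} {U : ι → Scheme.{u}} {f : ∀ i, U i ⟶ X}
  {κ : Type t'} {V : κ → Scheme.{u}} {g : ∀ i, V i ⟶ Y} {α : Cocycle f} {β : Cocycle g}

/-- The equivalence `G` carries multiplication by `s` to multiplication by `s'`. -/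
def MapsScalar (G : Coh f α ≌ Coh g β) (s : Γ(X, ⊤)) (s' : Γ(Y, ⊤)) : Prop :=
  ∀ M, G.functor.map (M.scalar s) = (G.functor.obj M).scalar s'

variable {G G' : Coh f α ≌ Coh g β} {s r : Γ(X, ⊤)} {s' r' : Γ(Y, ⊤)}

lemma MapsScalar.of_iso (h : MapsScalar G s s') (e : G.functor ≅ G'.functor) :
    MapsScalar G' s s' := fun M => by
  rw [← cancel_epi (e.hom.app M), ← e.hom.naturality, h, Coh.scalar_comp]

lemma MapsScalar.symm (h : MapsScalar G s s') : MapsScalar G.symm s' s := fun N => by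
  change G.inverse.map (N.scalar s') = (G.inverse.obj N).scalar s
  apply G.functor.map_injective
  rw [h, ← cancel_mono (G.counitIso.hom.app N), Coh.scalar_comp]
  exact G.counitIso.hom.naturality _

lemma MapsScalar.mul (h : MapsScalar G s s') (h' : MapsScalar G r r') :
    MapsScalar G (s * r) (s' * r') := fun M => by
  rw [Coh.scalar_mul, Coh.scalar_mul, Functor.map_comp, h, h']

lemma MapsScalar.add (h : MapsScalar G s s') (h' : MapsScalar G r r') :
    MapsScalar G (s + r) (s' + r') := fun M => by
  rw [Coh.scalar_add, Coh.scalar_add, Functor.map_add, h, h']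

/-- Each `N` is isomorphic to an object in the image of `G`, and scalars commute with isomorphisms.
-/
lemma MapsScalar.scalar_eq (h : MapsScalar G s s') (h' : MapsScalar G s r') (N : Coh g β) :
    N.scalar s' = N.scalar r' := by
  have e : G.functor.obj (G.inverse.obj N) ≅ N := G.counitIso.app N
  rw [← cancel_epi e.hom, ← Coh.scalar_comp, ← Coh.scalar_comp, ← h, ← h']

/-- The natural endomorphism of the identity which corresponds to multiplication by `s'`. -/
def scalarNatTrans (G : Coh f α ≌ Coh g β) (s' : Γ(Y, ⊤)) : 𝟭 (Coh f α) ⟶ 𝟭 (Coh f α) where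
  app M := G.functor.preimage ((G.functor.obj M).scalar s')
  naturality M N u := by
    apply G.functor.map_injective
    change G.functor.map (u ≫ _) = G.functor.map (_ ≫ u)
    rw [Functor.map_comp, Functor.map_comp, Functor.map_preimage, Functor.map_preimage,
      Coh.scalar_comp]

lemma mapsScalar_of_scalarNatTrans (h : ∀ M, (scalarNatTrans G s').app M = M.scalar s) :
    MapsScalar G s s' := fun M => by
  rw [← h]
  exact Functor.map_preimage _ _

end

section Chart

variable {S : Scheme.{u}} {ι : Type t} {U : ι → Scheme.{u}} {f : ∀ i, U i ⟶ S} {α : Cocycle f}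
  {W : S.Opens} (C : Chart α W)

include C

lemma Chart.eq_of_scalar_eq {s r : Γ(W, ⊤)} (h : C.E.scalar s = C.E.scalar r) : s = r := by
  have : IsAffine W := C.isAffineOpen
  obtain ⟨e⟩ := C.nonempty_equiv
  exact scalar_injective C.E C.pos e (appTop_injective (f := fun i => f i ∣_ W) (t := C.lift)) h

lemma Chart.exists_eq_scalar (z : 𝟭 (Coh (fun i => f i ∣_ W) (α.restrict W)) ⟶ 𝟭 _) :
    ∃ s : Γ(W, ⊤), ∀ M, z.app M = M.scalar s := by
  have : IsAffine W := C.isAffineOpen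
  have := C.isNoetherian
  obtain ⟨e⟩ := C.nonempty_equiv
  exact exists_natTrans_eq_scalar C.E C.pos e z

end Chart

section

variable {X Y : Scheme.{u}} {ι : Type t} {U : ι → Scheme.{u}} {f : ∀ i, U i ⟶ X}
  {κ : Type t'} {V : κ → Scheme.{u}} {g : ∀ i, V i ⟶ Y} {α : Cocycle f} {β : Cocycle g}
  {F : Coh f α ≌ Coh g β} {h : X → Y} {O O' : X.Opens} {W W' : Y.Opens}

lemma PreservesSupport.supportedOn_iff (hF : PreservesSupport F h) (hs : Function.Surjective h)
    (hO : ∀ x, x ∈ O ↔ h x ∈ W) (M : Coh f α) :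
    Coh.supportedOn α (O : Set X)ᶜ M ↔ Coh.supportedOn β (W : Set Y)ᶜ (F.functor.obj M) := by
  constructor
  · intro hM y hy
    obtain ⟨x, rfl⟩ := hs y
    exact fun hx => hM ((hF M x).mpr hy) ((hO x).mpr hx)
  · exact fun hM x hx hxO => hM ((hF M x).mp hx) ((hO x).mp hxO)

/-- `G` is the equivalence over open subsets that is induced by `F`. -/
def IsRestriction (F : Coh f α ≌ Coh g β) (O : X.Opens) (W : Y.Opens)
    (G : Coh (fun i => f i ∣_ O) (α.restrict O) ≌ Coh (fun i => g i ∣_ W) (β.restrict W)) : Prop :=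
  Nonempty (Coh.restrict α O ⋙ G.functor ≅ F.functor ⋙ Coh.restrict β W)

/-- `F` and its inverse match the sheaves supported off `O` with those supported off `W`, hence the
morphisms to be inverted. By the restriction condition both categories over the open subsets are
localizations at these, so they are equivalent by uniqueness of localization. -/
lemma PreservesSupport.exists_isRestriction (hF : PreservesSupport F h)
    (hs : Function.Surjective h) (hO : ∀ x, x ∈ O ↔ h x ∈ W) (hrα : RestrictionCondition α)
    (hrβ : RestrictionCondition β) : ∃ G, IsRestriction F O W G := by
  have := hrα O
  have := hrβ W
  let P := isoModulo (Coh.supportedOn α (O : Set X)ᶜ)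
  let Q := isoModulo (Coh.supportedOn β (W : Set Y)ᶜ)
  have h1 (M : Coh f α) := (hF.supportedOn_iff hs hO M).mp
  have h2 (N : Coh g β) (hN : Coh.supportedOn β (W : Set Y)ᶜ N) :
      Coh.supportedOn α (O : Set X)ᶜ (F.inverse.obj N) := by
    rw [hF.supportedOn_iff hs hO]
    have e : (F.functor.obj (F.inverse.obj N)).obj.support = N.obj.support :=
      Coh.support_eq_of_iso (F.counitIso.app N)
    exact e.trans_subset hN
  have : (F.functor ⋙ Coh.restrict β W).IsLocalization P := by
    refine Functor.IsLocalization.of_equivalence_source (Coh.restrict β W) Q _ P F.symm ?_ ?_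
      ((Functor.associator _ _ _).symm ≪≫ Functor.isoWhiskerRight F.counitIso _ ≪≫
        Functor.leftUnitor _)
    · intro N N' u hu
      exact MorphismProperty.le_isoClosure _ _ (isoModulo_map F.symm h2 hu)
    · intro M M' u hu
      exact Localization.inverts (Coh.restrict β W) Q _ (isoModulo_map F h1 hu)
  exact ⟨Localization.uniq (Coh.restrict α O) (F.functor ⋙ Coh.restrict β W) P,
    ⟨Localization.compUniqFunctor _ _ _⟩⟩

variable {G G₁ : Coh (fun i => f i ∣_ O) (α.restrict O) ≌ Coh (fun i => g i ∣_ W) (β.restrict W)}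
  {G' : Coh (fun i => f i ∣_ O') (α.restrict O') ≌ Coh (fun i => g i ∣_ W') (β.restrict W')}

/-- Functors out of a localization are determined by their composite with the localization functor.
-/
lemma IsRestriction.nonempty_iso (hrα : RestrictionCondition α) (hG : IsRestriction F O W G)
    (hG₁ : IsRestriction F O W G₁) : Nonempty (G.functor ≅ G₁.functor) := by
  have := hrα O
  obtain ⟨e⟩ := hG
  obtain ⟨e'⟩ := hG₁
  exact ⟨Localization.liftNatIso (Coh.restrict α O)
    (isoModulo (Coh.supportedOn α (O : Set X)ᶜ)) _ _ _ _ (e ≪≫ e'.symm)⟩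

lemma IsRestriction.nonempty_restrictLE_iso (hrα : RestrictionCondition α)
    (hG : IsRestriction F O W G) (hG' : IsRestriction F O' W' G') (hO : O' ≤ O) (hW : W' ≤ W) :
    Nonempty (Coh.restrictLE α hO ⋙ G'.functor ≅ G.functor ⋙ Coh.restrictLE β hW) := by
  have := hrα O
  obtain ⟨e⟩ := hG
  obtain ⟨e'⟩ := hG'
  refine ⟨Localization.liftNatIso (Coh.restrict α O)
    (isoModulo (Coh.supportedOn α (O : Set X)ᶜ)) (Coh.restrict α O ⋙ Coh.restrictLE α hO ⋙ G'.functor)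
      (Coh.restrict α O ⋙ G.functor ⋙ Coh.restrictLE β hW) _ _ ?_⟩
  exact (Functor.associator _ _ _).symm ≪≫ Functor.isoWhiskerRight (Coh.restrictIso α hO) _ ≪≫ e' ≪≫
    Functor.isoWhiskerLeft _ (Coh.restrictIso β hW).symm ≪≫ (Functor.associator _ _ _).symm ≪≫
    Functor.isoWhiskerRight e.symm _ ≪≫ Functor.associator _ _ _

lemma Coh.essSurj_restrictLE (hrα : RestrictionCondition α) (hO : O' ≤ O) :
    (Coh.restrictLE α hO).EssSurj := by
  have := hrα O'
  have := Localization.essSurj (Coh.restrict α O')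
    (isoModulo (Coh.supportedOn α (O' : Set X)ᶜ))
  exact ⟨fun M => ⟨_, ⟨(Coh.restrictIso α hO).app ((Coh.restrict α O').objPreimage M) ≪≫
    (Coh.restrict α O').objObjPreimageIso M⟩⟩⟩

variable {s : Γ(O, ⊤)} {s' : Γ(W, ⊤)}

/-- Up to isomorphism every sheaf over `O'` is the restriction of one over `O`, and on restrictions
naturality of the comparison of `G` with `G'` gives the claim. -/
lemma MapsScalar.restrictLE (hrα : RestrictionCondition α) (hs : MapsScalar G s s')
    (hG : IsRestriction F O W G) (hG' : IsRestriction F O' W' G') (hO : O' ≤ O) (hW : W' ≤ W) :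
    MapsScalar G' ((X.homOfLE hO).appTop s) ((Y.homOfLE hW).appTop s') := fun M => by
  obtain ⟨χ⟩ := hG.nonempty_restrictLE_iso hrα hG' hO hW
  have := Coh.essSurj_restrictLE hrα hO
  let N := (Coh.restrictLE α hO).objPreimage M
  let e : (Coh.restrictLE α hO).obj N ≅ M := (Coh.restrictLE α hO).objObjPreimageIso M
  have h1 := χ.hom.naturality (N.scalar s)
  have h2 : G'.functor.map (((Coh.restrictLE α hO).obj N).scalar ((X.homOfLE hO).appTop s)) =
      (G'.functor.obj ((Coh.restrictLE α hO).obj N)).scalar ((Y.homOfLE hW).appTop s') := by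
    rw [← cancel_mono (χ.hom.app N)]
    rw [Functor.comp_map, Functor.comp_map, hs, Coh.restrictLE_scalar, Coh.restrictLE_scalar] at h1
    exact h1.trans (Coh.scalar_comp _ _).symm
  rw [← cancel_epi (G'.functor.map e.hom), ← Functor.map_comp, ← Coh.scalar_comp, Functor.map_comp,
    h2, Coh.scalar_comp]

lemma MapsScalar.of_restrictLE (hrα : RestrictionCondition α) (hG : IsRestriction F O W G)
    (hloc : ∀ y ∈ W, ∃ (O' : X.Opens) (W' : Y.Opens) (hO : O' ≤ O) (hW : W' ≤ W), y ∈ W' ∧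
      ∃ G', IsRestriction F O' W' G' ∧
        MapsScalar G' ((X.homOfLE hO).appTop s) ((Y.homOfLE hW).appTop s')) :
    MapsScalar G s s' := fun M => by
  refine Coh.hom_ext_of_restrictLE fun y hy => ?_
  obtain ⟨O', W', hO, hW, hyW, G', hG', hs⟩ := hloc y hy
  refine ⟨W', hW, hyW, ?_⟩
  obtain ⟨χ⟩ := hG.nonempty_restrictLE_iso hrα hG' hO hW
  have h1 := χ.hom.naturality (M.scalar s)
  rw [Functor.comp_map, Functor.comp_map, Coh.restrictLE_scalar, hs] at h1
  rw [← cancel_epi (χ.hom.app M), Coh.restrictLE_scalar]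
  exact h1.symm.trans (Coh.scalar_comp _ _)

end

end TwistedSheaf

/-! ### The correspondence of functions as a local relation. -/

namespace TwistedSheaf

section Gluing

open TopologicalSpace Opposite

/-- A relation between the sections of two sheaves which is local, and locally a map, is a map. -/
lemma exists_of_local {T : TopCat.{u}} (A B : TopCat.Sheaf CommRingCat.{u} T)
    (R : ∀ W : Opens T, A.obj.obj (op W) → B.obj.obj (op W) → Prop)
    (hres : ∀ {W W' : Opens T} (i : W' ⟶ W) {a b}, R W a b →
      R W' (A.obj.map i.op a) (B.obj.map i.op b))
    (hloc : ∀ {W : Opens T} {a b}, (∀ y ∈ W, ∃ (W' : Opens T) (i : W' ⟶ W), y ∈ W' ∧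
      R W' (A.obj.map i.op a) (B.obj.map i.op b)) → R W a b)
    (huniq : ∀ {W : Opens T} {a b b'}, R W a b → R W a b' → b = b')
    (hex : ∀ {W : Opens T} (y) (_ : y ∈ W), ∃ (W' : Opens T) (_ : W' ⟶ W), y ∈ W' ∧
      ∀ a, ∃ b, R W' a b) {W : Opens T} (a : A.obj.obj (op W)) : ∃ b, R W a b := by
  choose W' i hy h using fun y : W => hex y.1 y.2
  choose b hb using fun y => h y (A.obj.map (i y).op a)
  obtain ⟨b', hb', -⟩ := B.existsUnique_gluing' W' W i
    (fun y hyW => Opens.mem_iSup.mpr ⟨⟨y, hyW⟩, hy ⟨y, hyW⟩⟩) b fun y z => by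
      refine huniq (a := A.obj.map (Opens.infLELeft (W' y) (W' z) ≫ i y).op a) ?_ ?_
      · have := hres (Opens.infLELeft (W' y) (W' z)) (hb y)
        rwa [← ConcreteCategory.comp_apply, ← A.obj.map_comp, ← op_comp] at this
      · have := hres (Opens.infLERight (W' y) (W' z)) (hb z)
        rwa [← ConcreteCategory.comp_apply, ← A.obj.map_comp, ← op_comp] at this
  refine ⟨b', hloc fun y hyW => ⟨_, i ⟨y, hyW⟩, hy ⟨y, hyW⟩, ?_⟩⟩
  rw [hb']
  exact hb _

end Gluing

section

variable {S : Scheme.{u}} {ι : Type t} {U : ι → Scheme.{u}} {f : ∀ i, U i ⟶ S} {α : Cocycle f}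

lemma Coh.restrict_scalar (M : Coh f α) (O : S.Opens) (s : Γ(S, ⊤)) :
    (Coh.restrict α O).map (M.scalar s) = ((Coh.restrict α O).obj M).scalar (O.ι.appTop s) := by
  apply ObjectProperty.hom_ext
  ext i : 1
  refine (pullback_map_smulEnd (f i ⁻¹ᵁ O).ι (M.obj.obj i) ((f i).appTop s)).trans ?_
  rw [scalar_hom]
  have h1 : (f i ⁻¹ᵁ O).ι.appTop ((f i).appTop s) = (f i ∣_ O).appTop (O.ι.appTop s) := by
    rw [← ConcreteCategory.comp_apply, ← ConcreteCategory.comp_apply, ← Scheme.Hom.comp_appTop,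
      ← Scheme.Hom.comp_appTop, morphismRestrict_ι]
  rw [h1]
  rfl

lemma homOfLE_appTop_topIso_inv {O O' : S.Opens} (h : O' ≤ O) (s : Γ(S, O)) :
    (S.homOfLE h).appTop (O.topIso.inv s) = O'.topIso.inv (S.presheaf.map (homOfLE h).op s) := by
  have h1 : O.topIso.inv ≫ (S.homOfLE h).appTop =
      S.presheaf.map (homOfLE h).op ≫ O'.topIso.inv := by
    rw [Scheme.homOfLE_appTop]
    exact (S.presheaf.map_comp _ _).symm.trans
      (S.presheaf.map_comp (homOfLE h).op (eqToIso O'.ι_image_top.symm).op.inv)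
  exact congr($h1 s)

lemma eq_of_homOfLE_appTop_eq {O : S.Opens} {s r : Γ(O, ⊤)} (h : ∀ x ∈ O, ∃ (O' : S.Opens)
    (hO : O' ≤ O), x ∈ O' ∧ (S.homOfLE hO).appTop s = (S.homOfLE hO).appTop r) : s = r := by
  have hbij := ConcreteCategory.bijective_of_isIso O.topIso.inv
  obtain ⟨s, rfl⟩ := hbij.surjective s
  obtain ⟨r, rfl⟩ := hbij.surjective r
  congr 1
  choose O' hO hx h using fun x : O => h x.1 x.2
  refine S.sheaf.eq_of_locally_eq' O' O (fun x => homOfLE (hO x))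
    (fun x hxO => TopologicalSpace.Opens.mem_iSup.mpr ⟨⟨x, hxO⟩, hx ⟨x, hxO⟩⟩) s r fun x => ?_
  apply (ConcreteCategory.bijective_of_isIso (O' x).topIso.inv).injective
  have h1 := h x
  rwa [homOfLE_appTop_topIso_inv, homOfLE_appTop_topIso_inv] at h1

/-- A function is determined by its action on twisted sheaves. -/
lemma Nice.eq_of_scalar_eq (hα : Nice α) (hr : RestrictionCondition α) {O : S.Opens} {s r : Γ(O, ⊤)}
    (h : ∀ M : Coh (fun i => f i ∣_ O) (α.restrict O), M.scalar s = M.scalar r) : s = r := by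
  refine eq_of_homOfLE_appTop_eq fun x hx => ?_
  obtain ⟨O', hxO', hO, ⟨C⟩⟩ := hα.exists_chart hx
  refine ⟨O', hO, hxO', C.eq_of_scalar_eq ?_⟩
  have := Coh.essSurj_restrictLE hr hO
  let e := (Coh.restrictLE α hO).objObjPreimageIso C.E
  rw [← cancel_epi e.hom, ← Coh.scalar_comp, ← Coh.scalar_comp, ← Coh.restrictLE_scalar,
    ← Coh.restrictLE_scalar, h]

end

section

variable {X Y : Scheme.{u}} {ι : Type t} {U : ι → Scheme.{u}} {f : ∀ i, U i ⟶ X}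
  {κ : Type t'} {V : κ → Scheme.{u}} {g : ∀ i, V i ⟶ Y} {α : Cocycle f} {β : Cocycle g}
  {F : Coh f α ≌ Coh g β} {h : X → Y} {O O' : X.Opens} {W W' : Y.Opens}
  {G : Coh (fun i => f i ∣_ O) (α.restrict O) ≌ Coh (fun i => g i ∣_ W) (β.restrict W)}
  {G' : Coh (fun i => f i ∣_ O') (α.restrict O') ≌ Coh (fun i => g i ∣_ W') (β.restrict W')}

lemma MapsScalar.restrict (hrα : RestrictionCondition α) {s : Γ(X, ⊤)} {s' : Γ(Y, ⊤)}
    (hs : MapsScalar F s s') (hG : IsRestriction F O W G) :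
    MapsScalar G (O.ι.appTop s) (W.ι.appTop s') := fun M => by
  obtain ⟨χ⟩ := hG
  have := hrα O
  have := Localization.essSurj (Coh.restrict α O) (isoModulo (Coh.supportedOn α (O : Set X)ᶜ))
  let N := (Coh.restrict α O).objPreimage M
  let e : (Coh.restrict α O).obj N ≅ M := (Coh.restrict α O).objObjPreimageIso M
  have h1 := χ.hom.naturality (N.scalar s)
  have h2 : G.functor.map (((Coh.restrict α O).obj N).scalar (O.ι.appTop s)) =
      (G.functor.obj ((Coh.restrict α O).obj N)).scalar (W.ι.appTop s') := by
    rw [← cancel_mono (χ.hom.app N)]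
    rw [Functor.comp_map, Functor.comp_map, hs, Coh.restrict_scalar, Coh.restrict_scalar] at h1
    exact h1.trans (Coh.scalar_comp _ _).symm
  rw [← cancel_epi (G.functor.map e.hom), ← Functor.map_comp, ← Coh.scalar_comp, Functor.map_comp,
    h2, Coh.scalar_comp]

lemma MapsScalar.eq_right (hβ : Nice β) (hrβ : RestrictionCondition β) {s : Γ(O, ⊤)}
    {s' r' : Γ(W, ⊤)} (hs : MapsScalar G s s') (hr : MapsScalar G s r') : s' = r' :=
  hβ.eq_of_scalar_eq hrβ (hs.scalar_eq hr)

lemma MapsScalar.eq_left (hα : Nice α) (hrα : RestrictionCondition α) {s r : Γ(O, ⊤)}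
    {s' : Γ(W, ⊤)} (hs : MapsScalar G s s') (hr : MapsScalar G r s') : s = r :=
  hα.eq_of_scalar_eq hrα (hs.symm.scalar_eq hr.symm)

/-- The functions `a` and `b` correspond under the equivalence `F`. -/
def Corresponds (F : Coh f α ≌ Coh g β) (O : X.Opens) (W : Y.Opens) (a : Γ(X, O)) (b : Γ(Y, W)) :
    Prop :=
  ∃ G, IsRestriction F O W G ∧ MapsScalar G (O.topIso.inv a) (W.topIso.inv b)

variable {a a' : Γ(X, O)} {b b' : Γ(Y, W)}

/-- The choice of equivalence in the definition is immaterial, since any two are isomorphic. -/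
lemma Corresponds.mapsScalar (hrα : RestrictionCondition α) (hG : IsRestriction F O W G)
    (hab : Corresponds F O W a b) : MapsScalar G (O.topIso.inv a) (W.topIso.inv b) := by
  obtain ⟨G₁, hG₁, hs⟩ := hab
  obtain ⟨e⟩ := hG₁.nonempty_iso hrα hG
  exact hs.of_iso e

lemma Corresponds.restrict (hrα : RestrictionCondition α) (hab : Corresponds F O W a b)
    (hG' : IsRestriction F O' W' G') (hO : O' ≤ O) (hW : W' ≤ W) :
    Corresponds F O' W' (X.presheaf.map (homOfLE hO).op a) (Y.presheaf.map (homOfLE hW).op b) := by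
  obtain ⟨G, hG, hs⟩ := hab
  refine ⟨G', hG', ?_⟩
  rw [← homOfLE_appTop_topIso_inv, ← homOfLE_appTop_topIso_inv]
  exact hs.restrictLE hrα hG hG' hO hW

lemma Corresponds.of_local (hrα : RestrictionCondition α) (hG : IsRestriction F O W G)
    (hloc : ∀ y ∈ W, ∃ (O' : X.Opens) (W' : Y.Opens) (hO : O' ≤ O) (hW : W' ≤ W), y ∈ W' ∧
      Corresponds F O' W' (X.presheaf.map (homOfLE hO).op a) (Y.presheaf.map (homOfLE hW).op b)) :
    Corresponds F O W a b := by
  refine ⟨G, hG, .of_restrictLE hrα hG fun y hy => ?_⟩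
  obtain ⟨O', W', hO, hW, hyW, G', hG', hs⟩ := hloc y hy
  refine ⟨O', W', hO, hW, hyW, G', hG', ?_⟩
  rwa [homOfLE_appTop_topIso_inv, homOfLE_appTop_topIso_inv]

lemma Corresponds.eq_right (hrα : RestrictionCondition α) (hβ : Nice β)
    (hrβ : RestrictionCondition β) (hab : Corresponds F O W a b) (hab' : Corresponds F O W a b') :
    b = b' := by
  obtain ⟨G, hG, hs⟩ := hab
  exact (ConcreteCategory.bijective_of_isIso W.topIso.inv).injective
    (hs.eq_right hβ hrβ (hab'.mapsScalar hrα hG))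

lemma Corresponds.eq_left (hα : Nice α) (hrα : RestrictionCondition α)
    (hab : Corresponds F O W a b) (hab' : Corresponds F O W a' b) : a = a' := by
  obtain ⟨G, hG, hs⟩ := hab
  exact (ConcreteCategory.bijective_of_isIso O.topIso.inv).injective
    (hs.eq_left hα hrα (hab'.mapsScalar hrα hG))

/-- Multiplication by `a`, transported through `G`, is a natural endomorphism of the identity over
`W`, and over a chart it is given by a function. -/
lemma Corresponds.exists_right (C : Chart β W) (hG : IsRestriction F O W G) (a : Γ(X, O)) :
    ∃ b, Corresponds F O W a b := by
  obtain ⟨s', hs'⟩ := C.exists_eq_scalar (scalarNatTrans G.symm (O.topIso.inv a))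
  refine ⟨W.topIso.hom s', G, hG, ?_⟩
  have h1 : W.topIso.inv (W.topIso.hom s') = s' := congr($(W.topIso.hom_inv_id) s')
  rw [h1]
  exact (mapsScalar_of_scalarNatTrans hs').symm

lemma Corresponds.exists_left (C : Chart α O) (hG : IsRestriction F O W G) (b : Γ(Y, W)) :
    ∃ a, Corresponds F O W a b := by
  obtain ⟨s, hs⟩ := C.exists_eq_scalar (scalarNatTrans G (W.topIso.inv b))
  refine ⟨O.topIso.hom s, G, hG, ?_⟩
  have h1 : O.topIso.inv (O.topIso.hom s) = s := congr($(O.topIso.hom_inv_id) s)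
  rw [h1]
  exact mapsScalar_of_scalarNatTrans hs

lemma Corresponds.add (hrα : RestrictionCondition α) (hab : Corresponds F O W a b)
    (hab' : Corresponds F O W a' b') : Corresponds F O W (a + a') (b + b') := by
  obtain ⟨G, hG, hs⟩ := hab
  refine ⟨G, hG, ?_⟩
  rw [map_add, map_add]
  exact hs.add (hab'.mapsScalar hrα hG)

lemma Corresponds.mul (hrα : RestrictionCondition α) (hab : Corresponds F O W a b)
    (hab' : Corresponds F O W a' b') : Corresponds F O W (a * a') (b * b') := by
  obtain ⟨G, hG, hs⟩ := hab
  refine ⟨G, hG, ?_⟩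
  rw [map_mul, map_mul]
  exact hs.mul (hab'.mapsScalar hrα hG)

end

end TwistedSheaf

/-! ### The induced isomorphism of schemes and its uniqueness. -/

namespace TwistedSheaf

open TopologicalSpace Opposite

lemma ι_appTop_injective {X : Scheme.{u}} {O : X.Opens} (hO : O = ⊤) :
    Function.Injective O.ι.appTop := by
  subst hO
  exact (ConcreteCategory.bijective_of_isIso (Scheme.Γ.mapIso X.topIso.op).hom).injective

lemma morphismRestrict_appTop_topIso_inv {X Y : Scheme.{u}} (p : X ⟶ Y) (W : Y.Opens)
    (b : Γ(Y, W)) : (p ∣_ W).appTop (W.topIso.inv b) = (p ⁻¹ᵁ W).topIso.inv (p.app W b) := by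
  have h1 : W.topIso.inv ≫ (p ∣_ W).appTop = p.app W ≫ (p ⁻¹ᵁ W).topIso.inv := by
    rw [morphismRestrict_appTop]
    have h2 := p.naturality (eqToIso W.ι_image_top.symm).op.inv
    refine (Category.assoc _ _ _).symm.trans ((congrArg (· ≫ _) h2).trans ?_)
    refine (Category.assoc _ _ _).trans (congrArg (p.app W ≫ ·) ?_)
    exact (X.presheaf.map_comp _ _).symm
  exact congr($h1 b)

section

variable {X Y : Scheme.{u}} {ι : Type t} {U : ι → Scheme.{u}} {f : ∀ i, U i ⟶ X}
  {κ : Type t'} {V : κ → Scheme.{u}} {g : ∀ i, V i ⟶ Y} {α : Cocycle f} {β : Cocycle g}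
  {F : Coh f α ≌ Coh g β} (hα : Nice α) (hβ : Nice β) (hrα : RestrictionCondition α)
  (hrβ : RestrictionCondition β) {h : X ≃ₜ Y} (hF : PreservesSupport F h)

/-- A homeomorphism, as an isomorphism of the underlying spaces. -/
def carrierIso (h : X ≃ₜ Y) : X.carrier ≅ Y.carrier := TopCat.isoOfHomeo h

include hrα hrβ hF in
lemma PreservesSupport.exists_isRestriction_carrierIso (W : Y.Opens) :
    ∃ G, IsRestriction F ((Opens.map (carrierIso h).hom).obj W) W G :=
  hF.exists_isRestriction h.surjective (fun _ => Iff.rfl) hrα hrβ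

-- Charts provide partners locally, uniqueness makes them agree on overlaps, and the sheaf property
-- glues them over any `W`.
include hrα hrβ hβ hF in
lemma PreservesSupport.exists_right (W : Y.Opens)
    (a : Γ(X, (Opens.map (carrierIso h).hom).obj W)) :
    ∃ b, Corresponds F ((Opens.map (carrierIso h).hom).obj W) W a b := by
  refine exists_of_local ((TopCat.Sheaf.pushforward _ (carrierIso h).hom).obj X.sheaf) Y.sheaf
    (fun W a b => Corresponds F ((Opens.map (carrierIso h).hom).obj W) W a b) ?_ ?_ ?_ ?_ a
  · intro W W' i a b hab
    obtain ⟨G, hG⟩ := hF.exists_isRestriction_carrierIso hrα hrβ W'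
    exact hab.restrict hrα hG ((Opens.map (carrierIso h).hom).map i).le i.le
  · intro W a b hloc
    obtain ⟨G, hG⟩ := hF.exists_isRestriction_carrierIso hrα hrβ W
    refine .of_local hrα hG fun y hy => ?_
    obtain ⟨W', i, hy', h'⟩ := hloc y hy
    exact ⟨_, W', ((Opens.map (carrierIso h).hom).map i).le, i.le, hy', h'⟩
  · intro W a b b' hb hb'
    exact hb.eq_right hrα hβ hrβ hb'
  · intro W y hy
    obtain ⟨W', hy', hW, ⟨C⟩⟩ := hβ.exists_chart hy
    obtain ⟨G, hG⟩ := hF.exists_isRestriction_carrierIso hrα hrβ W'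
    exact ⟨W', homOfLE hW, hy', Corresponds.exists_right C hG⟩

include hrα hrβ hα hF in
lemma PreservesSupport.exists_left (W : Y.Opens) (b : Γ(Y, W)) :
    ∃ a, Corresponds F ((Opens.map (carrierIso h).hom).obj W) W a b := by
  refine exists_of_local Y.sheaf ((TopCat.Sheaf.pushforward _ (carrierIso h).hom).obj X.sheaf)
    (fun W b a => Corresponds F ((Opens.map (carrierIso h).hom).obj W) W a b) ?_ ?_ ?_ ?_ b
  · intro W W' i b a hab
    obtain ⟨G, hG⟩ := hF.exists_isRestriction_carrierIso hrα hrβ W'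
    exact hab.restrict hrα hG ((Opens.map (carrierIso h).hom).map i).le i.le
  · intro W b a hloc
    obtain ⟨G, hG⟩ := hF.exists_isRestriction_carrierIso hrα hrβ W
    refine .of_local hrα hG fun y hy => ?_
    obtain ⟨W', i, hy', h'⟩ := hloc y hy
    exact ⟨_, W', ((Opens.map (carrierIso h).hom).map i).le, i.le, hy', h'⟩
  · intro W b a a' ha ha'
    exact ha.eq_left hα hrα ha'
  · intro W y hy
    obtain ⟨x, rfl⟩ := h.surjective y
    obtain ⟨O, hx, hO, ⟨C⟩⟩ := hα.exists_chart (x := x)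
      (O := (Opens.map (carrierIso h).hom).obj W) hy
    -- The chart lives on `X`; the homeomorphism turns its domain into the preimage of an open
    -- subset of `Y`.
    let W' : Y.Opens := (Opens.map (carrierIso h).inv).obj O
    have e : (Opens.map (carrierIso h).hom).obj W' = O := by
      ext z
      change h.symm (h z) ∈ O ↔ z ∈ O
      rw [h.symm_apply_apply]
    have hxW : h x ∈ W' := by
      change h.symm (h x) ∈ O
      rwa [h.symm_apply_apply]
    have hW : W' ≤ W := by
      intro z hz
      have h1 : h (h.symm z) ∈ W := hO hz
      rwa [h.apply_symm_apply] at h1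
    have C' : Chart α ((Opens.map (carrierIso h).hom).obj W') := e ▸ C
    obtain ⟨G, hG⟩ := hF.exists_isRestriction_carrierIso hrα hrβ W'
    exact ⟨W', homOfLE hW, hxW, Corresponds.exists_left C' hG⟩

-- Existence and uniqueness on both sides make the relation a bijection. It respects sums, products
-- and restriction because the relation does.
include hα hβ hrα hrβ hF in
lemma PreservesSupport.exists_presheaf_iso :
    ∃ θ : (TopCat.Presheaf.pushforward _ (carrierIso h).hom).obj X.presheaf ≅ Y.presheaf,
      ∀ (W : Y.Opens) (b : Γ(Y, W)),
        Corresponds F ((Opens.map (carrierIso h).hom).obj W) W (θ.inv.app (op W) b) b := by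
  choose φ hφ using hF.exists_right hβ hrα hrβ
  let ψ (W : Y.Opens) : Γ(X, (Opens.map (carrierIso h).hom).obj W) ≃+* Γ(Y, W) :=
    { Equiv.ofBijective (φ W) ⟨fun a a' e => (hφ W a).eq_left hα hrα (e ▸ hφ W a'), fun b => by
        obtain ⟨a, ha⟩ := hF.exists_left hα hrα hrβ W b
        exact ⟨a, (hφ W a).eq_right hrα hβ hrβ ha⟩⟩ with
      map_mul' a a' := (hφ W _).eq_right hrα hβ hrβ ((hφ W a).mul hrα (hφ W a'))
      map_add' a a' := (hφ W _).eq_right hrα hβ hrβ ((hφ W a).add hrα (hφ W a')) }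
  have hψ (W : Y.Opens) (a) : Corresponds F _ W a (ψ W a) := hφ W a
  let θ : (TopCat.Presheaf.pushforward _ (carrierIso h).hom).obj X.presheaf ≅ Y.presheaf :=
    NatIso.ofComponents (fun W => (ψ W.unop).toCommRingCatIso) (fun {W W'} i => by
      ext a
      obtain ⟨G, hG⟩ := hF.exists_isRestriction_carrierIso hrα hrβ W'.unop
      have h1 := (hψ W.unop a).restrict hrα hG ((Opens.map (carrierIso h).hom).map i.unop).le
        i.unop.le
      exact (hψ W'.unop _).eq_right hrα hβ hrβ h1)
  refine ⟨θ, fun W b => ?_⟩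
  have h1 := hψ W ((ψ W).symm b)
  rw [RingEquiv.apply_symm_apply] at h1
  exact h1

include hα hβ hrα hrβ hF in
lemma PreservesSupport.exists_iso : ∃ e : X ≅ Y, (∀ x, e.hom x = h x) ∧
    ∀ (W : Y.Opens) (b : Γ(Y, W)), Corresponds F (e.hom ⁻¹ᵁ W) W (e.hom.app W b) b := by
  obtain ⟨θ, hθ⟩ := hF.exists_presheaf_iso hα hβ hrα hrβ
  let e₁ : X.toPresheafedSpace ≅ Y.toPresheafedSpace :=
    PresheafedSpace.isoOfComponents (carrierIso h) θ
  -- An isomorphism of ringed spaces between locally ringed spaces is automatically local on stalks.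
  let e₂ : X.toLocallyRingedSpace ≅ Y.toLocallyRingedSpace :=
    LocallyRingedSpace.isoOfSheafedSpaceIso (SheafedSpace.isoMk e₁)
  let e : X ≅ Y := Scheme.fullyFaithfulForgetToLocallyRingedSpace.preimageIso e₂
  exact ⟨e, fun x => rfl, hθ⟩

include hα hβ hrα hrβ in
/-- An equivalence between categories of coherent twisted sheaves induces an isomorphism. -/
lemma exists_isInducedBy (F : Coh f α ≌ Coh g β) : ∃ e : X ≅ Y, IsInducedBy F e := by
  obtain ⟨h, hF⟩ := exists_homeomorph hα hβ hrα hrβ F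
  obtain ⟨e, he, hs⟩ := hF.exists_iso hα hβ hrα hrβ
  have he' : e.hom = (h : X → Y) := funext he
  refine ⟨e, ⟨fun Z _ M => ?_, fun W => ?_⟩⟩
  · rw [he', Coh.supportedOn, Coh.supportedOn, ← hF.image_support h.surjective,
      Set.image_subset_image_iff h.injective]
  · obtain ⟨G, hG⟩ := hF.exists_isRestriction (O := e.hom ⁻¹ᵁ W) (W := W) h.surjective (fun x => by
      rw [← he]
      rfl) hrα hrβ
    refine ⟨G, hG, fun s M => ?_⟩
    obtain ⟨b, rfl⟩ := (ConcreteCategory.bijective_of_isIso W.topIso.inv).surjective s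
    rw [morphismRestrict_appTop_topIso_inv]
    exact (hs W b).mapsScalar hrα hG M

variable {e e' : X ≅ Y}

/-- The condition on closed subsets is used twice: for the support of `M`, and for the preimage of
the support of `F M`. -/
lemma IsInducedBy.preservesSupport (hβ : Nice β) (hα : Nice α) (he : IsInducedBy F e) :
    PreservesSupport F e.hom := by
  intro M x
  have hb : Function.Bijective e.hom := (TopCat.homeoOfIso (Scheme.forgetToTop.mapIso e)).bijective
  have h1 := (he.supportedOn_iff _ (hα.isClosed_support M) M).mp Set.Subset.rfl
  have h2 := (he.supportedOn_iff (e.hom ⁻¹' (F.functor.obj M).obj.support)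
    ((hβ.isClosed_support _).preimage e.hom.continuous) M).mpr
      (Set.image_preimage_eq _ hb.surjective).symm.subset
  refine ⟨fun hx => h2 hx, fun hx => ?_⟩
  obtain ⟨x', hx', e'⟩ := h1 hx
  exact hb.injective e' ▸ hx'

include hα hβ hrα hrβ in
lemma IsInducedBy.eq (he : IsInducedBy F e) (he' : IsInducedBy F e') : e = e' := by
  have hp : (e.hom : X → Y) = e'.hom :=
    (he.preservesSupport hβ hα).eq hβ hrβ (he'.preservesSupport hβ hα)
  have hbase : e.hom.base = e'.hom.base := by
    ext x
    exact congrFun hp x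
  ext1
  refine Scheme.Hom.ext hbase fun W => ?_
  ext b
  -- The two preimages coincide as sets only after the maps on points have been compared, so the
  -- correspondence for `e` is moved along an inclusion before uniqueness applies.
  have hle : e'.hom ⁻¹ᵁ W ≤ e.hom ⁻¹ᵁ W := by
    intro x hx
    change e.hom x ∈ W
    rw [hp]
    exact hx
  obtain ⟨G, hG, hs⟩ := he.exists_equivalence W
  obtain ⟨G', hG', hs'⟩ := he'.exists_equivalence W
  have h1 : Corresponds F (e.hom ⁻¹ᵁ W) W (e.hom.app W b) b := by
    refine ⟨G, hG, ?_⟩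
    rw [← morphismRestrict_appTop_topIso_inv]
    exact hs _
  have h2 : Corresponds F (e'.hom ⁻¹ᵁ W) W (e'.hom.app W b) b := by
    refine ⟨G', hG', ?_⟩
    rw [← morphismRestrict_appTop_topIso_inv]
    exact hs' _
  have h3 := h1.restrict hrα hG' hle le_rfl
  have h4 : Y.presheaf.map (homOfLE (le_refl W)).op b = b :=
    congr($(Y.presheaf.map_id (op W)) b)
  rw [h4] at h3
  exact h3.eq_left hα hrα h2

-- The case of global functions, used for the constants in `k`: `F` restricts over the whole of `Y`
-- to the equivalence in `IsInducedBy`, which already prescribes the partner of `s'`.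
include hα hrα in
lemma IsInducedBy.appTop_eq (he : IsInducedBy F e) {s : Γ(X, ⊤)} {s' : Γ(Y, ⊤)}
    (hs : MapsScalar F s s') : e.hom.appTop s' = s := by
  obtain ⟨G, hG, hs'⟩ := he.exists_equivalence ⊤
  have h1 := hs.restrict hrα hG
  have h2 := MapsScalar.eq_left hα hrα (hs' _) h1
  have h3 : (e.hom ∣_ ⊤).appTop (Scheme.Opens.ι ⊤ |>.appTop s') =
      (Scheme.Opens.ι (e.hom ⁻¹ᵁ ⊤)).appTop (e.hom.appTop s') := by
    rw [← ConcreteCategory.comp_apply, ← ConcreteCategory.comp_apply, ← Scheme.Hom.comp_appTop,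
      ← Scheme.Hom.comp_appTop, morphismRestrict_ι]
  rw [h3] at h2
  exact ι_appTop_injective rfl h2

end

lemma nice_of_isVariety (k : Type u) [Field k] (X : Scheme.{u}) [X.Over (Spec (.of k))]
    [IsVariety k X] (𝒰 : Scheme.Cover.{u} (Scheme.precoverage @Etale) X) {α : Cocycle 𝒰.f}
    (hα : α.IsBrauer) : Nice α where
  noetherian := by
    have := IsVariety.locallyOfFiniteType (k := k) (X := X)
    exact LocallyOfFiniteType.isLocallyNoetherian (X ↘ Spec (.of k))
  separated := by
    have := IsVariety.isSeparated (k := k) (X := X)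
    constructor
    rw [← terminal.comp_from (X ↘ Spec (.of k))]
    infer_instance
  compact := by
    have := IsVariety.quasiCompact (k := k) (X := X)
    exact QuasiCompact.compactSpace_of_compactSpace (X ↘ Spec (.of k))
  jacobson := by
    have := IsVariety.locallyOfFiniteType (k := k) (X := X)
    exact LocallyOfFiniteType.jacobsonSpace (X ↘ Spec (.of k))
  etale i := 𝒰.map_prop i
  surj := (Scheme.presieve₀_mem_precoverage_iff (P := @Etale) (E := 𝒰.toPreZeroHypercover)).mp
    𝒰.mem₀ |>.1
  brauer := hα

end TwistedSheaf

end

theorem theorem3 (k : Type u) [Field k] (X Y : Scheme.{u})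
    [X.Over (Spec (.of k))] [Y.Over (Spec (.of k))]
    [TwistedSheaf.IsVariety k X] [TwistedSheaf.IsVariety k Y]
    (𝒰 : Scheme.Cover.{u} (Scheme.precoverage @Etale) X)
    (𝒱 : Scheme.Cover.{u} (Scheme.precoverage @Etale) Y)
    (α : TwistedSheaf.Cocycle 𝒰.f) (β : TwistedSheaf.Cocycle 𝒱.f)
    (hα : α.IsBrauer) (hβ : β.IsBrauer)
    (hX : TwistedSheaf.RestrictionCondition α) (hY : TwistedSheaf.RestrictionCondition β)
    (F : TwistedSheaf.Coh 𝒰.f α ≌ TwistedSheaf.Coh 𝒱.f β) :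
    ∃ e : X ≅ Y, TwistedSheaf.IsInducedBy F e ∧
      (∀ e' : X ≅ Y, TwistedSheaf.IsInducedBy F e' → e' = e) ∧
      ((∀ (c : k) (M : TwistedSheaf.Coh 𝒰.f α),
          F.functor.map (M.scalar (TwistedSheaf.constant k X c)) =
            (F.functor.obj M).scalar (TwistedSheaf.constant k Y c)) →
        e.hom.IsOver (Spec (.of k))) := by
  have hα' := TwistedSheaf.nice_of_isVariety k X 𝒰 hα
  have hβ' := TwistedSheaf.nice_of_isVariety k Y 𝒱 hβ
  obtain ⟨e, he⟩ := TwistedSheaf.exists_isInducedBy hα' hβ' hX hY F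
  refine ⟨e, he, fun e' he' => he'.eq hα' hβ' hX hY he, fun hk => ⟨?_⟩⟩
  -- A morphism to `Spec k` is determined by the images of the constants among global functions, and
  -- these are matched by `k`-linearity of `F`.
  refine ext_of_isAffine ?_
  rw [Scheme.Hom.comp_appTop, ← cancel_epi (Scheme.ΓSpecIso (.of k)).inv]
  ext c
  exact he.appTop_eq hα' hX (hk c)
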